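/- **Setting.** Let $(S_1(i),S_2(i))_i$ be a jointly stationary and ergodic process of non-negative channel power gains with finite means, such that the pair $(S_1(i),S_2(i))$ has a probability density. Let $\eta\in(0,1)$, $P_t>0$, $C(x)=\log_2(1+x)$, $[x]^+=\max\{x,0\}$. In each slot $i$ one chooses $q_1(i),\dots,q_6(i)\in[0,1]$ with $\sum_k q_k(i)=1$, $t(i)\in[0,1]$ and powers $P_1(i),P_2(i),P_r(i)\ge 0$. Put $C_{1r}=C(P_1S_1)$, $C_{2r}=C(P_2S_2)$, $C_{r1}=C(P_rS_1)$, $C_{r2}=C(P_rS_2)$, $C_{12r}=tC(P_1S_1)+(1-t)C\big(\tfrac{P_1S_1}{1+P_2S_2}\big)$, $C_{21r}=(1-t)C(P_2S_2)+tC\big(\tfrac{P_2S_2}{1+P_1S_1}\big)$, and let $\bar R_{1r},\bar R_{2r},\bar R_{r1},\bar R_{r2},\bar P_1,\bar P_2,\bar P_r$ be the limits, as $N\to\infty$, of the averages over the slots $1,\dots,N$ of $q_1C_{1r}+q_3C_{12r}$, $q_2C_{2r}+q_3C_{21r}$, $(q_4+q_6)C_{r1}$, $(q_5+q_6)C_{r2}$,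 $(q_1+q_3)P_1$, $(q_2+q_3)P_2$, $(q_4+q_5+q_6)P_r$. The long-term problem is to maximize $\eta\bar R_{1r}+(1-\eta)\bar R_{2r}$ subject to C1: $\bar R_{1r}=\bar R_{r2}$, C2: $\bar R_{2r}=\bar R_{r1}$, and the power constraint $\bar P_1+\bar P_2+\bar P_r=P_t$. **Protocol.** For weights $(\mu_1,\mu_2,\gamma)\in\mathbb R^3$ put $A=\eta-\mu_1$, $B=1-\eta-\mu_2$, $g=\gamma\ln 2$ and $P_1^{M_1}=[\frac{A}{g}-\frac1{S_1}]^+$, $P_2^{M_2}=[\frac{B}{g}-\frac1{S_2}]^+$, $P_r^{M_4}=[\frac{\mu_2}{g}-\frac1{S_1}]^+$, $P_r^{M_5}=[\frac{\mu_1}{g}-\frac1{S_2}]^+$, $P_r^{M_6}=\big[\frac{-b+\sqrt{b^2-4ac}}{2a}\big]^+$ with $a=gS_1S_2$, $b=g(S_1+S_2)-(\mu_1+\mu_2)S_1S_2$, $c=g-\mu_1S_2-\mu_2S_1$. If $A\le B$, put $t=0$, $P_1^{M_3}=\big[\frac Ag-\frac{B-A}{g}\frac1{S_1/S_2-1}\big]^+$,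 $P_2^{M_3}=\big[\frac{B-A}{g}\frac1{1-S_2/S_1}-\frac1{S_2}\big]^+$; otherwise put $t=1$, $P_1^{M_3}=\big[\frac{B-A}{g}\frac1{S_1/S_2-1}-\frac1{S_1}\big]^+$, $P_2^{M_3}=\big[\frac Bg-\frac{B-A}{g}\frac1{1-S_2/S_1}\big]^+$. The metrics are $\Lambda_1=AC_{1r}-\gamma P_1$, $\Lambda_2=BC_{2r}-\gamma P_2$, $\Lambda_3=AC_{12r}+BC_{21r}-\gamma(P_1+P_2)$, $\Lambda_4=\mu_2C_{r1}-\gamma P_r$, $\Lambda_5=\mu_1C_{r2}-\gamma P_r$, $\Lambda_6=\mu_1C_{r2}+\mu_2C_{r1}-\gamma P_r$, where $\Lambda_k$ is evaluated at the powers with superscript $M_k$. The selection regions are $\mathcal S_0$: $\mu_1\ne0,\mu_2\neq 0$; $\mathcal S_1$: $\mu_1=0,\mu_2\ne0$; $\mathcal S_2$: $\mu_1\ne0,\mu_2=0$. In each slot, four coins $\mathcal C_n\in\{0,1\}$ with $\Pr\{\mathcal C_n=1\}=p_n$ are flipped, independently of each other, of the other slots and of the channel, and the indicators $[\mathcal I_1,\dots,\mathcal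 I_6]$ are $[1,1,1,0,0,1]$ in $\mathcal S_0$ (and for $\mu_1=\mu_2=0$), $[1-\mathcal C_1,1,1,\mathcal C_1(1-\mathcal C_2),0,\mathcal C_1\mathcal C_2]$ in $\mathcal S_1$, and $[1,1-\mathcal C_3,1,0,\mathcal C_3(1-\mathcal C_4),\mathcal C_3\mathcal C_4]$ in $\mathcal S_2$. The protocol selects ($q_k=1$) the mode with the largest $\Lambda_k$ among those with $\mathcal I_k=1$ (ties broken by any fixed measurable rule), with the powers of that mode and the above $t$. A triple $(\mu_1,\mu_2,\gamma)$ is called *optimal* if for some $p_1,\dots,p_4\in[0,1]$ the protocol almost surely solves the long-term problem for the realized gain sequence. **Proposition.** Expectations below are over the gains of one slot; $q_k$ denotes the protocol's choice for any fixed coin outcomes (with $\mathcal C_1=1$ in Case 1 of $\mathcal S_1$ and $\mathcal C_3=1$ in Case 1 of $\mathcal S_2$), and capacities are taken at the protocol's powers (in formulas for coin probabilities: $C_{1r}$ at $P_1^{M_1}$, $C_{2r}$ at $P_2^{M_2}$, $C_{12r},C_{21r}$ at the powers of $M_3$, $C_{r1},C_{r2}$ at $P_r^{M_6}$). C1, C2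 and the power constraint are checked in expectation, for these $q_k$. 1. Every optimal triple satisfies $\mu_1\in[0,\eta)$, $\mu_2\in[0,1-\eta)$, $\gamma>0$ and lies in one of the mutually exclusive regions $\mathcal S_0,\mathcal S_1,\mathcal S_2$; at most one of the regions contains optimal triples. Hence the optimal triples are found by a search over these intervals with the following tests, which are necessary and sufficient for every triple in these intervals. 2. $\mathcal S_0$: no coin flip is involved, and the triple is optimal if and only if C1, C2 and the power constraint hold. 3. $\mathcal S_1$ ($\mu_1=0$): an optimal triple has $\mu_2\in[\eta,1-\eta)$. *Case 1, $\mu_2>\eta$:* $\Lambda_4=\Lambda_6$ for all positive gains. With $q=q_4+q_6$, the triple is optimal if and only if $E\{qC_{r2}\}>0$, $0\le p_2\le1$ for $p_2=\frac{E\{q_3C_{12r}\}}{E\{qC_{r2}\}}$, C2 and the power constraint hold; the coin probabilities for which the protocol is then optimal are exactly $p_1=1$ and this $p_2$. *Case 2, $\mu_2=\eta$:* $\Lambda_1=\Lambda_4=\Lambda_6$ for all positive gains. With $q=q_1+q_4+q_6$, $p_1=\frac{E\{q_2C_{2r}+q_3C_{21r}\}}{E\{qC_{r1}\}}$ and $p_2=\frac{(1-p_1)E\{qC_{1r}\}+E\{q_3C_{12r}\}}{p_1E\{qC_{r2}\}}$,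 the triple is optimal if and only if these quotients are defined (i.e. $E\{qC_{r1}\}$, $p_1$ and $E\{qC_{r2}\}$ are positive), $0\le p_1\le1$, $0\le p_2\le1$ and the power constraint holds; the coin probabilities for which the protocol is then optimal are exactly these $p_1,p_2$. 4. $\mathcal S_2$ ($\mu_2=0$): an optimal triple has $\mu_1\in[1-\eta,\eta)$. *Case 1, $\mu_1>1-\eta$:* $\Lambda_5=\Lambda_6$ for all positive gains. With $q=q_5+q_6$, the triple is optimal if and only if $E\{qC_{r1}\}>0$, $0\le p_4\le1$ for $p_4=\frac{E\{q_3C_{21r}\}}{E\{qC_{r1}\}}$, C1 and the power constraint hold; the coin probabilities are then exactly $p_3=1$ and this $p_4$. *Case 2, $\mu_1=1-\eta$:* $\Lambda_2=\Lambda_5=\Lambda_6$ for all positive gains. With $q=q_2+q_5+q_6$, $p_3=\frac{E\{q_1C_{1r}+q_3C_{12r}\}}{E\{qC_{r2}\}}$ and $p_4=\frac{(1-p_3)E\{qC_{2r}\}+E\{q_3C_{21r}\}}{p_3E\{qC_{r1}\}}$, the triple is optimal if and only if these quotients are defined (i.e. $E\{qC_{r2}\}$, $p_3$ and $E\{qC_{r1}\}$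 are positive), $0\le p_3\le1$, $0\le p_4\le1$ and the power constraint holds; the coin probabilities are then exactly these $p_3,p_4$. -/

import Mathlib

open MeasureTheory ProbabilityTheory Filter Topology

noncomputable section

namespace BidirRelay

/-- The pair `(S₁, S₂)` of squared channel amplitudes of one time slot. -/
abbrev Gain := ℝ × ℝ

/-- The process `S i = (S₁(i), S₂(i))` of channel power gains: jointly stationary and ergodic
(the shift is measure preserving and ergodic for the law of the whole sequence), non-negative,
with finite means, and such that the gains of a slot have a probability density. -/
structure IsFadingChannel {Ω : Type*} [MeasurableSpace Ω] (P : Measure Ω) (S : ℕ → Ω → Gain) :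
    Prop where
  measurable : ∀ i, Measurable (S i)
  ergodic : Ergodic (fun (x : ℕ → Gain) (i : ℕ) => x (i + 1)) (P.map fun ω i => S i ω)
  nonneg : ∀ i, ∀ᵐ ω ∂P, 0 ≤ (S i ω).1 ∧ 0 ≤ (S i ω).2
  density : ∀ i, (P.map (S i)) ≪ (volume : Measure Gain)
  mean₁ : ∀ i, Integrable (fun ω => (S i ω).1) P
  mean₂ : ∀ i, Integrable (fun ω => (S i ω).2) P

/-- `C(x) = log₂ (1 + x)`. -/
def cap (x : ℝ) : ℝ := Real.logb 2 (1 + x)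

/-! ### The long-term optimization problem

Mode `M_k` of the paper has index `k - 1 : Fin 6`. -/

/-- The variables of one time slot: (relaxed) mode selection `q`, decoding order `t`, and the
transmit powers of user 1, user 2 and the relay. -/
structure Action where
  q : Fin 6 → ℝ
  t : ℝ
  P₁ : ℝ
  P₂ : ℝ
  Pr : ℝ

/-- The constraints C3, C4, C5 and the non-negativity of the powers. -/
structure Action.Admissible (a : Action) : Prop where
  sum_q : ∑ k, a.q k = 1
  q_mem : ∀ k, 0 ≤ a.q k ∧ a.q k ≤ 1
  t_mem : 0 ≤ a.t ∧ a.t ≤ 1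
  P₁_nonneg : 0 ≤ a.P₁
  P₂_nonneg : 0 ≤ a.P₂
  Pr_nonneg : 0 ≤ a.Pr

/-- Multiple-access rate `C₁₂ᵣ` of user 1 for decoding order `t` and powers `P₁, P₂`. -/
def macRate₁ (t P₁ P₂ : ℝ) (s : Gain) : ℝ :=
  t * cap (P₁ * s.1) + (1 - t) * cap (P₁ * s.1 / (1 + P₂ * s.2))

/-- Multiple-access rate `C₂₁ᵣ` of user 2 for decoding order `t` and powers `P₁, P₂`. -/
def macRate₂ (t P₁ P₂ : ℝ) (s : Gain) : ℝ :=
  (1 - t) * cap (P₂ * s.2) + t * cap (P₂ * s.2 / (1 + P₁ * s.1))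

/-- `q₁ C₁ᵣ + q₃ C₁₂ᵣ`: user 1 to relay. -/
def Action.rate1r (a : Action) (s : Gain) : ℝ :=
  a.q 0 * cap (a.P₁ * s.1) + a.q 2 * macRate₁ a.t a.P₁ a.P₂ s

/-- `q₂ C₂ᵣ + q₃ C₂₁ᵣ`: user 2 to relay. -/
def Action.rate2r (a : Action) (s : Gain) : ℝ :=
  a.q 1 * cap (a.P₂ * s.2) + a.q 2 * macRate₂ a.t a.P₁ a.P₂ s

/-- `(q₄ + q₆) Cᵣ₁`: relay to user 1. -/
def Action.rater1 (a : Action) (s : Gain) : ℝ := (a.q 3 + a.q 5) * cap (a.Pr * s.1)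

/-- `(q₅ + q₆) Cᵣ₂`: relay to user 2. -/
def Action.rater2 (a : Action) (s : Gain) : ℝ := (a.q 4 + a.q 5) * cap (a.Pr * s.2)

/-- Power consumed by user 1. -/
def Action.power₁ (a : Action) : ℝ := (a.q 0 + a.q 2) * a.P₁

/-- Power consumed by user 2. -/
def Action.power₂ (a : Action) : ℝ := (a.q 1 + a.q 2) * a.P₂

/-- Power consumed by the relay. -/
def Action.powerr (a : Action) : ℝ := (a.q 3 + a.q 4 + a.q 5) * a.Pr

/-- `a` is the limit of the time averages `(1/N) ∑_{i < N} f i`. -/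
def HasTimeAverage (f : ℕ → ℝ) (a : ℝ) : Prop :=
  Tendsto (fun N : ℕ => (∑ i ∈ Finset.range N, f i) / (N : ℝ)) atTop (𝓝 a)

/-- For the sequence `s` of channel gains, the sequence `x` of slot variables satisfies all
constraints of the long-term problem with total power budget `Pt`, and its average rates are
`R₁ = R̄₁ᵣ = R̄ᵣ₂` (constraint C1) and `R₂ = R̄₂ᵣ = R̄ᵣ₁` (constraint C2). -/
structure IsFeasible (Pt : ℝ) (s : ℕ → Gain) (x : ℕ → Action) (R₁ R₂ : ℝ) : Prop where
  admissible : ∀ i, (x i).Admissible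
  avg1r : HasTimeAverage (fun i => (x i).rate1r (s i)) R₁
  avgr2 : HasTimeAverage (fun i => (x i).rater2 (s i)) R₁
  avg2r : HasTimeAverage (fun i => (x i).rate2r (s i)) R₂
  avgr1 : HasTimeAverage (fun i => (x i).rater1 (s i)) R₂
  power : ∃ p₁ p₂ pr : ℝ,
    HasTimeAverage (fun i => (x i).power₁) p₁ ∧ HasTimeAverage (fun i => (x i).power₂) p₂ ∧
      HasTimeAverage (fun i => (x i).powerr) pr ∧ p₁ + p₂ + pr = Pt

/-- `x` solves: maximize `η R̄₁ᵣ + (1 - η) R̄₂ᵣ` over all feasible sequences. -/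
def IsSolution (η Pt : ℝ) (s : ℕ → Gain) (x : ℕ → Action) : Prop :=
  ∃ R₁ R₂ : ℝ, IsFeasible Pt s x R₁ R₂ ∧
    ∀ (y : ℕ → Action) (R₁' R₂' : ℝ), IsFeasible Pt s y R₁' R₂' →
      η * R₁' + (1 - η) * R₂' ≤ η * R₁ + (1 - η) * R₂

/-! ### The protocol -/

/-- Selection weights `μ₁, μ₂` and power weight `γ`. -/
structure Weights where
  μ₁ : ℝ
  μ₂ : ℝ
  γ : ℝ

/-- Power of user 1 in mode `M₁`. -/
def power1M1 (η : ℝ) (w : Weights) (s : Gain) : ℝ :=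
  max ((η - w.μ₁) / (w.γ * Real.log 2) - 1 / s.1) 0

/-- Power of user 2 in mode `M₂`. -/
def power2M2 (η : ℝ) (w : Weights) (s : Gain) : ℝ :=
  max ((1 - η - w.μ₂) / (w.γ * Real.log 2) - 1 / s.2) 0

/-- Power of user 1 in mode `M₃`. -/
def power1M3 (η : ℝ) (w : Weights) (s : Gain) : ℝ :=
  if η - w.μ₁ ≤ 1 - η - w.μ₂ then
    max ((η - w.μ₁) / (w.γ * Real.log 2) -
      (1 - 2 * η + w.μ₁ - w.μ₂) / (w.γ * Real.log 2) * (1 / (s.1 / s.2 - 1))) 0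
  else
    max ((1 - 2 * η + w.μ₁ - w.μ₂) / (w.γ * Real.log 2) * (1 / (s.1 / s.2 - 1)) - 1 / s.1) 0

/-- Power of user 2 in mode `M₃`. -/
def power2M3 (η : ℝ) (w : Weights) (s : Gain) : ℝ :=
  if η - w.μ₁ ≤ 1 - η - w.μ₂ then
    max ((1 - 2 * η + w.μ₁ - w.μ₂) / (w.γ * Real.log 2) * (1 / (1 - s.2 / s.1)) - 1 / s.2) 0
  else
    max ((1 - η - w.μ₂) / (w.γ * Real.log 2) -
      (1 - 2 * η + w.μ₁ - w.μ₂) / (w.γ * Real.log 2) * (1 / (1 - s.2 / s.1))) 0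

/-- Power of the relay in mode `M₄`. -/
def powerrM4 (w : Weights) (s : Gain) : ℝ := max (w.μ₂ / (w.γ * Real.log 2) - 1 / s.1) 0

/-- Power of the relay in mode `M₅`. -/
def powerrM5 (w : Weights) (s : Gain) : ℝ := max (w.μ₁ / (w.γ * Real.log 2) - 1 / s.2) 0

/-- Power of the relay in mode `M₆`. -/
def powerrM6 (w : Weights) (s : Gain) : ℝ :=
  let a := w.γ * Real.log 2 * (s.1 * s.2)
  let b := w.γ * Real.log 2 * (s.1 + s.2) - (w.μ₁ + w.μ₂) * (s.1 * s.2)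
  let c := w.γ * Real.log 2 - w.μ₁ * s.2 - w.μ₂ * s.1
  max ((-b + Real.sqrt (b ^ 2 - 4 * a * c)) / (2 * a)) 0

/-- The decoding order `t`. -/
def decOrder (η : ℝ) (w : Weights) : ℝ := if η - w.μ₁ ≤ 1 - η - w.μ₂ then 0 else 1

/-- `C₁ᵣ` at the power of mode `M₁`. -/
def C1r (η : ℝ) (w : Weights) (s : Gain) : ℝ := cap (power1M1 η w s * s.1)

/-- `C₂ᵣ` at the power of mode `M₂`. -/
def C2r (η : ℝ) (w : Weights) (s : Gain) : ℝ := cap (power2M2 η w s * s.2)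

/-- `C₁₂ᵣ` at the powers and the decoding order of mode `M₃`. -/
def C12r (η : ℝ) (w : Weights) (s : Gain) : ℝ :=
  macRate₁ (decOrder η w) (power1M3 η w s) (power2M3 η w s) s

/-- `C₂₁ᵣ` at the powers and the decoding order of mode `M₃`. -/
def C21r (η : ℝ) (w : Weights) (s : Gain) : ℝ :=
  macRate₂ (decOrder η w) (power1M3 η w s) (power2M3 η w s) s

/-- `Cᵣ₁` at the power of mode `M₆`. -/
def Cr1 (w : Weights) (s : Gain) : ℝ := cap (powerrM6 w s * s.1)

/-- `Cᵣ₂` at the power of mode `M₆`. -/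
def Cr2 (w : Weights) (s : Gain) : ℝ := cap (powerrM6 w s * s.2)

/-- The selection metrics `Λ₁, …, Λ₆`. -/
def metric (η : ℝ) (w : Weights) (s : Gain) : Fin 6 → ℝ :=
  ![(η - w.μ₁) * C1r η w s - w.γ * power1M1 η w s,
    (1 - η - w.μ₂) * C2r η w s - w.γ * power2M2 η w s,
    (η - w.μ₁) * C12r η w s + (1 - η - w.μ₂) * C21r η w s -
      w.γ * (power1M3 η w s + power2M3 η w s),
    w.μ₂ * cap (powerrM4 w s * s.1) - w.γ * powerrM4 w s,
    w.μ₁ * cap (powerrM5 w s * s.2) - w.γ * powerrM5 w s,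
    w.μ₁ * Cr2 w s + w.μ₂ * Cr1 w s - w.γ * powerrM6 w s]

/-- The three selection regions. -/
inductive Region
  | S0
  | S1
  | S2

/-- The weights `w` lie in a given selection region. -/
def Weights.InRegion (w : Weights) : Region → Prop
  | .S0 => w.μ₁ ≠ 0 ∧ w.μ₂ ≠ 0
  | .S1 => w.μ₁ = 0 ∧ w.μ₂ ≠ 0
  | .S2 => w.μ₁ ≠ 0 ∧ w.μ₂ = 0

/-- The outcomes of the four coin flips of one time slot; the `n`-th coin has index `n - 1`. -/
abbrev Coins := Fin 4 → Bool

/-- The indicators `I₁, …, I₆` of the candidate modes. (For `μ₁ = μ₂ = 0`, which belongs to no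
selection region, the indicators of the first region are used.) -/
def indicator (w : Weights) (c : Coins) : Fin 6 → ℕ :=
  let C : Fin 4 → ℕ := fun n => (c n).toNat
  if w.μ₁ = 0 ∧ w.μ₂ ≠ 0 then
    ![1 - C 0, 1, 1, C 0 * (1 - C 1), 0, C 0 * C 1]
  else if w.μ₁ ≠ 0 ∧ w.μ₂ = 0 then
    ![1, 1 - C 2, 1, 0, C 2 * (1 - C 3), C 2 * C 3]
  else ![1, 1, 1, 0, 0, 1]

/-- The modes that are possible candidates for selection. -/
def candidates (w : Weights) (c : Coins) : Finset (Fin 6) :=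
  Finset.univ.filter fun k => indicator w c k = 1

/-- `sel K v` is an index `k ∈ K` with maximal `v k`: an `arg max` with some measurable rule
for breaking ties. -/
structure IsArgMax (sel : Finset (Fin 6) → (Fin 6 → ℝ) → Fin 6) : Prop where
  mem : ∀ K : Finset (Fin 6), K.Nonempty → ∀ v, sel K v ∈ K
  le : ∀ (K : Finset (Fin 6)) (v : Fin 6 → ℝ), ∀ k ∈ K, v k ≤ v (sel K v)
  measurable : ∀ K : Finset (Fin 6), Measurable (sel K)

section Protocol

variable (sel : Finset (Fin 6) → (Fin 6 → ℝ) → Fin 6) (η : ℝ) (w : Weights)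

/-- The mode selected for coin outcomes `c` and gains `s`: the candidate mode with the largest
selection metric. -/
def mode (c : Coins) (s : Gain) : Fin 6 := sel (candidates w c) (metric η w s)

/-- The slot variables chosen by the protocol for coin outcomes `c` and gains `s`. -/
def protocol (c : Coins) (s : Gain) : Action where
  q := fun k => if k = mode sel η w c s then 1 else 0
  t := decOrder η w
  P₁ := ![power1M1 η w s, 0, power1M3 η w s, 0, 0, 0] (mode sel η w c s)
  P₂ := ![0, power2M2 η w s, power2M3 η w s, 0, 0, 0] (mode sel η w c s)
  Pr := ![0, 0, 0, powerrM4 w s, powerrM5 w s, powerrM6 w s] (mode sel η w c s)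

end Protocol

/-- The law of the coin flips: independent over the slots and the four coins, the `n`-th coin
showing 1 (`true`) with probability `p n`. -/
def coinLaw (p : Fin 4 → unitInterval) : Measure (ℕ → Coins) :=
  Measure.infinitePi fun _ : ℕ => Measure.pi fun n => bernoulliMeasure true false (p n)

section Statistics

variable {Ω : Type*} [MeasurableSpace Ω] (P : Measure Ω) (S : ℕ → Ω → Gain)
  (sel : Finset (Fin 6) → (Fin 6 → ℝ) → Fin 6) (η Pt : ℝ) (w : Weights)

/-- The protocol with weights `w` and coin flip probabilities `p` solves the long-term problem,
for almost every realization of the channel and of the (independent) coin flips. -/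
def IsOptimalWith (p : Fin 4 → unitInterval) : Prop :=
  ∀ᵐ z ∂(P.prod (coinLaw p)),
    IsSolution η Pt (fun i => S i z.1) (fun i => protocol sel η w (z.2 i) (S i z.1))

/-- The weights `w` are optimal: for suitable coin flip probabilities the protocol solves the
long-term problem. -/
def IsOptimal : Prop := ∃ p : Fin 4 → unitInterval, IsOptimalWith P S sel η Pt w p

/-- Expectation of a function of the gains of a slot. -/
def expect (f : Gain → ℝ) : ℝ := ∫ ω, f (S 0 ω) ∂P

/-- `E{(∑_{k ∈ K} q_k) f}` for fixed coin outcomes `c`. -/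
def selExpect (c : Coins) (K : Finset (Fin 6)) (f : Gain → ℝ) : ℝ :=
  expect P S fun s => (∑ k ∈ K, (protocol sel η w c s).q k) * f s

/-- Constraint C1, in expectation, for fixed coin outcomes `c`:
`E{q₁ C₁ᵣ + q₃ C₁₂ᵣ} = E{(q₅ + q₆) Cᵣ₂}`. -/
def HoldsC1 (c : Coins) : Prop :=
  expect P S (fun s => (protocol sel η w c s).rate1r s) =
    expect P S (fun s => (protocol sel η w c s).rater2 s)

/-- Constraint C2, in expectation, for fixed coin outcomes `c`:
`E{q₂ C₂ᵣ + q₃ C₂₁ᵣ} = E{(q₄ + q₆) Cᵣ₁}`. -/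
def HoldsC2 (c : Coins) : Prop :=
  expect P S (fun s => (protocol sel η w c s).rate2r s) =
    expect P S (fun s => (protocol sel η w c s).rater1 s)

/-- The long-term power constraint, in expectation, for fixed coin outcomes `c`. -/
def HoldsPower (c : Coins) : Prop :=
  expect P S (fun s => (protocol sel η w c s).power₁) +
    expect P S (fun s => (protocol sel η w c s).power₂) +
      expect P S (fun s => (protocol sel η w c s).powerr) = Pt

/-- The box that is searched: `μ₁ ∈ [0, η)`, `μ₂ ∈ [0, 1 - η)`, `γ > 0`. -/
def InBox : Prop :=
  (0 ≤ w.μ₁ ∧ w.μ₁ < η) ∧ (0 ≤ w.μ₂ ∧ w.μ₂ < 1 - η) ∧ 0 < w.γ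

/-- `p₂` in the case `μ₁ = 0`, `μ₂ ≠ η`. -/
def p2CaseOne (c : Coins) : ℝ :=
  selExpect P S sel η w c {2} (C12r η w) / selExpect P S sel η w c {3, 5} (Cr2 w)

/-- `p₁` in the case `μ₁ = 0`, `μ₂ = η`. -/
def p1CaseTwo (c : Coins) : ℝ :=
  (selExpect P S sel η w c {1} (C2r η w) + selExpect P S sel η w c {2} (C21r η w)) /
    selExpect P S sel η w c {0, 3, 5} (Cr1 w)

/-- `p₂` in the case `μ₁ = 0`, `μ₂ = η`. -/
def p2CaseTwo (c : Coins) : ℝ :=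
  ((1 - p1CaseTwo P S sel η w c) * selExpect P S sel η w c {0, 3, 5} (C1r η w) +
      selExpect P S sel η w c {2} (C12r η w)) /
    (p1CaseTwo P S sel η w c * selExpect P S sel η w c {0, 3, 5} (Cr2 w))

/-- `p₄` in the case `μ₂ = 0`, `μ₁ ≠ 1 - η`. -/
def p4CaseOne (c : Coins) : ℝ :=
  selExpect P S sel η w c {2} (C21r η w) / selExpect P S sel η w c {4, 5} (Cr1 w)

/-- `p₃` in the case `μ₂ = 0`, `μ₁ = 1 - η`. -/
def p3CaseTwo (c : Coins) : ℝ :=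
  (selExpect P S sel η w c {0} (C1r η w) + selExpect P S sel η w c {2} (C12r η w)) /
    selExpect P S sel η w c {1, 4, 5} (Cr2 w)

/-- `p₄` in the case `μ₂ = 0`, `μ₁ = 1 - η`. -/
def p4CaseTwo (c : Coins) : ℝ :=
  ((1 - p3CaseTwo P S sel η w c) * selExpect P S sel η w c {1, 4, 5} (C2r η w) +
      selExpect P S sel η w c {2} (C21r η w)) /
    (p3CaseTwo P S sel η w c * selExpect P S sel η w c {1, 4, 5} (Cr1 w))

end Statistics

end BidirRelay

end

namespace BidirRelay

section Birkhoff

variable {X : Type*} {T : X → X}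

/-- The running maxima of the Birkhoff sums `f x + f (T x) + ⋯` with at least one summand. -/
def birkhoffMax (T : X → X) (f : X → ℝ) : ℕ → X → ℝ
  | 0 => f
  | n + 1 => fun x => f x + max 0 (birkhoffMax T f n (T x))

lemma birkhoffMax_mono (f : X → ℝ) (n : ℕ) (x : X) :
    birkhoffMax T f n x ≤ birkhoffMax T f (n + 1) x := by
  induction n generalizing x with
  | zero => simp [birkhoffMax]
  | succ n ih =>
    have := ih (T x)
    simp only [birkhoffMax] at this ⊢
    gcongr

lemma le_birkhoffMax (f : X → ℝ) (n : ℕ) (x : X) : f x ≤ birkhoffMax T f n x := by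
  cases n <;> simp [birkhoffMax]

lemma birkhoffSum_le_birkhoffMax (f : X → ℝ) (n : ℕ) (x : X) :
    birkhoffSum T f (n + 1) x ≤ birkhoffMax T f n x := by
  induction n generalizing x with
  | zero => simp [birkhoffMax, birkhoffSum]
  | succ n ih =>
    rw [birkhoffSum_succ']
    simp only [birkhoffMax]
    gcongr
    exact (ih (T x)).trans (le_max_right _ _)

variable [MeasurableSpace X] {μ : Measure X}

lemma measurable_birkhoffMax (hT : Measurable T) {f : X → ℝ} (hf : Measurable f) (n : ℕ) :
    Measurable (birkhoffMax T f n) := by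
  induction n with
  | zero => exact hf
  | succ n ih =>
    simp only [birkhoffMax]
    exact hf.add (measurable_const.max (ih.comp hT))

lemma integrable_birkhoffMax (hT : MeasurePreserving T μ μ) {f : X → ℝ} (hf : Integrable f μ)
    (n : ℕ) : Integrable (birkhoffMax T f n) μ := by
  induction n with
  | zero => exact hf
  | succ n ih =>
    simp only [birkhoffMax]
    have h := (hT.integrable_comp ih.1).2 ih
    have h2 := h.pos_part
    refine hf.add (h2.congr (ae_of_all _ fun x => ?_))
    simp [max_comm]

lemma integral_nonneg_of_birkhoffMax_tendsto (hT : MeasurePreserving T μ μ) {f : X → ℝ}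
    (hf : Integrable f μ) (h : ∀ᵐ x ∂μ, ∀ C : ℕ, ∃ n, (C : ℝ) < birkhoffMax T f n x) :
    0 ≤ ∫ x, f x ∂μ := by
  have hint := integrable_birkhoffMax hT hf
  have hmin : ∀ n, Integrable (fun x => min 0 (birkhoffMax T f n x)) μ := fun n => by
    have := (hint n).neg_part.neg
    refine this.congr (ae_of_all _ fun x => ?_)
    simp only [Pi.neg_apply]
    rcases le_total 0 (birkhoffMax T f n x) with h | h
    · simp [h]
    · simp [h]
  have hmax : ∀ n, Integrable (fun x => max 0 (birkhoffMax T f n x)) μ := fun n => by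
    refine (hint n).pos_part.congr (ae_of_all _ fun x => ?_)
    simp [max_comm]
  have hle : ∀ n, ∫ x, min 0 (birkhoffMax T f n x) ∂μ ≤ ∫ x, f x ∂μ := by
    intro n
    have h1 : ∫ x, birkhoffMax T f n x ∂μ ≤ ∫ x, birkhoffMax T f (n + 1) x ∂μ :=
      integral_mono (hint n) (hint (n + 1)) (birkhoffMax_mono f n)
    have h2 : ∫ x, birkhoffMax T f (n + 1) x ∂μ
        = ∫ x, f x ∂μ + ∫ x, max 0 (birkhoffMax T f n x) ∂μ := by
      simp only [birkhoffMax]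
      have hc : Integrable (fun x => max 0 (birkhoffMax T f n (T x))) μ :=
        (hT.integrable_comp (hmax n).1).2 (hmax n)
      rw [integral_add hf hc]
      congr 1
      have := integral_map (μ := μ) hT.measurable.aemeasurable
        (f := fun x => max 0 (birkhoffMax T f n x)) (by rw [hT.map_eq]; exact (hmax n).1)
      rw [hT.map_eq] at this
      exact this.symm
    have h3 : ∫ x, birkhoffMax T f n x ∂μ = ∫ x, min 0 (birkhoffMax T f n x) ∂μ
        + ∫ x, max 0 (birkhoffMax T f n x) ∂μ := by
      rw [← integral_add (hmin n) (hmax n)]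
      congr 1; ext x
      rw [min_add_max, zero_add]
    linarith
  have hlim : Tendsto (fun n => ∫ x, min 0 (birkhoffMax T f n x) ∂μ) atTop (𝓝 (∫ _, (0 : ℝ) ∂μ)) := by
    refine tendsto_integral_of_dominated_convergence (fun x => |f x|) (fun n => (hmin n).1)
      hf.abs (fun n => ae_of_all _ fun x => ?_) ?_
    · have := le_birkhoffMax (T := T) f n x
      rw [Real.norm_eq_abs, abs_of_nonpos (min_le_left _ _), neg_le]
      refine le_min (by simp) (le_trans ?_ this)
      exact neg_abs_le _
    · filter_upwards [h] with x hx
      obtain ⟨n, hn⟩ := hx 0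
      refine tendsto_const_nhds.congr' ?_
      filter_upwards [eventually_ge_atTop n] with k hk
      have hmono : Monotone fun n => birkhoffMax T f n x :=
        monotone_nat_of_le_succ fun n => birkhoffMax_mono f n x
      have : 0 ≤ birkhoffMax T f k x := by
        have := hmono hk
        simp only at this
        push_cast at hn
        linarith
      exact (min_eq_left this).symm
  simp only [integral_zero] at hlim
  exact le_of_tendsto' hlim hle

/-- If the integral of `f` is negative, the Birkhoff sums are almost surely bounded above. -/
lemma birkhoffSum_bddAbove_of_integral_neg [IsProbabilityMeasure μ] (hT : Ergodic T μ) {f : X → ℝ}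
    (hfm : Measurable f) (hf : Integrable f μ) (hneg : ∫ x, f x ∂μ < 0) :
    ∀ᵐ x ∂μ, ∃ C : ℝ, ∀ n, birkhoffSum T f n x ≤ C := by
  set A : Set X := {x | ∀ C : ℕ, ∃ n, (C : ℝ) < birkhoffMax T f n x} with hA
  have hAm : MeasurableSet A := by
    have : A = ⋂ C : ℕ, ⋃ n, {x | (C : ℝ) < birkhoffMax T f n x} := by
      ext x; simp [hA]
    rw [this]
    exact MeasurableSet.iInter fun C => MeasurableSet.iUnion fun n =>
      measurableSet_lt measurable_const (measurable_birkhoffMax hT.measurable hfm n)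
  have hinv : T ⁻¹' A = A := by
    ext x
    simp only [hA, Set.mem_preimage, Set.mem_ofPred_eq]
    constructor
    · intro h C
      obtain ⟨K, hK⟩ := exists_nat_gt ((C : ℝ) - f x)
      obtain ⟨n, hn⟩ := h K
      refine ⟨n + 1, ?_⟩
      simp only [birkhoffMax]
      have := le_max_right 0 (birkhoffMax T f n (T x))
      linarith
    · intro h C
      obtain ⟨K, hK⟩ := exists_nat_gt ((C : ℝ) + f x)
      obtain ⟨n, hn⟩ := h (max K ⌈f x⌉₊)
      refine ⟨n, ?_⟩
      have h1 := hn.trans_le (birkhoffMax_mono f n x)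
      simp only [birkhoffMax] at h1
      push_cast at h1
      have h2 : (C : ℝ) < max 0 (birkhoffMax T f n (T x)) := by
        have := le_max_left (K : ℝ) ⌈f x⌉₊
        linarith
      rcases lt_max_iff.1 h2 with h3 | h3
      · exact absurd h3 (not_lt.2 (Nat.cast_nonneg C))
      · exact h3
  rcases hT.toPreErgodic.ae_mem_or_ae_notMem hAm hinv with h | h
  · exact absurd (integral_nonneg_of_birkhoffMax_tendsto hT.toMeasurePreserving hf h)
      (not_le.2 hneg)
  · filter_upwards [h] with x hx
    simp only [hA, Set.mem_ofPred_eq, not_forall, not_exists, not_lt] at hx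
    obtain ⟨C, hC⟩ := hx
    refine ⟨C, fun n => ?_⟩
    cases n with
    | zero => simp
    | succ n => exact (birkhoffSum_le_birkhoffMax f n x).trans (hC n)

lemma birkhoffSum_div_eventually_le [IsProbabilityMeasure μ] (hT : Ergodic T μ) {f : X → ℝ}
    (hfm : Measurable f) (hf : Integrable f μ) :
    ∀ᵐ x ∂μ, ∀ k : ℕ, ∀ᶠ n : ℕ in atTop,
      birkhoffSum T f n x / n ≤ ∫ y, f y ∂μ + 1 / ((k : ℝ) + 1) := by
  rw [ae_all_iff]
  intro k
  set ε : ℝ := 1 / ((k : ℝ) + 1) with hε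
  have hεpos : 0 < ε := by positivity
  set c := ∫ y, f y ∂μ + ε / 2 with hc
  have hb := birkhoffSum_bddAbove_of_integral_neg hT (f := fun x => f x - c)
    (hfm.sub_const _) (hf.sub (integrable_const _)) (by
      rw [integral_sub hf (integrable_const _)]
      simp [hc]; linarith)
  filter_upwards [hb] with x ⟨C, hC⟩
  have hsum : ∀ n, birkhoffSum T (fun x => f x - c) n x = birkhoffSum T f n x - n * c := by
    intro n; simp [birkhoffSum, Finset.sum_sub_distrib]
  have hlim : Tendsto (fun n : ℕ => C / (n : ℝ)) atTop (𝓝 0) := tendsto_const_div_atTop_nhds_zero_nat C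
  filter_upwards [hlim.eventually (gt_mem_nhds (half_pos hεpos)), eventually_gt_atTop 0] with n hn h0
  have h1 := hC n
  rw [hsum] at h1
  have hn0 : (0 : ℝ) < n := by exact_mod_cast h0
  have h2 : birkhoffSum T f n x / n ≤ C / n + c := by
    rw [div_add' _ _ _ hn0.ne']
    gcongr
    linarith
  linarith

/-- **Birkhoff's pointwise ergodic theorem** for an ergodic transformation. -/
theorem tendsto_birkhoffSum_div [IsProbabilityMeasure μ] (hT : Ergodic T μ) {f : X → ℝ}
    (hfm : Measurable f) (hf : Integrable f μ) :
    ∀ᵐ x ∂μ, Tendsto (fun n : ℕ => birkhoffSum T f n x / n) atTop (𝓝 (∫ y, f y ∂μ)) := by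
  filter_upwards [birkhoffSum_div_eventually_le hT hfm hf,
    birkhoffSum_div_eventually_le hT hfm.neg hf.neg] with x h1 h2
  rw [Metric.tendsto_atTop']
  intro ε hε
  obtain ⟨k, hk⟩ := exists_nat_one_div_lt hε
  obtain ⟨N, hN⟩ := eventually_atTop.1 ((h1 k).and (h2 k))
  refine ⟨N, fun n hn => ?_⟩
  obtain ⟨ha, hb⟩ := hN n hn.le
  have : birkhoffSum T (-f) n x = - birkhoffSum T f n x := by
    simp [birkhoffSum]
  rw [this, neg_div] at hb
  simp only [Pi.neg_apply, integral_neg] at hb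
  rw [Real.dist_eq, abs_lt]
  constructor <;> linarith

end Birkhoff

section Skew

variable {X D : Type*} [MeasurableSpace X] [MeasurableSpace D]

lemma measurePreserving_shift_infinitePi (κ : Measure D) [IsProbabilityMeasure κ] (n : ℕ) :
    MeasurePreserving (fun (y : ℕ → D) i => y (i + n)) (Measure.infinitePi fun _ : ℕ => κ)
      (Measure.infinitePi fun _ : ℕ => κ) where
  measurable := by fun_prop
  map_eq := Measure.map_infinitePi_infinitePi_of_inj (P := fun _ : ℕ => κ)
    (f := fun i => i + n) (add_left_injective n)

/-- An event that does not depend on finitely many coordinates of an i.i.d. sequence is trivial. -/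
lemma infinitePi_zero_or_one (κ : Measure D) [IsProbabilityMeasure κ] {A : Set (ℕ → D)}
    (B : ℕ → Set (ℕ → D)) (hB : ∀ n, MeasurableSet (B n))
    (hA : ∀ n, A = (fun (y : ℕ → D) i => y (i + n)) ⁻¹' B n) :
    Measure.infinitePi (fun _ : ℕ => κ) A = 0 ∨ Measure.infinitePi (fun _ : ℕ => κ) A = 1 := by
  have hind : iIndep (fun i : ℕ => MeasurableSpace.comap (fun y : ℕ → D => y i) inferInstance)
      (Measure.infinitePi fun _ : ℕ => κ) :=
    iIndepFun_infinitePi (P := fun _ : ℕ => κ) (X := fun _ (x : D) => x) (fun _ => measurable_id)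
  refine measure_zero_or_one_of_measurableSet_limsup_atTop
    (fun i => (measurable_pi_apply i).comap_le) hind ?_
  rw [limsup_eq_iInf_iSup_of_nat, MeasurableSpace.measurableSet_iInf]
  intro n
  rw [hA n]
  have : @Measurable _ _ (⨆ i, ⨆ (_ : i ≥ n),
      MeasurableSpace.comap (fun y : ℕ → D => y i) inferInstance) MeasurableSpace.pi
      (fun (y : ℕ → D) i => y (i + n)) := by
    refine @measurable_pi_lambda _ _ _ (_) _ _ fun i => ?_
    rw [measurable_iff_comap_le]
    exact le_iSup₂_of_le (i + n) (Nat.le_add_left n i) le_rfl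
  exact this (hB n)

theorem ergodic_prod_shift {μ : Measure X} [IsProbabilityMeasure μ] {T : X → X} (hT : Ergodic T μ)
    (κ : Measure D) [IsProbabilityMeasure κ] :
    Ergodic (Prod.map T fun (y : ℕ → D) i => y (i + 1))
      (μ.prod (Measure.infinitePi fun _ : ℕ => κ)) := by
  set π := Measure.infinitePi fun _ : ℕ => κ with hπ
  have hσ := measurePreserving_shift_infinitePi κ 1
  refine ⟨hT.toMeasurePreserving.prod hσ, ⟨fun A hA hinv => ?_⟩⟩
  have hiter : ∀ n x y, (x, y) ∈ A ↔ (T^[n] x, fun i => y (i + n)) ∈ A := by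
    intro n
    induction n with
    | zero => intro x y; simp
    | succ n ih =>
      intro x y
      rw [ih x y, ← Set.ext_iff.1 hinv (T^[n] x, fun i => y (i + n))]
      simp [Prod.map, Function.iterate_succ_apply', add_assoc, add_comm 1 n]
  have h01 : ∀ x, π (Prod.mk x ⁻¹' A) = 0 ∨ π (Prod.mk x ⁻¹' A) = 1 := fun x =>
    infinitePi_zero_or_one κ (fun n => Prod.mk (T^[n] x) ⁻¹' A)
      (fun n => measurable_prodMk_left hA) (fun n => by
        ext y; exact hiter n x y)
  set φ : X → ENNReal := fun x => π (Prod.mk x ⁻¹' A) with hφ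
  have hφm : Measurable φ := measurable_measure_prodMk_left hA
  have hφT : ∀ x, φ (T x) = φ x := by
    intro x
    have h1 : Prod.mk x ⁻¹' A = (fun (y : ℕ → D) i => y (i + 1)) ⁻¹' (Prod.mk (T x) ⁻¹' A) := by
      ext y
      simpa using hiter 1 x y
    simp only [hφ]
    rw [h1, hσ.measure_preimage (measurable_prodMk_left hA).nullMeasurableSet]
  have hB : MeasurableSet {x | φ x = 0} := hφm (measurableSet_singleton 0)
  rw [eventuallyConst_set']
  rcases hT.toPreErgodic.ae_mem_or_ae_notMem hB (by ext x; simp [hφT]) with h | h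
  · left
    rw [ae_eq_empty, Measure.measure_prod_null hA]
    exact h
  · right
    rw [ae_eq_univ, Measure.measure_prod_null hA.compl]
    filter_upwards [h] with x hx
    have h1 : π (Prod.mk x ⁻¹' A) = 1 := (h01 x).resolve_left hx
    rw [Set.preimage_compl]
    exact (prob_compl_eq_zero_iff (measurable_prodMk_left hA)).2 h1

end Skew

section ErgodicAverages

variable {Ω X D : Type*} [MeasurableSpace Ω] [MeasurableSpace X] [MeasurableSpace D]
  {P : Measure Ω} [IsProbabilityMeasure P] {S : ℕ → Ω → X}

/-- Time averages along a stationary ergodic process and independent i.i.d. marks. -/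
theorem hasTimeAverage_of_ergodic (hS : ∀ i, Measurable (S i))
    (hE : Ergodic (fun (x : ℕ → X) (i : ℕ) => x (i + 1)) (P.map fun ω i => S i ω))
    (κ : Measure D) [IsProbabilityMeasure κ] {f : X × D → ℝ} (hfm : Measurable f)
    (hf : Integrable f ((P.map (S 0)).prod κ)) :
    ∀ᵐ z ∂(P.prod (Measure.infinitePi fun _ : ℕ => κ)),
      HasTimeAverage (fun i => f (S i z.1, z.2 i)) (∫ y, f y ∂((P.map (S 0)).prod κ)) := by
  set π := Measure.infinitePi fun _ : ℕ => κ with hπ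
  have hSm : Measurable fun ω i => S i ω := measurable_pi_lambda _ hS
  have : IsProbabilityMeasure (P.map fun ω i => S i ω) :=
    Measure.isProbabilityMeasure_map hSm.aemeasurable
  have : IsProbabilityMeasure (P.map (S 0)) :=
    Measure.isProbabilityMeasure_map (hS 0).aemeasurable
  have hmap : (P.prod π).map (Prod.map (fun ω i => S i ω) id)
      = (P.map fun ω i => S i ω).prod π := by
    rw [← Measure.map_prod_map _ _ hSm measurable_id, Measure.map_id]
  have he : Measurable fun z : (ℕ → X) × (ℕ → D) => (z.1 0, z.2 0) := by fun_prop
  have hmap0 : ((P.map fun ω i => S i ω).prod π).map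
      (fun z : (ℕ → X) × (ℕ → D) => (z.1 0, z.2 0)) = (P.map (S 0)).prod κ := by
    have := Measure.map_prod_map (P.map fun ω i => S i ω) π
      (f := fun x : ℕ → X => x 0) (g := fun y : ℕ → D => y 0) (by fun_prop) (by fun_prop)
    rw [Measure.map_map (by fun_prop) hSm, hπ, Measure.infinitePi_map_eval] at this
    exact this.symm
  have hint : Integrable (fun z : (ℕ → X) × (ℕ → D) => f (z.1 0, z.2 0))
      ((P.map fun ω i => S i ω).prod π) := by
    rw [← hmap0] at hf
    exact hf.comp_measurable he
  have key := tendsto_birkhoffSum_div (ergodic_prod_shift hE κ) (hfm.comp he) hint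
  rw [← hmap] at key
  have key2 := ae_of_ae_map (by fun_prop) key
  filter_upwards [key2] with z hz
  have hval : ∫ y, (f ∘ fun z : (ℕ → X) × (ℕ → D) => (z.1 0, z.2 0)) y
      ∂(P.prod π).map (Prod.map (fun ω i => S i ω) id) = ∫ y, f y ∂((P.map (S 0)).prod κ) := by
    rw [hmap, ← hmap0, integral_map he.aemeasurable hfm.aestronglyMeasurable]
    rfl
  rw [hval] at hz
  refine hz.congr fun n => ?_
  congr 1
  refine Finset.sum_congr rfl fun i _ => ?_
  have hit : (Prod.map (fun (x : ℕ → X) (i : ℕ) => x (i + 1)) fun (y : ℕ → D) i => y (i + 1))^[i]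
      (Prod.map (fun ω i => S i ω) id z) = (fun j => S (j + i) z.1, fun j => z.2 (j + i)) := by
    clear * -
    induction i with
    | zero => rfl
    | succ i ih =>
      rw [Function.iterate_succ_apply', ih]
      simp [Prod.map, add_assoc, add_comm 1 i]
  simp only [Function.comp_apply, hit, zero_add]

lemma HasTimeAverage.unique {f : ℕ → ℝ} {a b : ℝ} (ha : HasTimeAverage f a)
    (hb : HasTimeAverage f b) : a = b := tendsto_nhds_unique ha hb

lemma HasTimeAverage.le {f g : ℕ → ℝ} {a b : ℝ} (ha : HasTimeAverage f a)
    (hb : HasTimeAverage g b) (h : ∀ i, f i ≤ g i) : a ≤ b :=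
  le_of_tendsto_of_tendsto' ha hb fun N => by
    gcongr with i _
    exact h i

lemma HasTimeAverage.add {f g : ℕ → ℝ} {a b : ℝ} (ha : HasTimeAverage f a)
    (hb : HasTimeAverage g b) : HasTimeAverage (fun i => f i + g i) (a + b) :=
  (Tendsto.add ha hb).congr fun N => by rw [Finset.sum_add_distrib, add_div]

lemma HasTimeAverage.const_mul {f : ℕ → ℝ} {a : ℝ} (c : ℝ) (ha : HasTimeAverage f a) :
    HasTimeAverage (fun i => c * f i) (c * a) :=
  (Tendsto.const_mul c ha).congr fun N => by rw [← Finset.mul_sum, mul_div_assoc]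

/-- A non-negative function with finite time averages is integrable. -/
theorem integrable_of_hasTimeAverage (hS : ∀ i, Measurable (S i))
    (hE : Ergodic (fun (x : ℕ → X) (i : ℕ) => x (i + 1)) (P.map fun ω i => S i ω))
    (κ : Measure D) [IsProbabilityMeasure κ] {f : X × D → ℝ} (hfm : Measurable f)
    (h0 : ∀ y, 0 ≤ f y)
    (h : ∀ᵐ z ∂(P.prod (Measure.infinitePi fun _ : ℕ => κ)),
      ∃ a, HasTimeAverage (fun i => f (S i z.1, z.2 i)) a) :
    Integrable f ((P.map (S 0)).prod κ) := by
  have : IsProbabilityMeasure (P.map (S 0)) :=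
    Measure.isProbabilityMeasure_map (hS 0).aemeasurable
  have hk : ∀ k : ℕ, Integrable (fun y => min (f y) k) ((P.map (S 0)).prod κ) := fun k => by
    refine Integrable.of_bound (hfm.min measurable_const).aestronglyMeasurable k
      (ae_of_all _ fun y => ?_)
    rw [Real.norm_eq_abs, abs_of_nonneg (le_min (h0 y) (Nat.cast_nonneg k))]
    exact min_le_right _ _
  have hall : ∀ᵐ z ∂(P.prod (Measure.infinitePi fun _ : ℕ => κ)), ∀ k : ℕ,
      HasTimeAverage (fun i => min (f (S i z.1, z.2 i)) k)
        (∫ y, min (f y) k ∂((P.map (S 0)).prod κ)) := by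
    rw [ae_all_iff]
    exact fun k => hasTimeAverage_of_ergodic hS hE κ (hfm.min measurable_const) (hk k)
  obtain ⟨z, ⟨a, ha⟩, hz⟩ := (h.and hall).exists
  have hle : ∀ k : ℕ, ∫ y, min (f y) k ∂((P.map (S 0)).prod κ) ≤ a := fun k =>
    (hz k).le ha fun i => min_le_left _ _
  refine ⟨hfm.aestronglyMeasurable, ?_⟩
  rw [hasFiniteIntegral_iff_ofReal (ae_of_all _ h0)]
  have hlim : ∫⁻ y, ENNReal.ofReal (f y) ∂((P.map (S 0)).prod κ)
      = ⨆ k : ℕ, ∫⁻ y, ENNReal.ofReal (min (f y) k) ∂((P.map (S 0)).prod κ) := by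
    rw [← lintegral_iSup (fun k => (hfm.min measurable_const).ennreal_ofReal)
      (fun i j hij y => ENNReal.ofReal_le_ofReal (min_le_min_left _ (by exact_mod_cast hij)))]
    refine lintegral_congr fun y => le_antisymm ?_ (iSup_le fun k =>
      ENNReal.ofReal_le_ofReal (min_le_left _ _))
    obtain ⟨k, hk⟩ := exists_nat_ge (f y)
    exact le_iSup_of_le k (by rw [min_eq_left hk])
  rw [hlim]
  refine lt_of_le_of_lt (iSup_le fun k => ?_) (ENNReal.ofReal_lt_top (r := a))
  rw [← ofReal_integral_eq_lintegral_ofReal (hk k)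
    (ae_of_all _ fun y => le_min (h0 y) (Nat.cast_nonneg k))]
  exact ENNReal.ofReal_le_ofReal (hle k)

end ErgodicAverages

/-- A point outside a nonempty convex set of a finite-dimensional space can be weakly separated
from it by a nonzero functional. -/
theorem exists_functional_nonpos {E : Type*} [NormedAddCommGroup E] [NormedSpace ℝ E]
    [FiniteDimensional ℝ E] {C : Set E} (hC : Convex ℝ C) (hne : C.Nonempty) (h0 : (0 : E) ∉ C) :
    ∃ f : E →ₗ[ℝ] ℝ, f ≠ 0 ∧ ∀ x ∈ C, f x ≤ 0 := by
  by_cases hint : (interior C).Nonempty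
  · obtain ⟨f, hf, hle⟩ := geometric_hahn_banach_of_nonempty_interior_point hC
      (fun h => h0 (interior_subset h)) hint
    refine ⟨f.toLinearMap, fun h => hf (by ext x; exact LinearMap.congr_fun h x), fun x hx => ?_⟩
    simpa using hle x hx
  · rw [hC.interior_nonempty_iff_affineSpan_eq_top,
      AffineSubspace.affineSpan_eq_top_iff_vectorSpan_eq_top_of_nonempty ℝ E E hne] at hint
    obtain ⟨f, hf, hker⟩ := Submodule.exists_le_ker_of_lt_top _ (lt_top_iff_ne_top.2 hint)
    obtain ⟨x₀, hx₀⟩ := hne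
    have hconst : ∀ x ∈ C, f x = f x₀ := fun x hx => by
      have := hker (vsub_mem_vectorSpan ℝ hx hx₀)
      rw [LinearMap.mem_ker, vsub_eq_sub, map_sub] at this
      linarith
    rcases le_total (f x₀) 0 with h | h
    · exact ⟨f, hf, fun x hx => by rw [hconst x hx]; exact h⟩
    · exact ⟨-f, neg_ne_zero.2 hf, fun x hx => by
        rw [LinearMap.neg_apply, hconst x hx]; linarith⟩

/-! ### Rates and powers of a slot -/

lemma log_two_pos : 0 < Real.log 2 := Real.log_pos one_lt_two

lemma cap_nonneg {x : ℝ} (hx : 0 ≤ x) : 0 ≤ cap x :=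
  Real.logb_nonneg one_lt_two (by linarith)

lemma cap_zero : cap 0 = 0 := by simp [cap]

lemma cap_pos {x : ℝ} (hx : 0 < x) : 0 < cap x :=
  Real.logb_pos one_lt_two (by linarith)

lemma cap_mono {x y : ℝ} (hx : 0 ≤ x) (h : x ≤ y) : cap x ≤ cap y :=
  Real.logb_le_logb_of_le one_lt_two (by linarith) (by linarith)

lemma cap_eq (x : ℝ) : cap x = Real.log (1 + x) / Real.log 2 := rfl

lemma cap_mul_le {x y : ℝ} (hx : 0 ≤ x) (hy : 0 ≤ y) : cap (x * y) ≤ (x + y) / Real.log 2 := by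
  rw [cap_eq]
  have h2 := log_two_pos
  gcongr
  have h1 : Real.log (1 + x * y) ≤ Real.log ((1 + x) * (1 + y)) :=
    Real.log_le_log (by positivity) (by nlinarith)
  rw [Real.log_mul (by positivity) (by positivity)] at h1
  have h3 := Real.log_le_sub_one_of_pos (show 0 < 1 + x by linarith)
  have h4 := Real.log_le_sub_one_of_pos (show 0 < 1 + y by linarith)
  linarith

lemma measurable_cap : Measurable cap := by
  unfold cap Real.logb
  fun_prop

lemma macRate₁_nonneg {t p q : ℝ} {s : Gain} (ht : 0 ≤ t ∧ t ≤ 1) (hp : 0 ≤ p) (hq : 0 ≤ q)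
    (h1 : 0 ≤ s.1) (h2 : 0 ≤ s.2) : 0 ≤ macRate₁ t p q s :=
  add_nonneg (mul_nonneg ht.1 (cap_nonneg (by positivity)))
    (mul_nonneg (by linarith [ht.2]) (cap_nonneg (by positivity)))

lemma macRate₂_nonneg {t p q : ℝ} {s : Gain} (ht : 0 ≤ t ∧ t ≤ 1) (hp : 0 ≤ p) (hq : 0 ≤ q)
    (h1 : 0 ≤ s.1) (h2 : 0 ≤ s.2) : 0 ≤ macRate₂ t p q s :=
  add_nonneg (mul_nonneg (by linarith [ht.2]) (cap_nonneg (by positivity)))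
    (mul_nonneg ht.1 (cap_nonneg (by positivity)))

lemma macRate₁_le {t p q : ℝ} {s : Gain} (ht : 0 ≤ t ∧ t ≤ 1) (hp : 0 ≤ p) (hq : 0 ≤ q)
    (h1 : 0 ≤ s.1) (h2 : 0 ≤ s.2) : macRate₁ t p q s ≤ cap (p * s.1) := by
  have h : cap (p * s.1 / (1 + q * s.2)) ≤ cap (p * s.1) :=
    cap_mono (by positivity) (div_le_self (by positivity) (by nlinarith [mul_nonneg hq h2]))
  unfold macRate₁
  nlinarith [ht.2]

lemma macRate₂_le {t p q : ℝ} {s : Gain} (ht : 0 ≤ t ∧ t ≤ 1) (hp : 0 ≤ p) (hq : 0 ≤ q)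
    (h1 : 0 ≤ s.1) (h2 : 0 ≤ s.2) : macRate₂ t p q s ≤ cap (q * s.2) := by
  have h : cap (q * s.2 / (1 + p * s.1)) ≤ cap (q * s.2) :=
    cap_mono (by positivity) (div_le_self (by positivity) (by nlinarith [mul_nonneg hp h1]))
  unfold macRate₂
  nlinarith [ht.1]

namespace Action.Admissible

variable {a : Action} {s : Gain}

lemma power₁_nonneg (ha : a.Admissible) : 0 ≤ a.power₁ :=
  mul_nonneg (add_nonneg (ha.q_mem 0).1 (ha.q_mem 2).1) ha.P₁_nonneg

lemma power₂_nonneg (ha : a.Admissible) : 0 ≤ a.power₂ :=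
  mul_nonneg (add_nonneg (ha.q_mem 1).1 (ha.q_mem 2).1) ha.P₂_nonneg

lemma powerr_nonneg (ha : a.Admissible) : 0 ≤ a.powerr :=
  mul_nonneg (add_nonneg (add_nonneg (ha.q_mem 3).1 (ha.q_mem 4).1) (ha.q_mem 5).1) ha.Pr_nonneg

lemma rate1r_nonneg (ha : a.Admissible) (h1 : 0 ≤ s.1) (h2 : 0 ≤ s.2) : 0 ≤ a.rate1r s :=
  add_nonneg (mul_nonneg (ha.q_mem 0).1 (cap_nonneg (mul_nonneg ha.P₁_nonneg h1)))
    (mul_nonneg (ha.q_mem 2).1 (macRate₁_nonneg ha.t_mem ha.P₁_nonneg ha.P₂_nonneg h1 h2))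

lemma rate2r_nonneg (ha : a.Admissible) (h1 : 0 ≤ s.1) (h2 : 0 ≤ s.2) : 0 ≤ a.rate2r s :=
  add_nonneg (mul_nonneg (ha.q_mem 1).1 (cap_nonneg (mul_nonneg ha.P₂_nonneg h2)))
    (mul_nonneg (ha.q_mem 2).1 (macRate₂_nonneg ha.t_mem ha.P₁_nonneg ha.P₂_nonneg h1 h2))

lemma rater1_nonneg (ha : a.Admissible) (h1 : 0 ≤ s.1) : 0 ≤ a.rater1 s :=
  mul_nonneg (add_nonneg (ha.q_mem 3).1 (ha.q_mem 5).1) (cap_nonneg (mul_nonneg ha.Pr_nonneg h1))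

lemma rater2_nonneg (ha : a.Admissible) (h2 : 0 ≤ s.2) : 0 ≤ a.rater2 s :=
  mul_nonneg (add_nonneg (ha.q_mem 4).1 (ha.q_mem 5).1) (cap_nonneg (mul_nonneg ha.Pr_nonneg h2))

lemma sum_eq (ha : a.Admissible) : a.q 0 + a.q 1 + a.q 2 + a.q 3 + a.q 4 + a.q 5 = 1 := by
  have := ha.sum_q
  rwa [Fin.sum_univ_six] at this

lemma weighted_cap_le {θ p r : ℝ} (h0 : 0 ≤ θ) (h1 : θ ≤ 1) (hp : 0 ≤ p) (hr : 0 ≤ r) :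
    θ * cap (p * r) ≤ (θ * p + r) / Real.log 2 := by
  have h := mul_le_mul_of_nonneg_left (cap_mul_le hp hr) h0
  refine h.trans ?_
  rw [← mul_div_assoc]
  have := log_two_pos
  gcongr
  nlinarith

lemma rate1r_le (ha : a.Admissible) (h1 : 0 ≤ s.1) (h2 : 0 ≤ s.2) :
    a.rate1r s ≤ (a.power₁ + s.1) / Real.log 2 := by
  have hm := mul_le_mul_of_nonneg_left
    (macRate₁_le ha.t_mem ha.P₁_nonneg ha.P₂_nonneg h1 h2) (ha.q_mem 2).1
  have hsum := ha.sum_eq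
  have := weighted_cap_le (θ := a.q 0 + a.q 2)
    (add_nonneg (ha.q_mem 0).1 (ha.q_mem 2).1) (by
      linarith [(ha.q_mem 1).1, (ha.q_mem 3).1, (ha.q_mem 4).1, (ha.q_mem 5).1])
    ha.P₁_nonneg h1
  unfold Action.rate1r Action.power₁
  linarith

lemma rate2r_le (ha : a.Admissible) (h1 : 0 ≤ s.1) (h2 : 0 ≤ s.2) :
    a.rate2r s ≤ (a.power₂ + s.2) / Real.log 2 := by
  have hm := mul_le_mul_of_nonneg_left
    (macRate₂_le ha.t_mem ha.P₁_nonneg ha.P₂_nonneg h1 h2) (ha.q_mem 2).1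
  have hsum := ha.sum_eq
  have := weighted_cap_le (θ := a.q 1 + a.q 2)
    (add_nonneg (ha.q_mem 1).1 (ha.q_mem 2).1) (by
      linarith [(ha.q_mem 0).1, (ha.q_mem 3).1, (ha.q_mem 4).1, (ha.q_mem 5).1])
    ha.P₂_nonneg h2
  unfold Action.rate2r Action.power₂
  linarith

lemma rater1_le (ha : a.Admissible) (h1 : 0 ≤ s.1) :
    a.rater1 s ≤ (a.powerr + s.1) / Real.log 2 := by
  have hsum := ha.sum_eq
  refine (weighted_cap_le (θ := a.q 3 + a.q 5) (add_nonneg (ha.q_mem 3).1 (ha.q_mem 5).1) (by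
      linarith [(ha.q_mem 0).1, (ha.q_mem 1).1, (ha.q_mem 2).1, (ha.q_mem 4).1])
    ha.Pr_nonneg h1).trans ?_
  have := mul_nonneg (ha.q_mem 4).1 ha.Pr_nonneg
  unfold Action.powerr
  refine div_le_div_of_nonneg_right ?_ log_two_pos.le
  linarith

lemma rater2_le (ha : a.Admissible) (h2 : 0 ≤ s.2) :
    a.rater2 s ≤ (a.powerr + s.2) / Real.log 2 := by
  have hsum := ha.sum_eq
  refine (weighted_cap_le (θ := a.q 4 + a.q 5) (add_nonneg (ha.q_mem 4).1 (ha.q_mem 5).1) (by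
      linarith [(ha.q_mem 0).1, (ha.q_mem 1).1, (ha.q_mem 2).1, (ha.q_mem 3).1])
    ha.Pr_nonneg h2).trans ?_
  have := mul_nonneg (ha.q_mem 3).1 ha.Pr_nonneg
  unfold Action.powerr
  refine div_le_div_of_nonneg_right ?_ log_two_pos.le
  linarith

end Action.Admissible

/-! ### Stationary randomized policies -/

/-- The law of the gains of a slot. -/
structure IsGainLaw (ν : Measure Gain) : Prop where
  prob : IsProbabilityMeasure ν
  pos : ∀ᵐ s ∂ν, 0 < s.1 ∧ 0 < s.2
  ac : ν ≪ volume
  int₁ : Integrable (fun s : Gain => s.1) ν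
  int₂ : Integrable (fun s : Gain => s.2) ν

lemma IsFadingChannel.isGainLaw {Ω : Type*} [MeasurableSpace Ω] {P : Measure Ω}
    [IsProbabilityMeasure P] {S : ℕ → Ω → Gain} (hS : IsFadingChannel P S) :
    IsGainLaw (P.map (S 0)) where
  prob := Measure.isProbabilityMeasure_map (hS.measurable 0).aemeasurable
  pos := by
    have h1 : (volume : Measure Gain) {s | s.1 = 0} = 0 := by
      have : {s : Gain | s.1 = 0} = ({0} : Set ℝ) ×ˢ Set.univ := by ext; simp
      rw [this, Measure.volume_eq_prod, Measure.prod_prod]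
      simp
    have h2 : (volume : Measure Gain) {s | s.2 = 0} = 0 := by
      have : {s : Gain | s.2 = 0} = Set.univ ×ˢ ({0} : Set ℝ) := by ext; simp
      rw [this, Measure.volume_eq_prod, Measure.prod_prod]
      simp
    have h3 : ∀ᵐ s ∂P.map (S 0), 0 ≤ s.1 ∧ 0 ≤ s.2 := by
      exact (ae_map_iff (hS.measurable 0).aemeasurable
        ((measurableSet_le measurable_const measurable_fst).inter
          (measurableSet_le measurable_const measurable_snd))).2 (hS.nonneg 0)
    have h4 : ∀ᵐ s ∂P.map (S 0), ¬ s.1 = 0 := by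
      rw [ae_iff]; simpa using hS.density 0 h1
    have h5 : ∀ᵐ s ∂P.map (S 0), ¬ s.2 = 0 := by
      rw [ae_iff]; simpa using hS.density 0 h2
    filter_upwards [h3, h4, h5] with s a b c
    exact ⟨lt_of_le_of_ne a.1 (Ne.symm b), lt_of_le_of_ne a.2 (Ne.symm c)⟩
  ac := hS.density 0
  int₁ := (integrable_map_measure (by fun_prop) (hS.measurable 0).aemeasurable).2 (hS.mean₁ 0)
  int₂ := (integrable_map_measure (by fun_prop) (hS.measurable 0).aemeasurable).2 (hS.mean₂ 0)

section Policy

variable {D : Type*} [MeasurableSpace D]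

/-- A stationary policy: the action is a function of the gains and of a random mark. -/
structure IsPolicy (π : Gain × D → Action) : Prop where
  admissible : ∀ z, (π z).Admissible
  rate1r : Measurable fun z => (π z).rate1r z.1
  rate2r : Measurable fun z => (π z).rate2r z.1
  rater1 : Measurable fun z => (π z).rater1 z.1
  rater2 : Measurable fun z => (π z).rater2 z.1
  power₁ : Measurable fun z => (π z).power₁
  power₂ : Measurable fun z => (π z).power₂
  powerr : Measurable fun z => (π z).powerr

/-- The powers of a policy have finite means. -/
structure HasFinitePower (m : Measure (Gain × D)) (π : Gain × D → Action) : Prop where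
  power₁ : Integrable (fun z => (π z).power₁) m
  power₂ : Integrable (fun z => (π z).power₂) m
  powerr : Integrable (fun z => (π z).powerr) m

/-- The mean of the total power. -/
noncomputable def meanPower (m : Measure (Gain × D)) (π : Gain × D → Action) : ℝ :=
  ∫ z, (π z).power₁ ∂m + ∫ z, (π z).power₂ ∂m + ∫ z, (π z).powerr ∂m

/-- The constraints of the long-term problem in expectation. -/
structure IsStatFeasible (Pt : ℝ) (m : Measure (Gain × D)) (π : Gain × D → Action) : Prop where
  finite : HasFinitePower m π
  c1 : ∫ z, (π z).rate1r z.1 ∂m = ∫ z, (π z).rater2 z.1 ∂m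
  c2 : ∫ z, (π z).rate2r z.1 ∂m = ∫ z, (π z).rater1 z.1 ∂m
  power : meanPower m π = Pt

/-- The expected objective. -/
noncomputable def value (η : ℝ) (m : Measure (Gain × D)) (π : Gain × D → Action) : ℝ :=
  η * ∫ z, (π z).rate1r z.1 ∂m + (1 - η) * ∫ z, (π z).rate2r z.1 ∂m

variable {ν : Measure Gain} {κ : Measure D} {π : Gain × D → Action}

lemma IsGainLaw.ae_pos (hν : IsGainLaw ν) [IsProbabilityMeasure κ] :
    ∀ᵐ z ∂ν.prod κ, 0 < z.1.1 ∧ 0 < z.1.2 :=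
  have := hν.prob
  Measure.quasiMeasurePreserving_fst.ae hν.pos

lemma integrable_of_le_power (hν : IsGainLaw ν) [IsProbabilityMeasure κ]
    {r p : Gain × D → ℝ} {σ : Gain → ℝ} (hr : Measurable r) (hp : Integrable p (ν.prod κ))
    (hσ : Integrable σ ν)
    (h : ∀ z : Gain × D, 0 < z.1.1 → 0 < z.1.2 → 0 ≤ r z ∧ r z ≤ (p z + σ z.1) / Real.log 2) :
    Integrable r (ν.prod κ) := by
  have := hν.prob
  refine Integrable.mono' ((hp.add (hσ.comp_fst κ)).div_const (Real.log 2))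
    hr.aestronglyMeasurable ?_
  filter_upwards [hν.ae_pos (κ := κ)] with z hz
  rw [Real.norm_eq_abs, abs_of_nonneg (h z hz.1 hz.2).1]
  exact (h z hz.1 hz.2).2

namespace IsPolicy

variable (hπ : IsPolicy π) (hν : IsGainLaw ν) [IsProbabilityMeasure κ]
  (hf : HasFinitePower (ν.prod κ) π)

include hπ hν hf

lemma integrable_rate1r : Integrable (fun z => (π z).rate1r z.1) (ν.prod κ) :=
  integrable_of_le_power hν hπ.rate1r hf.power₁ hν.int₁ fun z h1 h2 =>
    ⟨(hπ.admissible z).rate1r_nonneg h1.le h2.le, (hπ.admissible z).rate1r_le h1.le h2.le⟩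

lemma integrable_rate2r : Integrable (fun z => (π z).rate2r z.1) (ν.prod κ) :=
  integrable_of_le_power hν hπ.rate2r hf.power₂ hν.int₂ fun z h1 h2 =>
    ⟨(hπ.admissible z).rate2r_nonneg h1.le h2.le, (hπ.admissible z).rate2r_le h1.le h2.le⟩

lemma integrable_rater1 : Integrable (fun z => (π z).rater1 z.1) (ν.prod κ) :=
  integrable_of_le_power hν hπ.rater1 hf.powerr hν.int₁ fun z h1 _ =>
    ⟨(hπ.admissible z).rater1_nonneg h1.le, (hπ.admissible z).rater1_le h1.le⟩

lemma integrable_rater2 : Integrable (fun z => (π z).rater2 z.1) (ν.prod κ) :=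
  integrable_of_le_power hν hπ.rater2 hf.powerr hν.int₂ fun z _ h2 =>
    ⟨(hπ.admissible z).rater2_nonneg h2.le, (hπ.admissible z).rater2_le h2.le⟩

end IsPolicy

/-- The Lagrangian of a slot: `A, B` weight the rates to the relay, `k₁, k₂` the rates from the
relay to users 1 and 2, and `g` the powers. -/
noncomputable def lagrangian (A B k₁ k₂ g : ℝ) (s : Gain) (a : Action) : ℝ :=
  A * a.rate1r s + B * a.rate2r s + k₁ * a.rater1 s + k₂ * a.rater2 s -
    g * (a.power₁ + a.power₂ + a.powerr)

/-- The action `a` maximizes the Lagrangian. -/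
def IsBest (A B k₁ k₂ g : ℝ) (s : Gain) (a : Action) : Prop :=
  ∀ b : Action, b.Admissible → lagrangian A B k₁ k₂ g s b ≤ lagrangian A B k₁ k₂ g s a

/-- The Lagrangian that belongs to the weights `w`. -/
noncomputable def Weights.lagr (η : ℝ) (w : Weights) : Gain → Action → ℝ :=
  lagrangian (η - w.μ₁) (1 - η - w.μ₂) w.μ₂ w.μ₁ w.γ

/-- The action `a` maximizes the Lagrangian that belongs to the weights `w`. -/
def Weights.Best (η : ℝ) (w : Weights) : Gain → Action → Prop :=
  IsBest (η - w.μ₁) (1 - η - w.μ₂) w.μ₂ w.μ₁ w.γ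

lemma IsPolicy.measurable_lagrangian (hπ : IsPolicy π) (A B k₁ k₂ g : ℝ) :
    Measurable fun z => lagrangian A B k₁ k₂ g z.1 (π z) := by
  have := hπ.rate1r
  have := hπ.rate2r
  have := hπ.rater1
  have := hπ.rater2
  have := hπ.power₁
  have := hπ.power₂
  have := hπ.powerr
  unfold lagrangian
  fun_prop

lemma IsPolicy.integrable_lagrangian (hπ : IsPolicy π) (hν : IsGainLaw ν) [IsProbabilityMeasure κ]
    (hf : HasFinitePower (ν.prod κ) π) (A B k₁ k₂ g : ℝ) :
    Integrable (fun z => lagrangian A B k₁ k₂ g z.1 (π z)) (ν.prod κ) := by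
  unfold lagrangian
  exact (((((hπ.integrable_rate1r hν hf).const_mul A).add
    ((hπ.integrable_rate2r hν hf).const_mul B)).add ((hπ.integrable_rater1 hν hf).const_mul k₁)).add
    ((hπ.integrable_rater2 hν hf).const_mul k₂)).sub
    (((hf.power₁.add hf.power₂).add hf.powerr).const_mul g)

lemma integral_linear_combination {Z : Type*} [MeasurableSpace Z] {m : Measure Z}
    {f₁ f₂ f₃ f₄ f₅ f₆ f₇ : Z → ℝ} (h₁ : Integrable f₁ m) (h₂ : Integrable f₂ m)
    (h₃ : Integrable f₃ m) (h₄ : Integrable f₄ m) (h₅ : Integrable f₅ m) (h₆ : Integrable f₆ m)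
    (h₇ : Integrable f₇ m) (a b c d e : ℝ) :
    ∫ z, (a * f₁ z + b * f₂ z + c * f₃ z + d * f₄ z - e * (f₅ z + f₆ z + f₇ z)) ∂m =
      a * ∫ z, f₁ z ∂m + b * ∫ z, f₂ z ∂m + c * ∫ z, f₃ z ∂m + d * ∫ z, f₄ z ∂m -
        e * (∫ z, f₅ z ∂m + ∫ z, f₆ z ∂m + ∫ z, f₇ z ∂m) := by
  have i12 : Integrable (fun z => a * f₁ z + b * f₂ z) m := (h₁.const_mul a).add (h₂.const_mul b)
  have i123 : Integrable (fun z => a * f₁ z + b * f₂ z + c * f₃ z) m := i12.add (h₃.const_mul c)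
  have i1234 : Integrable (fun z => a * f₁ z + b * f₂ z + c * f₃ z + d * f₄ z) m :=
    i123.add (h₄.const_mul d)
  have i56 : Integrable (fun z => f₅ z + f₆ z) m := h₅.add h₆
  have i567 : Integrable (fun z => f₅ z + f₆ z + f₇ z) m := i56.add h₇
  rw [integral_sub i1234 (i567.const_mul e), integral_add i123 (h₄.const_mul d),
    integral_add i12 (h₃.const_mul c), integral_add (h₁.const_mul a) (h₂.const_mul b)]
  simp only [integral_const_mul]
  rw [integral_add i56 h₇, integral_add h₅ h₆]

lemma IsPolicy.integral_lagrangian (hπ : IsPolicy π) (hν : IsGainLaw ν) [IsProbabilityMeasure κ]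
    (hf : HasFinitePower (ν.prod κ) π) (A B k₁ k₂ g : ℝ) :
    ∫ z, lagrangian A B k₁ k₂ g z.1 (π z) ∂ν.prod κ =
      A * ∫ z, (π z).rate1r z.1 ∂ν.prod κ + B * ∫ z, (π z).rate2r z.1 ∂ν.prod κ +
      k₁ * ∫ z, (π z).rater1 z.1 ∂ν.prod κ + k₂ * ∫ z, (π z).rater2 z.1 ∂ν.prod κ -
      g * meanPower (ν.prod κ) π := by
  unfold lagrangian meanPower
  exact integral_linear_combination (hπ.integrable_rate1r hν hf) (hπ.integrable_rate2r hν hf)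
    (hπ.integrable_rater1 hν hf) (hπ.integrable_rater2 hν hf) hf.power₁ hf.power₂ hf.powerr
    A B k₁ k₂ g

/-- Under the constraints, the expected Lagrangian is the objective up to a constant. -/
lemma IsStatFeasible.integral_lagr {Pt : ℝ} (h : IsStatFeasible Pt (ν.prod κ) π)
    (hπ : IsPolicy π) (hν : IsGainLaw ν) [IsProbabilityMeasure κ] (η : ℝ) (w : Weights) :
    ∫ z, w.lagr η z.1 (π z) ∂ν.prod κ = value η (ν.prod κ) π - w.γ * Pt := by
  unfold Weights.lagr
  rw [hπ.integral_lagrangian hν h.finite, h.power, ← h.c1, ← h.c2]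
  unfold value
  ring

end Policy

/-! ### Long-term averages of stationary policies -/

section Averages

variable {Ω : Type*} [MeasurableSpace Ω] {P : Measure Ω} [IsProbabilityMeasure P]
  {S : ℕ → Ω → Gain} {D : Type*} [MeasurableSpace D] {κ : Measure D} [IsProbabilityMeasure κ]
  {π : Gain × D → Action} {Pt : ℝ}

omit [IsProbabilityMeasure P] in
lemma IsFadingChannel.map_slot (hS : IsFadingChannel P S) (i : ℕ) : P.map (S i) = P.map (S 0) := by
  have hm : Measurable fun ω j => S j ω := measurable_pi_lambda _ hS.measurable
  induction i with
  | zero => rfl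
  | succ i ih =>
    rw [← ih]
    have h1 : P.map (S (i + 1)) = ((P.map fun ω j => S j ω).map
        (fun (x : ℕ → Gain) (i : ℕ) => x (i + 1))).map (fun x => x i) := by
      rw [Measure.map_map (by fun_prop) (by fun_prop), Measure.map_map (by fun_prop) hm]
      rfl
    rw [h1, hS.ergodic.map_eq, Measure.map_map (by fun_prop) hm]
    rfl

lemma IsFadingChannel.ae_slots (hS : IsFadingChannel P S) {q : Gain × D → Prop}
    (h : ∀ᵐ y ∂(P.map (S 0)).prod κ, q y) :
    ∀ᵐ z ∂P.prod (Measure.infinitePi fun _ : ℕ => κ), ∀ i, q (S i z.1, z.2 i) := by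
  rw [ae_all_iff]
  intro i
  have hmap : (P.prod (Measure.infinitePi fun _ : ℕ => κ)).map
      (Prod.map (S i) fun y : ℕ → D => y i) = (P.map (S 0)).prod κ := by
    rw [← Measure.map_prod_map _ _ (hS.measurable i) (by fun_prop), Measure.infinitePi_map_eval,
      hS.map_slot]
  rw [← hmap] at h
  exact ae_of_ae_map ((hS.measurable i).prodMap (by fun_prop)).aemeasurable h

lemma IsFadingChannel.ae_hasTimeAverage (hS : IsFadingChannel P S) {f : Gain × D → ℝ}
    (hfm : Measurable f) (hf : Integrable f ((P.map (S 0)).prod κ)) :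
    ∀ᵐ z ∂(P.prod (Measure.infinitePi fun _ : ℕ => κ)),
      HasTimeAverage (fun i => f (S i z.1, z.2 i)) (∫ y, f y ∂((P.map (S 0)).prod κ)) :=
  hasTimeAverage_of_ergodic hS.measurable hS.ergodic κ hfm hf

theorem IsStatFeasible.ae_isFeasible (hS : IsFadingChannel P S) (hπ : IsPolicy π)
    (h : IsStatFeasible Pt ((P.map (S 0)).prod κ) π) :
    ∀ᵐ z ∂(P.prod (Measure.infinitePi fun _ : ℕ => κ)),
      IsFeasible Pt (fun i => S i z.1) (fun i => π (S i z.1, z.2 i))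
        (∫ y, (π y).rate1r y.1 ∂((P.map (S 0)).prod κ))
        (∫ y, (π y).rate2r y.1 ∂((P.map (S 0)).prod κ)) := by
  have hν := hS.isGainLaw
  filter_upwards [hS.ae_hasTimeAverage hπ.rate1r (hπ.integrable_rate1r hν h.finite),
    hS.ae_hasTimeAverage hπ.rate2r (hπ.integrable_rate2r hν h.finite),
    hS.ae_hasTimeAverage hπ.rater1 (hπ.integrable_rater1 hν h.finite),
    hS.ae_hasTimeAverage hπ.rater2 (hπ.integrable_rater2 hν h.finite),
    hS.ae_hasTimeAverage hπ.power₁ h.finite.power₁,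
    hS.ae_hasTimeAverage hπ.power₂ h.finite.power₂,
    hS.ae_hasTimeAverage hπ.powerr h.finite.powerr] with z h1 h2 h3 h4 h5 h6 h7
  rw [← h.c2] at h3
  rw [← h.c1] at h4
  exact ⟨fun i => hπ.admissible _, h1, h4, h2, h3, _, _, _, h5, h6, h7, h.power⟩

theorem hasFinitePower_of_ae_isFeasible (hS : IsFadingChannel P S) (hπ : IsPolicy π)
    (h : ∀ᵐ z ∂(P.prod (Measure.infinitePi fun _ : ℕ => κ)), ∃ R₁ R₂,
      IsFeasible Pt (fun i => S i z.1) (fun i => π (S i z.1, z.2 i)) R₁ R₂) :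
    HasFinitePower ((P.map (S 0)).prod κ) π where
  power₁ := integrable_of_hasTimeAverage hS.measurable hS.ergodic κ hπ.power₁
    (fun z => (hπ.admissible z).power₁_nonneg) (by
      filter_upwards [h] with z ⟨R₁, R₂, hz⟩
      obtain ⟨p₁, p₂, pr, h1, h2, h3, -⟩ := hz.power
      exact ⟨_, h1⟩)
  power₂ := integrable_of_hasTimeAverage hS.measurable hS.ergodic κ hπ.power₂
    (fun z => (hπ.admissible z).power₂_nonneg) (by
      filter_upwards [h] with z ⟨R₁, R₂, hz⟩
      obtain ⟨p₁, p₂, pr, h1, h2, h3, -⟩ := hz.power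
      exact ⟨_, h2⟩)
  powerr := integrable_of_hasTimeAverage hS.measurable hS.ergodic κ hπ.powerr
    (fun z => (hπ.admissible z).powerr_nonneg) (by
      filter_upwards [h] with z ⟨R₁, R₂, hz⟩
      obtain ⟨p₁, p₂, pr, h1, h2, h3, -⟩ := hz.power
      exact ⟨_, h3⟩)

/-- A policy that is almost surely feasible is feasible in expectation, and its long-term rates
are the expected ones. -/
theorem isStatFeasible_of_ae_isFeasible (hS : IsFadingChannel P S) (hπ : IsPolicy π)
    (h : ∀ᵐ z ∂(P.prod (Measure.infinitePi fun _ : ℕ => κ)), ∃ R₁ R₂,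
      IsFeasible Pt (fun i => S i z.1) (fun i => π (S i z.1, z.2 i)) R₁ R₂) :
    IsStatFeasible Pt ((P.map (S 0)).prod κ) π ∧
    ∀ᵐ z ∂(P.prod (Measure.infinitePi fun _ : ℕ => κ)), ∀ R₁ R₂,
      IsFeasible Pt (fun i => S i z.1) (fun i => π (S i z.1, z.2 i)) R₁ R₂ →
        R₁ = ∫ y, (π y).rate1r y.1 ∂((P.map (S 0)).prod κ) ∧
        R₂ = ∫ y, (π y).rate2r y.1 ∂((P.map (S 0)).prod κ) := by
  have hν := hS.isGainLaw
  have hf := hasFinitePower_of_ae_isFeasible hS hπ h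
  have a1 := hS.ae_hasTimeAverage hπ.rate1r (hπ.integrable_rate1r hν hf)
  have a2 := hS.ae_hasTimeAverage hπ.rate2r (hπ.integrable_rate2r hν hf)
  constructor
  · obtain ⟨z, ⟨R₁, R₂, hz⟩, h1, h2, h3, h4, h5, h6, h7⟩ := (h.and (a1.and (a2.and
      ((hS.ae_hasTimeAverage hπ.rater1 (hπ.integrable_rater1 hν hf)).and
      ((hS.ae_hasTimeAverage hπ.rater2 (hπ.integrable_rater2 hν hf)).and
      ((hS.ae_hasTimeAverage hπ.power₁ hf.power₁).and
      ((hS.ae_hasTimeAverage hπ.power₂ hf.power₂).and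
      (hS.ae_hasTimeAverage hπ.powerr hf.powerr)))))))).exists
    obtain ⟨p₁, p₂, pr, g1, g2, g3, g4⟩ := hz.power
    refine ⟨hf, ?_, ?_, ?_⟩
    · rw [h1.unique hz.avg1r, h4.unique hz.avgr2]
    · rw [h2.unique hz.avg2r, h3.unique hz.avgr1]
    · unfold meanPower
      rw [h5.unique g1, h6.unique g2, h7.unique g3, g4]
  · filter_upwards [a1, a2] with z h1 h2 R₁ R₂ hz
    exact ⟨hz.avg1r.unique h1, hz.avg2r.unique h2⟩

lemma IsFeasible.hasTimeAverage_lagr {s : ℕ → Gain} {x : ℕ → Action} {R₁ R₂ : ℝ}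
    (h : IsFeasible Pt s x R₁ R₂) (η : ℝ) (w : Weights) :
    HasTimeAverage (fun i => w.lagr η (s i) (x i)) (η * R₁ + (1 - η) * R₂ - w.γ * Pt) := by
  obtain ⟨p₁, p₂, pr, h1, h2, h3, hp⟩ := h.power
  have := (((((h.avg1r.const_mul (η - w.μ₁)).add (h.avg2r.const_mul (1 - η - w.μ₂))).add
    (h.avgr1.const_mul w.μ₂)).add (h.avgr2.const_mul w.μ₁)).add
    (((h1.add h2).add h3).const_mul (-w.γ)))
  rw [hp] at this
  have h4 : (η - w.μ₁) * R₁ + (1 - η - w.μ₂) * R₂ + w.μ₂ * R₂ + w.μ₁ * R₁ + -w.γ * Pt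
    = η * R₁ + (1 - η) * R₂ - w.γ * Pt := by ring
  rw [h4] at this
  refine this.congr fun N => ?_
  congr 1
  refine Finset.sum_congr rfl fun i _ => ?_
  unfold Weights.lagr lagrangian
  ring

/-- A feasible policy that maximizes the Lagrangian in almost every slot solves the long-term
problem. -/
theorem ae_isSolution_of_best (hS : IsFadingChannel P S) (hπ : IsPolicy π)
    (h : IsStatFeasible Pt ((P.map (S 0)).prod κ) π) {η : ℝ} {w : Weights}
    (hb : ∀ᵐ y ∂((P.map (S 0)).prod κ), w.Best η y.1 (π y)) :
    ∀ᵐ z ∂(P.prod (Measure.infinitePi fun _ : ℕ => κ)),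
      IsSolution η Pt (fun i => S i z.1) (fun i => π (S i z.1, z.2 i)) := by
  filter_upwards [h.ae_isFeasible hS hπ, hS.ae_slots hb] with z hz hbest
  refine ⟨_, _, hz, fun y R₁' R₂' hy => ?_⟩
  have := (hy.hasTimeAverage_lagr η w).le (hz.hasTimeAverage_lagr η w)
    fun i => hbest i (y i) (hy.admissible i)
  linarith

/-- A policy that almost surely solves the long-term problem is feasible in expectation and at
least as good as every feasible stationary policy with random marks. -/
theorem value_le_of_ae_isSolution (hS : IsFadingChannel P S) (hπ : IsPolicy π) {η : ℝ}
    (h : ∀ᵐ z ∂(P.prod (Measure.infinitePi fun _ : ℕ => κ)),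
      IsSolution η Pt (fun i => S i z.1) (fun i => π (S i z.1, z.2 i))) :
    IsStatFeasible Pt ((P.map (S 0)).prod κ) π ∧
    ∀ (D' : Type) [MeasurableSpace D'] (κ' : Measure D') [IsProbabilityMeasure κ']
      (π' : Gain × D' → Action), IsPolicy π' → IsStatFeasible Pt ((P.map (S 0)).prod κ') π' →
      value η ((P.map (S 0)).prod κ') π' ≤ value η ((P.map (S 0)).prod κ) π := by
  obtain ⟨hf, hR⟩ := isStatFeasible_of_ae_isFeasible hS hπ (h.mono fun z hz => by
    obtain ⟨R₁, R₂, h1, -⟩ := hz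
    exact ⟨R₁, R₂, h1⟩)
  refine ⟨hf, fun D' _ κ' _ π' hπ' hf' => ?_⟩
  have e1 := Measure.ae_ae_of_ae_prod (h.and hR)
  have e2 := Measure.ae_ae_of_ae_prod (hf'.ae_isFeasible hS hπ')
  obtain ⟨ω, h1, h2⟩ := (e1.and e2).exists
  obtain ⟨d, ⟨R₁, R₂, hx, hopt⟩, hd⟩ := h1.exists
  obtain ⟨d', hd'⟩ := h2.exists
  obtain ⟨rfl, rfl⟩ := hd _ _ hx
  exact hopt _ _ _ hd'

end Averages

/-! ### Pure modes -/

/-- The Lagrangian of the six modes, as a function of the decoding order and the powers. -/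
noncomputable def modeLagr (A B k₁ k₂ g : ℝ) (s : Gain) (t p q r : ℝ) : Fin 6 → ℝ :=
  ![A * cap (p * s.1) - g * p,
    B * cap (q * s.2) - g * q,
    A * macRate₁ t p q s + B * macRate₂ t p q s - g * (p + q),
    k₁ * cap (r * s.1) - g * r,
    k₂ * cap (r * s.2) - g * r,
    k₂ * cap (r * s.2) + k₁ * cap (r * s.1) - g * r]

/-- The action that selects a single mode. -/
def pureAction (k : Fin 6) (t p q r : ℝ) : Action where
  q := fun j => if j = k then 1 else 0
  t := t
  P₁ := p
  P₂ := q
  Pr := r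

lemma pureAction_admissible (k : Fin 6) {t p q r : ℝ} (ht : 0 ≤ t ∧ t ≤ 1) (hp : 0 ≤ p)
    (hq : 0 ≤ q) (hr : 0 ≤ r) : (pureAction k t p q r).Admissible where
  sum_q := by simp [pureAction]
  q_mem := fun j => by unfold pureAction; dsimp only; split_ifs <;> simp
  t_mem := ht
  P₁_nonneg := hp
  P₂_nonneg := hq
  Pr_nonneg := hr

section Pure

variable {A B k₁ k₂ g : ℝ} {s : Gain}

lemma lagrangian_eq_sum (a : Action) :
    lagrangian A B k₁ k₂ g s a = ∑ k, a.q k * modeLagr A B k₁ k₂ g s a.t a.P₁ a.P₂ a.Pr k := by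
  rw [Fin.sum_univ_six]
  simp only [modeLagr, lagrangian, Action.rate1r, Action.rate2r, Action.rater1, Action.rater2,
    Action.power₁, Action.power₂, Action.powerr, Matrix.cons_val]
  ring

lemma lagrangian_pureAction (k : Fin 6) (t p q r : ℝ) :
    lagrangian A B k₁ k₂ g s (pureAction k t p q r) = modeLagr A B k₁ k₂ g s t p q r k := by
  rw [lagrangian_eq_sum]
  simp [pureAction]

lemma modeLagr_decoding (t p q r : ℝ) (k : Fin 6) :
    modeLagr A B k₁ k₂ g s t p q r k =
      t * modeLagr A B k₁ k₂ g s 1 p q r k + (1 - t) * modeLagr A B k₁ k₂ g s 0 p q r k := by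
  fin_cases k <;> simp [modeLagr, macRate₁, macRate₂] <;> ring

lemma lagrangian_le_of_modeLagr_le {C : ℝ}
    (h : ∀ (k : Fin 6) (t p q r : ℝ), (t = 0 ∨ t = 1) → 0 ≤ p → 0 ≤ q → 0 ≤ r →
      modeLagr A B k₁ k₂ g s t p q r k ≤ C)
    {b : Action} (hb : b.Admissible) : lagrangian A B k₁ k₂ g s b ≤ C := by
  rw [lagrangian_eq_sum]
  have hk : ∀ k, modeLagr A B k₁ k₂ g s b.t b.P₁ b.P₂ b.Pr k ≤ C := fun k => by
    rw [modeLagr_decoding]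
    have h0 := h k 0 b.P₁ b.P₂ b.Pr (Or.inl rfl) hb.P₁_nonneg hb.P₂_nonneg hb.Pr_nonneg
    have h1 := h k 1 b.P₁ b.P₂ b.Pr (Or.inr rfl) hb.P₁_nonneg hb.P₂_nonneg hb.Pr_nonneg
    have e0 := mul_le_mul_of_nonneg_left h0 (sub_nonneg.2 hb.t_mem.2)
    have e1 := mul_le_mul_of_nonneg_left h1 hb.t_mem.1
    linarith
  calc ∑ k, b.q k * modeLagr A B k₁ k₂ g s b.t b.P₁ b.P₂ b.Pr k ≤ ∑ k, b.q k * C :=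
        Finset.sum_le_sum fun k _ => mul_le_mul_of_nonneg_left (hk k) (hb.q_mem k).1
    _ = C := by rw [← Finset.sum_mul, hb.sum_q, one_mul]

lemma IsBest.modeLagr_le {a : Action} (h : IsBest A B k₁ k₂ g s a) (k : Fin 6) {t p q r : ℝ}
    (ht : t = 0 ∨ t = 1) (hp : 0 ≤ p) (hq : 0 ≤ q) (hr : 0 ≤ r) :
    modeLagr A B k₁ k₂ g s t p q r k ≤ lagrangian A B k₁ k₂ g s a := by
  rw [← lagrangian_pureAction]
  refine h _ (pureAction_admissible k ?_ hp hq hr)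
  rcases ht with rfl | rfl <;> simp

lemma continuous_cap_comp {X : Type*} [TopologicalSpace X] {f : X → ℝ}
    (hf : Continuous f) (h0 : ∀ x, 0 ≤ f x) : Continuous fun x => cap (f x) := by
  unfold cap Real.logb
  refine Continuous.div_const (Continuous.log (by fun_prop) fun x => ?_) _
  have := h0 x
  positivity

lemma continuous_modeLagr (hs : 0 ≤ s.1 ∧ 0 ≤ s.2) (t : ℝ) (k : Fin 6) :
    Continuous fun y : ℝ × ℝ × ℝ =>
      modeLagr A B k₁ k₂ g s t (max y.1 0) (max y.2.1 0) (max y.2.2 0) k := by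
  obtain ⟨h1, h2⟩ := hs
  have c1 : Continuous fun y : ℝ × ℝ × ℝ => cap (max y.1 0 * s.1) :=
    continuous_cap_comp (by fun_prop) fun y => by positivity
  have c2 : Continuous fun y : ℝ × ℝ × ℝ => cap (max y.2.1 0 * s.2) :=
    continuous_cap_comp (by fun_prop) fun y => by positivity
  have c3 : Continuous fun y : ℝ × ℝ × ℝ => cap (max y.2.2 0 * s.1) :=
    continuous_cap_comp (by fun_prop) fun y => by positivity
  have c4 : Continuous fun y : ℝ × ℝ × ℝ => cap (max y.2.2 0 * s.2) :=
    continuous_cap_comp (by fun_prop) fun y => by positivity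
  have c5 : Continuous fun y : ℝ × ℝ × ℝ => cap (max y.1 0 * s.1 / (1 + max y.2.1 0 * s.2)) :=
    continuous_cap_comp (Continuous.div (by fun_prop) (by fun_prop) fun y => by positivity)
      fun y => by positivity
  have c6 : Continuous fun y : ℝ × ℝ × ℝ => cap (max y.2.1 0 * s.2 / (1 + max y.1 0 * s.1)) :=
    continuous_cap_comp (Continuous.div (by fun_prop) (by fun_prop) fun y => by positivity)
      fun y => by positivity
  fin_cases k <;> simp only [modeLagr, macRate₁, macRate₂, Fin.zero_eta, Fin.mk_one,
    Fin.reduceFinMk, Matrix.cons_val] <;> fun_prop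

/-- It suffices to compare with pure modes at rational powers. -/
lemma isBest_of_rational (hs : 0 ≤ s.1 ∧ 0 ≤ s.2) {a : Action}
    (h : ∀ (k : Fin 6) (b : Bool) (p q r : ℚ),
      modeLagr A B k₁ k₂ g s (if b then 1 else 0) (max (p : ℝ) 0) (max (q : ℝ) 0) (max (r : ℝ) 0) k
        ≤ lagrangian A B k₁ k₂ g s a) : IsBest A B k₁ k₂ g s a := by
  intro b hb
  refine lagrangian_le_of_modeLagr_le (fun k t p q r ht hp hq hr => ?_) hb
  obtain ⟨β, rfl⟩ : ∃ β : Bool, t = if β then 1 else 0 := by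
    rcases ht with rfl | rfl
    · exact ⟨false, by simp⟩
    · exact ⟨true, by simp⟩
  have hd : DenseRange (Prod.map ((↑) : ℚ → ℝ) (Prod.map ((↑) : ℚ → ℝ) ((↑) : ℚ → ℝ))) :=
    Rat.denseRange_cast.prodMap (Rat.denseRange_cast.prodMap Rat.denseRange_cast)
  have := hd.induction_on (p := fun y : ℝ × ℝ × ℝ => modeLagr A B k₁ k₂ g s (if β then 1 else 0)
    (max y.1 0) (max y.2.1 0) (max y.2.2 0) k ≤ lagrangian A B k₁ k₂ g s a) (p, q, r)
    (isClosed_le (continuous_modeLagr hs _ k) continuous_const) (fun y => h k β y.1 y.2.1 y.2.2)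
  simpa [max_eq_left hp, max_eq_left hq, max_eq_left hr] using this

end Pure

/-! ### From optimality on average to optimality in every slot -/

section Slotwise

variable {D : Type*} [MeasurableSpace D] {ν : Measure Gain} {κ : Measure D}
  [IsProbabilityMeasure κ] {x : Gain × D → Action}

lemma isPolicy_const {a : Action} (ha : a.Admissible) : IsPolicy fun _ : Gain × D => a where
  admissible := fun _ => ha
  rate1r := by
    have := measurable_cap
    unfold Action.rate1r macRate₁
    fun_prop
  rate2r := by
    have := measurable_cap
    unfold Action.rate2r macRate₂
    fun_prop
  rater1 := by
    have := measurable_cap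
    unfold Action.rater1
    fun_prop
  rater2 := by
    have := measurable_cap
    unfold Action.rater2
    fun_prop
  power₁ := measurable_const
  power₂ := measurable_const
  powerr := measurable_const

lemma hasFinitePower_const (hν : IsGainLaw ν) (a : Action) :
    HasFinitePower (ν.prod κ) fun _ : Gain × D => a :=
  have := hν.prob
  ⟨integrable_const _, integrable_const _, integrable_const _⟩

open Classical in
lemma measurable_ite_mem {f g h : Gain × D → ℝ} {E : Set (Gain × D)} (hE : MeasurableSet E)
    (hf : Measurable f) (hg : Measurable g) (e : ∀ z, h z = if z ∈ E then f z else g z) :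
    Measurable h := by
  rw [funext e]
  exact Measurable.ite hE hf hg

open Classical in
lemma IsPolicy.ite {π : Gain × D → Action} (hx : IsPolicy x) (hπ : IsPolicy π)
    {E : Set (Gain × D)} (hE : MeasurableSet E) : IsPolicy fun z => if z ∈ E then π z else x z where
  admissible := fun z => by
    split_ifs
    exacts [hπ.admissible z, hx.admissible z]
  rate1r :=
    measurable_ite_mem hE hπ.rate1r hx.rate1r fun z => by by_cases hz : z ∈ E <;> simp [hz]
  rate2r :=
    measurable_ite_mem hE hπ.rate2r hx.rate2r fun z => by by_cases hz : z ∈ E <;> simp [hz]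
  rater1 :=
    measurable_ite_mem hE hπ.rater1 hx.rater1 fun z => by by_cases hz : z ∈ E <;> simp [hz]
  rater2 :=
    measurable_ite_mem hE hπ.rater2 hx.rater2 fun z => by by_cases hz : z ∈ E <;> simp [hz]
  power₁ :=
    measurable_ite_mem hE hπ.power₁ hx.power₁ fun z => by by_cases hz : z ∈ E <;> simp [hz]
  power₂ :=
    measurable_ite_mem hE hπ.power₂ hx.power₂ fun z => by by_cases hz : z ∈ E <;> simp [hz]
  powerr :=
    measurable_ite_mem hE hπ.powerr hx.powerr fun z => by by_cases hz : z ∈ E <;> simp [hz]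

open Classical in
lemma HasFinitePower.ite {m : Measure (Gain × D)} {π : Gain × D → Action}
    (hx : HasFinitePower m x) (hπ : HasFinitePower m π) {E : Set (Gain × D)}
    (hE : MeasurableSet E) : HasFinitePower m fun z => if z ∈ E then π z else x z where
  power₁ := by
    refine (Integrable.piecewise hE hπ.power₁.integrableOn hx.power₁.integrableOn).congr
      (ae_of_all _ fun z => ?_)
    by_cases hz : z ∈ E <;> simp [hz]
  power₂ := by
    refine (Integrable.piecewise hE hπ.power₂.integrableOn hx.power₂.integrableOn).congr
      (ae_of_all _ fun z => ?_)
    by_cases hz : z ∈ E <;> simp [hz]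
  powerr := by
    refine (Integrable.piecewise hE hπ.powerr.integrableOn hx.powerr.integrableOn).congr
      (ae_of_all _ fun z => ?_)
    by_cases hz : z ∈ E <;> simp [hz]

/-- A policy with maximal expected Lagrangian maximizes it in almost every slot. -/
theorem ae_isBest_of_integral_le (hν : IsGainLaw ν) (hx : IsPolicy x)
    (hf : HasFinitePower (ν.prod κ) x) {A B k₁ k₂ g : ℝ}
    (h : ∀ π : Gain × D → Action, IsPolicy π → HasFinitePower (ν.prod κ) π →
      ∫ z, lagrangian A B k₁ k₂ g z.1 (π z) ∂ν.prod κ ≤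
        ∫ z, lagrangian A B k₁ k₂ g z.1 (x z) ∂ν.prod κ) :
    ∀ᵐ z ∂ν.prod κ, IsBest A B k₁ k₂ g z.1 (x z) := by
  classical
  have key : ∀ a : Action, a.Admissible → ∀ᵐ z ∂ν.prod κ,
      lagrangian A B k₁ k₂ g z.1 a ≤ lagrangian A B k₁ k₂ g z.1 (x z) := by
    intro a ha
    have hc := isPolicy_const (D := D) ha
    have hcf := hasFinitePower_const (κ := κ) hν a
    set F := fun z : Gain × D => lagrangian A B k₁ k₂ g z.1 a with hF
    set G := fun z : Gain × D => lagrangian A B k₁ k₂ g z.1 (x z) with hG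
    have hFm : Measurable F := hc.measurable_lagrangian A B k₁ k₂ g
    have hGm : Measurable G := hx.measurable_lagrangian A B k₁ k₂ g
    have hFi : Integrable F (ν.prod κ) := hc.integrable_lagrangian hν hcf A B k₁ k₂ g
    have hGi : Integrable G (ν.prod κ) := hx.integrable_lagrangian hν hf A B k₁ k₂ g
    have hE : MeasurableSet {z | G z < F z} := measurableSet_lt hGm hFm
    have h1 := h _ (hx.ite hc hE) (hf.ite hcf hE)
    have heq : ∀ z, lagrangian A B k₁ k₂ g z.1 (if z ∈ {z | G z < F z} then a else x z)
        = G z + max (F z - G z) 0 := by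
      intro z
      by_cases hz : G z < F z
      · rw [if_pos (show z ∈ {z | G z < F z} from hz), max_eq_left (by linarith)]
        simp [hF, hG]
      · rw [if_neg (show z ∉ {z | G z < F z} from hz), max_eq_right (by linarith)]
        simp [hG]
    simp only [heq] at h1
    have hpi : Integrable (fun z => max (F z - G z) 0) (ν.prod κ) := (hFi.sub hGi).pos_part
    rw [integral_add hGi hpi] at h1
    have h2 : ∫ z, max (F z - G z) 0 ∂ν.prod κ = 0 :=
      le_antisymm (by linarith) (integral_nonneg fun z => le_max_right _ _)
    rw [integral_eq_zero_iff_of_nonneg (f := fun z => max (F z - G z) 0)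
      (fun z => le_max_right _ _) hpi] at h2
    filter_upwards [h2] with z hz
    have := le_max_left (F z - G z) 0
    simp only [Pi.zero_apply] at hz
    linarith
  have hall : ∀ᵐ z ∂ν.prod κ, ∀ (k : Fin 6) (b : Bool) (p q r : ℚ),
      modeLagr A B k₁ k₂ g z.1 (if b then 1 else 0) (max (p : ℝ) 0) (max (q : ℝ) 0)
        (max (r : ℝ) 0) k ≤ lagrangian A B k₁ k₂ g z.1 (x z) := by
    simp only [ae_all_iff]
    intro k b p q r
    simp only [← lagrangian_pureAction]
    refine key _ (pureAction_admissible k ?_ (le_max_right _ _) (le_max_right _ _)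
      (le_max_right _ _))
    cases b <;> simp
  filter_upwards [hall, hν.ae_pos (κ := κ)] with z hz hpos
  exact isBest_of_rational ⟨hpos.1.le, hpos.2.le⟩ hz

end Slotwise

/-! ### Existence of multipliers -/

section Mixture

variable {D₁ D₂ : Type*} [MeasurableSpace D₁] [MeasurableSpace D₂]

/-- The mixture of two laws of marks. -/
noncomputable def mixLaw (θ : ℝ) (κ₁ : Measure D₁) (κ₂ : Measure D₂) : Measure (D₁ ⊕ D₂) :=
  ENNReal.ofReal θ • κ₁.map Sum.inl + ENNReal.ofReal (1 - θ) • κ₂.map Sum.inr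

/-- The policy that follows `π₁` or `π₂` depending on the mark. -/
def mixPolicy (π₁ : Gain × D₁ → Action) (π₂ : Gain × D₂ → Action) (z : Gain × (D₁ ⊕ D₂)) :
    Action :=
  Sum.elim (fun d => π₁ (z.1, d)) (fun d => π₂ (z.1, d)) z.2

variable {ν : Measure Gain} {κ₁ : Measure D₁} {κ₂ : Measure D₂} [IsProbabilityMeasure κ₁]
  [IsProbabilityMeasure κ₂] {θ : ℝ}

lemma isProbabilityMeasure_mixLaw (h0 : 0 ≤ θ) (h1 : θ ≤ 1) :
    IsProbabilityMeasure (mixLaw θ κ₁ κ₂) where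
  measure_univ := by
    simp only [mixLaw, Measure.add_apply, Measure.smul_apply, smul_eq_mul,
      Measure.map_apply measurable_inl MeasurableSet.univ,
      Measure.map_apply measurable_inr MeasurableSet.univ, Set.preimage_univ, measure_univ, mul_one]
    rw [← ENNReal.ofReal_add h0 (by linarith)]
    simp

lemma prod_mixLaw [SFinite ν] :
    ν.prod (mixLaw θ κ₁ κ₂) =
      ENNReal.ofReal θ • (ν.prod κ₁).map (Prod.map id Sum.inl) +
        ENNReal.ofReal (1 - θ) • (ν.prod κ₂).map (Prod.map id Sum.inr) := by
  rw [mixLaw, Measure.prod_add, Measure.prod_smul_right, Measure.prod_smul_right,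
    ← Measure.map_prod_map _ _ measurable_id measurable_inl,
    ← Measure.map_prod_map _ _ measurable_id measurable_inr, Measure.map_id]

lemma measurable_mix {f : Gain × (D₁ ⊕ D₂) → ℝ} (h₁ : Measurable fun z : Gain × D₁ => f (z.1, .inl z.2))
    (h₂ : Measurable fun z : Gain × D₂ => f (z.1, .inr z.2)) : Measurable f := by
  have := (MeasurableEquiv.prodSumDistrib Gain D₁ D₂).symm.measurable_comp_iff (f := f)
  rw [← this]
  exact measurable_fun_sum h₁ h₂

lemma integrable_mix [SFinite ν] {f : Gain × (D₁ ⊕ D₂) → ℝ} (hf : Measurable f)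
    (h₁ : Integrable (fun z : Gain × D₁ => f (z.1, .inl z.2)) (ν.prod κ₁))
    (h₂ : Integrable (fun z : Gain × D₂ => f (z.1, .inr z.2)) (ν.prod κ₂)) :
    Integrable f (ν.prod (mixLaw θ κ₁ κ₂)) := by
  rw [prod_mixLaw]
  refine Integrable.add_measure (Integrable.smul_measure ?_ ENNReal.ofReal_ne_top)
    (Integrable.smul_measure ?_ ENNReal.ofReal_ne_top)
  · exact (integrable_map_measure hf.aestronglyMeasurable
      (measurable_id.prodMap measurable_inl).aemeasurable).2 h₁
  · exact (integrable_map_measure hf.aestronglyMeasurable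
      (measurable_id.prodMap measurable_inr).aemeasurable).2 h₂

lemma integral_mix [SFinite ν] (h0 : 0 ≤ θ) (h1 : θ ≤ 1) {f : Gain × (D₁ ⊕ D₂) → ℝ} (hf : Measurable f)
    (h₁ : Integrable (fun z : Gain × D₁ => f (z.1, .inl z.2)) (ν.prod κ₁))
    (h₂ : Integrable (fun z : Gain × D₂ => f (z.1, .inr z.2)) (ν.prod κ₂)) :
    ∫ z, f z ∂ν.prod (mixLaw θ κ₁ κ₂) =
      θ * ∫ z, f (z.1, .inl z.2) ∂ν.prod κ₁ + (1 - θ) * ∫ z, f (z.1, .inr z.2) ∂ν.prod κ₂ := by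
  have m1 : Measurable (Prod.map id Sum.inl : Gain × D₁ → Gain × (D₁ ⊕ D₂)) :=
    measurable_id.prodMap measurable_inl
  have m2 : Measurable (Prod.map id Sum.inr : Gain × D₂ → Gain × (D₁ ⊕ D₂)) :=
    measurable_id.prodMap measurable_inr
  rw [prod_mixLaw, integral_add_measure, integral_smul_measure, integral_smul_measure,
    integral_map m1.aemeasurable hf.aestronglyMeasurable,
    integral_map m2.aemeasurable hf.aestronglyMeasurable, ENNReal.toReal_ofReal h0,
    ENNReal.toReal_ofReal (by linarith)]
  · rfl
  · exact Integrable.smul_measure ((integrable_map_measure hf.aestronglyMeasurable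
      m1.aemeasurable).2 h₁) ENNReal.ofReal_ne_top
  · exact Integrable.smul_measure ((integrable_map_measure hf.aestronglyMeasurable
      m2.aemeasurable).2 h₂) ENNReal.ofReal_ne_top

lemma isPolicy_mix {π₁ : Gain × D₁ → Action} {π₂ : Gain × D₂ → Action} (h₁ : IsPolicy π₁)
    (h₂ : IsPolicy π₂) : IsPolicy (mixPolicy π₁ π₂) where
  admissible := fun ⟨s, d⟩ => by
    cases d with
    | inl d => exact h₁.admissible (s, d)
    | inr d => exact h₂.admissible (s, d)
  rate1r := measurable_mix h₁.rate1r h₂.rate1r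
  rate2r := measurable_mix h₁.rate2r h₂.rate2r
  rater1 := measurable_mix h₁.rater1 h₂.rater1
  rater2 := measurable_mix h₁.rater2 h₂.rater2
  power₁ := measurable_mix h₁.power₁ h₂.power₁
  power₂ := measurable_mix h₁.power₂ h₂.power₂
  powerr := measurable_mix h₁.powerr h₂.powerr

lemma hasFinitePower_mix [SFinite ν] {π₁ : Gain × D₁ → Action} {π₂ : Gain × D₂ → Action}
    (h₁ : IsPolicy π₁) (h₂ : IsPolicy π₂) (f₁ : HasFinitePower (ν.prod κ₁) π₁)
    (f₂ : HasFinitePower (ν.prod κ₂) π₂) :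
    HasFinitePower (ν.prod (mixLaw θ κ₁ κ₂)) (mixPolicy π₁ π₂) where
  power₁ := integrable_mix (isPolicy_mix h₁ h₂).power₁ f₁.power₁ f₂.power₁
  power₂ := integrable_mix (isPolicy_mix h₁ h₂).power₂ f₁.power₂ f₂.power₂
  powerr := integrable_mix (isPolicy_mix h₁ h₂).powerr f₁.powerr f₂.powerr

end Mixture

section Multipliers

variable {D : Type*} [MeasurableSpace D]

/-- The slacks of the constraints and the objective of a policy. -/
noncomputable def outcome (η Pt : ℝ) (m : Measure (Gain × D)) (π : Gain × D → Action) : Fin 4 → ℝ :=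
  ![∫ z, (π z).rate1r z.1 ∂m - ∫ z, (π z).rater2 z.1 ∂m,
    ∫ z, (π z).rate2r z.1 ∂m - ∫ z, (π z).rater1 z.1 ∂m,
    meanPower m π - Pt,
    value η m π]

lemma outcome_mix {D₁ D₂ : Type*} [MeasurableSpace D₁] [MeasurableSpace D₂] {ν : Measure Gain}
    (hν : IsGainLaw ν) {κ₁ : Measure D₁} {κ₂ : Measure D₂} [IsProbabilityMeasure κ₁]
    [IsProbabilityMeasure κ₂] {θ : ℝ} (h0 : 0 ≤ θ) (h1 : θ ≤ 1)
    {π₁ : Gain × D₁ → Action} {π₂ : Gain × D₂ → Action}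
    (h₁ : IsPolicy π₁) (h₂ : IsPolicy π₂) (f₁ : HasFinitePower (ν.prod κ₁) π₁)
    (f₂ : HasFinitePower (ν.prod κ₂) π₂) (η Pt : ℝ) :
    outcome η Pt (ν.prod (mixLaw θ κ₁ κ₂)) (mixPolicy π₁ π₂) =
      θ • outcome η Pt (ν.prod κ₁) π₁ + (1 - θ) • outcome η Pt (ν.prod κ₂) π₂ := by
  have := hν.prob
  have hm := isPolicy_mix h₁ h₂
  have e1 := integral_mix h0 h1 hm.rate1r (h₁.integrable_rate1r hν f₁) (h₂.integrable_rate1r hν f₂)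
  have e2 := integral_mix h0 h1 hm.rate2r (h₁.integrable_rate2r hν f₁) (h₂.integrable_rate2r hν f₂)
  have e3 := integral_mix h0 h1 hm.rater1 (h₁.integrable_rater1 hν f₁) (h₂.integrable_rater1 hν f₂)
  have e4 := integral_mix h0 h1 hm.rater2 (h₁.integrable_rater2 hν f₁) (h₂.integrable_rater2 hν f₂)
  have e5 := integral_mix h0 h1 hm.power₁ f₁.power₁ f₂.power₁
  have e6 := integral_mix h0 h1 hm.power₂ f₁.power₂ f₂.power₂
  have e7 := integral_mix h0 h1 hm.powerr f₁.powerr f₂.powerr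
  have r1 : ∀ (s : Gain) (d : D₁), mixPolicy π₁ π₂ (s, .inl d) = π₁ (s, d) := fun _ _ => rfl
  have r2 : ∀ (s : Gain) (d : D₂), mixPolicy π₁ π₂ (s, .inr d) = π₂ (s, d) := fun _ _ => rfl
  simp only [r1, r2, Prod.mk.eta] at e1 e2 e3 e4 e5 e6 e7
  ext i
  fin_cases i
  · simp [outcome, e1, e4]; ring
  · simp [outcome, e2, e3]; ring
  · simp [outcome, meanPower, e5, e6, e7]; ring
  · simp [outcome, value, e1, e2]; ring

/-- Multipliers of the constraints for a policy that is optimal among all policies with random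
marks. -/
theorem exists_multipliers {ν : Measure Gain} (hν : IsGainLaw ν) {η Pt V : ℝ}
    (hopt : ∀ (D' : Type) [MeasurableSpace D'] (κ' : Measure D') [IsProbabilityMeasure κ']
      (π' : Gain × D' → Action), IsPolicy π' → IsStatFeasible Pt (ν.prod κ') π' →
      value η (ν.prod κ') π' ≤ V) :
    ∃ c : Fin 4 → ℝ, c ≠ 0 ∧ 0 ≤ c 3 ∧
      ∀ (D' : Type) [MeasurableSpace D'] (κ' : Measure D') [IsProbabilityMeasure κ']
        (π' : Gain × D' → Action), IsPolicy π' → HasFinitePower (ν.prod κ') π' →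
        ∑ i, c i * outcome η Pt (ν.prod κ') π' i ≤ c 3 * V := by
  have := hν.prob
  let K : Set (Fin 4 → ℝ) := {v | ∃ (D' : Type) (_ : MeasurableSpace D') (κ' : Measure D')
    (_ : IsProbabilityMeasure κ') (π' : Gain × D' → Action), IsPolicy π' ∧
      HasFinitePower (ν.prod κ') π' ∧ v 0 = outcome η Pt (ν.prod κ') π' 0 ∧
      v 1 = outcome η Pt (ν.prod κ') π' 1 ∧ v 2 = outcome η Pt (ν.prod κ') π' 2 ∧
      v 3 < outcome η Pt (ν.prod κ') π' 3 - V}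
  have hmem : ∀ (D' : Type) [MeasurableSpace D'] (κ' : Measure D') [IsProbabilityMeasure κ']
      (π' : Gain × D' → Action), IsPolicy π' → HasFinitePower (ν.prod κ') π' → ∀ r : ℝ, 0 < r →
      ![outcome η Pt (ν.prod κ') π' 0, outcome η Pt (ν.prod κ') π' 1,
        outcome η Pt (ν.prod κ') π' 2, outcome η Pt (ν.prod κ') π' 3 - V - r] ∈ K := by
    intro D' _ κ' _ π' hπ hf r hr
    refine ⟨D', inferInstance, κ', inferInstance, π', hπ, hf, rfl, rfl, rfl, ?_⟩
    simp only [Matrix.cons_val]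
    linarith
  have hidle : (pureAction 0 0 0 0 0).Admissible :=
    pureAction_admissible 0 (by simp) le_rfl le_rfl le_rfl
  have hne : K.Nonempty := ⟨_, hmem Unit (Measure.dirac ()) _ (isPolicy_const hidle)
    (hasFinitePower_const hν _) 1 one_pos⟩
  have hconv : Convex ℝ K := by
    rintro u ⟨D₁, _, κ₁, _, π₁, h₁, f₁, a0, a1, a2, a3⟩ v ⟨D₂, _, κ₂, _, π₂, h₂, f₂, b0, b1, b2, b3⟩
      θ θ' h0 h0' hsum
    obtain rfl : θ' = 1 - θ := by linarith
    have hp := isProbabilityMeasure_mixLaw (κ₁ := κ₁) (κ₂ := κ₂) h0 (show θ ≤ 1 by linarith)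
    refine ⟨D₁ ⊕ D₂, inferInstance, mixLaw θ κ₁ κ₂, hp, mixPolicy π₁ π₂, isPolicy_mix h₁ h₂,
      hasFinitePower_mix h₁ h₂ f₁ f₂, ?_⟩
    rw [outcome_mix hν h0 (by linarith) h₁ h₂ f₁ f₂]
    simp only [Pi.add_apply, Pi.smul_apply, smul_eq_mul, a0, a1, a2, b0, b1, b2, true_and]
    rcases h0.eq_or_lt with rfl | hθ
    · simpa using b3
    · have e1 := mul_lt_mul_of_pos_left a3 hθ
      have e2 := mul_le_mul_of_nonneg_left b3.le h0'
      linarith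
  have h0K : (0 : Fin 4 → ℝ) ∉ K := by
    rintro ⟨D', _, κ', _, π', hπ, hf, a0, a1, a2, a3⟩
    simp only [outcome, Matrix.cons_val, Pi.zero_apply] at a0 a1 a2 a3
    have := hopt D' κ' π' hπ ⟨hf, by linarith, by linarith, by linarith⟩
    linarith
  obtain ⟨f, hf0, hf⟩ := exists_functional_nonpos hconv hne h0K
  have hexp : ∀ v : Fin 4 → ℝ, f v = ∑ i, f (Pi.single i 1) * v i := fun v => by
    rw [LinearMap.pi_apply_eq_sum_univ f v]
    refine Finset.sum_congr rfl fun i _ => ?_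
    rw [smul_eq_mul, mul_comm]
    congr 2
    ext j
    simp [Pi.single_apply, eq_comm]
  have hineq : ∀ (D' : Type) [MeasurableSpace D'] (κ' : Measure D') [IsProbabilityMeasure κ']
      (π' : Gain × D' → Action), IsPolicy π' → HasFinitePower (ν.prod κ') π' → ∀ r : ℝ, 0 < r →
      ∑ i, f (Pi.single i 1) * outcome η Pt (ν.prod κ') π' i ≤ f (Pi.single 3 1) * (V + r) := by
    intro D' _ κ' _ π' hπ hfp r hr
    have := hf _ (hmem D' κ' π' hπ hfp r hr)
    rw [hexp, Fin.sum_univ_four] at this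
    rw [Fin.sum_univ_four]
    simp only [Matrix.cons_val] at this
    linarith
  refine ⟨fun i => f (Pi.single i 1), fun h => hf0 ?_, ?_, ?_⟩
  · ext v
    simp [congrFun h _]
  · by_contra! hneg
    set T := ∑ i, f (Pi.single i 1) * outcome η Pt (ν.prod (Measure.dirac ()))
      (fun _ => pureAction 0 0 0 0 0) i
    have := hineq Unit (Measure.dirac ()) _ (isPolicy_const hidle) (hasFinitePower_const hν _)
      (|V| + (|T| + 1) / (-f (Pi.single 3 1))) (by
        have : 0 < -f (Pi.single 3 1) := by linarith
        positivity)
    have h2 : f (Pi.single 3 1) * (V + (|V| + (|T| + 1) / (-f (Pi.single 3 1))))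
        = f (Pi.single 3 1) * (V + |V|) - (|T| + 1) := by
      have := hneg.ne
      field_simp
      ring
    rw [h2] at this
    have h3 : f (Pi.single 3 1) * (V + |V|) ≤ 0 :=
      mul_nonpos_of_nonpos_of_nonneg hneg.le (by linarith [neg_abs_le V])
    linarith [neg_abs_le T]
  · intro D' _ κ' _ π' hπ hfp
    refine le_of_forall_pos_le_add fun ε hε => ?_
    have := hineq D' κ' π' hπ hfp (ε / (|f (Pi.single 3 1)| + 1)) (by positivity)
    have h2 : f (Pi.single 3 1) * (ε / (|f (Pi.single 3 1)| + 1)) ≤ ε := by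
      rw [mul_div_assoc', div_le_iff₀ (by positivity)]
      nlinarith [le_abs_self (f (Pi.single 3 1))]
    linarith

end Multipliers

lemma cap_le_linear {ε x : ℝ} (hε : 0 < ε) (hx : 0 ≤ x) :
    cap x ≤ (ε * (1 + x) - 1 - Real.log ε) / Real.log 2 := by
  rw [cap_eq]
  have := Real.log_le_sub_one_of_pos (show 0 < ε * (1 + x) by positivity)
  rw [Real.log_mul hε.ne' (by positivity)] at this
  refine div_le_div_of_nonneg_right ?_ log_two_pos.le
  linarith

lemma nonneg_of_waterfilling_le {α g σ C : ℝ} (hσ : 0 < σ)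
    (h : ∀ p : ℝ, 0 ≤ p → α * cap (p * σ) - g * p ≤ C) : 0 ≤ g := by
  by_contra! hg
  have hl := log_two_pos
  set ε := -g * Real.log 2 / (2 * σ * (|α| + 1)) with hε
  have hε0 : 0 < ε := by
    have : 0 < -g := by linarith
    positivity
  set K := |α| * ((ε - 1 - Real.log ε) / Real.log 2) with hK
  have hbound : ∀ p : ℝ, 0 ≤ p → -g / 2 * p ≤ C + K := by
    intro p hp
    have h1 := h p hp
    have h2 := cap_le_linear hε0 (mul_nonneg hp hσ.le)
    have h3 : -|α| * cap (p * σ) ≤ α * cap (p * σ) :=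
      mul_le_mul_of_nonneg_right (neg_abs_le α) (cap_nonneg (mul_nonneg hp hσ.le))
    have h4 := mul_le_mul_of_nonneg_left h2 (abs_nonneg α)
    have h5 : |α| * ((ε * (1 + p * σ) - 1 - Real.log ε) / Real.log 2)
        = K + |α| * (ε * σ / Real.log 2) * p := by
      rw [hK]; field_simp; ring
    have h6 : |α| * (ε * σ / Real.log 2) ≤ -g / 2 := by
      have : ε * σ / Real.log 2 = -g / 2 / (|α| + 1) := by
        rw [hε]; field_simp
      rw [this, mul_div_assoc', div_le_iff₀ (by positivity)]
      nlinarith [abs_nonneg α]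
    have h7 := mul_le_mul_of_nonneg_right h6 hp
    linarith
  have := hbound (2 * (|C + K| + 1) / -g) (by
    have : 0 < -g := by linarith
    positivity)
  have h2 : -g / 2 * (2 * (|C + K| + 1) / -g) = |C + K| + 1 := by
    have := hg.ne
    field_simp
  rw [h2] at this
  linarith [le_abs_self (C + K)]

lemma nonpos_of_cap_le {α σ C : ℝ} (hσ : 0 < σ) (h : ∀ p : ℝ, 0 ≤ p → α * cap (p * σ) ≤ C) :
    α ≤ 0 := by
  by_contra! hα
  obtain ⟨n, hn⟩ := exists_nat_gt (C / α)
  have h1 := h (2 ^ n / σ) (by positivity)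
  rw [div_mul_cancel₀ _ hσ.ne'] at h1
  have h2 : (n : ℝ) ≤ cap (2 ^ n) := by
    have : Real.logb 2 (2 ^ n) = n := by
      rw [Real.logb_pow, Real.logb_self_eq_one one_lt_two, mul_one]
    rw [← this]
    exact Real.logb_le_logb_of_le one_lt_two (by positivity) (by linarith)
  rw [div_lt_iff₀ hα] at hn
  nlinarith

lemma IsBest.power_weight_pos {A B k₁ k₂ g : ℝ} {s : Gain} {a : Action}
    (h : IsBest A B k₁ k₂ g s a) (h1 : 0 < s.1) (h2 : 0 < s.2) (hA : 0 ≤ A + k₂) (hB : 0 ≤ B + k₁)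
    (hne : ¬(A + k₂ = 0 ∧ B + k₁ = 0 ∧ k₁ = 0 ∧ k₂ = 0 ∧ g = 0)) : 0 < g := by
  have m : ∀ (k : Fin 6) (p : ℝ), 0 ≤ p → modeLagr A B k₁ k₂ g s 0 p p p k ≤ _ := fun k p hp =>
    h.modeLagr_le k (Or.inl rfl) hp hp hp
  have hg : 0 ≤ g := nonneg_of_waterfilling_le h1 (m 0)
  refine lt_of_le_of_ne hg fun hg0 => hne ?_
  have e0 : A ≤ 0 := nonpos_of_cap_le h1 fun p hp => by simpa [modeLagr, ← hg0] using m 0 p hp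
  have e1 : B ≤ 0 := nonpos_of_cap_le h2 fun p hp => by simpa [modeLagr, ← hg0] using m 1 p hp
  have e3 : k₁ ≤ 0 := nonpos_of_cap_le h1 fun p hp => by simpa [modeLagr, ← hg0] using m 3 p hp
  have e4 : k₂ ≤ 0 := nonpos_of_cap_le h2 fun p hp => by simpa [modeLagr, ← hg0] using m 4 p hp
  refine ⟨?_, ?_, ?_, ?_, hg0.symm⟩ <;> linarith

lemma IsBest.scale {A B k₁ k₂ g l : ℝ} {s : Gain} {a : Action} (h : IsBest A B k₁ k₂ g s a)
    (hl : 0 ≤ l) : IsBest (l * A) (l * B) (l * k₁) (l * k₂) (l * g) s a := by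
  intro b hb
  have e : ∀ c : Action, lagrangian (l * A) (l * B) (l * k₁) (l * k₂) (l * g) s c
      = l * lagrangian A B k₁ k₂ g s c := fun c => by unfold lagrangian; ring
  rw [e, e]
  exact mul_le_mul_of_nonneg_left (h b hb) hl

section

variable {D : Type} [MeasurableSpace D] {ν : Measure Gain} {κ : Measure D}
  [IsProbabilityMeasure κ] {x : Gain × D → Action} {η Pt : ℝ}

/-- **Duality**: a policy that is optimal among all policies with random marks maximizes, in almost
every slot, the Lagrangian of suitable weights with positive `γ`. -/
theorem exists_weights_best (hν : IsGainLaw ν) (hη : 0 < η ∧ η < 1) (hPt : 0 < Pt)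
    (hx : IsPolicy x) (hf : IsStatFeasible Pt (ν.prod κ) x)
    (hopt : ∀ (D' : Type) [MeasurableSpace D'] (κ' : Measure D') [IsProbabilityMeasure κ']
      (π' : Gain × D' → Action), IsPolicy π' → IsStatFeasible Pt (ν.prod κ') π' →
      value η (ν.prod κ') π' ≤ value η (ν.prod κ) x) :
    ∃ w : Weights, 0 < w.γ ∧ ∀ᵐ z ∂ν.prod κ, w.Best η z.1 (x z) := by
  have := hν.prob
  obtain ⟨c, hc0, hc3, hc⟩ := exists_multipliers hν hopt
  set V := value η (ν.prod κ) x with hV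
  have key : ∀ π : Gain × D → Action, IsPolicy π → HasFinitePower (ν.prod κ) π →
      ∫ z, lagrangian (c 3 * η + c 0) (c 3 * (1 - η) + c 1) (-c 1) (-c 0) (-c 2) z.1 (π z)
        ∂ν.prod κ ≤ c 3 * V + c 2 * Pt := by
    intro π hπ hfp
    have := hc D κ π hπ hfp
    rw [Fin.sum_univ_four] at this
    simp only [outcome, Matrix.cons_val, value] at this
    rw [hπ.integral_lagrangian hν hfp]
    linarith
  have hxv : ∫ z, lagrangian (c 3 * η + c 0) (c 3 * (1 - η) + c 1) (-c 1) (-c 0) (-c 2) z.1 (x z)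
        ∂ν.prod κ = c 3 * V + c 2 * Pt := by
    rw [hx.integral_lagrangian hν hf.finite, hf.power, ← hf.c1, ← hf.c2, hV, value]
    ring
  have hbest := ae_isBest_of_integral_le hν hx hf.finite fun π hπ hfp => by
    rw [hxv]; exact key π hπ hfp
  obtain ⟨z, hz, hz1, hz2⟩ := (hbest.and (hν.ae_pos (κ := κ))).exists
  have hg : 0 < -c 2 := by
    refine hz.power_weight_pos hz1 hz2 ?_ ?_ ?_
    · have := mul_nonneg hc3 hη.1.le; linarith
    · have := mul_nonneg hc3 (sub_nonneg.2 hη.2.le); linarith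
    · rintro ⟨e1, e2, e3, e4, e5⟩
      refine hc0 (funext fun i => ?_)
      have : c 3 = 0 := by linarith
      fin_cases i <;> simp only [Fin.zero_eta, Fin.mk_one, Fin.reduceFinMk, Pi.zero_apply] <;>
        linarith
  have hidle : (pureAction 0 0 0 0 0).Admissible :=
    pureAction_admissible 0 (by simp) le_rfl le_rfl le_rfl
  have h0 := key _ (isPolicy_const hidle) (hasFinitePower_const hν _)
  have hzero : ∀ z : Gain × D, lagrangian (c 3 * η + c 0) (c 3 * (1 - η) + c 1) (-c 1) (-c 0)
      (-c 2) z.1 (pureAction 0 0 0 0 0) = 0 := fun z => by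
    rw [lagrangian_pureAction]; simp [modeLagr, cap_zero]
  simp only [hzero, integral_zero] at h0
  have hl : 0 < c 3 := lt_of_le_of_ne hc3 fun h => by
    rw [← h] at h0
    nlinarith
  refine ⟨⟨-c 0 / c 3, -c 1 / c 3, -c 2 / c 3⟩, div_pos hg hl, ?_⟩
  filter_upwards [hbest] with z hz
  have := hz.scale (inv_pos.2 hl).le
  unfold Weights.Best
  convert this using 1 <;> field_simp <;> ring

/-- Some feasible policy has a positive objective. -/
lemma exists_value_pos (hν : IsGainLaw ν) (hη : 0 < η ∧ η < 1) (hPt : 0 < Pt) :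
    ∃ π : Gain × Unit → Action, IsPolicy π ∧ IsStatFeasible Pt (ν.prod (Measure.dirac ())) π ∧
      0 < value η (ν.prod (Measure.dirac ())) π := by
  have := hν.prob
  have hpos : ∀ f : Gain × Unit → ℝ, Integrable f (ν.prod (Measure.dirac ())) →
      (∀ z, 0 < z.1.1 → 0 < z.1.2 → 0 < f z) → 0 < ∫ z, f z ∂ν.prod (Measure.dirac ()) := by
    intro f hf h
    have hae : ∀ᵐ z ∂ν.prod (Measure.dirac ()), 0 < f z :=
      (hν.ae_pos (κ := Measure.dirac ())).mono fun z hz => h z hz.1 hz.2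
    rw [integral_pos_iff_support_of_nonneg_ae (hae.mono fun z hz => hz.le) hf]
    have : ∀ᵐ z ∂ν.prod (Measure.dirac ()), z ∈ Function.support f :=
      hae.mono fun z hz => hz.ne'
    rw [measure_congr (eventuallyEq_univ.2 (show Function.support f ∈ _ from this)), measure_univ]
    exact one_pos
  have hcap : ∀ σ : Gain → ℝ, Measurable σ → Integrable σ ν → (∀ s : Gain, 0 < s.1 → 0 < s.2 → 0 < σ s) →
      Integrable (fun z : Gain × Unit => cap (Pt * σ z.1)) (ν.prod (Measure.dirac ())) := by
    intro σ hσm hσ hσp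
    have hm := measurable_cap
    refine Integrable.mono' (((integrable_const Pt).add (hσ.comp_fst (Measure.dirac ()))).div_const
      (Real.log 2)) (Measurable.aestronglyMeasurable (by fun_prop)) ?_
    filter_upwards [hν.ae_pos (κ := Measure.dirac ())] with z hz
    have := hσp z.1 hz.1 hz.2
    rw [Real.norm_eq_abs, abs_of_nonneg (cap_nonneg (by positivity))]
    exact cap_mul_le hPt.le this.le
  have i1 := hcap (fun s => s.1) measurable_fst hν.int₁ fun s h _ => h
  have i2 := hcap (fun s => s.2) measurable_snd hν.int₂ fun s _ h => h
  have p1 := hpos _ i1 fun z h1 _ => cap_pos (mul_pos hPt h1)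
  have p2 := hpos _ i2 fun z _ h2 => cap_pos (mul_pos hPt h2)
  set a₁ := ∫ z : Gain × Unit, cap (Pt * z.1.1) ∂ν.prod (Measure.dirac ()) with ha₁
  set a₂ := ∫ z : Gain × Unit, cap (Pt * z.1.2) ∂ν.prod (Measure.dirac ()) with ha₂
  set θ := a₂ / (a₁ + a₂) with hθ
  have hθ0 : 0 < θ := by positivity
  have hθ1 : 1 - θ = a₁ / (a₁ + a₂) := by rw [hθ]; field_simp; ring
  have hθ2 : 0 < 1 - θ := by rw [hθ1]; positivity
  let a : Action := ⟨![θ, 0, 0, 0, 1 - θ, 0], 0, Pt, 0, Pt⟩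
  have ha : a.Admissible := by
    refine ⟨?_, fun k => ?_, by simp [a], hPt.le, le_rfl, hPt.le⟩
    · rw [Fin.sum_univ_six]; simp [a]
    · fin_cases k <;> simp [a] <;> constructor <;> linarith
  have r1 : ∀ z : Gain × Unit, a.rate1r z.1 = θ * cap (Pt * z.1.1) := fun z => by
    simp [a, Action.rate1r]
  have r2 : ∀ z : Gain × Unit, a.rate2r z.1 = 0 := fun z => by simp [a, Action.rate2r]
  have r3 : ∀ z : Gain × Unit, a.rater1 z.1 = 0 := fun z => by simp [a, Action.rater1]
  have r4 : ∀ z : Gain × Unit, a.rater2 z.1 = (1 - θ) * cap (Pt * z.1.2) := fun z => by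
    simp [a, Action.rater2]
  refine ⟨fun _ => a, isPolicy_const ha, ⟨hasFinitePower_const hν a, ?_, ?_, ?_⟩, ?_⟩
  · simp only [r1, r4, integral_const_mul]
    rw [← ha₁, ← ha₂, hθ1, hθ]
    ring
  · simp only [r2, r3]
  · simp only [meanPower, integral_const, probReal_univ, one_smul]
    simp [a, Action.power₁, Action.power₂, Action.powerr]
    ring
  · simp only [value, r1, r2, integral_const_mul, integral_zero, mul_zero, add_zero]
    have := hη.1
    positivity

end

/-! ### Exceptional sets of gains -/

section Null

variable {ν : Measure Gain}

lemma IsGainLaw.ae_notMem_of_subsingleton_right (hν : IsGainLaw ν) {E : Set Gain}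
    (hE : MeasurableSet E) (h : ∀ x y y', (x, y) ∈ E → (x, y') ∈ E → y = y') :
    ∀ᵐ s ∂ν, s ∉ E := by
  have h0 : (volume : Measure Gain) E = 0 := by
    rw [Measure.volume_eq_prod, Measure.measure_prod_null hE]
    refine ae_of_all _ fun x => ?_
    exact Set.Subsingleton.measure_zero (fun y hy y' hy' => h x y y' hy hy') _
  simpa [ae_iff] using hν.ac h0

lemma IsGainLaw.ae_notMem_of_subsingleton_left (hν : IsGainLaw ν) {E : Set Gain}
    (hE : MeasurableSet E) (h : ∀ x x' y, (x, y) ∈ E → (x', y) ∈ E → x = x') :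
    ∀ᵐ s ∂ν, s ∉ E := by
  have h0 : (volume : Measure Gain) E = 0 := by
    have h1 : ∀ y, volume ((fun x => (x, y)) ⁻¹' E) = 0 := fun y =>
      Set.Subsingleton.measure_zero (fun x hx x' hx' => h x x' y hx hx') _
    rw [Measure.volume_eq_prod, Measure.prod_apply_symm hE]
    simp [h1]
  simpa [ae_iff] using hν.ac h0

lemma IsGainLaw.ae_inv_sub_inv_ne (hν : IsGainLaw ν) (c : ℝ) :
    ∀ᵐ s ∂ν, 1 / s.1 - 1 / s.2 ≠ c := by
  refine hν.ae_notMem_of_subsingleton_right (E := {s | 1 / s.1 - 1 / s.2 = c})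
    (measurableSet_eq_fun (by fun_prop) measurable_const) fun x y y' h h' => ?_
  simp only [Set.mem_ofPred_eq] at h h'
  have : 1 / y = 1 / y' := by linarith
  simpa using this

lemma IsGainLaw.ae_ne (hν : IsGainLaw ν) : ∀ᵐ s ∂ν, s.1 ≠ s.2 := by
  filter_upwards [hν.ae_inv_sub_inv_ne 0] with s hs h
  exact hs (by rw [h, sub_self])

end Null

/-! ### Measurability of the protocol -/

section Measurability

variable (η : ℝ) (w : Weights)

lemma measurable_power1M1 : Measurable (power1M1 η w) := by
  unfold power1M1; fun_prop

lemma measurable_power2M2 : Measurable (power2M2 η w) := by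
  unfold power2M2; fun_prop

lemma measurable_power1M3 : Measurable (power1M3 η w) := by
  unfold power1M3; split_ifs <;> fun_prop

lemma measurable_power2M3 : Measurable (power2M3 η w) := by
  unfold power2M3; split_ifs <;> fun_prop

lemma measurable_powerrM4 : Measurable (powerrM4 w) := by
  unfold powerrM4; fun_prop

lemma measurable_powerrM5 : Measurable (powerrM5 w) := by
  unfold powerrM5; fun_prop

lemma measurable_powerrM6 : Measurable (powerrM6 w) := by
  unfold powerrM6; fun_prop

lemma measurable_C1r : Measurable (C1r η w) :=
  measurable_cap.comp ((measurable_power1M1 η w).mul measurable_fst)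

lemma measurable_C2r : Measurable (C2r η w) :=
  measurable_cap.comp ((measurable_power2M2 η w).mul measurable_snd)

lemma measurable_C12r : Measurable (C12r η w) := by
  have := measurable_cap
  have := measurable_power1M3 η w
  have := measurable_power2M3 η w
  unfold C12r macRate₁
  fun_prop

lemma measurable_C21r : Measurable (C21r η w) := by
  have := measurable_cap
  have := measurable_power1M3 η w
  have := measurable_power2M3 η w
  unfold C21r macRate₂
  fun_prop

lemma measurable_Cr1 : Measurable (Cr1 w) :=
  measurable_cap.comp ((measurable_powerrM6 w).mul measurable_fst)

lemma measurable_Cr2 : Measurable (Cr2 w) :=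
  measurable_cap.comp ((measurable_powerrM6 w).mul measurable_snd)

lemma measurable_capM4 : Measurable fun s : Gain => cap (powerrM4 w s * s.1) :=
  measurable_cap.comp ((measurable_powerrM4 w).mul measurable_fst)

lemma measurable_capM5 : Measurable fun s : Gain => cap (powerrM5 w s * s.2) :=
  measurable_cap.comp ((measurable_powerrM5 w).mul measurable_snd)

lemma measurable_metric : Measurable (metric η w) := by
  have := measurable_power1M1 η w
  have := measurable_power2M2 η w
  have := measurable_power1M3 η w
  have := measurable_power2M3 η w
  have := measurable_powerrM4 w
  have := measurable_powerrM5 w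
  have := measurable_powerrM6 w
  have := measurable_C1r η w
  have := measurable_C2r η w
  have := measurable_C12r η w
  have := measurable_C21r η w
  have := measurable_Cr1 w
  have := measurable_Cr2 w
  have := measurable_capM4 w
  have := measurable_capM5 w
  refine measurable_pi_lambda _ fun k => ?_
  fin_cases k <;> simp only [metric, Fin.zero_eta, Fin.mk_one, Fin.reduceFinMk, Matrix.cons_val] <;>
    fun_prop

end Measurability

section Effects

variable (sel : Finset (Fin 6) → (Fin 6 → ℝ) → Fin 6) (η : ℝ) (w : Weights) (c : Coins) (s : Gain)

lemma protocol_rate1r : (protocol sel η w c s).rate1r s =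
    ![C1r η w s, 0, C12r η w s, 0, 0, 0] (mode sel η w c s) := by
  unfold protocol Action.rate1r
  generalize mode sel η w c s = k
  fin_cases k <;> simp [C1r, C12r]

lemma protocol_rate2r : (protocol sel η w c s).rate2r s =
    ![0, C2r η w s, C21r η w s, 0, 0, 0] (mode sel η w c s) := by
  unfold protocol Action.rate2r
  generalize mode sel η w c s = k
  fin_cases k <;> simp [C2r, C21r]

lemma protocol_rater1 : (protocol sel η w c s).rater1 s =
    ![0, 0, 0, cap (powerrM4 w s * s.1), 0, Cr1 w s] (mode sel η w c s) := by
  unfold protocol Action.rater1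
  generalize mode sel η w c s = k
  fin_cases k <;> simp [Cr1]

lemma protocol_rater2 : (protocol sel η w c s).rater2 s =
    ![0, 0, 0, 0, cap (powerrM5 w s * s.2), Cr2 w s] (mode sel η w c s) := by
  unfold protocol Action.rater2
  generalize mode sel η w c s = k
  fin_cases k <;> simp [Cr2]

lemma protocol_power₁ : (protocol sel η w c s).power₁ =
    ![power1M1 η w s, 0, power1M3 η w s, 0, 0, 0] (mode sel η w c s) := by
  unfold protocol Action.power₁
  generalize mode sel η w c s = k
  fin_cases k <;> simp

lemma protocol_power₂ : (protocol sel η w c s).power₂ =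
    ![0, power2M2 η w s, power2M3 η w s, 0, 0, 0] (mode sel η w c s) := by
  unfold protocol Action.power₂
  generalize mode sel η w c s = k
  fin_cases k <;> simp

lemma protocol_powerr : (protocol sel η w c s).powerr =
    ![0, 0, 0, powerrM4 w s, powerrM5 w s, powerrM6 w s] (mode sel η w c s) := by
  unfold protocol Action.powerr
  generalize mode sel η w c s = k
  fin_cases k <;> simp

lemma decOrder_eq : decOrder η w = 0 ∨ decOrder η w = 1 := by
  unfold decOrder; split_ifs <;> simp

lemma power1M1_nonneg : 0 ≤ power1M1 η w s := le_max_right _ _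

lemma power2M2_nonneg : 0 ≤ power2M2 η w s := le_max_right _ _

lemma power1M3_nonneg : 0 ≤ power1M3 η w s := by
  unfold power1M3; split_ifs <;> exact le_max_right _ _

lemma power2M3_nonneg : 0 ≤ power2M3 η w s := by
  unfold power2M3; split_ifs <;> exact le_max_right _ _

lemma powerrM4_nonneg : 0 ≤ powerrM4 w s := le_max_right _ _

lemma powerrM5_nonneg : 0 ≤ powerrM5 w s := le_max_right _ _

lemma powerrM6_nonneg : 0 ≤ powerrM6 w s := le_max_right _ _

lemma protocol_admissible : (protocol sel η w c s).Admissible := by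
  refine ⟨by simp [protocol], fun k => ?_, ?_, ?_, ?_, ?_⟩
  · unfold protocol; dsimp only; split_ifs <;> simp
  · have := decOrder_eq η w
    rcases this with h | h <;> simp [protocol, h]
  · unfold protocol
    generalize mode sel η w c s = k
    have := power1M1_nonneg η w s
    have := power1M3_nonneg η w s
    fin_cases k <;> simp <;> assumption
  · unfold protocol
    generalize mode sel η w c s = k
    have := power2M2_nonneg η w s
    have := power2M3_nonneg η w s
    fin_cases k <;> simp <;> assumption
  · unfold protocol
    generalize mode sel η w c s = k
    have := powerrM4_nonneg w s
    have := powerrM5_nonneg w s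
    have := powerrM6_nonneg w s
    fin_cases k <;> simp <;> assumption

/-- The Lagrangian of the protocol's action for arbitrary coefficients. -/
lemma lagrangian_protocol (A B k₁ k₂ g : ℝ) :
    lagrangian A B k₁ k₂ g s (protocol sel η w c s) =
      ![A * C1r η w s - g * power1M1 η w s,
        B * C2r η w s - g * power2M2 η w s,
        A * C12r η w s + B * C21r η w s - g * (power1M3 η w s + power2M3 η w s),
        k₁ * cap (powerrM4 w s * s.1) - g * powerrM4 w s,
        k₂ * cap (powerrM5 w s * s.2) - g * powerrM5 w s,
        k₂ * Cr2 w s + k₁ * Cr1 w s - g * powerrM6 w s] (mode sel η w c s) := by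
  unfold lagrangian
  rw [protocol_rate1r, protocol_rate2r, protocol_rater1, protocol_rater2, protocol_power₁,
    protocol_power₂, protocol_powerr]
  generalize mode sel η w c s = k
  fin_cases k <;> (simp; try ring)

lemma lagr_protocol : w.lagr η s (protocol sel η w c s) = metric η w s (mode sel η w c s) := by
  unfold Weights.lagr
  rw [lagrangian_protocol]
  rfl

variable {sel} (hsel : IsArgMax sel)

include hsel in
lemma measurable_mode : Measurable (mode sel η w c) :=
  (hsel.measurable _).comp (measurable_metric η w)

lemma measurable_table {D : Type*} [MeasurableSpace D] {k : D → Fin 6} (hk : Measurable k)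
    {F : D → Fin 6 → ℝ} (hF : Measurable F) : Measurable fun s => F s (k s) := by
  have : (fun s => F s (k s)) = fun s => ∑ j, if k s = j then F s j else 0 := by
    funext s; simp
  rw [this]
  exact Finset.measurable_sum _ fun j _ =>
    Measurable.ite (hk (measurableSet_singleton j)) ((measurable_pi_apply j).comp hF)
      measurable_const

include hsel in
lemma isPolicy_protocol : IsPolicy fun z : Gain × Coins => protocol sel η w z.2 z.1 := by
  have key : ∀ F : Gain → Fin 6 → ℝ, Measurable F →
      Measurable fun z : Gain × Coins => F z.1 (mode sel η w z.2 z.1) := fun F hF =>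
    measurable_from_prod_countable_left fun c => measurable_table (measurable_mode η w c hsel) hF
  refine ⟨fun z => protocol_admissible _ _ _ _ _, ?_, ?_, ?_, ?_, ?_, ?_, ?_⟩
  · simp only [protocol_rate1r]
    refine key (fun s => ![C1r η w s, 0, C12r η w s, 0, 0, 0])
      (measurable_pi_lambda _ fun k => ?_)
    fin_cases k <;> first | exact measurable_C1r η w | exact measurable_C12r η w |
      exact measurable_const
  · simp only [protocol_rate2r]
    refine key (fun s => ![0, C2r η w s, C21r η w s, 0, 0, 0])
      (measurable_pi_lambda _ fun k => ?_)
    fin_cases k <;> first | exact measurable_C2r η w | exact measurable_C21r η w |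
      exact measurable_const
  · simp only [protocol_rater1]
    refine key (fun s => ![0, 0, 0, cap (powerrM4 w s * s.1), 0, Cr1 w s])
      (measurable_pi_lambda _ fun k => ?_)
    fin_cases k <;> first | exact measurable_capM4 w | exact measurable_Cr1 w |
      exact measurable_const
  · simp only [protocol_rater2]
    refine key (fun s => ![0, 0, 0, 0, cap (powerrM5 w s * s.2), Cr2 w s])
      (measurable_pi_lambda _ fun k => ?_)
    fin_cases k <;> first | exact measurable_capM5 w | exact measurable_Cr2 w |
      exact measurable_const
  · simp only [protocol_power₁]
    refine key (fun s => ![power1M1 η w s, 0, power1M3 η w s, 0, 0, 0])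
      (measurable_pi_lambda _ fun k => ?_)
    fin_cases k <;> first | exact measurable_power1M1 η w | exact measurable_power1M3 η w |
      exact measurable_const
  · simp only [protocol_power₂]
    refine key (fun s => ![0, power2M2 η w s, power2M3 η w s, 0, 0, 0])
      (measurable_pi_lambda _ fun k => ?_)
    fin_cases k <;> first | exact measurable_power2M2 η w | exact measurable_power2M3 η w |
      exact measurable_const
  · simp only [protocol_powerr]
    refine key (fun s => ![0, 0, 0, powerrM4 w s, powerrM5 w s, powerrM6 w s])
      (measurable_pi_lambda _ fun k => ?_)
    fin_cases k <;> first | exact measurable_powerrM4 w | exact measurable_powerrM5 w |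
      exact measurable_powerrM6 w | exact measurable_const

end Effects

/-! ### First-order conditions -/

/-- The first-order condition for maximizing `a log (u + p σ) + b log (v + p τ) - g p`. -/
lemma first_order {a b g u v σ τ p₀ : ℝ} (hp : 0 < p₀) (hu : 0 < u + p₀ * σ) (hv : 0 < v + p₀ * τ)
    (h : ∀ p, 0 ≤ p → a * Real.log (u + p * σ) + b * Real.log (v + p * τ) - g * p ≤
      a * Real.log (u + p₀ * σ) + b * Real.log (v + p₀ * τ) - g * p₀) :
    a * (σ / (u + p₀ * σ)) + b * (τ / (v + p₀ * τ)) = g := by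
  have hloc : IsLocalMax (fun p => a * Real.log (u + p * σ) + b * Real.log (v + p * τ) - g * p)
      p₀ := by
    filter_upwards [lt_mem_nhds hp] with p hp'
    exact h p hp'.le
  have d1 : HasDerivAt (fun p : ℝ => u + p * σ) σ p₀ := by
    simpa using ((hasDerivAt_id p₀).mul_const σ).const_add u
  have d2 : HasDerivAt (fun p : ℝ => v + p * τ) τ p₀ := by
    simpa using ((hasDerivAt_id p₀).mul_const τ).const_add v
  have d3 : HasDerivAt (fun p : ℝ => g * p) g p₀ := by
    simpa using (hasDerivAt_id p₀).const_mul g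
  have := hloc.hasDerivAt_eq_zero
    ((((d1.log hu.ne').const_mul a).add ((d2.log hv.ne').const_mul b)).sub d3)
  linarith

lemma cap_mul_log_two (x : ℝ) : cap x * Real.log 2 = Real.log (1 + x) := by
  rw [cap_eq, div_mul_cancel₀ _ log_two_pos.ne']

/-- The first-order condition for water filling. -/
lemma waterfilling_first_order {α γ σ p₀ : ℝ} (hσ : 0 < σ) (hp : 0 < p₀)
    (h : ∀ p, 0 ≤ p → α * cap (p * σ) - γ * p ≤ α * cap (p₀ * σ) - γ * p₀) :
    α * σ = γ * Real.log 2 * (1 + p₀ * σ) := by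
  have hl := log_two_pos
  have hpos : 0 < 1 + p₀ * σ := by positivity
  have := first_order (a := α) (b := 0) (g := γ * Real.log 2) (u := 1) (v := 1) (σ := σ) (τ := σ)
    hp hpos hpos fun p hp' => by
      have := mul_le_mul_of_nonneg_right (h p hp') hl.le
      simp only [← cap_mul_log_two]
      linarith
  rw [zero_mul, add_zero] at this
  field_simp at this
  linarith

/-- The first-order condition for the broadcast mode. -/
lemma broadcast_first_order {α β γ σ τ p₀ : ℝ} (hσ : 0 < σ) (hτ : 0 < τ) (hp : 0 < p₀)
    (h : ∀ p, 0 ≤ p → α * cap (p * σ) + β * cap (p * τ) - γ * p ≤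
      α * cap (p₀ * σ) + β * cap (p₀ * τ) - γ * p₀) :
    α * (σ / (1 + p₀ * σ)) + β * (τ / (1 + p₀ * τ)) = γ * Real.log 2 := by
  have hl := log_two_pos
  refine first_order hp (by positivity) (by positivity) fun p hp' => ?_
  have := mul_le_mul_of_nonneg_right (h p hp') hl.le
  simp only [← cap_mul_log_two]
  linarith

/-- The Lagrangian of the multiple-access mode in natural logarithms, user 1 being decoded
first. -/
noncomputable def macLagr (A B g σ τ p q : ℝ) : ℝ :=
  A * Real.log (1 + p * σ + q * τ) + (B - A) * Real.log (1 + q * τ) - g * (p + q)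

section Mac

variable {A B k₁ k₂ g : ℝ} {s : Gain} {p q r : ℝ}

lemma cap_div (hp : 0 ≤ p) (hq : 0 ≤ q) (h1 : 0 ≤ s.1) (h2 : 0 ≤ s.2) :
    cap (p * s.1 / (1 + q * s.2)) =
      (Real.log (1 + p * s.1 + q * s.2) - Real.log (1 + q * s.2)) / Real.log 2 := by
  rw [cap_eq, ← Real.log_div (by positivity) (by positivity)]
  congr 2
  field_simp
  ring

lemma macLagr_zero (hp : 0 ≤ p) (hq : 0 ≤ q) (h1 : 0 ≤ s.1) (h2 : 0 ≤ s.2) :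
    A * macRate₁ 0 p q s + B * macRate₂ 0 p q s - g * (p + q) =
      macLagr A B (g * Real.log 2) s.1 s.2 p q / Real.log 2 := by
  have hl := log_two_pos
  simp only [macRate₁, macRate₂, macLagr, cap_div hp hq h1 h2, cap_eq]
  field_simp
  ring

lemma macLagr_one (hp : 0 ≤ p) (hq : 0 ≤ q) (h1 : 0 ≤ s.1) (h2 : 0 ≤ s.2) :
    A * macRate₁ 1 p q s + B * macRate₂ 1 p q s - g * (p + q) =
      macLagr B A (g * Real.log 2) s.2 s.1 q p / Real.log 2 := by
  have hl := log_two_pos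
  have := cap_div (s := (s.2, s.1)) hq hp h2 h1
  simp only at this
  simp only [macRate₁, macRate₂, macLagr, this, cap_eq]
  field_simp
  ring

/-- First-order conditions at an interior maximum of the multiple-access mode. -/
lemma macLagr_first_order {σ τ p₀ q₀ : ℝ} (hσ : 0 < σ) (hτ : 0 < τ) (hp : 0 < p₀) (hq : 0 < q₀)
    (h : ∀ p q, 0 ≤ p → 0 ≤ q → macLagr A B g σ τ p q ≤ macLagr A B g σ τ p₀ q₀) :
    A * σ = g * (1 + p₀ * σ + q₀ * τ) ∧ (B - A) * τ * σ = g * (σ - τ) * (1 + q₀ * τ) := by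
  have hx : 0 < 1 + p₀ * σ + q₀ * τ := by positivity
  have hy : 0 < 1 + q₀ * τ := by positivity
  have e1 := first_order (a := A) (b := 0) (g := g) (u := 1 + q₀ * τ) (v := 1) (σ := σ) (τ := 0)
    hp (by positivity) (by positivity) fun p hp' => by
      have := h p q₀ hp' hq.le
      simp only [macLagr] at this
      rw [show 1 + q₀ * τ + p * σ = 1 + p * σ + q₀ * τ by ring,
        show 1 + q₀ * τ + p₀ * σ = 1 + p₀ * σ + q₀ * τ by ring]
      linarith
  have e2 := first_order (a := A) (b := B - A) (g := g) (u := 1 + p₀ * σ) (v := 1) (σ := τ)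
    (τ := τ) hq (by positivity) (by positivity) fun q hq' => by
      have := h p₀ q hp.le hq'
      simp only [macLagr] at this
      linarith
  rw [show 1 + q₀ * τ + p₀ * σ = 1 + p₀ * σ + q₀ * τ by ring, zero_mul, add_zero] at e1
  have e1' : A * σ = g * (1 + p₀ * σ + q₀ * τ) := by
    field_simp at e1
    linarith
  refine ⟨e1', ?_⟩
  have e3 : A * (τ / (1 + p₀ * σ + q₀ * τ)) * σ = g * τ := by
    have : A * (τ / (1 + p₀ * σ + q₀ * τ)) * σ = A * (σ / (1 + p₀ * σ + q₀ * τ)) * τ := by ring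
    rw [this, e1]
  have e4 : (B - A) * (τ / (1 + q₀ * τ)) * σ = g * (σ - τ) := by
    have : (A * (τ / (1 + p₀ * σ + q₀ * τ)) + (B - A) * (τ / (1 + q₀ * τ))) * σ = g * σ := by
      rw [e2]
    linarith
  field_simp at e4
  linarith

end Mac

/-! ### Optimal powers of the single modes -/

lemma log_le_log_add {x y : ℝ} (hx : 0 < x) (hy : 0 < y) :
    Real.log x ≤ Real.log y + (x - y) / y := by
  have := Real.log_le_sub_one_of_pos (div_pos hx hy)
  rw [Real.log_div hx.ne' hy.ne'] at this
  have e : x / y - 1 = (x - y) / y := by field_simp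
  linarith

lemma waterfilling_log_lt {α G σ p : ℝ} (hG : 0 < G) (hσ : 0 < σ) (hp : 0 ≤ p)
    (hne : p ≠ max (α / G - 1 / σ) 0) :
    α * Real.log (1 + p * σ) - G * p <
      α * Real.log (1 + max (α / G - 1 / σ) 0 * σ) - G * max (α / G - 1 / σ) 0 := by
  rcases lt_or_ge G (α * σ) with h | h
  · have hraw : 0 < α / G - 1 / σ := by
      rw [sub_pos, div_lt_div_iff₀ hσ hG]; linarith
    rw [max_eq_left hraw.le] at hne ⊢
    set P := α / G - 1 / σ with hP
    have hα : 0 < α := by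
      by_contra! hα
      nlinarith
    have hY : 1 + P * σ = α * σ / G := by rw [hP]; field_simp; ring
    have hYpos : 0 < 1 + P * σ := by positivity
    have hX : 0 < 1 + p * σ := by positivity
    have hlt := Real.log_lt_sub_one_of_pos (div_pos hX hYpos) (by
      intro h1
      rw [div_eq_one_iff_eq hYpos.ne'] at h1
      exact hne (mul_right_cancel₀ hσ.ne' (by linarith)))
    rw [Real.log_div hX.ne' hYpos.ne'] at hlt
    have h2 := mul_lt_mul_of_pos_left hlt hα
    have h3 : α * ((1 + p * σ) / (1 + P * σ) - 1) = G * (p - P) := by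
      rw [hY]
      have : P = α / G - 1 / σ := hP
      rw [this]
      field_simp
      ring
    linarith
  · have hraw : α / G - 1 / σ ≤ 0 := by
      rw [sub_nonpos, div_le_div_iff₀ hG hσ]; linarith
    rw [max_eq_right hraw] at hne ⊢
    have hp' : 0 < p := lt_of_le_of_ne hp (Ne.symm hne)
    simp only [zero_mul, add_zero, Real.log_one, mul_zero, sub_zero, sub_neg]
    rcases le_or_gt α 0 with hα | hα
    · have : 0 ≤ Real.log (1 + p * σ) := Real.log_nonneg (by nlinarith [mul_pos hp' hσ])
      nlinarith [mul_pos hG hp']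
    · have h1 := Real.log_lt_sub_one_of_pos (show 0 < 1 + p * σ by positivity)
        (by nlinarith [mul_pos hp' hσ])
      nlinarith

lemma waterfilling_lt {α γ σ p : ℝ} (hγ : 0 < γ) (hσ : 0 < σ) (hp : 0 ≤ p)
    (hne : p ≠ max (α / (γ * Real.log 2) - 1 / σ) 0) :
    α * cap (p * σ) - γ * p <
      α * cap (max (α / (γ * Real.log 2) - 1 / σ) 0 * σ) -
        γ * max (α / (γ * Real.log 2) - 1 / σ) 0 := by
  have hl := log_two_pos
  have := waterfilling_log_lt (mul_pos hγ hl) hσ hp hne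
  simp only [← cap_mul_log_two] at this
  refine lt_of_mul_lt_mul_right ?_ hl.le
  linarith

lemma waterfilling_le {α γ σ p : ℝ} (hγ : 0 < γ) (hσ : 0 < σ) (hp : 0 ≤ p) :
    α * cap (p * σ) - γ * p ≤
      α * cap (max (α / (γ * Real.log 2) - 1 / σ) 0 * σ) -
        γ * max (α / (γ * Real.log 2) - 1 / σ) 0 := by
  by_cases hne : p = max (α / (γ * Real.log 2) - 1 / σ) 0
  · rw [← hne]
  · exact (waterfilling_lt hγ hσ hp hne).le

section Broadcast

variable {w : Weights} {s : Gain}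

lemma powerrM6_root (hγ : w.γ ≠ 0) (h1 : 0 < s.1) (h2 : 0 < s.2)
    (hd : 0 ≤ (w.γ * Real.log 2 * (s.1 + s.2) - (w.μ₁ + w.μ₂) * (s.1 * s.2)) ^ 2 -
      4 * (w.γ * Real.log 2 * (s.1 * s.2)) * (w.γ * Real.log 2 - w.μ₁ * s.2 - w.μ₂ * s.1))
    (hp : 0 < powerrM6 w s) :
    w.μ₁ * s.2 * (1 + powerrM6 w s * s.1) + w.μ₂ * s.1 * (1 + powerrM6 w s * s.2) =
      w.γ * Real.log 2 * (1 + powerrM6 w s * s.1) * (1 + powerrM6 w s * s.2) := by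
  have hl := log_two_pos
  unfold powerrM6 at hp ⊢
  dsimp only at hp ⊢
  set a := w.γ * Real.log 2 * (s.1 * s.2) with ha
  set b := w.γ * Real.log 2 * (s.1 + s.2) - (w.μ₁ + w.μ₂) * (s.1 * s.2) with hb
  set c := w.γ * Real.log 2 - w.μ₁ * s.2 - w.μ₂ * s.1 with hc
  have ha0 : a ≠ 0 := by positivity
  rw [lt_max_iff] at hp
  have hp := hp.resolve_right (lt_irrefl 0)
  rw [max_eq_left hp.le]
  set p := (-b + Real.sqrt (b ^ 2 - 4 * a * c)) / (2 * a) with hpdef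
  have h3 : 2 * a * p + b = Real.sqrt (b ^ 2 - 4 * a * c) := by
    rw [hpdef]; field_simp; ring
  have h4 : (2 * a * p + b) ^ 2 = b ^ 2 - 4 * a * c := by rw [h3, Real.sq_sqrt hd]
  have h5 : 4 * a * (a * p ^ 2 + b * p + c) = 0 := by linarith
  have h6 : a * p ^ 2 + b * p + c = 0 := by
    rcases mul_eq_zero.1 h5 with h | h
    · exact absurd h (by positivity)
    · exact h
  rw [ha, hb, hc] at h6
  linarith

lemma powerrM6_disc (hm : 0 ≤ w.μ₁ * w.μ₂) :
    0 ≤ (w.γ * Real.log 2 * (s.1 + s.2) - (w.μ₁ + w.μ₂) * (s.1 * s.2)) ^ 2 -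
      4 * (w.γ * Real.log 2 * (s.1 * s.2)) * (w.γ * Real.log 2 - w.μ₁ * s.2 - w.μ₂ * s.1) := by
  have : (w.γ * Real.log 2 * (s.1 + s.2) - (w.μ₁ + w.μ₂) * (s.1 * s.2)) ^ 2 -
      4 * (w.γ * Real.log 2 * (s.1 * s.2)) * (w.γ * Real.log 2 - w.μ₁ * s.2 - w.μ₂ * s.1) =
      (w.γ * Real.log 2 * (s.2 - s.1) + (w.μ₁ - w.μ₂) * (s.1 * s.2)) ^ 2 +
        4 * (w.μ₁ * w.μ₂) * (s.1 * s.2) ^ 2 := by ring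
  rw [this]
  positivity

lemma powerrM6_eq_zero (hγ : 0 < w.γ) (h1 : 0 < s.1) (h2 : 0 < s.2) (hm : 0 ≤ w.μ₁ * w.μ₂)
    (hp : powerrM6 w s = 0) : w.μ₁ * s.2 + w.μ₂ * s.1 ≤ w.γ * Real.log 2 := by
  have hl := log_two_pos
  have hd := powerrM6_disc (w := w) (s := s) hm
  unfold powerrM6 at hp
  dsimp only at hp
  set a := w.γ * Real.log 2 * (s.1 * s.2) with ha
  set b := w.γ * Real.log 2 * (s.1 + s.2) - (w.μ₁ + w.μ₂) * (s.1 * s.2) with hb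
  set c := w.γ * Real.log 2 - w.μ₁ * s.2 - w.μ₂ * s.1 with hc
  have ha0 : 0 < a := by positivity
  have h3 := max_eq_right_iff.1 hp
  rw [div_le_iff₀ (by positivity), zero_mul] at h3
  have h4 : Real.sqrt (b ^ 2 - 4 * a * c) ≤ b := by linarith
  have h5 := (Real.sqrt_le_left (le_trans (Real.sqrt_nonneg _) h4)).1 h4
  have h6 : 0 ≤ 4 * a * c := by linarith
  have h7 : 0 ≤ c := by
    by_contra! hneg
    nlinarith
  linarith

/-- The power of mode `M₆` is optimal. -/
lemma broadcast_le (hγ : 0 < w.γ) (hm₁ : 0 ≤ w.μ₁) (hm₂ : 0 ≤ w.μ₂) (h1 : 0 < s.1) (h2 : 0 < s.2)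
    {p : ℝ} (hp : 0 ≤ p) :
    w.μ₁ * cap (p * s.2) + w.μ₂ * cap (p * s.1) - w.γ * p ≤
      w.μ₁ * Cr2 w s + w.μ₂ * Cr1 w s - w.γ * powerrM6 w s := by
  have hl := log_two_pos
  have hm := mul_nonneg hm₁ hm₂
  have hP := powerrM6_nonneg w s
  unfold Cr1 Cr2
  set P := powerrM6 w s with hPdef
  refine le_of_mul_le_mul_right ?_ hl
  have e : ∀ q, (w.μ₁ * cap (q * s.2) + w.μ₂ * cap (q * s.1) - w.γ * q) * Real.log 2 =
      w.μ₁ * Real.log (1 + q * s.2) + w.μ₂ * Real.log (1 + q * s.1) - w.γ * Real.log 2 * q := by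
    intro q; rw [← cap_mul_log_two, ← cap_mul_log_two]; ring
  rw [e, e]
  have t2 := mul_le_mul_of_nonneg_left (log_le_log_add (show 0 < 1 + p * s.2 by positivity)
    (show 0 < 1 + P * s.2 by positivity)) hm₁
  have t1 := mul_le_mul_of_nonneg_left (log_le_log_add (show 0 < 1 + p * s.1 by positivity)
    (show 0 < 1 + P * s.1 by positivity)) hm₂
  have key : w.μ₁ * ((1 + p * s.2 - (1 + P * s.2)) / (1 + P * s.2)) +
      w.μ₂ * ((1 + p * s.1 - (1 + P * s.1)) / (1 + P * s.1)) ≤ w.γ * Real.log 2 * (p - P) := by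
    rcases hP.eq_or_lt with h0 | h0
    · rw [← h0]
      have := powerrM6_eq_zero hγ h1 h2 hm (hPdef ▸ h0.symm)
      simp only [zero_mul, add_zero, div_one, sub_zero]
      nlinarith
    · have hr := powerrM6_root hγ.ne' h1 h2 (powerrM6_disc hm) h0
      rw [← hPdef] at hr
      have hr2 : w.μ₁ * (s.2 / (1 + P * s.2)) + w.μ₂ * (s.1 / (1 + P * s.1)) =
          w.γ * Real.log 2 := by
        field_simp
        linarith
      rw [← hr2]
      apply le_of_eq
      field_simp
      ring
  linarith

end Broadcast

section Mac

variable {A B G σ τ : ℝ}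

/-- Sufficiency of the Karush–Kuhn–Tucker conditions in the multiple-access mode. -/
lemma macLagr_le_of_kkt (hA : 0 ≤ A) (hAB : A ≤ B) (hσ : 0 < σ) (hτ : 0 < τ) {p q P Q : ℝ}
    (hp : 0 ≤ p) (hq : 0 ≤ q) (hP : 0 ≤ P) (hQ : 0 ≤ Q) {d₁ d₂ : ℝ}
    (hd₁ : d₁ = A * (σ / (1 + P * σ + Q * τ)) - G)
    (hd₂ : d₂ = A * (τ / (1 + P * σ + Q * τ)) + (B - A) * (τ / (1 + Q * τ)) - G)
    (h₁ : d₁ ≤ 0) (h₂ : d₂ ≤ 0) (c₁ : P * d₁ = 0) (c₂ : Q * d₂ = 0) :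
    macLagr A B G σ τ p q ≤ macLagr A B G σ τ P Q := by
  have hx : 0 < 1 + P * σ + Q * τ := by positivity
  have hy : 0 < 1 + Q * τ := by positivity
  have t1 := mul_le_mul_of_nonneg_left
    (log_le_log_add (show 0 < 1 + p * σ + q * τ by positivity) hx) hA
  have t2 := mul_le_mul_of_nonneg_left
    (log_le_log_add (show 0 < 1 + q * τ by positivity) hy) (sub_nonneg.2 hAB)
  have key : A * ((1 + p * σ + q * τ - (1 + P * σ + Q * τ)) / (1 + P * σ + Q * τ)) +
      (B - A) * ((1 + q * τ - (1 + Q * τ)) / (1 + Q * τ)) =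
      d₁ * (p - P) + d₂ * (q - Q) + G * (p + q - P - Q) := by
    rw [hd₁, hd₂]
    field_simp
    ring
  have n1 : d₁ * p ≤ 0 := mul_nonpos_of_nonpos_of_nonneg h₁ hp
  have n2 : d₂ * q ≤ 0 := mul_nonpos_of_nonpos_of_nonneg h₂ hq
  unfold macLagr
  linarith

/-- The interior stationary point of the multiple-access mode. -/
lemma mac_stationary (hG : G ≠ 0) (hσ : 0 < σ) (hτ : 0 < τ) (hne : σ ≠ τ) {p q : ℝ}
    (hp : p = A / G - (B - A) / G * (1 / (σ / τ - 1)))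
    (hq : q = (B - A) / G * (1 / (1 - τ / σ)) - 1 / τ) :
    A * σ = G * (1 + p * σ + q * τ) ∧ (B - A) * τ * σ = G * (σ - τ) * (1 + q * τ) := by
  have h1 : σ - τ ≠ 0 := sub_ne_zero.2 hne
  have e1 : 1 / (σ / τ - 1) = τ / (σ - τ) := by
    rw [show σ / τ - 1 = (σ - τ) / τ by field_simp, one_div_div]
  have e2 : 1 / (1 - τ / σ) = σ / (σ - τ) := by
    rw [show 1 - τ / σ = (σ - τ) / σ by field_simp, one_div_div]
  rw [e1] at hp
  rw [e2] at hq
  subst hp hq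
  constructor <;> field_simp <;> ring

/-- The maximum of the multiple-access mode is attained at the stationary point or with a single
active user. -/
lemma macLagr_le (hA : 0 < A) (hAB : A ≤ B) (hG : 0 < G) (hσ : 0 < σ) (hτ : 0 < τ) (hne : σ ≠ τ)
    {p q C : ℝ} (hp : 0 ≤ p) (hq : 0 ≤ q)
    (h₁ : A * Real.log (1 + max (A / G - 1 / σ) 0 * σ) - G * max (A / G - 1 / σ) 0 ≤ C)
    (h₂ : B * Real.log (1 + max (B / G - 1 / τ) 0 * τ) - G * max (B / G - 1 / τ) 0 ≤ C)
    (h₃ : macLagr A B G σ τ (max (A / G - (B - A) / G * (1 / (σ / τ - 1))) 0)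
      (max ((B - A) / G * (1 / (1 - τ / σ)) - 1 / τ) 0) ≤ C) :
    macLagr A B G σ τ p q ≤ C := by
  have hB : 0 < B := hA.trans_le hAB
  have hsing : ∀ {α ρ : ℝ}, 0 < α → 0 < ρ → ∀ P, P = max (α / G - 1 / ρ) 0 →
      (P = 0 ∧ α * ρ ≤ G) ∨ (0 < P ∧ 1 + P * ρ = α * ρ / G) := by
    intro α ρ hα hρ P hP
    rcases le_or_gt (α / G - 1 / ρ) 0 with h | h
    · left
      refine ⟨by rw [hP, max_eq_right h], ?_⟩
      rw [sub_nonpos, div_le_div_iff₀ hG hρ] at h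
      linarith
    · right
      rw [max_eq_left h.le] at hP
      refine ⟨hP ▸ h, ?_⟩
      rw [hP]; field_simp; ring
  rcases le_or_gt (A * σ) (B * τ) with hc | hc
  · set Q := max (B / G - 1 / τ) 0 with hQ
    have hval : macLagr A B G σ τ 0 Q = B * Real.log (1 + Q * τ) - G * Q := by
      simp only [macLagr, zero_mul, add_zero, zero_add]; ring
    refine le_trans (macLagr_le_of_kkt hA.le hAB hσ hτ hp hq le_rfl (show 0 ≤ Q from le_max_right _ _)
      rfl rfl ?_ ?_ (zero_mul _) ?_) (hval.trans_le h₂)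
    · rcases hsing hB hτ Q hQ with ⟨h0, hle⟩ | ⟨h0, heq⟩
      · rw [h0]; simp; linarith
      · simp only [zero_mul, add_zero]
        rw [heq, sub_nonpos]
        have : A * (σ / (B * τ / G)) = A * σ / (B * τ) * G := by field_simp
        rw [this]
        have h5 : A * σ / (B * τ) ≤ 1 := (div_le_one (by positivity)).2 hc
        nlinarith
    · rcases hsing hB hτ Q hQ with ⟨h0, hle⟩ | ⟨h0, heq⟩
      · rw [h0]; simp; linarith
      · simp only [zero_mul, add_zero]
        rw [heq]
        apply le_of_eq
        field_simp
        ring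
    · rcases hsing hB hτ Q hQ with ⟨h0, hle⟩ | ⟨h0, heq⟩
      · rw [h0]; simp
      · simp only [zero_mul, add_zero]
        rw [heq]
        field_simp
        ring
  · have hστ : τ < σ := by
      by_contra! h
      nlinarith
    have hd : 0 < σ - τ := sub_pos.2 hστ
    have e1 : 1 / (σ / τ - 1) = τ / (σ - τ) := by
      rw [show σ / τ - 1 = (σ - τ) / τ by field_simp, one_div_div]
    have e2 : 1 / (1 - τ / σ) = σ / (σ - τ) := by
      rw [show 1 - τ / σ = (σ - τ) / σ by field_simp, one_div_div]
    rcases le_or_gt ((B - A) / G * (1 / (1 - τ / σ)) - 1 / τ) 0 with hq0 | hq0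
    · rw [e2, div_mul_div_comm, sub_nonpos, div_le_div_iff₀ (by positivity) hτ] at hq0
      set P := max (A / G - 1 / σ) 0 with hP
      have hval : macLagr A B G σ τ P 0 = A * Real.log (1 + P * σ) - G * P := by
        simp [macLagr]
      refine le_trans (macLagr_le_of_kkt hA.le hAB hσ hτ hp hq (show 0 ≤ P from le_max_right _ _) le_rfl
        rfl rfl ?_ ?_ ?_ (zero_mul _)) (hval.trans_le h₁)
      · rcases hsing hA hσ P hP with ⟨h0, hle⟩ | ⟨h0, heq⟩
        · rw [h0]; simp; linarith
        · simp only [zero_mul, add_zero]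
          rw [heq]
          apply le_of_eq
          field_simp
          ring
      · rcases hsing hA hσ P hP with ⟨h0, hle⟩ | ⟨h0, heq⟩
        · rw [h0]; simp; nlinarith
        · simp only [zero_mul, add_zero, div_one]
          rw [heq]
          have : A * (τ / (A * σ / G)) = G * τ / σ := by field_simp
          rw [this]
          have h5 : (B - A) * τ ≤ G * (σ - τ) / σ := by
            rw [le_div_iff₀ hσ]; linarith
          have h6 : G * (σ - τ) / σ = G - G * τ / σ := by field_simp
          linarith
      · rcases hsing hA hσ P hP with ⟨h0, hle⟩ | ⟨h0, heq⟩
        · rw [h0]; simp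
        · simp only [zero_mul, add_zero]
          rw [heq]
          field_simp
          ring
    · have hp0 : 0 < A / G - (B - A) / G * (1 / (σ / τ - 1)) := by
        rw [e1, div_mul_div_comm, sub_pos, div_lt_div_iff₀ (by positivity) hG]
        nlinarith
      rw [max_eq_left hp0.le, max_eq_left hq0.le] at h₃
      set P := A / G - (B - A) / G * (1 / (σ / τ - 1)) with hP
      set Q := (B - A) / G * (1 / (1 - τ / σ)) - 1 / τ with hQ
      obtain ⟨f1, f2⟩ := mac_stationary hG.ne' hσ hτ hne hP hQ
      have hx : 0 < 1 + P * σ + Q * τ := by positivity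
      have hy : 0 < 1 + Q * τ := by positivity
      have g1 : A * (σ / (1 + P * σ + Q * τ)) - G = 0 := by
        rw [← mul_div_assoc, f1]; field_simp; ring
      have g2 : A * (τ / (1 + P * σ + Q * τ)) + (B - A) * (τ / (1 + Q * τ)) - G = 0 := by
        have a1 : A * (τ / (1 + P * σ + Q * τ)) = G * τ / σ := by
          rw [eq_div_iff hσ.ne']
          calc A * (τ / (1 + P * σ + Q * τ)) * σ = (A * σ) * τ / (1 + P * σ + Q * τ) := by ring
            _ = G * τ := by rw [f1]; field_simp
        have a2 : (B - A) * (τ / (1 + Q * τ)) = G * (σ - τ) / σ := by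
          rw [eq_div_iff hσ.ne']
          calc (B - A) * (τ / (1 + Q * τ)) * σ = ((B - A) * τ * σ) / (1 + Q * τ) := by ring
            _ = G * (σ - τ) := by rw [f2]; field_simp
        rw [a1, a2]
        field_simp
        ring
      exact le_trans (macLagr_le_of_kkt hA.le hAB hσ hτ hp hq hp0.le hq0.le rfl rfl g1.le g2.le
        (by rw [g1, mul_zero]) (by rw [g2, mul_zero])) h₃

/-- The user with the larger weight should be decoded last. -/
lemma macLagr_swap_le (hAB : A ≤ B) (hσ : 0 < σ) (hτ : 0 < τ) {p q : ℝ} (hp : 0 ≤ p)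
    (hq : 0 ≤ q) : macLagr B A G τ σ q p ≤ macLagr A B G σ τ p q := by
  have h1 : Real.log (1 + p * σ + q * τ) ≤ Real.log (1 + p * σ) + Real.log (1 + q * τ) := by
    rw [← Real.log_mul (by positivity) (by positivity)]
    refine Real.log_le_log (by positivity) ?_
    nlinarith [mul_nonneg (mul_nonneg hp hσ.le) (mul_nonneg hq hτ.le)]
  unfold macLagr
  rw [show 1 + q * τ + p * σ = 1 + p * σ + q * τ by ring]
  nlinarith [mul_nonneg (sub_nonneg.2 hAB) (sub_nonneg.2 h1)]

end Mac

/-! ### The protocol maximizes the Lagrangian -/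

section Box

variable {η : ℝ} {w : Weights} {s : Gain}

lemma powerrM6_eq_powerrM4 (hw : InBox η w) (h1 : 0 < s.1) (h2 : 0 < s.2) (h : w.μ₁ = 0) :
    powerrM6 w s = powerrM4 w s := by
  by_contra hne
  have e1 := waterfilling_lt (α := w.μ₂) hw.2.2 h1 (powerrM6_nonneg w s) hne
  have e2 := broadcast_le hw.2.2 hw.1.1 hw.2.1.1 h1 h2 (powerrM4_nonneg w s)
  unfold Cr1 Cr2 at e2
  rw [h] at e2
  unfold powerrM4 at e2
  linarith

lemma powerrM6_eq_powerrM5 (hw : InBox η w) (h1 : 0 < s.1) (h2 : 0 < s.2) (h : w.μ₂ = 0) :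
    powerrM6 w s = powerrM5 w s := by
  by_contra hne
  have e1 := waterfilling_lt (α := w.μ₁) hw.2.2 h2 (powerrM6_nonneg w s) hne
  have e2 := broadcast_le hw.2.2 hw.1.1 hw.2.1.1 h1 h2 (powerrM5_nonneg w s)
  unfold Cr1 Cr2 at e2
  rw [h] at e2
  unfold powerrM5 at e2
  linarith

lemma metric_three_eq (hw : InBox η w) (h1 : 0 < s.1) (h2 : 0 < s.2) (h : w.μ₁ = 0) :
    metric η w s 3 = metric η w s 5 := by
  simp [metric, Cr1, Cr2, powerrM6_eq_powerrM4 hw h1 h2 h, h]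

lemma metric_four_eq (hw : InBox η w) (h1 : 0 < s.1) (h2 : 0 < s.2) (h : w.μ₂ = 0) :
    metric η w s 4 = metric η w s 5 := by
  simp [metric, Cr1, Cr2, powerrM6_eq_powerrM5 hw h1 h2 h, h]

lemma power1M1_eq_powerrM4 (h : w.μ₁ = 0) (h' : w.μ₂ = η) : power1M1 η w s = powerrM4 w s := by
  simp [power1M1, powerrM4, h, h']

lemma power2M2_eq_powerrM5 (h : w.μ₂ = 0) (h' : w.μ₁ = 1 - η) :
    power2M2 η w s = powerrM5 w s := by
  simp [power2M2, powerrM5, h, h']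

lemma metric_zero_eq (h : w.μ₁ = 0) (h' : w.μ₂ = η) : metric η w s 0 = metric η w s 3 := by
  simp [metric, C1r, power1M1_eq_powerrM4 h h', h, h']

lemma metric_one_eq (h : w.μ₂ = 0) (h' : w.μ₁ = 1 - η) : metric η w s 1 = metric η w s 4 := by
  simp [metric, C2r, power2M2_eq_powerrM5 h h', h, h']

lemma metric_two_eq_mac (h1 : 0 < s.1) (h2 : 0 < s.2) (h : η - w.μ₁ ≤ 1 - η - w.μ₂) :
    metric η w s 2 * Real.log 2 =
      macLagr (η - w.μ₁) (1 - η - w.μ₂) (w.γ * Real.log 2) s.1 s.2 (power1M3 η w s)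
        (power2M3 η w s) := by
  have := macLagr_zero (A := η - w.μ₁) (B := 1 - η - w.μ₂) (g := w.γ) (power1M3_nonneg η w s)
    (power2M3_nonneg η w s) h1.le h2.le
  rw [eq_div_iff log_two_pos.ne'] at this
  rw [← this]
  simp [metric, C12r, C21r, decOrder, h]

lemma metric_two_eq_mac' (h1 : 0 < s.1) (h2 : 0 < s.2) (h : ¬η - w.μ₁ ≤ 1 - η - w.μ₂) :
    metric η w s 2 * Real.log 2 =
      macLagr (1 - η - w.μ₂) (η - w.μ₁) (w.γ * Real.log 2) s.2 s.1 (power2M3 η w s)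
        (power1M3 η w s) := by
  have := macLagr_one (A := η - w.μ₁) (B := 1 - η - w.μ₂) (g := w.γ) (power1M3_nonneg η w s)
    (power2M3_nonneg η w s) h1.le h2.le
  rw [eq_div_iff log_two_pos.ne'] at this
  rw [← this]
  simp [metric, C12r, C21r, decOrder, h]

lemma power1M3_of_le (h : η - w.μ₁ ≤ 1 - η - w.μ₂) : power1M3 η w s =
    max ((η - w.μ₁) / (w.γ * Real.log 2) -
      ((1 - η - w.μ₂) - (η - w.μ₁)) / (w.γ * Real.log 2) * (1 / (s.1 / s.2 - 1))) 0 := by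
  rw [power1M3, if_pos h]; ring_nf

lemma power2M3_of_le (h : η - w.μ₁ ≤ 1 - η - w.μ₂) : power2M3 η w s =
    max (((1 - η - w.μ₂) - (η - w.μ₁)) / (w.γ * Real.log 2) * (1 / (1 - s.2 / s.1)) -
      1 / s.2) 0 := by
  rw [power2M3, if_pos h]; ring_nf

lemma power1M3_of_not_le (h : ¬η - w.μ₁ ≤ 1 - η - w.μ₂) :
    power1M3 η w s =
    max (((η - w.μ₁) - (1 - η - w.μ₂)) / (w.γ * Real.log 2) * (1 / (1 - s.1 / s.2)) -
      1 / s.1) 0 := by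
  rw [power1M3, if_neg h]
  have : 1 / (1 - s.1 / s.2) = -(1 / (s.1 / s.2 - 1)) := by
    rw [← neg_sub, one_div, inv_neg, one_div]
  rw [this]
  ring_nf

lemma power2M3_of_not_le (h : ¬η - w.μ₁ ≤ 1 - η - w.μ₂) :
    power2M3 η w s =
    max ((1 - η - w.μ₂) / (w.γ * Real.log 2) -
      ((η - w.μ₁) - (1 - η - w.μ₂)) / (w.γ * Real.log 2) * (1 / (s.2 / s.1 - 1))) 0 := by
  rw [power2M3, if_neg h]
  have : 1 / (1 - s.2 / s.1) = -(1 / (s.2 / s.1 - 1)) := by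
    rw [← neg_sub, one_div, inv_neg, one_div]
  rw [this]
  ring_nf

lemma mac_le (hw : InBox η w) (h1 : 0 < s.1) (h2 : 0 < s.2) (hne : s.1 ≠ s.2) {C : ℝ}
    (m0 : metric η w s 0 ≤ C) (m1 : metric η w s 1 ≤ C) (m2 : metric η w s 2 ≤ C)
    {t p q : ℝ} (ht : t = 0 ∨ t = 1) (hp : 0 ≤ p) (hq : 0 ≤ q) :
    (η - w.μ₁) * macRate₁ t p q s + (1 - η - w.μ₂) * macRate₂ t p q s - w.γ * (p + q) ≤ C := by
  have hl := log_two_pos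
  have hA : 0 < η - w.μ₁ := sub_pos.2 hw.1.2
  have hB : 0 < 1 - η - w.μ₂ := sub_pos.2 hw.2.1.2
  have hG : 0 < w.γ * Real.log 2 := mul_pos hw.2.2 hl
  have g0 := mul_le_mul_of_nonneg_right m0 hl.le
  have g1 := mul_le_mul_of_nonneg_right m1 hl.le
  have g2 := mul_le_mul_of_nonneg_right m2 hl.le
  have k0 : (η - w.μ₁) * Real.log (1 + max ((η - w.μ₁) / (w.γ * Real.log 2) - 1 / s.1) 0 * s.1) -
      w.γ * Real.log 2 * max ((η - w.μ₁) / (w.γ * Real.log 2) - 1 / s.1) 0 ≤ C * Real.log 2 := by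
    refine le_trans (le_of_eq ?_) g0
    rw [← cap_mul_log_two]
    simp only [metric, Matrix.cons_val, C1r, power1M1]
    ring
  have k1 : (1 - η - w.μ₂) *
      Real.log (1 + max ((1 - η - w.μ₂) / (w.γ * Real.log 2) - 1 / s.2) 0 * s.2) -
      w.γ * Real.log 2 * max ((1 - η - w.μ₂) / (w.γ * Real.log 2) - 1 / s.2) 0 ≤
        C * Real.log 2 := by
    refine le_trans (le_of_eq ?_) g1
    rw [← cap_mul_log_two]
    simp only [metric, Matrix.cons_val, C2r, power2M2]
    ring
  by_cases h : η - w.μ₁ ≤ 1 - η - w.μ₂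
  · rw [metric_two_eq_mac h1 h2 h, power1M3_of_le h, power2M3_of_le h] at g2
    have key := macLagr_le hA h hG h1 h2 hne hp hq k0 k1 g2
    rcases ht with rfl | rfl
    · rw [macLagr_zero hp hq h1.le h2.le, div_le_iff₀ hl]
      exact key
    · rw [macLagr_one hp hq h1.le h2.le, div_le_iff₀ hl]
      exact (macLagr_swap_le h h1 h2 hp hq).trans key
  · rw [metric_two_eq_mac' h1 h2 h, power1M3_of_not_le h, power2M3_of_not_le h] at g2
    have h' := (not_le.1 h).le
    have key := macLagr_le hB h' hG h2 h1 hne.symm hq hp k1 k0 g2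
    rcases ht with rfl | rfl
    · rw [macLagr_zero hp hq h1.le h2.le, div_le_iff₀ hl]
      exact (macLagr_swap_le h' h2 h1 hq hp).trans key
    · rw [macLagr_one hp hq h1.le h2.le, div_le_iff₀ hl]
      exact key

/-- In the box, the metrics of the modes `M₁, M₂, M₃, M₆` bound the Lagrangian. -/
theorem lagr_le_of_metric_le (hw : InBox η w) (h1 : 0 < s.1) (h2 : 0 < s.2) (hne : s.1 ≠ s.2)
    {C : ℝ} (m0 : metric η w s 0 ≤ C) (m1 : metric η w s 1 ≤ C) (m2 : metric η w s 2 ≤ C)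
    (m5 : metric η w s 5 ≤ C) {b : Action} (hb : b.Admissible) : w.lagr η s b ≤ C := by
  refine lagrangian_le_of_modeLagr_le (fun k t p q r ht hp hq hr => ?_) hb
  have b5 := (broadcast_le hw.2.2 hw.1.1 hw.2.1.1 h1 h2 hr).trans m5
  have n1 := mul_nonneg hw.1.1 (cap_nonneg (mul_nonneg hr h2.le))
  have n2 := mul_nonneg hw.2.1.1 (cap_nonneg (mul_nonneg hr h1.le))
  fin_cases k
  · exact (waterfilling_le hw.2.2 h1 hp).trans m0
  · exact (waterfilling_le hw.2.2 h2 hq).trans m1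
  · exact mac_le hw h1 h2 hne m0 m1 m2 ht hp hq
  · simp [modeLagr]; linarith
  · simp [modeLagr]; linarith
  · simp [modeLagr]; linarith

end Box

section Candidates

variable (η : ℝ) (w : Weights) (c : Coins) (s : Gain) {sel : Finset (Fin 6) → (Fin 6 → ℝ) → Fin 6}

lemma two_mem_candidates : 2 ∈ candidates w c := by
  simp only [candidates, Finset.mem_filter, Finset.mem_univ, true_and, indicator]
  split_ifs <;> rfl

lemma mode_mem (hsel : IsArgMax sel) : mode sel η w c s ∈ candidates w c :=
  hsel.mem _ ⟨2, two_mem_candidates w c⟩ _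

lemma metric_le_mode (hsel : IsArgMax sel) {k : Fin 6} (hk : k ∈ candidates w c) :
    metric η w s k ≤ metric η w s (mode sel η w c s) :=
  hsel.le _ _ k hk

variable {w c}

lemma mem_candidates_S0 (h : ¬(w.μ₁ = 0 ∧ w.μ₂ ≠ 0)) (h' : ¬(w.μ₁ ≠ 0 ∧ w.μ₂ = 0)) (k : Fin 6) :
    k ∈ candidates w c ↔ k ≠ 3 ∧ k ≠ 4 := by
  simp only [candidates, Finset.mem_filter, Finset.mem_univ, true_and, indicator, if_neg h,
    if_neg h']
  fin_cases k <;> simp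

lemma mem_candidates_S1 (h : w.μ₁ = 0 ∧ w.μ₂ ≠ 0) (k : Fin 6) :
    k ∈ candidates w c ↔ ((k = 1 ∨ k = 2) ∨ (k = 0 ∧ c 0 = false) ∨
      (k = 3 ∧ c 0 = true ∧ c 1 = false) ∨ (k = 5 ∧ c 0 = true ∧ c 1 = true)) := by
  simp only [candidates, Finset.mem_filter, Finset.mem_univ, true_and, indicator, if_pos h]
  rcases c 0 <;> rcases c 1 <;> fin_cases k <;> simp

lemma mem_candidates_S2 (h : w.μ₁ ≠ 0 ∧ w.μ₂ = 0) (k : Fin 6) :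
    k ∈ candidates w c ↔ ((k = 0 ∨ k = 2) ∨ (k = 1 ∧ c 2 = false) ∨
      (k = 4 ∧ c 2 = true ∧ c 3 = false) ∨ (k = 5 ∧ c 2 = true ∧ c 3 = true)) := by
  have h' : ¬(w.μ₁ = 0 ∧ w.μ₂ ≠ 0) := fun h0 => h.1 h0.1
  simp only [candidates, Finset.mem_filter, Finset.mem_univ, true_and, indicator, if_neg h',
    if_pos h]
  rcases c 2 <;> rcases c 3 <;> fin_cases k <;> simp

end Candidates

/-! ### Coincidences of powers are exceptional -/

section Null

variable {ν : Measure Gain} (η : ℝ) (w : Weights)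

lemma inv_div_sub_one_inj {x y y' : ℝ} (hx : 0 < x) (h : 1 / (x / y - 1) = 1 / (x / y' - 1)) :
    y = y' := by
  rw [one_div, one_div, inv_inj, sub_left_inj, div_eq_mul_inv, div_eq_mul_inv] at h
  exact inv_injective (mul_left_cancel₀ hx.ne' h)

lemma inv_one_sub_div_inj {x x' y : ℝ} (hy : 0 < y) (h : 1 / (1 - y / x) = 1 / (1 - y / x')) :
    x = x' := by
  rw [one_div, one_div, inv_inj, sub_right_inj, div_eq_mul_inv, div_eq_mul_inv] at h
  exact inv_injective (mul_left_cancel₀ hy.ne' h)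

lemma IsGainLaw.ae_power1M3_ne (hν : IsGainLaw ν) (K : ℝ) :
    ∀ᵐ s ∂ν, ¬(0 < power1M3 η w s ∧ power1M3 η w s = K - 1 / s.1) := by
  set E : Set Gain := {s | 0 < s.1 ∧ 0 < power1M3 η w s ∧ power1M3 η w s = K - 1 / s.1} with hE
  have hm := measurable_power1M3 η w
  have hEm : MeasurableSet E :=
    (measurableSet_lt measurable_const measurable_fst).inter
      ((measurableSet_lt measurable_const hm).inter
        (measurableSet_eq_fun hm (by fun_prop)))
  set β := (1 - 2 * η + w.μ₁ - w.μ₂) / (w.γ * Real.log 2) with hβ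
  have hnull : ∀ᵐ s ∂ν, s ∉ E := by
    by_cases h : η - w.μ₁ ≤ 1 - η - w.μ₂
    · have hraw : ∀ s ∈ E, 0 < s.1 ∧
          (η - w.μ₁) / (w.γ * Real.log 2) - β * (1 / (s.1 / s.2 - 1)) = K - 1 / s.1 := by
        rintro s ⟨h1, h3, h4⟩
        refine ⟨h1, ?_⟩
        rw [← h4]
        rw [power1M3, if_pos h, ← hβ] at h3 ⊢
        rw [max_eq_left ((lt_max_iff.1 h3).resolve_right (lt_irrefl 0)).le]
      rcases eq_or_ne β 0 with h0 | h0
      · refine hν.ae_notMem_of_subsingleton_left hEm fun x x' y hx hx' => ?_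
        have e := (hraw _ hx).2
        have e' := (hraw _ hx').2
        simp only [h0, zero_mul, sub_zero] at e e'
        have : 1 / x = 1 / x' := by linarith
        simpa using this
      · refine hν.ae_notMem_of_subsingleton_right hEm fun x y y' hx hx' => ?_
        have e := (hraw _ hx).2
        have e' := (hraw _ hx').2
        simp only at e e'
        exact inv_div_sub_one_inj (hraw _ hx).1 (mul_left_cancel₀ h0 (by linarith))
    · have hraw : ∀ s ∈ E, 0 < s.1 ∧ 0 < β * (1 / (s.1 / s.2 - 1)) - 1 / s.1 ∧
          β * (1 / (s.1 / s.2 - 1)) - 1 / s.1 = K - 1 / s.1 := by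
        rintro s ⟨h1, h3, h4⟩
        refine ⟨h1, ?_⟩
        rw [← h4]
        rw [power1M3, if_neg h, ← hβ] at h3 ⊢
        have := (lt_max_iff.1 h3).resolve_right (lt_irrefl 0)
        exact ⟨this, (max_eq_left this.le).symm⟩
      refine hν.ae_notMem_of_subsingleton_right hEm fun x y y' hx hx' => ?_
      obtain ⟨p1, p2, p3⟩ := hraw _ hx
      obtain ⟨-, p2', p3'⟩ := hraw _ hx'
      simp only at p1 p2 p3 p2' p3'
      have h0 : β ≠ 0 := by
        rintro h0
        rw [h0, zero_mul, zero_sub] at p2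
        have : 0 < 1 / x := by positivity
        linarith
      exact inv_div_sub_one_inj p1 (mul_left_cancel₀ h0 (by linarith))
  have := hν.pos
  filter_upwards [hnull, this] with s hs hp h
  exact hs ⟨hp.1, h⟩

lemma IsGainLaw.ae_power2M3_ne (hν : IsGainLaw ν) (K : ℝ) :
    ∀ᵐ s ∂ν, ¬(0 < power2M3 η w s ∧ power2M3 η w s = K - 1 / s.2) := by
  set E : Set Gain := {s | 0 < s.2 ∧ 0 < power2M3 η w s ∧ power2M3 η w s = K - 1 / s.2} with hE
  have hm := measurable_power2M3 η w
  have hEm : MeasurableSet E :=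
    (measurableSet_lt measurable_const measurable_snd).inter
      ((measurableSet_lt measurable_const hm).inter
        (measurableSet_eq_fun hm (by fun_prop)))
  set β := (1 - 2 * η + w.μ₁ - w.μ₂) / (w.γ * Real.log 2) with hβ
  have hnull : ∀ᵐ s ∂ν, s ∉ E := by
    by_cases h : η - w.μ₁ ≤ 1 - η - w.μ₂
    · have hraw : ∀ s ∈ E, 0 < s.2 ∧ 0 < β * (1 / (1 - s.2 / s.1)) - 1 / s.2 ∧
          β * (1 / (1 - s.2 / s.1)) - 1 / s.2 = K - 1 / s.2 := by
        rintro s ⟨h1, h3, h4⟩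
        refine ⟨h1, ?_⟩
        rw [← h4]
        rw [power2M3, if_pos h, ← hβ] at h3 ⊢
        have := (lt_max_iff.1 h3).resolve_right (lt_irrefl 0)
        exact ⟨this, (max_eq_left this.le).symm⟩
      refine hν.ae_notMem_of_subsingleton_left hEm fun x x' y hx hx' => ?_
      obtain ⟨p1, p2, p3⟩ := hraw _ hx
      obtain ⟨-, p2', p3'⟩ := hraw _ hx'
      simp only at p1 p2 p3 p2' p3'
      have h0 : β ≠ 0 := by
        rintro h0
        rw [h0, zero_mul, zero_sub] at p2
        have : 0 < 1 / y := by positivity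
        linarith
      exact inv_one_sub_div_inj p1 (mul_left_cancel₀ h0 (by linarith))
    · have hraw : ∀ s ∈ E, 0 < s.2 ∧
          (1 - η - w.μ₂) / (w.γ * Real.log 2) - β * (1 / (1 - s.2 / s.1)) = K - 1 / s.2 := by
        rintro s ⟨h1, h3, h4⟩
        refine ⟨h1, ?_⟩
        rw [← h4]
        rw [power2M3, if_neg h, ← hβ] at h3 ⊢
        rw [max_eq_left ((lt_max_iff.1 h3).resolve_right (lt_irrefl 0)).le]
      rcases eq_or_ne β 0 with h0 | h0
      · refine hν.ae_notMem_of_subsingleton_right hEm fun x y y' hx hx' => ?_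
        have e := (hraw _ hx).2
        have e' := (hraw _ hx').2
        simp only [h0, zero_mul, sub_zero] at e e'
        have : 1 / y = 1 / y' := by linarith
        simpa using this
      · refine hν.ae_notMem_of_subsingleton_left hEm fun x x' y hx hx' => ?_
        have e := (hraw _ hx).2
        have e' := (hraw _ hx').2
        simp only at e e'
        exact inv_one_sub_div_inj (hraw _ hx).1 (mul_left_cancel₀ h0 (by linarith))
  filter_upwards [hnull, hν.pos] with s hs hp h
  exact hs ⟨hp.2, h⟩

/-- The power of mode `M₆` satisfies the first-order condition for proportional weights only. -/
lemma IsGainLaw.ae_powerrM6_first_order (hν : IsGainLaw ν) (v : Weights) (hv : 0 < v.γ) :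
    ∀ᵐ s ∂ν, 0 < powerrM6 w s →
      v.μ₁ * (s.2 / (1 + powerrM6 w s * s.2)) + v.μ₂ * (s.1 / (1 + powerrM6 w s * s.1)) =
        v.γ * Real.log 2 → w.μ₁ * v.γ = v.μ₁ * w.γ ∧ w.μ₂ * v.γ = v.μ₂ * w.γ := by
  have hl := log_two_pos
  set G := w.γ * Real.log 2 with hG
  set H := v.γ * Real.log 2 with hH
  have hHpos : 0 < H := mul_pos hv hl
  set α := w.μ₁ * H - v.μ₁ * G with hα
  set β := w.μ₂ * H - v.μ₂ * G with hβ
  set k := (w.μ₁ + w.μ₂) / G with hk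
  set Δ := (v.μ₁ - v.μ₂) ^ 2 + H * (H * k ^ 2 - 2 * (v.μ₁ + v.μ₂) * k) with hΔ
  filter_upwards [hν.pos, hν.ae_ne, hν.ae_inv_sub_inv_ne ((α + β) * (v.μ₂ / β - v.μ₁ / α) / H),
    hν.ae_inv_sub_inv_ne ((Real.sqrt Δ - (v.μ₁ - v.μ₂)) / H),
    hν.ae_inv_sub_inv_ne ((-Real.sqrt Δ - (v.μ₁ - v.μ₂)) / H)] with s hs hne n1 n2 n3 hP hfoc
  obtain ⟨h1, h2⟩ := hs
  have hγ : w.γ ≠ 0 := by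
    rintro h0
    simp [powerrM6, h0] at hP
  have hG0 : G ≠ 0 := mul_ne_zero hγ hl.ne'
  set P := powerrM6 w s with hPdef
  set d := 1 / s.1 - 1 / s.2 with hd
  have hx : 0 < P + 1 / s.1 := by positivity
  have hy : 0 < P + 1 / s.2 := by positivity
  set x := P + 1 / s.1 with hxdef
  set y := P + 1 / s.2 with hydef
  have hxy : x - y = d := by rw [hxdef, hydef, hd]; ring
  have ex : s.1 / (1 + P * s.1) = 1 / x := by rw [hxdef]; field_simp; ring
  have ey : s.2 / (1 + P * s.2) = 1 / y := by rw [hydef]; field_simp; ring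
  rw [ex, ey] at hfoc
  have f2 : v.μ₁ * x + v.μ₂ * y = H * (x * y) := by
    field_simp at hfoc
    linarith
  have hd0 : d ≠ 0 := by
    rw [hd]
    intro h0
    have : 1 / s.1 = 1 / s.2 := by linarith
    exact hne (by simpa using this)
  by_cases hdisc : 0 ≤ (w.γ * Real.log 2 * (s.1 + s.2) - (w.μ₁ + w.μ₂) * (s.1 * s.2)) ^ 2 -
      4 * (w.γ * Real.log 2 * (s.1 * s.2)) * (w.γ * Real.log 2 - w.μ₁ * s.2 - w.μ₂ * s.1)
  · have hr := powerrM6_root hγ h1 h2 hdisc hP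
    rw [← hPdef, ← hG] at hr
    have f1 : w.μ₁ * x + w.μ₂ * y = G * (x * y) := by
      rw [hxdef, hydef]
      field_simp
      linarith
    have f3 : α * x + β * y = 0 := by
      have : H * (w.μ₁ * x + w.μ₂ * y) - G * (v.μ₁ * x + v.μ₂ * y) = 0 := by
        rw [f1, f2]; ring
      rw [hα, hβ]; linarith
    by_cases hα0 : α = 0
    · have hβ0 : β = 0 := by
        rw [hα0, zero_mul, zero_add] at f3
        exact (mul_eq_zero.1 f3).resolve_right hy.ne'
      rw [hα, hG, hH] at hα0
      rw [hβ, hG, hH] at hβ0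
      constructor
      · refine mul_right_cancel₀ hl.ne' ?_; linarith
      · refine mul_right_cancel₀ hl.ne' ?_; linarith
    · have hβ0 : β ≠ 0 := by
        rintro h0
        rw [h0, zero_mul, add_zero] at f3
        exact (mul_ne_zero hα0 hx.ne') f3
      exfalso
      apply n1
      have ex : x = -(β * y / α) := by field_simp; linarith
      have ey' : (α + β) * y = -(α * d) := by
        rw [← hxy]; linarith
      have f4 : v.μ₁ / y + v.μ₂ / x = H := by rw [← hfoc]; ring
      have e1 : v.μ₂ / x = -(v.μ₂ * α / (β * y)) := by
        rw [ex]; field_simp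
      rw [e1] at f4
      have e2 : (α + β) * (v.μ₂ / β - v.μ₁ / α) = d * H := by
        rw [← f4]
        have : d = -((α + β) * y / α) := by field_simp; linarith
        rw [this]
        field_simp
        ring
      rw [eq_div_iff hHpos.ne', ← e2]
  · exfalso
    push Not at hdisc
    have hPf : 2 * P * G = (w.μ₁ + w.μ₂) - G * (1 / s.1 + 1 / s.2) := by
      have hP' := hP
      rw [hPdef] at hP' ⊢
      unfold powerrM6 at hP' ⊢
      dsimp only at hP' ⊢
      rw [Real.sqrt_eq_zero_of_nonpos hdisc.le, add_zero] at hP' ⊢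
      rw [max_eq_left ((lt_max_iff.1 hP').resolve_right (lt_irrefl 0)).le, ← hG]
      field_simp
      ring
    have hsum : x + y = k := by
      rw [hk, eq_div_iff hG0, hxdef, hydef]; linarith
    have hxk : x = (k + d) / 2 := by linarith
    have hyk : y = (k - d) / 2 := by linarith
    have hq : (H * d + (v.μ₁ - v.μ₂)) ^ 2 = Δ := by
      rw [hxk, hyk] at f2
      rw [hΔ]
      linear_combination 4 * H * f2
    rcases sq_eq_sq_iff_eq_or_eq_neg.1 (hq.trans (Real.sq_sqrt (hq ▸ sq_nonneg _)).symm) with h | h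
    · exact n2 (by rw [eq_div_iff hHpos.ne']; linarith)
    · exact n3 (by rw [eq_div_iff hHpos.ne']; linarith)

end Null

/-! ### Identification of the weights from an optimal slot -/

/-- Gains that are positive and avoid the coincidences of powers for the weights `w, v`. -/
structure Generic (η : ℝ) (w v : Weights) (s : Gain) : Prop where
  pos₁ : 0 < s.1
  pos₂ : 0 < s.2
  ne : s.1 ≠ s.2
  mac₁ : ¬(0 < power1M3 η w s ∧
    power1M3 η w s = (η - v.μ₁) / (v.γ * Real.log 2) - 1 / s.1)
  mac₂ : ¬(0 < power2M3 η w s ∧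
    power2M3 η w s = (1 - η - v.μ₂) / (v.γ * Real.log 2) - 1 / s.2)
  relay : 0 < powerrM6 w s →
    v.μ₁ * (s.2 / (1 + powerrM6 w s * s.2)) + v.μ₂ * (s.1 / (1 + powerrM6 w s * s.1)) =
      v.γ * Real.log 2 → w.μ₁ * v.γ = v.μ₁ * w.γ ∧ w.μ₂ * v.γ = v.μ₂ * w.γ

lemma IsGainLaw.ae_generic {ν : Measure Gain} (hν : IsGainLaw ν) (η : ℝ) (w v : Weights)
    (hv : 0 < v.γ) : ∀ᵐ s ∂ν, Generic η w v s := by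
  filter_upwards [hν.pos, hν.ae_ne, hν.ae_power1M3_ne η w _, hν.ae_power2M3_ne η w _,
    hν.ae_powerrM6_first_order w v hv] with s h1 h2 h3 h4 h5
  exact ⟨h1.1, h1.2, h2, h3, h4, h5⟩

section Slot

variable {sel : Finset (Fin 6) → (Fin 6 → ℝ) → Fin 6} {η : ℝ} {w v : Weights} {c : Coins}
  {s : Gain}

lemma pos_of_cap_mul_pos {p x : ℝ} (hp : 0 ≤ p) (h : 0 < cap (p * x)) : 0 < p := by
  rcases hp.eq_or_lt with h0 | h0
  · rw [← h0, zero_mul, cap_zero] at h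
    exact absurd h (lt_irrefl 0)
  · exact h0

lemma gamma_ne_zero_of_waterfilling_pos {α γ σ : ℝ} (hσ : 0 < σ)
    (h : 0 < max (α / (γ * Real.log 2) - 1 / σ) 0) :
    γ ≠ 0 ∧ α * σ = γ * Real.log 2 * (1 + max (α / (γ * Real.log 2) - 1 / σ) 0 * σ) := by
  have h' := (lt_max_iff.1 h).resolve_right (lt_irrefl 0)
  have hγ : γ ≠ 0 := by
    rintro rfl
    have : 0 < 1 / σ := by positivity
    simp only [zero_mul, div_zero, zero_sub] at h'
    linarith
  have hl := log_two_pos.ne'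
  refine ⟨hγ, ?_⟩
  rw [max_eq_left h'.le]
  field_simp
  ring

/-- If water filling for the coefficients `α, γ` is optimal for `α', γ'`, these are
proportional. -/
lemma waterfilling_identify {α γ α' γ' σ : ℝ} (hσ : 0 < σ) (hγ' : 0 < γ')
    (h : 0 < max (α / (γ * Real.log 2) - 1 / σ) 0)
    (hb : ∀ p, 0 ≤ p → α' * cap (p * σ) - γ' * p ≤
      α' * cap (max (α / (γ * Real.log 2) - 1 / σ) 0 * σ) -
        γ' * max (α / (γ * Real.log 2) - 1 / σ) 0) :
    γ ≠ 0 ∧ α' * γ = α * γ' ∧ 0 < α' := by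
  have hl := log_two_pos
  obtain ⟨hγ, e⟩ := gamma_ne_zero_of_waterfilling_pos hσ h
  have e' := waterfilling_first_order hσ h hb
  set P := max (α / (γ * Real.log 2) - 1 / σ) 0
  have hY : 0 < 1 + P * σ := by positivity
  refine ⟨hγ, ?_, ?_⟩
  · refine mul_right_cancel₀ hσ.ne' ?_
    linear_combination γ * e' - γ' * e
  · by_contra! hneg
    have : 0 < γ' * Real.log 2 * (1 + P * σ) := by positivity
    nlinarith

lemma Weights.Best.mode_le (h : v.Best η s (protocol sel η w c s)) (k : Fin 6) {t p q r : ℝ}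
    (ht : t = 0 ∨ t = 1) (hp : 0 ≤ p) (hq : 0 ≤ q) (hr : 0 ≤ r) :
    modeLagr (η - v.μ₁) (1 - η - v.μ₂) v.μ₂ v.μ₁ v.γ s t p q r k ≤
      lagrangian (η - v.μ₁) (1 - η - v.μ₂) v.μ₂ v.μ₁ v.γ s (protocol sel η w c s) :=
  IsBest.modeLagr_le h k ht hp hq hr

lemma identify_one (hs : 0 < s.1) (hv : 0 < v.γ) (hb : v.Best η s (protocol sel η w c s))
    (hk : mode sel η w c s = 0) (hP : 0 < power1M1 η w s) :
    (η - v.μ₁) * w.γ = (η - w.μ₁) * v.γ ∧ 0 < η - v.μ₁ := by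
  refine (waterfilling_identify hs hv hP fun p hp => ?_).2
  have := hb.mode_le 0 (Or.inl rfl) hp le_rfl le_rfl
  rw [lagrangian_protocol, hk] at this
  exact this

lemma identify_two (hs : 0 < s.2) (hv : 0 < v.γ) (hb : v.Best η s (protocol sel η w c s))
    (hk : mode sel η w c s = 1) (hP : 0 < power2M2 η w s) :
    (1 - η - v.μ₂) * w.γ = (1 - η - w.μ₂) * v.γ ∧ 0 < 1 - η - v.μ₂ := by
  refine (waterfilling_identify hs hv hP fun p hp => ?_).2
  have := hb.mode_le 1 (Or.inl rfl) le_rfl hp le_rfl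
  rw [lagrangian_protocol, hk] at this
  exact this

lemma macRate₁_zero_right {t p : ℝ} : macRate₁ t p 0 s = cap (p * s.1) := by
  simp [macRate₁]; ring

lemma macRate₂_zero_left {t q : ℝ} : macRate₂ t 0 q s = cap (q * s.2) := by
  simp [macRate₂]; ring

lemma macRate₁_zero_left {t q : ℝ} : macRate₁ t 0 q s = 0 := by
  simp [macRate₁, cap_zero]

lemma macRate₂_zero_right {t p : ℝ} : macRate₂ t p 0 s = 0 := by
  simp [macRate₂, cap_zero]

lemma mac_identify {A B G A' B' G' σ τ P Q : ℝ} (hG' : 0 < G') (hσ : 0 < σ) (hτ : 0 < τ)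
    (hP : 0 < P) (hQ : 0 < Q)
    (e₁ : A * σ = G * (1 + P * σ + Q * τ))
    (e₂ : (B - A) * τ * σ = G * (σ - τ) * (1 + Q * τ))
    (e₁' : A' * σ = G' * (1 + P * σ + Q * τ))
    (e₂' : (B' - A') * τ * σ = G' * (σ - τ) * (1 + Q * τ)) :
    (A' * G = A * G' ∧ 0 < A') ∧ B' * G = B * G' ∧ 0 < B' := by
  have hA : A' * G = A * G' := by
    refine mul_right_cancel₀ hσ.ne' ?_
    linear_combination G * e₁' - G' * e₁
  have hB : B' * G = B * G' := by
    refine mul_right_cancel₀ (mul_pos hτ hσ).ne' ?_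
    linear_combination G * e₂' - G' * e₂ + τ * σ * hA
  have hA' : 0 < A' := by
    refine pos_of_mul_pos_left (b := σ) ?_ hσ.le
    rw [e₁']; positivity
  refine ⟨⟨hA, hA'⟩, hB, ?_⟩
  refine pos_of_mul_pos_left (b := τ * σ) ?_ (mul_pos hτ hσ).le
  have : B' * (τ * σ) = G' * (τ * (P * σ) + σ * (1 + Q * τ)) := by
    linear_combination e₂' + τ * e₁'
  rw [this]
  positivity

lemma power_pos_gamma_ne (h : 0 < power1M3 η w s) (h' : 0 < power2M3 η w s) : w.γ ≠ 0 := by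
  rintro h0
  by_cases hAB : η - w.μ₁ ≤ 1 - η - w.μ₂
  · rw [power1M3_of_le hAB, h0] at h
    simp at h
  · rw [power2M3_of_not_le hAB, h0] at h'
    simp at h'

lemma identify_three (hs : Generic η w v s) (hv : 0 < v.γ)
    (hb : v.Best η s (protocol sel η w c s)) (hk : mode sel η w c s = 2)
    (hpos : 0 < power1M3 η w s ∨ 0 < power2M3 η w s) :
    ((η - v.μ₁) * w.γ = (η - w.μ₁) * v.γ ∧ 0 < η - v.μ₁) ∧
      (1 - η - v.μ₂) * w.γ = (1 - η - w.μ₂) * v.γ ∧ 0 < 1 - η - v.μ₂ := by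
  have hl := log_two_pos
  obtain ⟨h1, h2, hne, n1, n2, -⟩ := hs
  have hP := power1M3_nonneg η w s
  have hQ := power2M3_nonneg η w s
  have key : ∀ (k : Fin 6) (t p q : ℝ), (t = 0 ∨ t = 1) → 0 ≤ p → 0 ≤ q →
      modeLagr (η - v.μ₁) (1 - η - v.μ₂) v.μ₂ v.μ₁ v.γ s t p q 0 k ≤
      (η - v.μ₁) * C12r η w s + (1 - η - v.μ₂) * C21r η w s -
        v.γ * (power1M3 η w s + power2M3 η w s) := by
    intro k t p q ht hp hq
    have := hb.mode_le k ht hp hq le_rfl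
    rw [lagrangian_protocol, hk] at this
    exact this
  unfold C12r C21r at key
  have hsolve : ∀ {α σ p : ℝ}, 0 < σ → α * σ = v.γ * Real.log 2 * (1 + p * σ) →
      p = α / (v.γ * Real.log 2) - 1 / σ := by
    intro α σ p hσ h
    field_simp
    linarith
  rcases hQ.eq_or_lt with hQ0 | hQ0
  · exfalso
    have hP0 : 0 < power1M3 η w s := hpos.resolve_right (by rw [← hQ0]; exact lt_irrefl 0)
    refine n1 ⟨hP0, hsolve h1 (waterfilling_first_order h1 hP0 fun p hp => ?_)⟩
    have := key 0 0 p 0 (Or.inl rfl) hp le_rfl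
    rw [← hQ0, macRate₁_zero_right, macRate₂_zero_right] at this
    simp only [modeLagr, Matrix.cons_val] at this
    linarith
  rcases hP.eq_or_lt with hP0 | hP0
  · exfalso
    refine n2 ⟨hQ0, hsolve h2 (waterfilling_first_order h2 hQ0 fun p hp => ?_)⟩
    have := key 1 0 0 p (Or.inl rfl) le_rfl hp
    rw [← hP0, macRate₁_zero_left, macRate₂_zero_left] at this
    simp only [modeLagr, Matrix.cons_val] at this
    linarith
  have hγ := power_pos_gamma_ne hP0 hQ0
  have hG : w.γ * Real.log 2 ≠ 0 := mul_ne_zero hγ hl.ne'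
  have hH : 0 < v.γ * Real.log 2 := mul_pos hv hl
  have fin : ∀ {a b : ℝ}, a * (w.γ * Real.log 2) = b * (v.γ * Real.log 2) → a * w.γ = b * v.γ :=
    fun h => mul_right_cancel₀ hl.ne' (by linarith)
  by_cases hAB : η - w.μ₁ ≤ 1 - η - w.μ₂
  · obtain ⟨e1, e2⟩ := mac_stationary hG h1 h2 hne
      (p := power1M3 η w s) (q := power2M3 η w s) (by
        rw [power1M3_of_le hAB] at hP0 ⊢
        exact max_eq_left ((lt_max_iff.1 hP0).resolve_right (lt_irrefl 0)).le) (by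
        rw [power2M3_of_le hAB] at hQ0 ⊢
        exact max_eq_left ((lt_max_iff.1 hQ0).resolve_right (lt_irrefl 0)).le)
    obtain ⟨e1', e2'⟩ := macLagr_first_order (A := η - v.μ₁) (B := 1 - η - v.μ₂)
      (g := v.γ * Real.log 2) h1 h2 hP0 hQ0 fun p q hp hq => by
        have := key 2 0 p q (Or.inl rfl) hp hq
        rw [show decOrder η w = 0 by rw [decOrder, if_pos hAB]] at this
        simp only [modeLagr, Matrix.cons_val] at this
        rw [macLagr_zero hp hq h1.le h2.le, macLagr_zero hP hQ h1.le h2.le,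
          div_le_div_iff_of_pos_right hl] at this
        exact this
    obtain ⟨⟨a1, a2⟩, a3, a4⟩ := mac_identify hH h1 h2 hP0 hQ0 e1 e2 e1' e2'
    exact ⟨⟨fin a1, a2⟩, fin a3, a4⟩
  · obtain ⟨e1, e2⟩ := mac_stationary hG h2 h1 hne.symm
      (p := power2M3 η w s) (q := power1M3 η w s) (by
        rw [power2M3_of_not_le hAB] at hQ0 ⊢
        exact max_eq_left ((lt_max_iff.1 hQ0).resolve_right (lt_irrefl 0)).le) (by
        rw [power1M3_of_not_le hAB] at hP0 ⊢
        exact max_eq_left ((lt_max_iff.1 hP0).resolve_right (lt_irrefl 0)).le)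
    obtain ⟨e1', e2'⟩ := macLagr_first_order (A := 1 - η - v.μ₂) (B := η - v.μ₁)
      (g := v.γ * Real.log 2) h2 h1 hQ0 hP0 fun p q hp hq => by
        have := key 2 1 q p (Or.inr rfl) hq hp
        rw [show decOrder η w = 1 by rw [decOrder, if_neg hAB]] at this
        simp only [modeLagr, Matrix.cons_val] at this
        rw [macLagr_one hq hp h1.le h2.le, macLagr_one hP hQ h1.le h2.le,
          div_le_div_iff_of_pos_right hl] at this
        exact this
    obtain ⟨⟨a1, a2⟩, a3, a4⟩ := mac_identify hH h2 h1 hQ0 hP0 e1 e2 e1' e2'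
    exact ⟨⟨fin a3, a4⟩, fin a1, a2⟩

lemma identify_four (h1 : 0 < s.1) (h2 : 0 < s.2) (hv : 0 < v.γ)
    (hb : v.Best η s (protocol sel η w c s)) (hk : mode sel η w c s = 3)
    (hP : 0 < powerrM4 w s) :
    v.μ₂ * w.γ = w.μ₂ * v.γ ∧ 0 < v.μ₂ ∧ v.μ₁ ≤ 0 := by
  have key := fun (k : Fin 6) (r : ℝ) (hr : 0 ≤ r) => by
    have := hb.mode_le k (Or.inl rfl) le_rfl le_rfl hr
    rw [lagrangian_protocol, hk] at this
    exact this
  obtain ⟨-, e1, e2⟩ := waterfilling_identify h1 hv hP fun r hr => key 3 r hr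
  refine ⟨e1, e2, ?_⟩
  have h5 := key 5 _ hP.le
  have hc := cap_pos (mul_pos hP h2)
  simp only [modeLagr, Matrix.cons_val] at h5
  by_contra! hneg
  nlinarith

lemma identify_five (h1 : 0 < s.1) (h2 : 0 < s.2) (hv : 0 < v.γ)
    (hb : v.Best η s (protocol sel η w c s)) (hk : mode sel η w c s = 4)
    (hP : 0 < powerrM5 w s) :
    v.μ₁ * w.γ = w.μ₁ * v.γ ∧ 0 < v.μ₁ ∧ v.μ₂ ≤ 0 := by
  have key := fun (k : Fin 6) (r : ℝ) (hr : 0 ≤ r) => by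
    have := hb.mode_le k (Or.inl rfl) le_rfl le_rfl hr
    rw [lagrangian_protocol, hk] at this
    exact this
  obtain ⟨-, e1, e2⟩ := waterfilling_identify h2 hv hP fun r hr => key 4 r hr
  refine ⟨e1, e2, ?_⟩
  have h5 := key 5 _ hP.le
  have hc := cap_pos (mul_pos hP h1)
  simp only [modeLagr, Matrix.cons_val] at h5
  by_contra! hneg
  nlinarith

lemma identify_six (hs : Generic η w v s) (hv : 0 < v.γ)
    (hb : v.Best η s (protocol sel η w c s)) (hk : mode sel η w c s = 5)
    (hP : 0 < powerrM6 w s) :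
    w.γ ≠ 0 ∧ (w.μ₁ * v.γ = v.μ₁ * w.γ ∧ w.μ₂ * v.γ = v.μ₂ * w.γ) ∧
      (0 ≤ v.μ₁ ∧ 0 ≤ v.μ₂) ∧ ¬(v.μ₁ = 0 ∧ v.μ₂ = 0) := by
  have hl := log_two_pos
  have h1 := hs.pos₁
  have h2 := hs.pos₂
  have key := fun (k : Fin 6) (r : ℝ) (hr : 0 ≤ r) => by
    have := hb.mode_le k (Or.inl rfl) le_rfl le_rfl hr
    rw [lagrangian_protocol, hk] at this
    exact this
  have hfoc := broadcast_first_order h2 h1 hP fun r hr => key 5 r hr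
  have h3 := key 3 _ hP.le
  have h4 := key 4 _ hP.le
  have hc1 := cap_pos (mul_pos hP h1)
  have hc2 := cap_pos (mul_pos hP h2)
  simp only [modeLagr, Matrix.cons_val, Cr1, Cr2] at h3 h4
  refine ⟨?_, hs.relay hP hfoc, ⟨?_, ?_⟩, ?_⟩
  · rintro h0
    simp [powerrM6, h0] at hP
  · by_contra! hneg
    nlinarith
  · by_contra! hneg
    nlinarith
  · rintro ⟨e1, e2⟩
    rw [e1, e2, zero_mul, zero_mul, add_zero] at hfoc
    exact (mul_pos hv hl).ne hfoc

lemma rate1r_pos_imp (h : 0 < (protocol sel η w c s).rate1r s) :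
    (mode sel η w c s = 0 ∧ 0 < power1M1 η w s) ∨
      (mode sel η w c s = 2 ∧ (0 < power1M3 η w s ∨ 0 < power2M3 η w s)) := by
  rw [protocol_rate1r] at h
  generalize mode sel η w c s = k at h
  have e2 : 0 < C12r η w s → 0 < power1M3 η w s := fun h => by
    rcases (power1M3_nonneg η w s).eq_or_lt with h0 | h0
    · rw [C12r, ← h0, macRate₁_zero_left] at h
      exact absurd h (lt_irrefl 0)
    · exact h0
  fin_cases k <;> simp at h ⊢
  · exact pos_of_cap_mul_pos (power1M1_nonneg η w s) h
  · exact Or.inl (e2 h)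

lemma rate2r_pos_imp (h : 0 < (protocol sel η w c s).rate2r s) :
    (mode sel η w c s = 1 ∧ 0 < power2M2 η w s) ∨
      (mode sel η w c s = 2 ∧ (0 < power1M3 η w s ∨ 0 < power2M3 η w s)) := by
  rw [protocol_rate2r] at h
  generalize mode sel η w c s = k at h
  have e2 : 0 < C21r η w s → 0 < power2M3 η w s := fun h => by
    rcases (power2M3_nonneg η w s).eq_or_lt with h0 | h0
    · rw [C21r, ← h0, macRate₂_zero_right] at h
      exact absurd h (lt_irrefl 0)
    · exact h0
  fin_cases k <;> simp at h ⊢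
  · exact pos_of_cap_mul_pos (power2M2_nonneg η w s) h
  · exact Or.inr (e2 h)

lemma rater1_pos_imp (h : 0 < (protocol sel η w c s).rater1 s) :
    (mode sel η w c s = 3 ∧ 0 < powerrM4 w s) ∨
      (mode sel η w c s = 5 ∧ 0 < powerrM6 w s) := by
  rw [protocol_rater1] at h
  generalize mode sel η w c s = k at h
  fin_cases k <;> simp at h ⊢
  · exact pos_of_cap_mul_pos (powerrM4_nonneg w s) h
  · exact pos_of_cap_mul_pos (powerrM6_nonneg w s) h

lemma rater2_pos_imp (h : 0 < (protocol sel η w c s).rater2 s) :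
    (mode sel η w c s = 4 ∧ 0 < powerrM5 w s) ∨
      (mode sel η w c s = 5 ∧ 0 < powerrM6 w s) := by
  rw [protocol_rater2] at h
  generalize mode sel η w c s = k at h
  fin_cases k <;> simp at h ⊢
  · exact pos_of_cap_mul_pos (powerrM5_nonneg w s) h
  · exact pos_of_cap_mul_pos (powerrM6_nonneg w s) h

lemma identify_rate1r (hs : Generic η w v s) (hv : 0 < v.γ)
    (hb : v.Best η s (protocol sel η w c s)) (h : 0 < (protocol sel η w c s).rate1r s) :
    (η - v.μ₁) * w.γ = (η - w.μ₁) * v.γ ∧ 0 < η - v.μ₁ := by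
  rcases rate1r_pos_imp h with ⟨hk, hP⟩ | ⟨hk, hP⟩
  · exact identify_one hs.pos₁ hv hb hk hP
  · exact (identify_three hs hv hb hk hP).1

lemma identify_rate2r (hs : Generic η w v s) (hv : 0 < v.γ)
    (hb : v.Best η s (protocol sel η w c s)) (h : 0 < (protocol sel η w c s).rate2r s) :
    (1 - η - v.μ₂) * w.γ = (1 - η - w.μ₂) * v.γ ∧ 0 < 1 - η - v.μ₂ := by
  rcases rate2r_pos_imp h with ⟨hk, hP⟩ | ⟨hk, hP⟩
  · exact identify_two hs.pos₂ hv hb hk hP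
  · exact (identify_three hs hv hb hk hP).2

end Slot

/-! ### Identification of the weights of an optimal protocol -/

section Identify

variable {sel : Finset (Fin 6) → (Fin 6 → ℝ) → Fin 6} {η : ℝ} {w v : Weights} {c : Coins}
  {s : Gain}

lemma best_of_lower_weight₁ (hw : InBox η w) (hs : Generic η w v s) (h0 : w.μ₁ = 0)
    (hμ : v.μ₂ = w.μ₂) (hγ : v.γ = w.γ) (hv : v.μ₁ ≤ 0)
    (hb : v.Best η s (protocol sel η w c s)) (hr : (protocol sel η w c s).rate1r s = 0)
    (hr' : (protocol sel η w c s).rater2 s = 0) : w.Best η s (protocol sel η w c s) := by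
  have hC : w.lagr η s (protocol sel η w c s) = v.lagr η s (protocol sel η w c s) := by
    simp only [Weights.lagr, lagrangian, hr, hr', hμ, hγ]
    ring
  have h1 := hs.pos₁
  have h2 := hs.pos₂
  have key := fun (k : Fin 6) (t p q r : ℝ) (ht : t = 0 ∨ t = 1) (hp : 0 ≤ p) (hq : 0 ≤ q)
    (hr : 0 ≤ r) => hb.mode_le k ht hp hq hr
  rw [hμ, hγ] at key
  intro b hb'
  refine lagr_le_of_metric_le (C := w.lagr η s (protocol sel η w c s)) hw h1 h2 hs.ne ?_ ?_ ?_ ?_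
    hb' <;> rw [hC, Weights.lagr, hμ, hγ]
  · refine le_trans ?_ (key 0 0 _ 0 0 (Or.inl rfl) (power1M1_nonneg η w s) le_rfl le_rfl)
    have := cap_nonneg (mul_nonneg (power1M1_nonneg η w s) h1.le)
    simp only [metric, modeLagr, Matrix.cons_val, C1r, h0]
    nlinarith
  · exact key 1 0 0 _ 0 (Or.inl rfl) le_rfl (power2M2_nonneg η w s) le_rfl
  · refine le_trans ?_ (key 2 _ _ _ 0 (decOrder_eq η w) (power1M3_nonneg η w s)
      (power2M3_nonneg η w s) le_rfl)
    have hd : 0 ≤ decOrder η w ∧ decOrder η w ≤ 1 := by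
      rcases decOrder_eq η w with h | h <;> rw [h] <;> norm_num
    have := macRate₁_nonneg hd (power1M3_nonneg η w s) (power2M3_nonneg η w s) h1.le h2.le
    simp only [metric, modeLagr, Matrix.cons_val, C12r, C21r, h0]
    nlinarith
  · rw [← metric_three_eq hw h1 h2 h0]
    exact key 3 0 0 0 _ (Or.inl rfl) le_rfl le_rfl (powerrM4_nonneg w s)

lemma best_of_lower_weight₂ (hw : InBox η w) (hs : Generic η w v s) (h0 : w.μ₂ = 0)
    (hμ : v.μ₁ = w.μ₁) (hγ : v.γ = w.γ) (hv : v.μ₂ ≤ 0)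
    (hb : v.Best η s (protocol sel η w c s)) (hr : (protocol sel η w c s).rate2r s = 0)
    (hr' : (protocol sel η w c s).rater1 s = 0) : w.Best η s (protocol sel η w c s) := by
  have hC : w.lagr η s (protocol sel η w c s) = v.lagr η s (protocol sel η w c s) := by
    simp only [Weights.lagr, lagrangian, hr, hr', hμ, hγ]
    ring
  have h1 := hs.pos₁
  have h2 := hs.pos₂
  have key := fun (k : Fin 6) (t p q r : ℝ) (ht : t = 0 ∨ t = 1) (hp : 0 ≤ p) (hq : 0 ≤ q)
    (hr : 0 ≤ r) => hb.mode_le k ht hp hq hr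
  rw [hμ, hγ] at key
  intro b hb'
  refine lagr_le_of_metric_le (C := w.lagr η s (protocol sel η w c s)) hw h1 h2 hs.ne ?_ ?_ ?_ ?_
    hb' <;> rw [hC, Weights.lagr, hμ, hγ]
  · exact key 0 0 _ 0 0 (Or.inl rfl) (power1M1_nonneg η w s) le_rfl le_rfl
  · refine le_trans ?_ (key 1 0 0 _ 0 (Or.inl rfl) le_rfl (power2M2_nonneg η w s) le_rfl)
    have := cap_nonneg (mul_nonneg (power2M2_nonneg η w s) h2.le)
    simp only [metric, modeLagr, Matrix.cons_val, C2r, h0]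
    nlinarith
  · refine le_trans ?_ (key 2 _ _ _ 0 (decOrder_eq η w) (power1M3_nonneg η w s)
      (power2M3_nonneg η w s) le_rfl)
    have hd : 0 ≤ decOrder η w ∧ decOrder η w ≤ 1 := by
      rcases decOrder_eq η w with h | h <;> rw [h] <;> norm_num
    have := macRate₂_nonneg hd (power1M3_nonneg η w s) (power2M3_nonneg η w s) h1.le h2.le
    simp only [metric, modeLagr, Matrix.cons_val, C12r, C21r, h0]
    nlinarith
  · rw [← metric_four_eq hw h1 h2 h0]
    exact key 4 0 0 0 _ (Or.inl rfl) le_rfl le_rfl (powerrM5_nonneg w s)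

lemma exists_of_integral_pos {Z : Type*} [MeasurableSpace Z] {m : Measure Z} {f : Z → ℝ}
    {q : Z → Prop} (h : 0 < ∫ z, f z ∂m) (hq : ∀ᵐ z ∂m, q z) : ∃ z, q z ∧ 0 < f z := by
  by_contra! hne
  exact absurd (integral_nonpos_of_ae (hq.mono hne)) (not_le.2 h)

lemma eq_S1_of_mode_eq_three (hsel : IsArgMax sel) (hk : mode sel η w c s = 3) :
    w.μ₁ = 0 ∧ w.μ₂ ≠ 0 := by
  by_contra hS
  have hm := mode_mem η w c s hsel
  rw [hk] at hm
  by_cases hS' : w.μ₁ ≠ 0 ∧ w.μ₂ = 0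
  · rw [mem_candidates_S2 hS'] at hm
    simp at hm
  · rw [mem_candidates_S0 hS hS'] at hm
    simp at hm

lemma eq_S2_of_mode_eq_four (hsel : IsArgMax sel) (hk : mode sel η w c s = 4) :
    w.μ₁ ≠ 0 ∧ w.μ₂ = 0 := by
  by_contra hS
  have hm := mode_mem η w c s hsel
  rw [hk] at hm
  by_cases hS' : w.μ₁ = 0 ∧ w.μ₂ ≠ 0
  · rw [mem_candidates_S1 hS'] at hm
    simp at hm
  · rw [mem_candidates_S0 hS' hS] at hm
    simp at hm

lemma Weights.exists_inRegion (h : ¬(w.μ₁ = 0 ∧ w.μ₂ = 0)) : ∃ r, w.InRegion r := by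
  by_cases h1 : w.μ₁ = 0
  · exact ⟨.S1, h1, fun h2 => h ⟨h1, h2⟩⟩
  · by_cases h2 : w.μ₂ = 0
    · exact ⟨.S2, h1, h2⟩
    · exact ⟨.S0, h1, h2⟩

lemma Weights.InRegion.eq {r r' : Region} (h : w.InRegion r) (h' : w.InRegion r') : r = r' := by
  cases r <;> cases r' <;> simp_all [Weights.InRegion]

lemma Weights.eq_of (h₁ : w.μ₁ = v.μ₁) (h₂ : w.μ₂ = v.μ₂) (h₃ : w.γ = v.γ) : w = v := by
  cases w; cases v; simp_all

variable {ν : Measure Gain} {κ : Measure Coins} [IsProbabilityMeasure κ] {Pt : ℝ}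

/-- If a feasible protocol with positive objective maximizes the Lagrangian of some weights `v`
in almost every slot, its own weights lie in the box and have the same property. -/
theorem identify (hν : IsGainLaw ν) (hη : 0 < η ∧ η < 1) (hsel : IsArgMax sel)
    (hf : IsStatFeasible Pt (ν.prod κ) fun z => protocol sel η w z.2 z.1)
    (hval : 0 < value η (ν.prod κ) fun z => protocol sel η w z.2 z.1) (hv : 0 < v.γ)
    (hb : ∀ᵐ z ∂ν.prod κ, v.Best η z.1 (protocol sel η w z.2 z.1)) :
    InBox η w ∧ (∀ᵐ z ∂ν.prod κ, w.Best η z.1 (protocol sel η w z.2 z.1)) ∧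
      ∃ r, w.InRegion r ∧ (InBox η v → v.InRegion r) := by
  have := hν.prob
  have hpol := isPolicy_protocol η w hsel
  have hgen : ∀ᵐ z ∂ν.prod κ, Generic η w v z.1 :=
    Measure.quasiMeasurePreserving_fst.ae (hν.ae_generic η w v hv)
  have hadm := fun z : Gain × Coins => protocol_admissible sel η w z.2 z.1
  have p1 : ∀ᵐ z ∂ν.prod κ, 0 ≤ (protocol sel η w z.2 z.1).rate1r z.1 :=
    hgen.mono fun z hz => (hadm z).rate1r_nonneg hz.pos₁.le hz.pos₂.le
  have p2 : ∀ᵐ z ∂ν.prod κ, 0 ≤ (protocol sel η w z.2 z.1).rate2r z.1 :=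
    hgen.mono fun z hz => (hadm z).rate2r_nonneg hz.pos₁.le hz.pos₂.le
  have p3 : ∀ᵐ z ∂ν.prod κ, 0 ≤ (protocol sel η w z.2 z.1).rater1 z.1 :=
    hgen.mono fun z hz => (hadm z).rater1_nonneg hz.pos₁.le
  have p4 : ∀ᵐ z ∂ν.prod κ, 0 ≤ (protocol sel η w z.2 z.1).rater2 z.1 :=
    hgen.mono fun z hz => (hadm z).rater2_nonneg hz.pos₂.le
  have i1 := hpol.integrable_rate1r hν hf.finite
  have i2 := hpol.integrable_rate2r hν hf.finite
  have i3 := hpol.integrable_rater1 hν hf.finite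
  have i4 := hpol.integrable_rater2 hν hf.finite
  have c1 := hf.c1
  have c2 := hf.c2
  unfold value at hval
  set R₁ := ∫ z, (protocol sel η w z.2 z.1).rate1r z.1 ∂ν.prod κ with hR₁
  set R₂ := ∫ z, (protocol sel η w z.2 z.1).rate2r z.1 ∂ν.prod κ with hR₂
  have hR₁0 : 0 ≤ R₁ := integral_nonneg_of_ae p1
  have hR₂0 : 0 ≤ R₂ := integral_nonneg_of_ae p2
  have z1 : R₁ = 0 → ∀ᵐ z ∂ν.prod κ, (protocol sel η w z.2 z.1).rate1r z.1 = 0 ∧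
      (protocol sel η w z.2 z.1).rater2 z.1 = 0 := fun h =>
    ((integral_eq_zero_iff_of_nonneg_ae p1 i1).1 h).and
      ((integral_eq_zero_iff_of_nonneg_ae p4 i4).1 (c1.symm.trans h))
  have z2 : R₂ = 0 → ∀ᵐ z ∂ν.prod κ, (protocol sel η w z.2 z.1).rate2r z.1 = 0 ∧
      (protocol sel η w z.2 z.1).rater1 z.1 = 0 := fun h =>
    ((integral_eq_zero_iff_of_nonneg_ae p2 i2).1 h).and
      ((integral_eq_zero_iff_of_nonneg_ae p3 i3).1 (c2.symm.trans h))
  have same : w = v → InBox η v → ¬(v.μ₁ = 0 ∧ v.μ₂ = 0) →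
      InBox η w ∧ (∀ᵐ z ∂ν.prod κ, w.Best η z.1 (protocol sel η w z.2 z.1)) ∧
      ∃ r, w.InRegion r ∧ (InBox η v → v.InRegion r) := by
    intro h hB hne
    subst h
    obtain ⟨r, hr⟩ := Weights.exists_inRegion hne
    exact ⟨hB, hb, r, hr, fun _ => hr⟩
  rcases hR₁0.eq_or_lt with hR₁z | hR₁p
  · have hz := z1 hR₁z.symm
    have hR₂p : 0 < R₂ := by
      rw [← hR₁z] at hval
      refine pos_of_mul_pos_right (a := 1 - η) ?_ (sub_pos.2 hη.2).le
      linarith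
    obtain ⟨z, ⟨hg, hbz⟩, hz2⟩ := exists_of_integral_pos hR₂p (hgen.and hb)
    obtain ⟨eB, hB⟩ := identify_rate2r hg hv hbz hz2
    obtain ⟨y, ⟨⟨hg', hby⟩, hy0⟩, hy2⟩ :=
      exists_of_integral_pos (c2 ▸ hR₂p) ((hgen.and hb).and hz)
    rcases rater1_pos_imp hy2 with ⟨hk, hP⟩ | ⟨hk, hP⟩
    · obtain ⟨eμ, hμ, hμ'⟩ := identify_four hg'.pos₁ hg'.pos₂ hv hby hk hP
      have hS := eq_S1_of_mode_eq_three hsel hk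
      have hγ : v.γ = w.γ := by
        refine mul_left_cancel₀ (sub_pos.2 hη.2).ne' ?_
        linarith
      have hμe : v.μ₂ = w.μ₂ := by
        rw [hγ] at eμ
        exact mul_right_cancel₀ (hγ ▸ hv).ne' eμ
      have hbox : InBox η w :=
        ⟨⟨hS.1.ge, hS.1.trans_lt hη.1⟩, ⟨hμe ▸ hμ.le, by linarith⟩, hγ ▸ hv⟩
      refine ⟨hbox, ?_, .S1, hS, fun hvB => ⟨le_antisymm hμ' hvB.1.1, hμ.ne'⟩⟩
      filter_upwards [hgen, hb, hz] with z h1 h2 h3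
      exact best_of_lower_weight₁ hbox h1 hS.1 hμe hγ hμ' h2 h3.1 h3.2
    · exfalso
      have := hy0.2
      rw [protocol_rater2, hk] at this
      exact (cap_pos (mul_pos hP hg'.pos₂)).ne' this
  · obtain ⟨z, ⟨hg, hbz⟩, hz1⟩ := exists_of_integral_pos hR₁p (hgen.and hb)
    obtain ⟨eA, hA⟩ := identify_rate1r hg hv hbz hz1
    obtain ⟨y, ⟨⟨hg', hby⟩, hy0⟩, hy2⟩ := exists_of_integral_pos (c1 ▸ hR₁p)
      ((hgen.and hb).and (ae_all_iff.2 z2))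
    rcases rater2_pos_imp hy2 with ⟨hk, hP⟩ | ⟨hk, hP⟩
    · obtain ⟨eμ, hμ, hμ'⟩ := identify_five hg'.pos₁ hg'.pos₂ hv hby hk hP
      have hS := eq_S2_of_mode_eq_four hsel hk
      have hγ : v.γ = w.γ := by
        refine mul_left_cancel₀ hη.1.ne' ?_
        linarith
      have hμe : v.μ₁ = w.μ₁ := by
        rw [hγ] at eμ
        exact mul_right_cancel₀ (hγ ▸ hv).ne' eμ
      have hbox : InBox η w :=
        ⟨⟨hμe ▸ hμ.le, by linarith⟩, ⟨hS.2.ge, hS.2.trans_lt (sub_pos.2 hη.2)⟩, hγ ▸ hv⟩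
      rcases hR₂0.eq_or_lt with hR₂z | hR₂p
      · refine ⟨hbox, ?_, .S2, hS, fun hvB => ⟨hμ.ne', le_antisymm hμ' hvB.2.1.1⟩⟩
        filter_upwards [hgen, hb, z2 hR₂z.symm] with z h1 h2 h3
        exact best_of_lower_weight₂ hbox h1 hS.2 hμe hγ hμ' h2 h3.1 h3.2
      · obtain ⟨x, ⟨hgx, hbx⟩, hx2⟩ := exists_of_integral_pos hR₂p (hgen.and hb)
        obtain ⟨eB, hB⟩ := identify_rate2r hgx hv hbx hx2
        rw [hγ] at eB
        have hμ2 := mul_right_cancel₀ (hγ ▸ hv).ne' eB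
        have hwv : w = v := Weights.eq_of hμe.symm (by linarith) hγ.symm
        exact same hwv (hwv ▸ hbox) fun h => hμ.ne' h.1
    · obtain ⟨hγ0, ⟨e1, e2⟩, ⟨n1, n2⟩, hne⟩ := identify_six hg' hv hby hk hP
      have hγ : v.γ = w.γ := by
        refine mul_left_cancel₀ hη.1.ne' ?_
        linarith
      rw [hγ] at e1 e2
      have hγp : 0 < w.γ := hγ ▸ hv
      have hwv : w = v := Weights.eq_of (mul_right_cancel₀ hγp.ne' e1)
        (mul_right_cancel₀ hγp.ne' e2) hγ.symm
      have hR₂p : 0 < R₂ := by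
        refine lt_of_le_of_ne hR₂0 fun h => ?_
        have := (hy0 h.symm).2
        rw [protocol_rater1, hk] at this
        exact (cap_pos (mul_pos hP hg'.pos₁)).ne' this
      obtain ⟨x, ⟨hgx, hbx⟩, hx2⟩ := exists_of_integral_pos hR₂p (hgen.and hb)
      obtain ⟨eB, hB⟩ := identify_rate2r hgx hv hbx hx2
      exact same hwv ⟨⟨n1, by linarith⟩, ⟨n2, by linarith⟩, hv⟩ hne

end Identify

/-! ### Optimal weights and the stationary problem -/

section Coins

/-- The law of the coins of one slot. -/
noncomputable def slotLaw (p : Fin 4 → unitInterval) : Measure Coins :=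
  Measure.pi fun n => bernoulliMeasure true false (p n)

instance (p : Fin 4 → unitInterval) : IsProbabilityMeasure (slotLaw p) := by
  unfold slotLaw; infer_instance

lemma integral_slotLaw_prod (p : Fin 4 → unitInterval) (f : Fin 4 → Bool → ℝ) :
    ∫ c, ∏ n, f n (c n) ∂slotLaw p =
      ∏ n, ((p n : ℝ) * f n true + (1 - (p n : ℝ)) * f n false) := by
  unfold slotLaw
  rw [integral_fintype_prod_eq_prod]
  refine Finset.prod_congr rfl fun n _ => ?_
  rw [integral_bernoulliMeasure]
  simp

/-- The indicator of a coin showing 1. -/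
def coinInd (n : Fin 4) (c : Coins) : ℝ := if c n = true then 1 else 0

lemma integral_coinInd (p : Fin 4 → unitInterval) (n : Fin 4) :
    ∫ c, coinInd n c ∂slotLaw p = p n := by
  have := integral_slotLaw_prod p fun m b => if m = n then (if b = true then 1 else 0) else 1
  simp only [Finset.prod_ite_eq', Finset.mem_univ, if_true] at this
  simp only [coinInd, this]
  fin_cases n <;> simp [Fin.prod_univ_four]

lemma integral_coinInd_mul (p : Fin 4 → unitInterval) {n m : Fin 4} (h : n < m) :
    ∫ c, coinInd n c * coinInd m c ∂slotLaw p = p n * p m := by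
  have := integral_slotLaw_prod p fun k b => if k = n ∨ k = m then (if b = true then 1 else 0) else 1
  have e : ∀ c : Coins, coinInd n c * coinInd m c =
      ∏ k, (if k = n ∨ k = m then (if c k = true then (1 : ℝ) else 0) else 1) := by
    intro c
    unfold coinInd
    fin_cases n <;> fin_cases m <;> simp_all [Fin.prod_univ_four]
  simp only [e, this]
  fin_cases n <;> fin_cases m <;> simp_all [Fin.prod_univ_four]

end Coins

section FinitePower

variable {sel : Finset (Fin 6) → (Fin 6 → ℝ) → Fin 6} {η : ℝ} {w : Weights} {c : Coins}
  {s : Gain}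

lemma metric_zero_nonneg (hw : InBox η w) (h1 : 0 < s.1) : 0 ≤ metric η w s 0 := by
  have := waterfilling_le (α := η - w.μ₁) hw.2.2 h1 le_rfl
  rw [zero_mul, cap_zero, mul_zero, mul_zero, sub_zero] at this
  exact this

lemma metric_one_nonneg (hw : InBox η w) (h2 : 0 < s.2) : 0 ≤ metric η w s 1 := by
  have := waterfilling_le (α := 1 - η - w.μ₂) hw.2.2 h2 le_rfl
  rw [zero_mul, cap_zero, mul_zero, mul_zero, sub_zero] at this
  exact this

lemma metric_mode_nonneg (hsel : IsArgMax sel) (hw : InBox η w) (h1 : 0 < s.1) (h2 : 0 < s.2) :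
    0 ≤ metric η w s (mode sel η w c s) := by
  by_cases hS : w.μ₁ = 0 ∧ w.μ₂ ≠ 0
  · exact (metric_one_nonneg hw h2).trans
      (metric_le_mode η w c s hsel ((mem_candidates_S1 hS 1).2 (by simp)))
  · refine (metric_zero_nonneg hw h1).trans (metric_le_mode η w c s hsel ?_)
    by_cases hS' : w.μ₁ ≠ 0 ∧ w.μ₂ = 0
    · exact (mem_candidates_S2 hS' 0).2 (by simp)
    · exact (mem_candidates_S0 hS hS' 0).2 (by simp)

lemma cap_mul_le_eps {ε p σ : ℝ} (hε : 0 < ε) (hp : 0 ≤ p) (hσ : 0 ≤ σ) :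
    cap (p * σ) ≤ (ε * p + σ / ε) / Real.log 2 := by
  have := cap_mul_le (x := ε * p) (y := σ / ε) (by positivity) (by positivity)
  rwa [show ε * p * (σ / ε) = p * σ by field_simp] at this

/-- A power whose cost is covered by the rates is at most linear in the gains. -/
lemma power_le_of_cost_le {γ α β p q σ τ : ℝ} (hγ : 0 < γ) (hα' : α ≤ 1) (hβ' : β ≤ 1)
    (hp : 0 ≤ p) (hq : 0 ≤ q) (hσ : 0 ≤ σ) (hτ : 0 ≤ τ)
    (h : γ * (p + q) ≤ α * cap (p * σ) + β * cap (q * τ)) :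
    p + q ≤ 4 / (γ * Real.log 2) ^ 2 * (σ + τ) := by
  have hl := log_two_pos
  have hG : 0 < γ * Real.log 2 := mul_pos hγ hl
  have hε : 0 < γ * Real.log 2 / 2 := by positivity
  have e1 := cap_mul_le_eps hε hp hσ
  have e2 := cap_mul_le_eps hε hq hτ
  have n1 := cap_nonneg (mul_nonneg hp hσ)
  have n2 := cap_nonneg (mul_nonneg hq hτ)
  rw [le_div_iff₀ hl] at e1 e2
  have f1 : α * cap (p * σ) ≤ cap (p * σ) := mul_le_of_le_one_left n1 hα'
  have f2 : β * cap (q * τ) ≤ cap (q * τ) := mul_le_of_le_one_left n2 hβ'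
  have h1 : γ * (p + q) * Real.log 2 ≤ (cap (p * σ) + cap (q * τ)) * Real.log 2 :=
    mul_le_mul_of_nonneg_right (by linarith) hl.le
  have h2 : γ * Real.log 2 / 2 * (p + q) ≤ (σ + τ) / (γ * Real.log 2 / 2) := by
    rw [add_div]
    linarith
  rw [le_div_iff₀ hε] at h2
  rw [div_mul_eq_mul_div, le_div_iff₀ (by positivity)]
  linarith

lemma power_total_le (hsel : IsArgMax sel) (hη : 0 < η ∧ η < 1) (hw : InBox η w) (h1 : 0 < s.1)
    (h2 : 0 < s.2) :
    (protocol sel η w c s).power₁ + (protocol sel η w c s).power₂ +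
      (protocol sel η w c s).powerr ≤ 8 / (w.γ * Real.log 2) ^ 2 * (s.1 + s.2) := by
  have hm := metric_mode_nonneg (c := c) hsel hw h1 h2
  obtain ⟨⟨m1, m1'⟩, ⟨m2, m2'⟩, hγ⟩ := hw
  obtain ⟨hη0, hη1⟩ := hη
  rw [protocol_power₁, protocol_power₂, protocol_powerr]
  have hd : 0 ≤ decOrder η w ∧ decOrder η w ≤ 1 := by
    rcases decOrder_eq η w with h | h <;> rw [h] <;> norm_num
  have hK : 0 ≤ 4 / (w.γ * Real.log 2) ^ 2 := by positivity
  have hK2 : 8 / (w.γ * Real.log 2) ^ 2 = 2 * (4 / (w.γ * Real.log 2) ^ 2) := by ring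
  rw [hK2]
  set K := 4 / (w.γ * Real.log 2) ^ 2
  have hs1 := mul_nonneg hK h1.le
  have hs2 := mul_nonneg hK h2.le
  have hA : 0 ≤ η - w.μ₁ := by linarith
  have hB : 0 ≤ 1 - η - w.μ₂ := by linarith
  have hone : ∀ {α p σ : ℝ}, α ≤ 1 → 0 ≤ p → 0 ≤ σ → w.γ * p ≤ α * cap (p * σ) →
      p ≤ K * σ := by
    intro α p σ a2 a3 a4 a5
    have := power_le_of_cost_le (β := 0) (q := 0) (τ := 0) hγ a2 zero_le_one a3 le_rfl a4
      le_rfl (by simpa using a5)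
    simpa using this
  generalize mode sel η w c s = k at hm
  fin_cases k <;> simp [metric] at hm ⊢
  · have := hone (by linarith) (power1M1_nonneg η w s) h1.le hm
    linarith
  · have := hone (by linarith) (power2M2_nonneg η w s) h2.le hm
    linarith
  · have e1 := mul_le_mul_of_nonneg_left (macRate₁_le hd (power1M3_nonneg η w s)
      (power2M3_nonneg η w s) h1.le h2.le) hA
    have e2 := mul_le_mul_of_nonneg_left (macRate₂_le hd (power1M3_nonneg η w s)
      (power2M3_nonneg η w s) h1.le h2.le) hB
    unfold C12r C21r at hm
    have := power_le_of_cost_le (α := η - w.μ₁) (β := 1 - η - w.μ₂) hγ (by linarith) (by linarith) (power1M3_nonneg η w s)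
      (power2M3_nonneg η w s) h1.le h2.le (by linarith)
    linarith
  · have := hone (by linarith) (powerrM4_nonneg w s) h1.le hm
    linarith
  · have := hone (by linarith) (powerrM5_nonneg w s) h2.le hm
    linarith
  · unfold Cr1 Cr2 at hm
    have hP := powerrM6_nonneg w s
    have c1 : cap (powerrM6 w s * s.1) ≤ cap (powerrM6 w s * (s.1 + s.2)) :=
      cap_mono (mul_nonneg hP h1.le) (mul_le_mul_of_nonneg_left (by linarith) hP)
    have c2 : cap (powerrM6 w s * s.2) ≤ cap (powerrM6 w s * (s.1 + s.2)) :=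
      cap_mono (mul_nonneg hP h2.le) (mul_le_mul_of_nonneg_left (by linarith) hP)
    have := hone (α := w.μ₁ + w.μ₂) (by linarith) hP (add_nonneg h1.le h2.le) (by
      nlinarith)
    linarith

/-- In the box, the powers of the protocol have finite means. -/
lemma hasFinitePower_protocol {ν : Measure Gain} (hν : IsGainLaw ν) {κ : Measure Coins}
    [IsProbabilityMeasure κ] (hsel : IsArgMax sel) (hη : 0 < η ∧ η < 1) (hw : InBox η w) :
    HasFinitePower (ν.prod κ) fun z => protocol sel η w z.2 z.1 := by
  have := hν.prob
  have hpol := isPolicy_protocol η w hsel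
  have hint : Integrable (fun z : Gain × Coins => 8 / (w.γ * Real.log 2) ^ 2 * (z.1.1 + z.1.2))
      (ν.prod κ) := ((hν.int₁.add hν.int₂).comp_fst κ).const_mul _
  have hadm := fun z : Gain × Coins => protocol_admissible sel η w z.2 z.1
  have key : ∀ f : Gain × Coins → ℝ, Measurable f → (∀ z, 0 ≤ f z ∧ f z ≤
      (protocol sel η w z.2 z.1).power₁ + (protocol sel η w z.2 z.1).power₂ +
        (protocol sel η w z.2 z.1).powerr) → Integrable f (ν.prod κ) := by
    intro f hf hle
    refine hint.mono' hf.aestronglyMeasurable ?_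
    filter_upwards [hν.ae_pos (κ := κ)] with z hz
    rw [Real.norm_of_nonneg (hle z).1]
    exact (hle z).2.trans (power_total_le hsel hη hw hz.1 hz.2)
  refine ⟨key _ hpol.power₁ fun z => ?_, key _ hpol.power₂ fun z => ?_,
    key _ hpol.powerr fun z => ?_⟩ <;>
  · have a1 := (hadm z).power₁_nonneg
    have a2 := (hadm z).power₂_nonneg
    have a3 := (hadm z).powerr_nonneg
    constructor <;> linarith

end FinitePower

section Optimal

variable {Ω : Type*} [MeasurableSpace Ω] {P : Measure Ω} [IsProbabilityMeasure P]
  {S : ℕ → Ω → Gain} {sel : Finset (Fin 6) → (Fin 6 → ℝ) → Fin 6} {η Pt : ℝ} {w w' : Weights}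
  {p p' : Fin 4 → unitInterval}

lemma isOptimalWith_of_best (hS : IsFadingChannel P S) (hsel : IsArgMax sel)
    (hf : IsStatFeasible Pt ((P.map (S 0)).prod (slotLaw p)) fun z => protocol sel η w z.2 z.1)
    (hb : ∀ᵐ z ∂(P.map (S 0)).prod (slotLaw p), w.Best η z.1 (protocol sel η w z.2 z.1)) :
    IsOptimalWith P S sel η Pt w p :=
  ae_isSolution_of_best hS (isPolicy_protocol η w hsel) hf hb

/-- What optimality of the protocol means for the stationary problem. -/
structure OptimalFacts (ν : Measure Gain) (sel : Finset (Fin 6) → (Fin 6 → ℝ) → Fin 6) (η Pt : ℝ)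
    (w : Weights) (κ : Measure Coins) : Prop where
  feasible : IsStatFeasible Pt (ν.prod κ) fun z => protocol sel η w z.2 z.1
  value_pos : 0 < value η (ν.prod κ) fun z => protocol sel η w z.2 z.1
  opt : ∀ (D' : Type) [MeasurableSpace D'] (κ' : Measure D') [IsProbabilityMeasure κ']
    (π' : Gain × D' → Action), IsPolicy π' → IsStatFeasible Pt (ν.prod κ') π' →
    value η (ν.prod κ') π' ≤ value η (ν.prod κ) fun z => protocol sel η w z.2 z.1
  inBox : InBox η w
  best : ∀ᵐ z ∂ν.prod κ, w.Best η z.1 (protocol sel η w z.2 z.1)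
  region : ∃ r, w.InRegion r

lemma IsOptimalWith.facts (hS : IsFadingChannel P S) (hsel : IsArgMax sel) (hη : 0 < η ∧ η < 1)
    (hPt : 0 < Pt) (h : IsOptimalWith P S sel η Pt w p) :
    OptimalFacts (P.map (S 0)) sel η Pt w (slotLaw p) := by
  have hν := hS.isGainLaw
  have hpol := isPolicy_protocol η w hsel
  obtain ⟨hf, hopt⟩ := value_le_of_ae_isSolution (κ := slotLaw p) hS hpol h
  obtain ⟨v, hv, hb⟩ := exists_weights_best hν hη hPt hpol hf hopt
  obtain ⟨π, hπ, hπf, hπv⟩ := exists_value_pos hν hη hPt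
  have hval := hπv.trans_le (hopt Unit _ π hπ hπf)
  obtain ⟨h1, h2, r, hr, -⟩ := identify hν hη hsel hf hval hv hb
  exact ⟨hf, hval, hopt, h1, h2, r, hr⟩

/-- The expected Lagrangian of any policy is at most that of a policy that maximizes it in almost
every slot. -/
lemma integral_lagr_le_of_best {ν : Measure Gain} (hν : IsGainLaw ν) {D D' : Type*}
    [MeasurableSpace D] [MeasurableSpace D'] {κ : Measure D} [IsProbabilityMeasure κ]
    {κ' : Measure D'} [IsProbabilityMeasure κ'] {x : Gain × D → Action} {y : Gain × D' → Action}
    (hx : IsPolicy x) (hxf : HasFinitePower (ν.prod κ) x) (hy : IsPolicy y)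
    (hyf : HasFinitePower (ν.prod κ') y) (hb : ∀ᵐ z ∂ν.prod κ', w.Best η z.1 (y z)) :
    ∫ z, w.lagr η z.1 (x z) ∂ν.prod κ ≤ ∫ z, w.lagr η z.1 (y z) ∂ν.prod κ' := by
  have := hν.prob
  have ix : Integrable (fun z => w.lagr η z.1 (x z)) (ν.prod κ) :=
    hx.integrable_lagrangian hν hxf _ _ _ _ _
  have iy : Integrable (fun z => w.lagr η z.1 (y z)) (ν.prod κ') :=
    hy.integrable_lagrangian hν hyf _ _ _ _ _
  rw [integral_prod _ ix, integral_prod _ iy]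
  refine integral_mono_ae ix.integral_prod_left iy.integral_prod_left ?_
  filter_upwards [Measure.ae_ae_of_ae_prod hb, ix.prod_right_ae, iy.prod_right_ae] with s h1 h2 h3
  have hle : ∀ d, w.lagr η s (x (s, d)) ≤ ∫ d', w.lagr η s (y (s, d')) ∂κ' := by
    intro d
    have := integral_mono_ae (integrable_const (w.lagr η s (x (s, d)))) h3
      (h1.mono fun d' hd' => hd' _ (hx.admissible (s, d)))
    simpa using this
  have := integral_mono h2 (integrable_const (∫ d', w.lagr η s (y (s, d')) ∂κ')) hle
  simpa using this

/-- Optimal weights lie in the same selection region. -/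
theorem OptimalFacts.region_eq {ν : Measure Gain} {κ κ' : Measure Coins} [IsProbabilityMeasure κ]
    [IsProbabilityMeasure κ'] (hν : IsGainLaw ν) (hsel : IsArgMax sel) (hη : 0 < η ∧ η < 1)
    (h : OptimalFacts ν sel η Pt w κ) (h' : OptimalFacts ν sel η Pt w' κ') {r r' : Region}
    (hr : w.InRegion r) (hr' : w'.InRegion r') : r = r' := by
  have hpol := isPolicy_protocol η w hsel
  have hpol' := isPolicy_protocol η w' hsel
  have hval : value η (ν.prod κ) (fun z => protocol sel η w z.2 z.1) =
      value η (ν.prod κ') (fun z => protocol sel η w' z.2 z.1) :=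
    le_antisymm (h'.opt Coins κ _ hpol h.feasible) (h.opt Coins κ' _ hpol' h'.feasible)
  have hb : ∀ᵐ z ∂ν.prod κ, w'.Best η z.1 (protocol sel η w z.2 z.1) := by
    refine ae_isBest_of_integral_le hν hpol h.feasible.finite fun π hπ hπf => ?_
    have e1 := integral_lagr_le_of_best (w := w') (η := η) hν hπ hπf hpol' h'.feasible.finite
      h'.best
    rw [h'.feasible.integral_lagr hpol' hν, ← hval, ← h.feasible.integral_lagr hpol hν η w'] at e1
    exact e1
  obtain ⟨-, -, r₀, h1, h2⟩ := identify hν hη hsel h.feasible h.value_pos h'.inBox.2.2 hb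
  exact (hr.eq h1).trans ((h2 h'.inBox).eq hr')

end Optimal

/-! ### Ties between selection metrics -/

section MacStrict

variable {A B G σ τ : ℝ}

lemma log_lt_log_add {x y : ℝ} (hx : 0 < x) (hy : 0 < y) (hne : x ≠ y) :
    Real.log x < Real.log y + (x - y) / y := by
  have := Real.log_lt_sub_one_of_pos (div_pos hx hy) (by rwa [ne_eq, div_eq_one_iff_eq hy.ne'])
  rw [Real.log_div hx.ne' hy.ne'] at this
  have e : x / y - 1 = (x - y) / y := by field_simp
  linarith

/-- An interior stationary point of the multiple-access mode is the unique maximizer. -/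
lemma macLagr_lt (hA : 0 < A) (hAB : A ≤ B) (hG : 0 < G) (hσ : 0 < σ) (hτ : 0 < τ) (hne : σ ≠ τ)
    {P Q p q : ℝ} (hP : 0 < P) (hQ : 0 < Q) (hp : 0 ≤ p) (hq : 0 ≤ q)
    (e₁ : A * σ = G * (1 + P * σ + Q * τ)) (e₂ : (B - A) * τ * σ = G * (σ - τ) * (1 + Q * τ))
    (h : ¬(p = P ∧ q = Q)) : macLagr A B G σ τ p q < macLagr A B G σ τ P Q := by
  have hx : 0 < 1 + P * σ + Q * τ := by positivity
  have hy : 0 < 1 + Q * τ := by positivity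
  have hx' : 0 < 1 + p * σ + q * τ := by positivity
  have hy' : 0 < 1 + q * τ := by positivity
  have hBA : 0 < B - A := by
    refine lt_of_le_of_ne (sub_nonneg.2 hAB) fun h0 => ?_
    rw [← h0, zero_mul, zero_mul] at e₂
    exact mul_ne_zero (mul_ne_zero hG.ne' (sub_ne_zero.2 hne)) hy.ne' e₂.symm
  have f1 : A / (1 + P * σ + Q * τ) = G / σ := by
    rw [div_eq_div_iff hx.ne' hσ.ne']; linarith
  have f2 : (B - A) / (1 + Q * τ) = G * (σ - τ) / (τ * σ) := by
    rw [div_eq_div_iff hy.ne' (mul_pos hτ hσ).ne']; linarith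
  have key : A * ((1 + p * σ + q * τ - (1 + P * σ + Q * τ)) / (1 + P * σ + Q * τ)) +
      (B - A) * ((1 + q * τ - (1 + Q * τ)) / (1 + Q * τ)) = G * (p + q - P - Q) := by
    have : A * ((1 + p * σ + q * τ - (1 + P * σ + Q * τ)) / (1 + P * σ + Q * τ)) +
      (B - A) * ((1 + q * τ - (1 + Q * τ)) / (1 + Q * τ)) =
      A / (1 + P * σ + Q * τ) * ((p - P) * σ + (q - Q) * τ) +
        (B - A) / (1 + Q * τ) * ((q - Q) * τ) := by ring
    rw [this, f1, f2]
    field_simp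
    ring
  have key2 : A * Real.log (1 + p * σ + q * τ) + (B - A) * Real.log (1 + q * τ) <
      A * Real.log (1 + P * σ + Q * τ) + (B - A) * Real.log (1 + Q * τ) +
        G * (p + q - P - Q) := by
    rw [← key]
    have t1 := mul_le_mul_of_nonneg_left (log_le_log_add hx' hx) hA.le
    have t2 := mul_le_mul_of_nonneg_left (log_le_log_add hy' hy) hBA.le
    by_cases hq' : 1 + q * τ = 1 + Q * τ
    · have hqQ : q = Q := mul_right_cancel₀ hτ.ne' (by linarith)
      have hpP : 1 + p * σ + q * τ ≠ 1 + P * σ + Q * τ := by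
        intro h'
        exact h ⟨mul_right_cancel₀ hσ.ne' (by linarith), hqQ⟩
      have t1' := mul_lt_mul_of_pos_left (log_lt_log_add hx' hx hpP) hA
      linarith
    · have t2' := mul_lt_mul_of_pos_left (log_lt_log_add hy' hy hq') hBA
      linarith
  unfold macLagr
  linarith

lemma macLagr_lt_of_lt_right (hA : 0 < A) (hAB : A ≤ B) (hσ : 0 < σ) (hτ : 0 < τ) {τ' p q : ℝ}
    (hp : 0 ≤ p) (hq : 0 < q) (h : τ < τ') : macLagr A B G σ τ p q < macLagr A B G σ τ' p q := by
  have hqτ := mul_lt_mul_of_pos_left h hq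
  have h1 := mul_lt_mul_of_pos_left (Real.log_lt_log (show 0 < 1 + p * σ + q * τ by positivity)
    (show 1 + p * σ + q * τ < 1 + p * σ + q * τ' by linarith)) hA
  have h2 := mul_le_mul_of_nonneg_left (Real.log_le_log (show 0 < 1 + q * τ by positivity)
    (show 1 + q * τ ≤ 1 + q * τ' by linarith)) (sub_nonneg.2 hAB)
  unfold macLagr
  linarith

lemma macLagr_lt_of_lt_left (hA : 0 < A) (hσ : 0 < σ) (hτ : 0 < τ) {σ' p q : ℝ}
    (hp : 0 < p) (hq : 0 ≤ q) (h : σ < σ') : macLagr A B G σ τ p q < macLagr A B G σ' τ p q := by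
  have hqτ := mul_lt_mul_of_pos_left h hp
  have h1 := mul_lt_mul_of_pos_left (Real.log_lt_log (show 0 < 1 + p * σ + q * τ by positivity)
    (show 1 + p * σ + q * τ < 1 + p * σ' + q * τ by linarith)) hA
  unfold macLagr
  linarith

end MacStrict

section Slot

variable {η : ℝ} {w : Weights} {s : Gain}

/-- The objective of the multiple-access mode for the decoding order of the protocol. -/
noncomputable def macObjective (η : ℝ) (w : Weights) (p q : ℝ) (s : Gain) : ℝ :=
  (η - w.μ₁) * macRate₁ (decOrder η w) p q s + (1 - η - w.μ₂) * macRate₂ (decOrder η w) p q s -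
    w.γ * (p + q)

lemma metric_two_eq_macObjective :
    metric η w s 2 = macObjective η w (power1M3 η w s) (power2M3 η w s) s := rfl

lemma macObjective_of_le (h1 : 0 < s.1) (h2 : 0 < s.2) (h : η - w.μ₁ ≤ 1 - η - w.μ₂) {p q : ℝ}
    (hp : 0 ≤ p) (hq : 0 ≤ q) : macObjective η w p q s =
      macLagr (η - w.μ₁) (1 - η - w.μ₂) (w.γ * Real.log 2) s.1 s.2 p q / Real.log 2 := by
  rw [macObjective, decOrder, if_pos h, macLagr_zero hp hq h1.le h2.le]

lemma macObjective_of_not_le (h1 : 0 < s.1) (h2 : 0 < s.2) (h : ¬η - w.μ₁ ≤ 1 - η - w.μ₂)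
    {p q : ℝ} (hp : 0 ≤ p) (hq : 0 ≤ q) : macObjective η w p q s =
      macLagr (1 - η - w.μ₂) (η - w.μ₁) (w.γ * Real.log 2) s.2 s.1 q p / Real.log 2 := by
  rw [macObjective, decOrder, if_neg h, macLagr_one hp hq h1.le h2.le]

lemma macObjective_zero_right {p : ℝ} :
    macObjective η w p 0 s = (η - w.μ₁) * cap (p * s.1) - w.γ * p := by
  rw [macObjective, macRate₁_zero_right, macRate₂_zero_right]; ring

lemma macObjective_zero_left {q : ℝ} :
    macObjective η w 0 q s = (1 - η - w.μ₂) * cap (q * s.2) - w.γ * q := by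
  rw [macObjective, macRate₁_zero_left, macRate₂_zero_left]; ring

lemma macObjective_lt (hw : InBox η w) (h1 : 0 < s.1) (h2 : 0 < s.2) (hne : s.1 ≠ s.2)
    (hP : 0 < power1M3 η w s) (hQ : 0 < power2M3 η w s) {p q : ℝ} (hp : 0 ≤ p) (hq : 0 ≤ q)
    (h : ¬(p = power1M3 η w s ∧ q = power2M3 η w s)) :
    macObjective η w p q s < metric η w s 2 := by
  have hl := log_two_pos
  have hA : 0 < η - w.μ₁ := sub_pos.2 hw.1.2
  have hB : 0 < 1 - η - w.μ₂ := sub_pos.2 hw.2.1.2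
  have hG : 0 < w.γ * Real.log 2 := mul_pos hw.2.2 hl
  rw [metric_two_eq_macObjective]
  by_cases hAB : η - w.μ₁ ≤ 1 - η - w.μ₂
  · obtain ⟨e1, e2⟩ := mac_stationary hG.ne' h1 h2 hne
      (p := power1M3 η w s) (q := power2M3 η w s) (by
        rw [power1M3_of_le hAB] at hP ⊢
        exact max_eq_left ((lt_max_iff.1 hP).resolve_right (lt_irrefl 0)).le) (by
        rw [power2M3_of_le hAB] at hQ ⊢
        exact max_eq_left ((lt_max_iff.1 hQ).resolve_right (lt_irrefl 0)).le)
    rw [macObjective_of_le h1 h2 hAB hp hq, macObjective_of_le h1 h2 hAB hP.le hQ.le,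
      div_lt_div_iff_of_pos_right hl]
    exact macLagr_lt hA hAB hG h1 h2 hne hP hQ hp hq e1 e2 h
  · obtain ⟨e1, e2⟩ := mac_stationary hG.ne' h2 h1 hne.symm
      (p := power2M3 η w s) (q := power1M3 η w s) (by
        rw [power2M3_of_not_le hAB] at hQ ⊢
        exact max_eq_left ((lt_max_iff.1 hQ).resolve_right (lt_irrefl 0)).le) (by
        rw [power1M3_of_not_le hAB] at hP ⊢
        exact max_eq_left ((lt_max_iff.1 hP).resolve_right (lt_irrefl 0)).le)
    rw [macObjective_of_not_le h1 h2 hAB hp hq, macObjective_of_not_le h1 h2 hAB hP.le hQ.le,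
      div_lt_div_iff_of_pos_right hl]
    exact macLagr_lt hB (not_le.1 hAB).le hG h2 h1 hne.symm hQ hP hq hp e1 e2
      fun h' => h ⟨h'.2, h'.1⟩

/-- If the multiple-access mode is selected, both users are active or none. -/
lemma power_pos_and_pos (hw : InBox η w) (hs : Generic η w w s)
    (m0 : metric η w s 0 ≤ metric η w s 2) (m1 : metric η w s 1 ≤ metric η w s 2)
    (h : 0 < power1M3 η w s ∨ 0 < power2M3 η w s) :
    0 < power1M3 η w s ∧ 0 < power2M3 η w s := by
  have hP := power1M3_nonneg η w s
  have hQ := power2M3_nonneg η w s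
  rcases hQ.eq_or_lt with hQ0 | hQ0
  · exfalso
    have hP0 := h.resolve_right (by rw [← hQ0]; exact lt_irrefl 0)
    rw [metric_two_eq_macObjective, ← hQ0, macObjective_zero_right] at m0
    have e : power1M3 η w s = power1M1 η w s := by
      by_contra hne
      exact absurd (waterfilling_lt hw.2.2 hs.pos₁ hP hne) (not_lt.2 m0)
    refine hs.mac₁ ⟨hP0, ?_⟩
    rw [e] at hP0 ⊢
    exact max_eq_left ((lt_max_iff.1 hP0).resolve_right (lt_irrefl 0)).le
  rcases hP.eq_or_lt with hP0 | hP0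
  · exfalso
    rw [metric_two_eq_macObjective, ← hP0, macObjective_zero_left] at m1
    have e : power2M3 η w s = power2M2 η w s := by
      by_contra hne
      exact absurd (waterfilling_lt hw.2.2 hs.pos₂ hQ hne) (not_lt.2 m1)
    refine hs.mac₂ ⟨hQ0, ?_⟩
    rw [e] at hQ0 ⊢
    exact max_eq_left ((lt_max_iff.1 hQ0).resolve_right (lt_irrefl 0)).le
  exact ⟨hP0, hQ0⟩

/-- An active multiple-access mode beats the modes with a single active user. -/
lemma metric_lt_two (hw : InBox η w) (hs : Generic η w w s) (hP : 0 < power1M3 η w s)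
    (hQ : 0 < power2M3 η w s) :
    metric η w s 0 < metric η w s 2 ∧ metric η w s 1 < metric η w s 2 := by
  constructor
  · have := macObjective_lt hw hs.pos₁ hs.pos₂ hs.ne hP hQ (power1M1_nonneg η w s) le_rfl
      fun h => hQ.ne h.2
    rwa [macObjective_zero_right] at this
  · have := macObjective_lt hw hs.pos₁ hs.pos₂ hs.ne hP hQ le_rfl (power2M2_nonneg η w s)
      fun h => hP.ne h.1
    rwa [macObjective_zero_left] at this

lemma waterfilling_eq_zero {α γ σ : ℝ} (hγ : 0 < γ) (hσ : 0 < σ)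
    (h : α * cap (max (α / (γ * Real.log 2) - 1 / σ) 0 * σ) -
      γ * max (α / (γ * Real.log 2) - 1 / σ) 0 = 0) :
    max (α / (γ * Real.log 2) - 1 / σ) 0 = 0 := by
  by_contra hne
  have := waterfilling_lt hγ hσ le_rfl (Ne.symm hne)
  rw [zero_mul, cap_zero, mul_zero, mul_zero, sub_zero] at this
  exact this.ne' h

lemma power1M1_eq_zero (hw : InBox η w) (h1 : 0 < s.1) (h : metric η w s 0 = 0) :
    power1M1 η w s = 0 := waterfilling_eq_zero hw.2.2 h1 h

lemma power2M2_eq_zero (hw : InBox η w) (h2 : 0 < s.2) (h : metric η w s 1 = 0) :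
    power2M2 η w s = 0 := waterfilling_eq_zero hw.2.2 h2 h

lemma powerrM4_eq_zero (hw : InBox η w) (h1 : 0 < s.1) (h : metric η w s 3 = 0) :
    powerrM4 w s = 0 := waterfilling_eq_zero hw.2.2 h1 h

lemma powerrM5_eq_zero (hw : InBox η w) (h2 : 0 < s.2) (h : metric η w s 4 = 0) :
    powerrM5 w s = 0 := waterfilling_eq_zero hw.2.2 h2 h

lemma metric_two_eq_zero (hP : power1M3 η w s = 0) (hQ : power2M3 η w s = 0) :
    metric η w s 2 = 0 := by
  rw [metric_two_eq_macObjective, hP, hQ, macObjective_zero_right, zero_mul, cap_zero]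
  ring

end Slot

section Null

variable {ν : Measure Gain} {η : ℝ} {w : Weights}

lemma measurable_metric_apply (η : ℝ) (w : Weights) (k : Fin 6) :
    Measurable fun s => metric η w s k :=
  (measurable_pi_apply k).comp (measurable_metric η w)

lemma macObjective_lt_of_lt_snd (hw : InBox η w) {x y y' p q : ℝ} (hx : 0 < x) (hy : 0 < y)
    (h : y < y') (hp : 0 ≤ p) (hq : 0 < q) :
    macObjective η w p q (x, y) < macObjective η w p q (x, y') := by
  have hl := log_two_pos
  by_cases hAB : η - w.μ₁ ≤ 1 - η - w.μ₂
  · rw [macObjective_of_le (s := (x, y)) hx hy hAB hp hq.le,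
      macObjective_of_le (s := (x, y')) hx (hy.trans h) hAB hp hq.le, div_lt_div_iff_of_pos_right hl]
    exact macLagr_lt_of_lt_right (sub_pos.2 hw.1.2) hAB hx hy hp hq h
  · rw [macObjective_of_not_le (s := (x, y)) hx hy hAB hp hq.le,
      macObjective_of_not_le (s := (x, y')) hx (hy.trans h) hAB hp hq.le,
      div_lt_div_iff_of_pos_right hl]
    exact macLagr_lt_of_lt_left (sub_pos.2 hw.2.1.2) hy hx hq hp h

lemma macObjective_lt_of_lt_fst (hw : InBox η w) {x x' y p q : ℝ} (hx : 0 < x) (hy : 0 < y)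
    (h : x < x') (hp : 0 < p) (hq : 0 ≤ q) :
    macObjective η w p q (x, y) < macObjective η w p q (x', y) := by
  have hl := log_two_pos
  by_cases hAB : η - w.μ₁ ≤ 1 - η - w.μ₂
  · rw [macObjective_of_le (s := (x, y)) hx hy hAB hp.le hq,
      macObjective_of_le (s := (x', y)) (hx.trans h) hy hAB hp.le hq, div_lt_div_iff_of_pos_right hl]
    exact macLagr_lt_of_lt_left (sub_pos.2 hw.1.2) hx hy hp hq h
  · rw [macObjective_of_not_le (s := (x, y)) hx hy hAB hp.le hq,
      macObjective_of_not_le (s := (x', y)) (hx.trans h) hy hAB hp.le hq,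
      div_lt_div_iff_of_pos_right hl]
    exact macLagr_lt_of_lt_right (sub_pos.2 hw.2.1.2) (not_le.1 hAB).le hy hx hq hp h

lemma macObjective_le (hw : InBox η w) {s : Gain} (h1 : 0 < s.1) (h2 : 0 < s.2) (hne : s.1 ≠ s.2)
    (m0 : metric η w s 0 ≤ metric η w s 2) (m1 : metric η w s 1 ≤ metric η w s 2) {p q : ℝ}
    (hp : 0 ≤ p) (hq : 0 ≤ q) : macObjective η w p q s ≤ metric η w s 2 :=
  mac_le hw h1 h2 hne m0 m1 le_rfl (decOrder_eq η w) hp hq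

lemma eq_of_forall_not_lt {p : ℝ → Prop} (h : ∀ y y', p y → p y' → ¬y < y') {y y' : ℝ} (hy : p y)
    (hy' : p y') : y = y' :=
  le_antisymm (not_lt.1 (h _ _ hy' hy)) (not_lt.1 (h _ _ hy hy'))

lemma IsGainLaw.ae_metric_one_ne (hν : IsGainLaw ν) (hw : InBox η w) {F : ℝ → ℝ}
    (hF : Measurable F) :
    ∀ᵐ s ∂ν, ¬(0 < power2M2 η w s ∧ metric η w s 1 = F s.1) := by
  set E : Set Gain := {s : Gain | 0 < s.2 ∧ 0 < power2M2 η w s ∧ metric η w s 1 = F s.1}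
    with hEdef
  have hE : MeasurableSet E :=
    (measurableSet_lt measurable_const measurable_snd).inter
      ((measurableSet_lt measurable_const (measurable_power2M2 η w)).inter
        (measurableSet_eq_fun (measurable_metric_apply η w 1) (hF.comp measurable_fst)))
  have hlt : ∀ x y y', (x, y) ∈ E → (x, y') ∈ E → ¬y < y' := by
    rintro x y y' ⟨h1, h2, h3⟩ ⟨h1', -, h3'⟩ hlt
    simp only at h1 h1' h3 h3'
    have e1 := waterfilling_le (α := 1 - η - w.μ₂) hw.2.2 h1' h2.le
    have e2 : cap (power2M2 η w (x, y) * y) < cap (power2M2 η w (x, y) * y') := by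
      rw [cap_eq, cap_eq, div_lt_div_iff_of_pos_right log_two_pos]
      refine Real.log_lt_log (by positivity) ?_
      have := mul_lt_mul_of_pos_left hlt h2
      linarith
    have e3 := mul_lt_mul_of_pos_left e2 (sub_pos.2 hw.2.1.2)
    have e4 : metric η w (x, y) 1 < metric η w (x, y') 1 := by
      refine lt_of_lt_of_le ?_ e1
      show (1 - η - w.μ₂) * cap (power2M2 η w (x, y) * y) - w.γ * power2M2 η w (x, y) < _
      linarith
    rw [h3, h3'] at e4
    exact lt_irrefl _ e4
  filter_upwards [hν.pos, hν.ae_notMem_of_subsingleton_right hE fun x y y' h h' =>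
    eq_of_forall_not_lt (p := fun y => (x, y) ∈ E) (hlt x) h h'] with s h1 h2 h3
  exact h2 ⟨h1.2, h3⟩

lemma IsGainLaw.ae_metric_zero_ne (hν : IsGainLaw ν) (hw : InBox η w) {F : ℝ → ℝ}
    (hF : Measurable F) :
    ∀ᵐ s ∂ν, ¬(0 < power1M1 η w s ∧ metric η w s 0 = F s.2) := by
  set E : Set Gain := {s : Gain | 0 < s.1 ∧ 0 < power1M1 η w s ∧ metric η w s 0 = F s.2}
    with hEdef
  have hE : MeasurableSet E :=
    (measurableSet_lt measurable_const measurable_fst).inter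
      ((measurableSet_lt measurable_const (measurable_power1M1 η w)).inter
        (measurableSet_eq_fun (measurable_metric_apply η w 0) (hF.comp measurable_snd)))
  have hlt : ∀ y x x', (x, y) ∈ E → (x', y) ∈ E → ¬x < x' := by
    rintro y x x' ⟨h1, h2, h3⟩ ⟨h1', -, h3'⟩ hlt
    simp only at h1 h1' h3 h3'
    have e1 := waterfilling_le (α := η - w.μ₁) hw.2.2 h1' h2.le
    have e2 : cap (power1M1 η w (x, y) * x) < cap (power1M1 η w (x, y) * x') := by
      rw [cap_eq, cap_eq, div_lt_div_iff_of_pos_right log_two_pos]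
      refine Real.log_lt_log (by positivity) ?_
      have := mul_lt_mul_of_pos_left hlt h2
      linarith
    have e3 := mul_lt_mul_of_pos_left e2 (sub_pos.2 hw.1.2)
    have e4 : metric η w (x, y) 0 < metric η w (x', y) 0 := by
      refine lt_of_lt_of_le ?_ e1
      show (η - w.μ₁) * cap (power1M1 η w (x, y) * x) - w.γ * power1M1 η w (x, y) < _
      linarith
    rw [h3, h3'] at e4
    exact lt_irrefl _ e4
  filter_upwards [hν.pos, hν.ae_notMem_of_subsingleton_left hE fun x x' y h h' =>
    eq_of_forall_not_lt (p := fun x => (x, y) ∈ E) (hlt y) h h'] with s h1 h2 h3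
  exact h2 ⟨h1.1, h3⟩

lemma IsGainLaw.ae_metric_two_ne_fst (hν : IsGainLaw ν) (hw : InBox η w) {F : ℝ → ℝ}
    (hF : Measurable F) :
    ∀ᵐ s ∂ν, ¬(0 < power2M3 η w s ∧ metric η w s 0 ≤ metric η w s 2 ∧
      metric η w s 1 ≤ metric η w s 2 ∧ metric η w s 2 = F s.1) := by
  set E : Set Gain := {s : Gain | (0 < s.1 ∧ 0 < s.2 ∧ s.1 ≠ s.2) ∧ 0 < power2M3 η w s ∧
    metric η w s 0 ≤ metric η w s 2 ∧ metric η w s 1 ≤ metric η w s 2 ∧ metric η w s 2 = F s.1}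
    with hEdef
  have hm := measurable_metric_apply η w
  have hE : MeasurableSet E :=
    ((measurableSet_lt measurable_const measurable_fst).inter
      ((measurableSet_lt measurable_const measurable_snd).inter
        (measurableSet_eq_fun measurable_fst measurable_snd).compl)).inter
      ((measurableSet_lt measurable_const (measurable_power2M3 η w)).inter
        ((measurableSet_le (hm 0) (hm 2)).inter ((measurableSet_le (hm 1) (hm 2)).inter
          (measurableSet_eq_fun (hm 2) (hF.comp measurable_fst)))))
  have hlt : ∀ x y y', (x, y) ∈ E → (x, y') ∈ E → ¬y < y' := by
    rintro x y y' ⟨⟨h1, h2, -⟩, h3, -, -, h4⟩ ⟨⟨-, h2', hne⟩, -, m0, m1, h4'⟩ hlt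
    have e1 := macObjective_lt_of_lt_snd hw h1 h2 hlt (power1M3_nonneg η w (x, y)) h3
    have e2 := macObjective_le hw (s := (x, y')) h1 h2' hne m0 m1 (power1M3_nonneg η w (x, y)) h3.le
    have e3 := e1.trans_le e2
    rw [← metric_two_eq_macObjective, h4, h4'] at e3
    exact lt_irrefl _ e3
  filter_upwards [hν.pos, hν.ae_ne, hν.ae_notMem_of_subsingleton_right hE fun x y y' h h' =>
    eq_of_forall_not_lt (p := fun y => (x, y) ∈ E) (hlt x) h h'] with s h1 h2 h3 h4
  exact h3 ⟨⟨h1.1, h1.2, h2⟩, h4⟩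

lemma IsGainLaw.ae_metric_two_ne_snd (hν : IsGainLaw ν) (hw : InBox η w) {F : ℝ → ℝ}
    (hF : Measurable F) :
    ∀ᵐ s ∂ν, ¬(0 < power1M3 η w s ∧ metric η w s 0 ≤ metric η w s 2 ∧
      metric η w s 1 ≤ metric η w s 2 ∧ metric η w s 2 = F s.2) := by
  set E : Set Gain := {s : Gain | (0 < s.1 ∧ 0 < s.2 ∧ s.1 ≠ s.2) ∧ 0 < power1M3 η w s ∧
    metric η w s 0 ≤ metric η w s 2 ∧ metric η w s 1 ≤ metric η w s 2 ∧ metric η w s 2 = F s.2}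
    with hEdef
  have hm := measurable_metric_apply η w
  have hE : MeasurableSet E :=
    ((measurableSet_lt measurable_const measurable_fst).inter
      ((measurableSet_lt measurable_const measurable_snd).inter
        (measurableSet_eq_fun measurable_fst measurable_snd).compl)).inter
      ((measurableSet_lt measurable_const (measurable_power1M3 η w)).inter
        ((measurableSet_le (hm 0) (hm 2)).inter ((measurableSet_le (hm 1) (hm 2)).inter
          (measurableSet_eq_fun (hm 2) (hF.comp measurable_snd)))))
  have hlt : ∀ y x x', (x, y) ∈ E → (x', y) ∈ E → ¬x < x' := by
    rintro y x x' ⟨⟨h1, h2, -⟩, h3, -, -, h4⟩ ⟨⟨h1', -, hne⟩, -, m0, m1, h4'⟩ hlt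
    have e1 := macObjective_lt_of_lt_fst hw h1 h2 hlt h3 (power2M3_nonneg η w (x, y))
    have e2 := macObjective_le hw (s := (x', y)) h1' h2 hne m0 m1 h3.le (power2M3_nonneg η w (x, y))
    have e3 := e1.trans_le e2
    rw [← metric_two_eq_macObjective, h4, h4'] at e3
    exact lt_irrefl _ e3
  filter_upwards [hν.pos, hν.ae_ne, hν.ae_notMem_of_subsingleton_left hE fun x x' y h h' =>
    eq_of_forall_not_lt (p := fun x => (x, y) ∈ E) (hlt y) h h'] with s h1 h2 h3 h4
  exact h3 ⟨⟨h1.1, h1.2, h2⟩, h4⟩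

end Null

/-! ### Expectations of gated quantities -/

section Gate

variable (sel : Finset (Fin 6) → (Fin 6 → ℝ) → Fin 6) (η : ℝ) (w : Weights) (c : Coins)

/-- The indicator of the selection of a mode in `K`. -/
noncomputable def gate (K : Finset (Fin 6)) (s : Gain) : ℝ :=
  if mode sel η w c s ∈ K then 1 else 0

lemma sum_q_eq_gate (K : Finset (Fin 6)) (s : Gain) :
    ∑ k ∈ K, (protocol sel η w c s).q k = gate sel η w c K s := by
  simp [protocol, gate]

variable {sel} (hsel : IsArgMax sel)

include hsel in
lemma measurable_gate (K : Finset (Fin 6)) : Measurable (gate sel η w c K) := by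
  have : gate sel η w c K = fun s => if mode sel η w c s ∈ K then 1 else 0 := rfl
  rw [this]
  exact Measurable.ite (measurable_mode η w c hsel (Set.to_countable (K : Set (Fin 6))).measurableSet)
    measurable_const measurable_const

variable {η w c}

include hsel in
/-- A rate or power that is bounded in terms of the power used is integrable after gating. -/
lemma integrable_gate_mul {ν : Measure Gain} (hν : IsGainLaw ν) (hη : 0 < η ∧ η < 1)
    (hw : InBox η w) {K : Finset (Fin 6)} {g : Gain → ℝ} (hg : Measurable g) (C : ℝ) (hC : 0 ≤ C)
    (h : ∀ s : Gain, 0 < s.1 → 0 < s.2 → mode sel η w c s ∈ K → 0 ≤ g s ∧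
      g s ≤ C * ((protocol sel η w c s).power₁ + (protocol sel η w c s).power₂ +
        (protocol sel η w c s).powerr + (s.1 + s.2))) :
    Integrable (fun s => gate sel η w c K s * g s) ν := by
  refine (((hν.int₁.add hν.int₂).const_mul (8 / (w.γ * Real.log 2) ^ 2 + 1)).const_mul C).mono'
    ((measurable_gate η w c hsel K).mul hg).aestronglyMeasurable ?_
  filter_upwards [hν.pos] with s hs
  have hT := power_total_le (c := c) hsel hη hw hs.1 hs.2
  have hs' : 0 ≤ s.1 + s.2 := add_nonneg hs.1.le hs.2.le
  simp only [Pi.add_apply]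
  unfold gate
  split_ifs with hk
  · obtain ⟨h0, h1⟩ := h s hs.1 hs.2 hk
    rw [one_mul, Real.norm_of_nonneg h0]
    refine h1.trans (mul_le_mul_of_nonneg_left ?_ hC)
    linarith
  · rw [zero_mul, norm_zero]
    positivity

end Gate

lemma integral_add_mul_coin {ν : Measure Gain} [IsProbabilityMeasure ν] {κ : Measure Coins}
    [IsProbabilityMeasure κ] {f g : Gain → ℝ} (hf : Integrable f ν) (hg : Integrable g ν)
    (φ : Coins → ℝ) :
    ∫ z, (f z.1 + g z.1 * φ z.2) ∂ν.prod κ = ∫ s, f s ∂ν + (∫ s, g s ∂ν) * ∫ c, φ c ∂κ := by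
  rw [integral_add (hf.comp_fst κ) (hg.mul_prod Integrable.of_finite), integral_prod_mul,
    integral_fun_fst]
  simp

section S1

variable {sel : Finset (Fin 6) → (Fin 6 → ℝ) → Fin 6} {η : ℝ} {w : Weights} {s : Gain}

/-- Gains for which ties between the groups `{M₁, M₄, M₆}`, `{M₂}`, `{M₃}` of modes occur with
vanishing powers only. -/
structure TieFreeS1 (η : ℝ) (w : Weights) (s : Gain) : Prop where
  gen : Generic η w w s
  tie₁ : metric η w s 0 ≤ metric η w s 2 → metric η w s 1 = metric η w s 2 →
    power2M2 η w s = 0 ∧ power1M3 η w s = 0 ∧ power2M3 η w s = 0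
  tie₂ : metric η w s 1 = metric η w s 3 → power2M2 η w s = 0 ∧ powerrM4 w s = 0
  tie₃ : metric η w s 0 ≤ metric η w s 2 → metric η w s 1 ≤ metric η w s 2 →
    metric η w s 2 = metric η w s 3 →
    power1M3 η w s = 0 ∧ power2M3 η w s = 0 ∧ powerrM4 w s = 0

lemma ae_tieFreeS1 {ν : Measure Gain} (hν : IsGainLaw ν) (hw : InBox η w) :
    ∀ᵐ s ∂ν, TieFreeS1 η w s := by
  set F : ℝ → ℝ := fun x => metric η w (x, 0) 3
  have hF : Measurable F :=
    (measurable_metric_apply η w 3).comp (measurable_id.prodMk measurable_const)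
  filter_upwards [hν.ae_generic η w w hw.2.2, hν.ae_metric_one_ne hw hF,
    hν.ae_metric_two_ne_fst hw hF] with s hs n1 n2
  have both := power_pos_and_pos hw hs
  have eP : 0 ≤ power1M3 η w s := power1M3_nonneg η w s
  have eQ : 0 ≤ power2M3 η w s := power2M3_nonneg η w s
  refine ⟨hs, fun m0 e => ?_, fun e => ?_, fun m0 m1 e => ?_⟩
  · have hz : ¬(0 < power1M3 η w s ∨ 0 < power2M3 η w s) := fun h => by
      obtain ⟨hP, hQ⟩ := both m0 e.le h
      exact (metric_lt_two hw hs hP hQ).2.ne e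
    push Not at hz
    have hP := le_antisymm hz.1 eP
    have hQ := le_antisymm hz.2 eQ
    exact ⟨power2M2_eq_zero hw hs.pos₂ (e.trans (metric_two_eq_zero hP hQ)), hP, hQ⟩
  · have hQ : power2M2 η w s = 0 := by
      by_contra hne
      exact n1 ⟨lt_of_le_of_ne (power2M2_nonneg η w s) (Ne.symm hne), e⟩
    refine ⟨hQ, powerrM4_eq_zero hw hs.pos₁ ?_⟩
    rw [← e]
    simp [metric, C2r, hQ, cap_zero]
  · have hz : ¬(0 < power1M3 η w s ∨ 0 < power2M3 η w s) := fun h => by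
      obtain ⟨hP, hQ⟩ := both m0 m1 h
      exact n2 ⟨hQ, m0, m1, e⟩
    push Not at hz
    have hP := le_antisymm hz.1 eP
    have hQ := le_antisymm hz.2 eQ
    exact ⟨hP, hQ, powerrM4_eq_zero hw hs.pos₁ (e ▸ metric_two_eq_zero hP hQ)⟩

lemma metric_zero_le_three (hw : InBox η w) (h1 : 0 < s.1) (h0 : w.μ₁ = 0) (hμ : η ≤ w.μ₂) :
    metric η w s 0 ≤ metric η w s 3 := by
  refine le_trans ?_ (waterfilling_le hw.2.2 h1 (power1M1_nonneg η w s))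
  have := cap_nonneg (mul_nonneg (power1M1_nonneg η w s) h1.le)
  simp only [metric, C1r, Matrix.cons_val, h0]
  nlinarith

/-- For these coins the candidate modes attain the maximal Lagrangian. -/
def GoodS1 (η : ℝ) (w : Weights) (c : Coins) : Prop := c 0 = true ∨ w.μ₂ = η

variable {c c' : Coins}

section

variable (hsel : IsArgMax sel) (hη : 0 < η) (hw : InBox η w) (h0 : w.μ₁ = 0) (hμ : η ≤ w.μ₂)

include hsel hη hw h0 hμ

omit hw in
lemma mode_cases_S1 (hc : GoodS1 η w c) :
    mode sel η w c s = 1 ∨ mode sel η w c s = 2 ∨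
      (mode sel η w c s = 0 ∧ c 0 = false ∧ w.μ₂ = η) ∨
      (mode sel η w c s = 3 ∧ c 0 = true ∧ c 1 = false) ∨
      (mode sel η w c s = 5 ∧ c 0 = true ∧ c 1 = true) := by
  have hS : w.μ₁ = 0 ∧ w.μ₂ ≠ 0 := ⟨h0, (hη.trans_le hμ).ne'⟩
  rcases (mem_candidates_S1 hS _).1 (mode_mem η w c s hsel) with (h | h) | ⟨h, h'⟩ | h | h
  · exact Or.inl h
  · exact Or.inr (Or.inl h)
  · exact Or.inr (Or.inr (Or.inl ⟨h, h', hc.resolve_left (by simp [h'])⟩))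
  · exact Or.inr (Or.inr (Or.inr (Or.inl h)))
  · exact Or.inr (Or.inr (Or.inr (Or.inr h)))

lemma metric_le_mode_S1 (h1 : 0 < s.1) (h2 : 0 < s.2) (hc : GoodS1 η w c) :
    metric η w s 1 ≤ metric η w s (mode sel η w c s) ∧
    metric η w s 2 ≤ metric η w s (mode sel η w c s) ∧
    metric η w s 3 ≤ metric η w s (mode sel η w c s) := by
  have hS : w.μ₁ = 0 ∧ w.μ₂ ≠ 0 := ⟨h0, (hη.trans_le hμ).ne'⟩
  refine ⟨metric_le_mode η w c s hsel ((mem_candidates_S1 hS 1).2 (by simp)),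
    metric_le_mode η w c s hsel ((mem_candidates_S1 hS 2).2 (by simp)), ?_⟩
  rcases hc0 : c 0 with _ | _
  · rw [← metric_zero_eq h0 (hc.resolve_left (by simp [hc0]))]
    exact metric_le_mode η w c s hsel ((mem_candidates_S1 hS 0).2 (by simp [hc0]))
  · rcases hc1 : c 1 with _ | _
    · exact metric_le_mode η w c s hsel ((mem_candidates_S1 hS 3).2 (by simp [hc0, hc1]))
    · rw [metric_three_eq hw h1 h2 h0]
      exact metric_le_mode η w c s hsel ((mem_candidates_S1 hS 5).2 (by simp [hc0, hc1]))

lemma metric_mode_relay_S1 (h1 : 0 < s.1) (h2 : 0 < s.2) (hc : GoodS1 η w c)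
    (hk : mode sel η w c s ∈ ({0, 3, 5} : Finset (Fin 6))) :
    metric η w s (mode sel η w c s) = metric η w s 3 := by
  rcases mode_cases_S1 (s := s) hsel hη h0 hμ hc with h | h | h | h | h
  · simp [h] at hk
  · simp [h] at hk
  · rw [h.1, metric_zero_eq h0 h.2.2]
  · rw [h.1]
  · rw [h.1, metric_three_eq hw h1 h2 h0]

lemma best_of_goodS1 (hs : Generic η w w s) (hc : GoodS1 η w c) :
    w.Best η s (protocol sel η w c s) := by
  intro b hb
  obtain ⟨m1, m2, m3⟩ := metric_le_mode_S1 hsel hη hw h0 hμ hs.pos₁ hs.pos₂ hc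
  have := lagr_le_of_metric_le hw hs.pos₁ hs.pos₂ hs.ne
    ((metric_zero_le_three hw hs.pos₁ h0 hμ).trans m3) m1 m2
    (metric_three_eq (η := η) hw hs.pos₁ hs.pos₂ h0 ▸ m3) hb
  rw [← lagr_protocol] at this
  exact this

/-- The selected group of modes does not depend on the coins, up to vanishing powers. -/
lemma gate_congr_S1 (hs : TieFreeS1 η w s) (hc : GoodS1 η w c) (hc' : GoodS1 η w c') :
    (gate sel η w c {1} s = gate sel η w c' {1} s ∨ power2M2 η w s = 0) ∧
    (gate sel η w c {2} s = gate sel η w c' {2} s ∨ power1M3 η w s = 0 ∧ power2M3 η w s = 0) ∧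
    (gate sel η w c {0, 3, 5} s = gate sel η w c' {0, 3, 5} s ∨ powerrM4 w s = 0) := by
  have h1 := hs.gen.pos₁
  have h2 := hs.gen.pos₂
  have g : ∀ {c}, GoodS1 η w c → mode sel η w c s = 1 ∨ mode sel η w c s = 2 ∨
      mode sel η w c s ∈ ({0, 3, 5} : Finset (Fin 6)) := by
    intro c hc
    rcases mode_cases_S1 (s := s) hsel hη h0 hμ hc with h | h | h | h | h <;> simp [h]
  have m03 := metric_zero_le_three hw h1 h0 hμ
  obtain ⟨m1, m2, m3⟩ := metric_le_mode_S1 hsel hη hw h0 hμ h1 h2 hc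
  obtain ⟨m1', m2', m3'⟩ := metric_le_mode_S1 hsel hη hw h0 hμ h1 h2 hc'
  have r := metric_mode_relay_S1 hsel hη hw h0 hμ h1 h2 hc
  have r' := metric_mode_relay_S1 hsel hη hw h0 hμ h1 h2 hc'
  have ng : ∀ {c : Coins}, mode sel η w c s ∈ ({0, 3, 5} : Finset (Fin 6)) →
      mode sel η w c s ≠ 1 ∧ mode sel η w c s ≠ 2 := by
    intro c h
    constructor <;> intro h' <;> simp [h'] at h
  rcases g hc with h | h | h <;> rcases g hc' with h' | h' | h'
  · simp [gate, h, h']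
  · rw [h] at m1 m2 m3
    rw [h'] at m1' m2' m3'
    obtain ⟨a1, a2, a3⟩ := hs.tie₁ (m03.trans m3') (le_antisymm m1' m2)
    exact ⟨Or.inr a1, Or.inr ⟨a2, a3⟩, Or.inl (by simp [gate, h, h'])⟩
  · rw [h] at m1 m2 m3
    rw [r' h'] at m1' m2' m3'
    obtain ⟨a1, a2⟩ := hs.tie₂ (le_antisymm m1' m3)
    exact ⟨Or.inr a1, Or.inl (by simp [gate, h, (ng h').2]), Or.inr a2⟩
  · rw [h] at m1 m2 m3
    rw [h'] at m1' m2' m3'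
    obtain ⟨a1, a2, a3⟩ := hs.tie₁ (m03.trans m3) (le_antisymm m1 m2')
    exact ⟨Or.inr a1, Or.inr ⟨a2, a3⟩, Or.inl (by simp [gate, h, h'])⟩
  · simp [gate, h, h']
  · rw [h] at m1 m2 m3
    rw [r' h'] at m1' m2' m3'
    obtain ⟨a1, a2, a3⟩ := hs.tie₃ (m03.trans m3) m1 (le_antisymm m2' m3)
    exact ⟨Or.inl (by simp [gate, h, (ng h').1]), Or.inr ⟨a1, a2⟩, Or.inr a3⟩
  · rw [r h] at m1 m2 m3
    rw [h'] at m1' m2' m3'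
    obtain ⟨a1, a2⟩ := hs.tie₂ (le_antisymm m1 m3')
    exact ⟨Or.inr a1, Or.inl (by simp [gate, h', (ng h).2]), Or.inr a2⟩
  · rw [r h] at m1 m2 m3
    rw [h'] at m1' m2' m3'
    obtain ⟨a1, a2, a3⟩ := hs.tie₃ (m03.trans m3') m1' (le_antisymm m2 m3')
    exact ⟨Or.inl (by simp [gate, h', (ng h).1]), Or.inr ⟨a1, a2⟩, Or.inr a3⟩
  · have e : ∀ K : Finset (Fin 6), (∀ k ∈ K, k = 1 ∨ k = 2) → gate sel η w c K s = 0 ∧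
        gate sel η w c' K s = 0 := by
      intro K hK
      constructor
      · exact if_neg fun hm => (hK _ hm).elim (ng h).1 (ng h).2
      · exact if_neg fun hm => (hK _ hm).elim (ng h').1 (ng h').2
    refine ⟨Or.inl ?_, Or.inl ?_, Or.inl (by rw [gate, gate, if_pos h, if_pos h'])⟩
    · rw [(e {1} (by simp)).1, (e {1} (by simp)).2]
    · rw [(e {2} (by simp)).1, (e {2} (by simp)).2]

end

end S1

lemma measurable_section {f : Gain × Coins → ℝ} (hf : Measurable f) (c : Coins) :
    Measurable fun s => f (s, c) := hf.comp (measurable_id.prodMk measurable_const)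

/-- The total power used in a slot. -/
noncomputable def totalPower (a : Action) : ℝ := a.power₁ + a.power₂ + a.powerr

section Total

variable {sel : Finset (Fin 6) → (Fin 6 → ℝ) → Fin 6} {η : ℝ} {w : Weights} {ν : Measure Gain}

lemma integrable_powers (hν : IsGainLaw ν) (hsel : IsArgMax sel) (hη : 0 < η ∧ η < 1)
    (hw : InBox η w) (c : Coins) :
    Integrable (fun s => (protocol sel η w c s).power₁) ν ∧
    Integrable (fun s => (protocol sel η w c s).power₂) ν ∧
    Integrable (fun s => (protocol sel η w c s).powerr) ν := by
  have hpol := isPolicy_protocol η w hsel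
  have key : ∀ f : Gain → ℝ, Measurable f →
      (∀ s, 0 ≤ f s ∧ f s ≤ totalPower (protocol sel η w c s)) → Integrable f ν := by
    intro f hf hle
    refine ((hν.int₁.add hν.int₂).const_mul (8 / (w.γ * Real.log 2) ^ 2)).mono'
      hf.aestronglyMeasurable ?_
    filter_upwards [hν.pos] with s hs
    have hT : totalPower (protocol sel η w c s) ≤ 8 / (w.γ * Real.log 2) ^ 2 * (s.1 + s.2) :=
      power_total_le hsel hη hw hs.1 hs.2
    simp only [Pi.add_apply]
    rw [Real.norm_of_nonneg (hle s).1]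
    exact (hle s).2.trans hT
  have hadm := fun s => protocol_admissible sel η w c s
  have m1 := measurable_section hpol.power₁ c
  have m2 := measurable_section hpol.power₂ c
  have m3 := measurable_section hpol.powerr c
  have n1 := fun s => (hadm s).power₁_nonneg
  have n2 := fun s => (hadm s).power₂_nonneg
  have n3 := fun s => (hadm s).powerr_nonneg
  refine ⟨key _ m1 fun s => ⟨n1 s, ?_⟩, key _ m2 fun s => ⟨n2 s, ?_⟩, key _ m3 fun s => ⟨n3 s, ?_⟩⟩ <;>
  · have a1 := n1 s
    have a2 := n2 s
    have a3 := n3 s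
    unfold totalPower
    linarith

lemma integral_totalPower (hν : IsGainLaw ν) (hsel : IsArgMax sel) (hη : 0 < η ∧ η < 1)
    (hw : InBox η w) (c : Coins) :
    ∫ s, (protocol sel η w c s).power₁ ∂ν + ∫ s, (protocol sel η w c s).power₂ ∂ν +
      ∫ s, (protocol sel η w c s).powerr ∂ν = ∫ s, totalPower (protocol sel η w c s) ∂ν := by
  obtain ⟨i1, i2, i3⟩ := integrable_powers hν hsel hη hw c
  have e := integral_add (i1.add i2) i3
  simp only [Pi.add_apply] at e
  unfold totalPower
  rw [e, integral_add i1 i2]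

lemma meanPower_eq_integral {D : Type*} [MeasurableSpace D] {m : Measure (Gain × D)}
    {π : Gain × D → Action} (h : HasFinitePower m π) :
    meanPower m π = ∫ z, totalPower (π z) ∂m := by
  have e := integral_add (h.power₁.add h.power₂) h.powerr
  simp only [Pi.add_apply] at e
  unfold meanPower totalPower
  rw [e, integral_add h.power₁ h.power₂]

end Total

/-! ### The first degenerate region -/

section S1

variable {sel : Finset (Fin 6) → (Fin 6 → ℝ) → Fin 6} {η : ℝ} {w : Weights} {s : Gain}
  {c c' : Coins}

lemma power1M1_le_powerrM4 (hw : InBox η w) (h0 : w.μ₁ = 0) (hμ : η ≤ w.μ₂) :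
    power1M1 η w s ≤ powerrM4 w s := by
  have hG : 0 < w.γ * Real.log 2 := mul_pos hw.2.2 log_two_pos
  refine max_le_max (sub_le_sub_right ?_ _) le_rfl
  rw [h0, sub_zero]
  exact div_le_div_of_nonneg_right hμ hG.le

variable (hsel : IsArgMax sel) (hη : 0 < η) (hw : InBox η w) (h0 : w.μ₁ = 0) (hμ : η ≤ w.μ₂)

include hsel hη hw h0 hμ

/-- The outcome of a slot in terms of the gates for reference coins. -/
lemma effects_S1 (hs : TieFreeS1 η w s) (hc : GoodS1 η w c) (hc' : GoodS1 η w c') :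
    (protocol sel η w c s).rate1r s = gate sel η w c' {2} s * C12r η w s +
      gate sel η w c' {0, 3, 5} s * C1r η w s * (1 - coinInd 0 c) ∧
    (protocol sel η w c s).rate2r s = gate sel η w c' {1} s * C2r η w s +
      gate sel η w c' {2} s * C21r η w s ∧
    (protocol sel η w c s).rater1 s = gate sel η w c' {0, 3, 5} s * Cr1 w s * coinInd 0 c ∧
    (protocol sel η w c s).rater2 s =
      gate sel η w c' {0, 3, 5} s * Cr2 w s * (coinInd 0 c * coinInd 1 c) ∧
    totalPower (protocol sel η w c s) = gate sel η w c' {1} s * power2M2 η w s +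
      gate sel η w c' {2} s * (power1M3 η w s + power2M3 η w s) +
      gate sel η w c' {0, 3, 5} s * powerrM4 w s := by
  have h1 := hs.gen.pos₁
  have h2 := hs.gen.pos₂
  have e64 := powerrM6_eq_powerrM4 hw h1 h2 h0
  obtain ⟨g1, g2, g3⟩ := gate_congr_S1 hsel hη hw h0 hμ hs hc' hc
  have k1 : gate sel η w c' {1} s * C2r η w s = gate sel η w c {1} s * C2r η w s := by
    rcases g1 with h | h
    · rw [h]
    · simp [C2r, h, cap_zero]
  have k2 : gate sel η w c' {1} s * power2M2 η w s = gate sel η w c {1} s * power2M2 η w s := by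
    rcases g1 with h | h
    · rw [h]
    · simp [h]
  have k3 : gate sel η w c' {2} s * C12r η w s = gate sel η w c {2} s * C12r η w s := by
    rcases g2 with h | ⟨h, h'⟩
    · rw [h]
    · simp [C12r, h, h', macRate₁, cap_zero]
  have k4 : gate sel η w c' {2} s * C21r η w s = gate sel η w c {2} s * C21r η w s := by
    rcases g2 with h | ⟨h, h'⟩
    · rw [h]
    · simp [C21r, h, h', macRate₂, cap_zero]
  have k5 : gate sel η w c' {2} s * (power1M3 η w s + power2M3 η w s) =
      gate sel η w c {2} s * (power1M3 η w s + power2M3 η w s) := by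
    rcases g2 with h | ⟨h, h'⟩
    · rw [h]
    · simp [h, h']
  have k6 : ∀ f : ℝ, (powerrM4 w s = 0 → f = 0) →
      gate sel η w c' {0, 3, 5} s * f = gate sel η w c {0, 3, 5} s * f := by
    intro f hf
    rcases g3 with h | h
    · rw [h]
    · rw [hf h, mul_zero, mul_zero]
  have k7 := k6 (Cr1 w s) fun h => by simp [Cr1, e64, h, cap_zero]
  have k8 := k6 (Cr2 w s) fun h => by simp [Cr2, e64, h, cap_zero]
  have k9 := k6 (powerrM4 w s) id
  have k10 := k6 (C1r η w s) fun h => by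
    have : power1M1 η w s = 0 :=
      le_antisymm (h ▸ power1M1_le_powerrM4 hw h0 hμ) (power1M1_nonneg η w s)
    simp [C1r, this, cap_zero]
  rw [k1, k2, k3, k4, k5, k7, k8, k9, k10]
  unfold totalPower
  rw [protocol_rate1r, protocol_rate2r, protocol_rater1, protocol_rater2, protocol_power₁,
    protocol_power₂, protocol_powerr]
  rcases mode_cases_S1 (s := s) hsel hη h0 hμ hc with h | h | ⟨h, hc0, hμ'⟩ | ⟨h, hc0, hc1⟩ |
    ⟨h, hc0, hc1⟩
  · simp [gate, h]
  · simp [gate, h]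
  · simp [gate, h, coinInd, hc0, power1M1_eq_powerrM4 h0 hμ']
  · simp [gate, h, coinInd, hc0, hc1, Cr1, e64]
  · simp [gate, h, coinInd, hc0, hc1, e64]

variable {ν : Measure Gain} (hν : IsGainLaw ν) (hη' : η < 1)

include hν hη'

lemma integrable_gates_S1 (hc : GoodS1 η w c) :
    (Integrable (fun s => gate sel η w c {2} s * C12r η w s) ν ∧
      Integrable (fun s => gate sel η w c {0, 3, 5} s * C1r η w s) ν) ∧
    (Integrable (fun s => gate sel η w c {1} s * C2r η w s) ν ∧
      Integrable (fun s => gate sel η w c {2} s * C21r η w s) ν) ∧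
    Integrable (fun s => gate sel η w c {0, 3, 5} s * Cr1 w s) ν ∧
    Integrable (fun s => gate sel η w c {0, 3, 5} s * Cr2 w s) ν := by
  have hl := log_two_pos
  have hC : 0 ≤ 1 / Real.log 2 := by positivity
  have hd : 0 ≤ decOrder η w ∧ decOrder η w ≤ 1 := by
    rcases decOrder_eq η w with h | h <;> rw [h] <;> norm_num
  have capb : ∀ {p q x y T : ℝ}, 0 ≤ p → 0 < x → 0 < y → p ≤ q → q ≤ T →
      0 ≤ cap (p * x) ∧ cap (p * x) ≤ 1 / Real.log 2 * (T + (x + y)) := by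
    intro p q x y T hp hx hy hpq hqT
    refine ⟨cap_nonneg (mul_nonneg hp hx.le), (cap_mul_le hp hx.le).trans ?_⟩
    rw [one_div_mul_eq_div]
    exact div_le_div_of_nonneg_right (by linarith) hl.le
  have hR : ∀ s : Gain, 0 < s.1 → 0 < s.2 → mode sel η w c s ∈ ({0, 3, 5} : Finset (Fin 6)) →
      powerrM6 w s = powerrM4 w s ∧ powerrM4 w s ≤ (protocol sel η w c s).power₁ +
        (protocol sel η w c s).power₂ + (protocol sel η w c s).powerr := by
    intro s h1 h2 hk
    have e64 := powerrM6_eq_powerrM4 hw h1 h2 h0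
    refine ⟨e64, ?_⟩
    rw [protocol_power₁, protocol_power₂, protocol_powerr]
    rcases mode_cases_S1 (s := s) hsel hη h0 hμ hc with h | h | ⟨h, hc0, hμ'⟩ | ⟨h, -⟩ | ⟨h, -⟩
    · simp [h] at hk
    · simp [h] at hk
    · simp [h, power1M1_eq_powerrM4 h0 hμ']
    · simp [h]
    · simp [h, e64]
  have hR' := fun s => power1M1_le_powerrM4 (s := s) hw h0 hμ
  have h2P : ∀ s : Gain, mode sel η w c s = 2 → power1M3 η w s + power2M3 η w s ≤
      (protocol sel η w c s).power₁ + (protocol sel η w c s).power₂ +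
        (protocol sel η w c s).powerr := by
    intro s h
    rw [protocol_power₁, protocol_power₂, protocol_powerr]
    simp [h]
  refine ⟨⟨?_, ?_⟩, ⟨?_, ?_⟩, ?_, ?_⟩
  · refine integrable_gate_mul hsel hν ⟨hη, hη'⟩ hw (measurable_C12r η w) _ hC fun s h1 h2 hk => ?_
    have hP := power1M3_nonneg η w s
    have hQ := power2M3_nonneg η w s
    refine ⟨macRate₁_nonneg hd hP hQ h1.le h2.le, (macRate₁_le hd hP hQ h1.le h2.le).trans ?_⟩
    have := h2P s (by simpa using hk)
    exact (capb hP h1 h2 le_rfl (by linarith)).2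
  · refine integrable_gate_mul hsel hν ⟨hη, hη'⟩ hw (measurable_C1r η w) _ hC fun s h1 h2 hk => ?_
    exact capb (power1M1_nonneg η w s) h1 h2 (hR' s) (hR s h1 h2 hk).2
  · refine integrable_gate_mul hsel hν ⟨hη, hη'⟩ hw (measurable_C2r η w) _ hC fun s h1 h2 hk => ?_
    rw [add_comm s.1 s.2]
    refine capb (power2M2_nonneg η w s) h2 h1 le_rfl ?_
    rw [protocol_power₁, protocol_power₂, protocol_powerr]
    simp only [Finset.mem_singleton] at hk
    simp [hk]
  · refine integrable_gate_mul hsel hν ⟨hη, hη'⟩ hw (measurable_C21r η w) _ hC fun s h1 h2 hk => ?_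
    have hP := power1M3_nonneg η w s
    have hQ := power2M3_nonneg η w s
    refine ⟨macRate₂_nonneg hd hP hQ h1.le h2.le, (macRate₂_le hd hP hQ h1.le h2.le).trans ?_⟩
    have := h2P s (by simpa using hk)
    rw [add_comm s.1 s.2]
    exact (capb hQ h2 h1 le_rfl (by linarith)).2
  · refine integrable_gate_mul hsel hν ⟨hη, hη'⟩ hw (measurable_Cr1 w) _ hC fun s h1 h2 hk => ?_
    have := hR s h1 h2 hk
    exact capb (powerrM6_nonneg w s) h1 h2 this.1.le this.2
  · refine integrable_gate_mul hsel hν ⟨hη, hη'⟩ hw (measurable_Cr2 w) _ hC fun s h1 h2 hk => ?_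
    have := hR s h1 h2 hk
    rw [add_comm s.1 s.2]
    exact capb (powerrM6_nonneg w s) h2 h1 this.1.le this.2

variable {p : Fin 4 → unitInterval}

/-- The expected rates and power of the protocol for random coins. -/
lemma integrals_S1 (hc : GoodS1 η w c) (hp : ∀ᵐ c ∂slotLaw p, GoodS1 η w c) :
    ∫ z, (protocol sel η w z.2 z.1).rate1r z.1 ∂ν.prod (slotLaw p) =
      ∫ s, gate sel η w c {2} s * C12r η w s ∂ν +
        (∫ s, gate sel η w c {0, 3, 5} s * C1r η w s ∂ν) * (1 - p 0) ∧
    ∫ z, (protocol sel η w z.2 z.1).rate2r z.1 ∂ν.prod (slotLaw p) =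
      ∫ s, gate sel η w c {1} s * C2r η w s ∂ν + ∫ s, gate sel η w c {2} s * C21r η w s ∂ν ∧
    ∫ z, (protocol sel η w z.2 z.1).rater1 z.1 ∂ν.prod (slotLaw p) =
      (∫ s, gate sel η w c {0, 3, 5} s * Cr1 w s ∂ν) * p 0 ∧
    ∫ z, (protocol sel η w z.2 z.1).rater2 z.1 ∂ν.prod (slotLaw p) =
      (∫ s, gate sel η w c {0, 3, 5} s * Cr2 w s ∂ν) * (p 0 * p 1) ∧
    meanPower (ν.prod (slotLaw p)) (fun z => protocol sel η w z.2 z.1) =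
      ∫ s, totalPower (protocol sel η w c s) ∂ν := by
  have := hν.prob
  obtain ⟨⟨i1, i2⟩, ⟨i3, i4⟩, i5, i6⟩ := integrable_gates_S1 hsel hη hw h0 hμ hν hη' hc
  have hae : ∀ᵐ z ∂ν.prod (slotLaw p), TieFreeS1 η w z.1 ∧ GoodS1 η w z.2 :=
    (Measure.quasiMeasurePreserving_fst.ae (ae_tieFreeS1 hν hw)).and
      (Measure.quasiMeasurePreserving_snd.ae hp)
  have eff := hae.mono fun z hz => effects_S1 (c' := c) hsel hη hw h0 hμ hz.1 hz.2 hc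
  have zero : Integrable (fun _ : Gain => (0 : ℝ)) ν := integrable_zero _ _ _
  have e0 : ∫ c, (1 - coinInd 0 c) ∂slotLaw p = 1 - p 0 := by
    rw [integral_sub Integrable.of_finite Integrable.of_finite, integral_coinInd]
    simp
  refine ⟨?_, ?_, ?_, ?_, ?_⟩
  · rw [integral_congr_ae (eff.mono fun z hz => hz.1),
      integral_add_mul_coin (κ := slotLaw p) i1 i2 fun c => 1 - coinInd 0 c, e0]
  · rw [integral_congr_ae (eff.mono fun z hz => hz.2.1), ← integral_add i3 i4,
      integral_fun_fst fun s => gate sel η w c {1} s * C2r η w s +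
        gate sel η w c {2} s * C21r η w s]
    simp
  · have := integral_add_mul_coin (κ := slotLaw p) zero i5 (coinInd 0)
    simp only [zero_add, integral_zero] at this
    rw [integral_congr_ae (eff.mono fun z hz => hz.2.2.1), this, integral_coinInd]
  · have := integral_add_mul_coin (κ := slotLaw p) zero i6 fun c => coinInd 0 c * coinInd 1 c
    simp only [zero_add, integral_zero] at this
    rw [integral_congr_ae (eff.mono fun z hz => hz.2.2.2.1), this,
      integral_coinInd_mul p (by decide)]
  · rw [meanPower_eq_integral (hasFinitePower_protocol hν hsel ⟨hη, hη'⟩ hw)]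
    have : ∀ᵐ z ∂ν.prod (slotLaw p), totalPower (protocol sel η w z.2 z.1) =
        totalPower (protocol sel η w c z.1) := by
      filter_upwards [hae, eff] with z h1 h2
      rw [h2.2.2.2.2, (effects_S1 (c' := c) hsel hη hw h0 hμ h1.1 hc hc).2.2.2.2]
    rw [integral_congr_ae this, integral_fun_fst fun s => totalPower (protocol sel η w c s)]
    simp

end S1

/-! ### Expectations over the gains of a slot -/

section Expect

variable {Ω : Type*} [MeasurableSpace Ω] {P : Measure Ω} [IsProbabilityMeasure P]
  {S : ℕ → Ω → Gain} {sel : Finset (Fin 6) → (Fin 6 → ℝ) → Fin 6} {η Pt : ℝ} {w : Weights}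
  {c : Coins}

omit [IsProbabilityMeasure P] in
lemma expect_eq (hS : IsFadingChannel P S) {f : Gain → ℝ} (hf : Measurable f) :
    expect P S f = ∫ s, f s ∂P.map (S 0) :=
  (integral_map (hS.measurable 0).aemeasurable hf.aestronglyMeasurable).symm

omit [IsProbabilityMeasure P] in
lemma selExpect_eq (hS : IsFadingChannel P S) (hsel : IsArgMax sel) (K : Finset (Fin 6))
    {f : Gain → ℝ} (hf : Measurable f) :
    selExpect P S sel η w c K f = ∫ s, gate sel η w c K s * f s ∂P.map (S 0) := by
  unfold selExpect
  simp only [sum_q_eq_gate]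
  exact expect_eq hS ((measurable_gate η w c hsel K).mul hf)

lemma holdsPower_iff (hS : IsFadingChannel P S) (hsel : IsArgMax sel) (hη : 0 < η ∧ η < 1)
    (hw : InBox η w) : HoldsPower P S sel η Pt w c ↔
      ∫ s, totalPower (protocol sel η w c s) ∂P.map (S 0) = Pt := by
  have hpol := isPolicy_protocol η w hsel
  rw [HoldsPower, expect_eq hS (measurable_section hpol.power₁ c),
    expect_eq hS (measurable_section hpol.power₂ c), expect_eq hS (measurable_section hpol.powerr c),
    integral_totalPower hS.isGainLaw hsel hη hw c]

omit [IsProbabilityMeasure P] in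
lemma holdsC1_iff (hS : IsFadingChannel P S) (hsel : IsArgMax sel) : HoldsC1 P S sel η w c ↔
    ∫ s, (protocol sel η w c s).rate1r s ∂P.map (S 0) =
      ∫ s, (protocol sel η w c s).rater2 s ∂P.map (S 0) := by
  have hpol := isPolicy_protocol η w hsel
  rw [HoldsC1, expect_eq hS (measurable_section hpol.rate1r c),
    expect_eq hS (measurable_section hpol.rater2 c)]

omit [IsProbabilityMeasure P] in
lemma holdsC2_iff (hS : IsFadingChannel P S) (hsel : IsArgMax sel) : HoldsC2 P S sel η w c ↔
    ∫ s, (protocol sel η w c s).rate2r s ∂P.map (S 0) =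
      ∫ s, (protocol sel η w c s).rater1 s ∂P.map (S 0) := by
  have hpol := isPolicy_protocol η w hsel
  rw [HoldsC2, expect_eq hS (measurable_section hpol.rate2r c),
    expect_eq hS (measurable_section hpol.rater1 c)]

/-- If the coin `n` shows `0` with positive probability, an almost sure property holds for some fixed
coins with this outcome and almost all gains. -/
lemma exists_coins_of_ae {ν : Measure Gain} [SFinite ν] {p : Fin 4 → unitInterval} {n : Fin 4}
    {q : Gain × Coins → Prop} (h : ∀ᵐ z ∂ν.prod (slotLaw p), q z) (hp : (p n : ℝ) ≠ 1) :
    ∃ c : Coins, c n = false ∧ ∀ᵐ s ∂ν, q (s, c) := by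
  have h1 : ∀ᵐ y ∂(slotLaw p).prod ν, q y.swap :=
    (Measure.measurePreserving_swap (μ := slotLaw p) (ν := ν)).quasiMeasurePreserving.ae h
  have h2 := Measure.ae_ae_of_ae_prod h1
  by_contra hne
  apply hp
  rw [← integral_coinInd p n]
  have : ∀ᵐ c ∂slotLaw p, coinInd n c = 1 := by
    filter_upwards [h2] with c hc
    rcases hcn : c n with _ | _
    · exact absurd ⟨c, hcn, hc⟩ hne
    · simp [coinInd, hcn]
  rw [integral_congr_ae this]
  simp

lemma ae_coin_eq_true {p : Fin 4 → unitInterval} {n : Fin 4} (hp : (p n : ℝ) = 1) :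
    ∀ᵐ c ∂slotLaw p, c n = true := by
  have h0 : ∫ c, (1 - coinInd n c) ∂slotLaw p = 0 := by
    rw [integral_sub Integrable.of_finite Integrable.of_finite, integral_coinInd, hp]
    simp
  have hn : ∀ c : Coins, 0 ≤ 1 - coinInd n c := by
    intro c; unfold coinInd; split_ifs <;> norm_num
  have := (integral_eq_zero_iff_of_nonneg hn Integrable.of_finite).1 h0
  filter_upwards [this] with c hc
  by_contra hcn
  simp [coinInd, hcn] at hc

end Expect

section S1

variable {sel : Finset (Fin 6) → (Fin 6 → ℝ) → Fin 6} {η Pt : ℝ} {w : Weights} {s : Gain}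
  {c c' : Coins} {ν : Measure Gain} {p : Fin 4 → unitInterval}

/-- The range of `μ₂` for optimal weights of the first degenerate region. -/
lemma OptimalFacts.le_μ₂ {κ : Measure Coins} [IsProbabilityMeasure κ] (hν : IsGainLaw ν)
    (hsel : IsArgMax sel) (hη : 0 < η ∧ η < 1) (h : OptimalFacts ν sel η Pt w κ)
    (hS : w.InRegion .S1) : η ≤ w.μ₂ := by
  have hb := h.best.and (hν.ae_pos (κ := κ))
  have hex : ∃ z : Gain × Coins, (w.Best η z.1 (protocol sel η w z.2 z.1) ∧ 0 < z.1.1 ∧ 0 < z.1.2) ∧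
      ((mode sel η w z.2 z.1 = 3 ∧ 0 < powerrM4 w z.1) ∨
        (mode sel η w z.2 z.1 = 5 ∧ 0 < powerrM6 w z.1)) := by
    by_contra! hne
    have z1 : ∀ᵐ z ∂ν.prod κ, (protocol sel η w z.2 z.1).rater1 z.1 ≤ 0 := by
      filter_upwards [hb] with z hz
      by_contra! hpos
      rcases rater1_pos_imp hpos with h' | h'
      · exact absurd h'.2 (not_lt.2 ((hne z hz).1 h'.1))
      · exact absurd h'.2 (not_lt.2 ((hne z hz).2 h'.1))
    have z2 : ∀ᵐ z ∂ν.prod κ, (protocol sel η w z.2 z.1).rater2 z.1 ≤ 0 := by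
      filter_upwards [hb] with z hz
      by_contra! hpos
      rcases rater2_pos_imp hpos with h' | h'
      · exact (eq_S2_of_mode_eq_four hsel h'.1).1 hS.1
      · exact absurd h'.2 (not_lt.2 ((hne z hz).2 h'.1))
    have hv := h.value_pos
    have e1 := integral_nonpos_of_ae z1
    have e2 := integral_nonpos_of_ae z2
    rw [value, h.feasible.c1, h.feasible.c2] at hv
    have := mul_nonpos_of_nonneg_of_nonpos hη.1.le e2
    have := mul_nonpos_of_nonneg_of_nonpos (sub_pos.2 hη.2).le e1
    linarith
  obtain ⟨z, ⟨hbz, h1, h2⟩, hz⟩ := hex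
  have key : ∀ r : ℝ, 0 < r → (η - w.μ₁) * cap (r * z.1.1) - w.γ * r ≤
      w.μ₂ * cap (r * z.1.1) - w.γ * r → η ≤ w.μ₂ := by
    intro r hr hle
    rw [hS.1] at hle
    have := cap_pos (mul_pos hr h1)
    by_contra! hneg
    nlinarith
  rcases hz with ⟨hk, hP⟩ | ⟨hk, hP⟩
  · refine key _ hP ?_
    have := hbz.mode_le 0 (Or.inl rfl) hP.le le_rfl le_rfl
    rw [lagrangian_protocol, hk] at this
    exact this
  · refine key _ hP ?_
    have := hbz.mode_le 0 (Or.inl rfl) hP.le le_rfl le_rfl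
    rw [lagrangian_protocol, hk] at this
    refine this.trans (le_of_eq ?_)
    simp [Cr1, hS.1]

lemma gate_relay_S1 (hsel : IsArgMax sel) (h0 : w.μ₁ = 0) (hμ : w.μ₂ ≠ 0) (hc : c 0 = true) :
    gate sel η w c {3, 5} = gate sel η w c {0, 3, 5} := by
  funext s
  have : mode sel η w c s ≠ 0 := by
    intro hk
    have hm := mode_mem η w c s hsel
    rw [hk, mem_candidates_S1 ⟨h0, hμ⟩] at hm
    simp [hc] at hm
  simp [gate, this]

variable (hsel : IsArgMax sel) (hη : 0 < η) (hw : InBox η w) (h0 : w.μ₁ = 0) (hμ : η ≤ w.μ₂)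
  (hν : IsGainLaw ν) (hη' : η < 1)

include hsel hη hw h0 hμ hν hη'

lemma isStatFeasible_iff_S1 (hc : GoodS1 η w c) (hp : ∀ᵐ c ∂slotLaw p, GoodS1 η w c) :
    IsStatFeasible Pt (ν.prod (slotLaw p)) (fun z => protocol sel η w z.2 z.1) ↔
      ∫ s, gate sel η w c {2} s * C12r η w s ∂ν +
          (∫ s, gate sel η w c {0, 3, 5} s * C1r η w s ∂ν) * (1 - p 0) =
        (∫ s, gate sel η w c {0, 3, 5} s * Cr2 w s ∂ν) * (p 0 * p 1) ∧
      ∫ s, gate sel η w c {1} s * C2r η w s ∂ν + ∫ s, gate sel η w c {2} s * C21r η w s ∂ν =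
        (∫ s, gate sel η w c {0, 3, 5} s * Cr1 w s ∂ν) * p 0 ∧
      ∫ s, totalPower (protocol sel η w c s) ∂ν = Pt := by
  obtain ⟨e1, e2, e3, e4, e5⟩ := integrals_S1 hsel hη hw h0 hμ hν hη' hc hp
  rw [← e1, ← e2, ← e3, ← e4, ← e5]
  exact ⟨fun h => ⟨h.c1, h.c2, h.power⟩, fun h =>
    ⟨hasFinitePower_protocol hν hsel ⟨hη, hη'⟩ hw, h.1, h.2.1, h.2.2⟩⟩

lemma relay_pos_S1 (hc : GoodS1 η w c) (hp : ∀ᵐ c ∂slotLaw p, GoodS1 η w c)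
    (h : OptimalFacts ν sel η Pt w (slotLaw p)) :
    (0 : ℝ) < p 0 ∧ 0 < ∫ s, gate sel η w c {0, 3, 5} s * Cr1 w s ∂ν ∧
      0 < ∫ s, gate sel η w c {0, 3, 5} s * Cr2 w s ∂ν := by
  obtain ⟨-, -, e3, e4, -⟩ := integrals_S1 (p := p) hsel hη hw h0 hμ hν hη' hc hp
  obtain ⟨-, -, i5, i6⟩ := integrable_gates_S1 (c := c) hsel hη hw h0 hμ hν hη' hc
  have hg : ∀ s, 0 ≤ gate sel η w c {0, 3, 5} s := by
    intro s; unfold gate; split_ifs <;> norm_num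
  have n1 : 0 ≤ᵐ[ν] fun s => gate sel η w c {0, 3, 5} s * Cr1 w s := by
    filter_upwards [hν.pos] with s hs
    exact mul_nonneg (hg s) (cap_nonneg (mul_nonneg (powerrM6_nonneg w s) hs.1.le))
  have n2 : 0 ≤ᵐ[ν] fun s => gate sel η w c {0, 3, 5} s * Cr2 w s := by
    filter_upwards [hν.pos] with s hs
    exact mul_nonneg (hg s) (cap_nonneg (mul_nonneg (powerrM6_nonneg w s) hs.2.le))
  have hP : ∀ {x : ℝ}, 0 < x → ∀ s, cap (powerrM6 w s * x) = 0 → powerrM6 w s = 0 := by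
    intro x hx s hcap
    by_contra hne
    exact (cap_pos (mul_pos (lt_of_le_of_ne (powerrM6_nonneg w s) (Ne.symm hne)) hx)).ne' hcap
  have z12 : ∫ s, gate sel η w c {0, 3, 5} s * Cr1 w s ∂ν = 0 →
      ∫ s, gate sel η w c {0, 3, 5} s * Cr2 w s ∂ν = 0 := by
    intro hz
    rw [integral_eq_zero_iff_of_nonneg_ae n2 i6]
    filter_upwards [(integral_eq_zero_iff_of_nonneg_ae n1 i5).1 hz, hν.pos] with s hs hpos
    rcases mul_eq_zero.1 hs with h' | h'
    · simp [h']
    · simp [Cr2, hP hpos.1 s h', cap_zero]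
  have z21 : ∫ s, gate sel η w c {0, 3, 5} s * Cr2 w s ∂ν = 0 →
      ∫ s, gate sel η w c {0, 3, 5} s * Cr1 w s ∂ν = 0 := by
    intro hz
    rw [integral_eq_zero_iff_of_nonneg_ae n1 i5]
    filter_upwards [(integral_eq_zero_iff_of_nonneg_ae n2 i6).1 hz, hν.pos] with s hs hpos
    rcases mul_eq_zero.1 hs with h' | h'
    · simp [h']
    · simp [Cr1, hP hpos.2 s h', cap_zero]
  have j1 := integral_nonneg_of_ae n1
  have j2 := integral_nonneg_of_ae n2
  have hv := h.value_pos
  rw [value, h.feasible.c1, h.feasible.c2, e3, e4] at hv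
  refine ⟨lt_of_le_of_ne (p 0).2.1 fun hz => ?_, lt_of_le_of_ne j1 fun hz => ?_,
    lt_of_le_of_ne j2 fun hz => ?_⟩
  · rw [← hz] at hv
    simp at hv
  · rw [← hz, z12 hz.symm] at hv
    simp at hv
  · rw [← hz, z21 hz.symm] at hv
    simp at hv

omit hν hη' in
/-- Where the protocol is optimal although the first coin shows `0`, the relay is silent. -/
lemma relay_silent_S1 (hμ' : η < w.μ₂) {c₁ : Coins} (hc₁ : c₁ 0 = false) (ht : TieFreeS1 η w s)
    (hbs : w.Best η s (protocol sel η w c₁ s)) (hc : c 0 = true)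
    (hk : mode sel η w c s = 3 ∨ mode sel η w c s = 5) : powerrM4 w s = 0 := by
  have hS : w.μ₁ = 0 ∧ w.μ₂ ≠ 0 := ⟨h0, (hη.trans hμ').ne'⟩
  have h1 := ht.gen.pos₁
  have h2 := ht.gen.pos₂
  have hgood : GoodS1 η w c := Or.inl hc
  have hr : metric η w s (mode sel η w c s) = metric η w s 3 :=
    metric_mode_relay_S1 hsel hη hw h0 hμ h1 h2 hgood (by rcases hk with hk | hk <;> simp [hk])
  obtain ⟨m1, m2, -⟩ := metric_le_mode_S1 hsel hη hw h0 hμ h1 h2 hgood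
  rw [hr] at m1 m2
  have h3 : metric η w s 3 ≤ metric η w s (mode sel η w c₁ s) := by
    have e := hbs.mode_le 3 (t := 0) (Or.inl rfl) (le_refl 0) (le_refl 0) (powerrM4_nonneg w s)
    rw [lagrangian_protocol] at e
    exact e
  have h03 : metric η w s 0 ≤ metric η w s 3 := metric_zero_le_three hw h1 h0 hμ
  have hm := (mem_candidates_S1 hS _).1 (mode_mem η w c₁ s hsel)
  simp only [hc₁, Bool.false_eq_true, false_and, and_false, or_false, and_true] at hm
  rcases hm with (hm | hm) | hm <;> rw [hm] at h3
  · exact (ht.tie₂ (le_antisymm m1 h3)).2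
  · exact (ht.tie₃ (h03.trans h3) (m1.trans h3) (le_antisymm m2 h3)).2.2
  · have e3 : metric η w s 3 = w.μ₂ * cap (powerrM4 w s * s.1) - w.γ * powerrM4 w s := rfl
    have e4 : metric η w s 0 = (η - w.μ₁) * cap (power1M1 η w s * s.1) -
      w.γ * power1M1 η w s := rfl
    have hP : power1M1 η w s = 0 := by
      by_contra hP
      have hP' := lt_of_le_of_ne (power1M1_nonneg η w s) (Ne.symm hP)
      have e1 : w.μ₂ * cap (power1M1 η w s * s.1) - w.γ * power1M1 η w s ≤
          w.μ₂ * cap (powerrM4 w s * s.1) - w.γ * powerrM4 w s :=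
        waterfilling_le hw.2.2 h1 hP'.le
      have e2 := mul_pos (sub_pos.2 hμ') (cap_pos (mul_pos hP' h1))
      rw [e3, e4, h0] at h3
      linarith
    have e5 : metric η w s 0 = 0 := by rw [e4, hP]; simp [cap_zero]
    rw [e5] at h3 h03
    exact powerrM4_eq_zero hw h1 (le_antisymm h3 h03)

lemma coin_eq_one_S1 (hμ' : η < w.μ₂) (h : OptimalFacts ν sel η Pt w (slotLaw p)) :
    (p 0 : ℝ) = 1 := by
  have := hν.prob
  by_contra hp
  obtain ⟨c₁, hc₁, hb⟩ := exists_coins_of_ae h.best hp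
  have hS : w.μ₁ = 0 ∧ w.μ₂ ≠ 0 := ⟨h0, (hη.trans hμ').ne'⟩
  have key : ∀ᵐ s ∂ν, ∀ c : Coins, (mode sel η w c s = 3 ∨ mode sel η w c s = 5) →
      powerrM4 w s = 0 ∧ powerrM6 w s = 0 := by
    filter_upwards [hb, ae_tieFreeS1 hν hw] with s hbs ht c hk
    rw [powerrM6_eq_powerrM4 hw ht.gen.pos₁ ht.gen.pos₂ h0, and_self]
    have hc : c 0 = true := by
      have hm := (mem_candidates_S1 hS _).1 (mode_mem η w c s hsel)
      rcases hk with hk | hk <;> rw [hk] at hm <;> simp at hm <;> exact hm.1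
    exact relay_silent_S1 hsel hη hw h0 hμ hμ' hc₁ ht hbs hc hk
  have hv := h.value_pos
  have hae : ∀ᵐ z ∂ν.prod (slotLaw p), ∀ c : Coins,
      (mode sel η w c z.1 = 3 ∨ mode sel η w c z.1 = 5) →
      powerrM4 w z.1 = 0 ∧ powerrM6 w z.1 = 0 :=
    Measure.quasiMeasurePreserving_fst.ae key
  have z1 : ∀ᵐ z ∂ν.prod (slotLaw p), (protocol sel η w z.2 z.1).rater1 z.1 ≤ 0 := by
    filter_upwards [hae] with z hz
    by_contra! hpos
    rcases rater1_pos_imp hpos with h' | h'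
    · exact h'.2.ne' (hz _ (Or.inl h'.1)).1
    · exact h'.2.ne' (hz _ (Or.inr h'.1)).2
  have z2 : ∀ᵐ z ∂ν.prod (slotLaw p), (protocol sel η w z.2 z.1).rater2 z.1 ≤ 0 := by
    filter_upwards [hae] with z hz
    by_contra! hpos
    rcases rater2_pos_imp hpos with h' | h'
    · exact (eq_S2_of_mode_eq_four hsel h'.1).1 h0
    · exact h'.2.ne' (hz _ (Or.inr h'.1)).2
  rw [value, h.feasible.c1, h.feasible.c2] at hv
  have := mul_nonpos_of_nonneg_of_nonpos hη.le (integral_nonpos_of_ae z2)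
  have := mul_nonpos_of_nonneg_of_nonpos (sub_pos.2 hη').le (integral_nonpos_of_ae z1)
  linarith

end S1

section S1Optimal

variable {Ω : Type*} [MeasurableSpace Ω] {P : Measure Ω} [IsProbabilityMeasure P]
  {S : ℕ → Ω → Gain} {sel : Finset (Fin 6) → (Fin 6 → ℝ) → Fin 6} {η Pt : ℝ} {w : Weights}
  {c : Coins} {p : Fin 4 → unitInterval} (hS : IsFadingChannel P S) (hsel : IsArgMax sel)
  (hη : 0 < η ∧ η < 1) (hPt : 0 < Pt) (hw : InBox η w) (h0 : w.μ₁ = 0)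

include hS hsel hη hw h0

lemma isOptimalWith_of_feasible_S1 (hμ : η ≤ w.μ₂) (hp : ∀ᵐ c ∂slotLaw p, GoodS1 η w c)
    (h : IsStatFeasible Pt ((P.map (S 0)).prod (slotLaw p)) fun z => protocol sel η w z.2 z.1) :
    IsOptimalWith P S sel η Pt w p := by
  have hν := hS.isGainLaw
  have := hν.prob
  refine isOptimalWith_of_best hS hsel h ?_
  filter_upwards [Measure.quasiMeasurePreserving_fst.ae (hν.ae_generic η w w hw.2.2),
    Measure.quasiMeasurePreserving_snd.ae hp] with z h1 h2
  exact best_of_goodS1 hsel hη.1 hw h0 hμ h1 h2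

include hPt

/-- Optimality in the first degenerate region for `μ₂ > η`. -/
theorem isOptimalWith_iff_S1_gt (hμ : η < w.μ₂) (hc : c 0 = true) :
    IsOptimalWith P S sel η Pt w p ↔
      0 < selExpect P S sel η w c {3, 5} (Cr2 w) ∧ (p 0 : ℝ) = 1 ∧
      (p 1 : ℝ) * selExpect P S sel η w c {3, 5} (Cr2 w) =
        selExpect P S sel η w c {2} (C12r η w) ∧
      HoldsC2 P S sel η w c ∧ HoldsPower P S sel η Pt w c := by
  have hν := hS.isGainLaw
  have hgood : GoodS1 η w c := Or.inl hc
  have hae : (p 0 : ℝ) = 1 → ∀ᵐ c ∂slotLaw p, GoodS1 η w c := fun hp =>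
    (ae_coin_eq_true hp).mono fun c hc => Or.inl hc
  have hC2 : HoldsC2 P S sel η w c ↔
      ∫ s, gate sel η w c {1} s * C2r η w s ∂P.map (S 0) +
        ∫ s, gate sel η w c {2} s * C21r η w s ∂P.map (S 0) =
      ∫ s, gate sel η w c {0, 3, 5} s * Cr1 w s ∂P.map (S 0) := by
    obtain ⟨-, ⟨i3, i4⟩, -⟩ := integrable_gates_S1 hsel hη.1 hw h0 hμ.le hν hη.2 hgood
    have eff := (ae_tieFreeS1 hν hw).mono fun s hs =>
      effects_S1 (c' := c) hsel hη.1 hw h0 hμ.le hs hgood hgood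
    rw [holdsC2_iff hS hsel, integral_congr_ae (eff.mono fun s hs => hs.2.1),
      integral_congr_ae (eff.mono fun s hs => hs.2.2.1), integral_add i3 i4]
    simp [coinInd, hc]
  rw [selExpect_eq hS hsel _ (measurable_Cr2 w), selExpect_eq hS hsel _ (measurable_C12r η w),
    gate_relay_S1 hsel h0 (hη.1.trans hμ).ne' hc, hC2, holdsPower_iff hS hsel hη hw]
  constructor
  · intro h
    have hf := h.facts hS hsel hη hPt
    have hp := coin_eq_one_S1 hsel hη.1 hw h0 hμ.le hν hη.2 hμ hf
    obtain ⟨e1, e2, e3⟩ :=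
      (isStatFeasible_iff_S1 hsel hη.1 hw h0 hμ.le hν hη.2 hgood (hae hp)).1 hf.feasible
    obtain ⟨-, -, hpos⟩ := relay_pos_S1 hsel hη.1 hw h0 hμ.le hν hη.2 hgood (hae hp) hf
    rw [hp] at e1 e2
    exact ⟨hpos, hp, by linarith, by linarith, e3⟩
  · rintro ⟨-, hp, e1, e2, e3⟩
    refine isOptimalWith_of_feasible_S1 hS hsel hη hw h0 hμ.le (hae hp)
      ((isStatFeasible_iff_S1 hsel hη.1 hw h0 hμ.le hν hη.2 hgood (hae hp)).2 ?_)
    rw [hp]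
    exact ⟨by linarith, by linarith, e3⟩

/-- Optimality in the first degenerate region for `μ₂ = η`. -/
theorem isOptimalWith_iff_S1_eq (hμ : w.μ₂ = η) :
    IsOptimalWith P S sel η Pt w p ↔
      0 < selExpect P S sel η w c {0, 3, 5} (Cr1 w) ∧ (0 : ℝ) < p 0 ∧
      0 < selExpect P S sel η w c {0, 3, 5} (Cr2 w) ∧
      (p 0 : ℝ) * selExpect P S sel η w c {0, 3, 5} (Cr1 w) =
        selExpect P S sel η w c {1} (C2r η w) + selExpect P S sel η w c {2} (C21r η w) ∧
      (p 1 : ℝ) * (p 0 * selExpect P S sel η w c {0, 3, 5} (Cr2 w)) =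
        (1 - p 0) * selExpect P S sel η w c {0, 3, 5} (C1r η w) +
          selExpect P S sel η w c {2} (C12r η w) ∧
      HoldsPower P S sel η Pt w c := by
  have hν := hS.isGainLaw
  have hgood : ∀ c, GoodS1 η w c := fun c => Or.inr hμ
  have hae : ∀ᵐ c ∂slotLaw p, GoodS1 η w c := ae_of_all _ hgood
  rw [selExpect_eq hS hsel _ (measurable_Cr2 w), selExpect_eq hS hsel _ (measurable_C12r η w),
    selExpect_eq hS hsel _ (measurable_Cr1 w), selExpect_eq hS hsel _ (measurable_C21r η w),
    selExpect_eq hS hsel _ (measurable_C1r η w), selExpect_eq hS hsel _ (measurable_C2r η w),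
    holdsPower_iff hS hsel hη hw]
  have hiff := isStatFeasible_iff_S1 (Pt := Pt) hsel hη.1 hw h0 hμ.ge hν hη.2 (hgood c) hae
  constructor
  · intro h
    have hf := h.facts hS hsel hη hPt
    obtain ⟨e1, e2, e3⟩ := hiff.1 hf.feasible
    obtain ⟨hp, hpos1, hpos2⟩ := relay_pos_S1 hsel hη.1 hw h0 hμ.ge hν hη.2 (hgood c) hae hf
    exact ⟨hpos1, hp, hpos2, by linarith, by linarith, e3⟩
  · rintro ⟨-, -, -, e1, e2, e3⟩
    exact isOptimalWith_of_feasible_S1 hS hsel hη hw h0 hμ.ge hae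
      (hiff.2 ⟨by linarith, by linarith, e3⟩)

end S1Optimal

section S2

variable {sel : Finset (Fin 6) → (Fin 6 → ℝ) → Fin 6} {η : ℝ} {w : Weights} {s : Gain}

/-- Gains for which ties between the groups `{M₂, M₅, M₆}`, `{M₁}`, `{M₃}` of modes occur with
vanishing powers only. -/
structure TieFreeS2 (η : ℝ) (w : Weights) (s : Gain) : Prop where
  gen : Generic η w w s
  tie₁ : metric η w s 1 ≤ metric η w s 2 → metric η w s 0 = metric η w s 2 →
    power1M1 η w s = 0 ∧ power1M3 η w s = 0 ∧ power2M3 η w s = 0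
  tie₂ : metric η w s 0 = metric η w s 4 → power1M1 η w s = 0 ∧ powerrM5 w s = 0
  tie₃ : metric η w s 1 ≤ metric η w s 2 → metric η w s 0 ≤ metric η w s 2 →
    metric η w s 2 = metric η w s 4 →
    power1M3 η w s = 0 ∧ power2M3 η w s = 0 ∧ powerrM5 w s = 0

lemma ae_tieFreeS2 {ν : Measure Gain} (hν : IsGainLaw ν) (hw : InBox η w) :
    ∀ᵐ s ∂ν, TieFreeS2 η w s := by
  set F : ℝ → ℝ := fun x => metric η w (0, x) 4
  have hF : Measurable F :=
    (measurable_metric_apply η w 4).comp (measurable_const.prodMk measurable_id)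
  filter_upwards [hν.ae_generic η w w hw.2.2, hν.ae_metric_zero_ne hw hF,
    hν.ae_metric_two_ne_snd hw hF] with s hs n1 n2
  have both := power_pos_and_pos hw hs
  have eP : 0 ≤ power1M3 η w s := power1M3_nonneg η w s
  have eQ : 0 ≤ power2M3 η w s := power2M3_nonneg η w s
  refine ⟨hs, fun m1 e => ?_, fun e => ?_, fun m1 m0 e => ?_⟩
  · have hz : ¬(0 < power1M3 η w s ∨ 0 < power2M3 η w s) := fun h => by
      obtain ⟨hP, hQ⟩ := both e.le m1 h
      exact (metric_lt_two hw hs hP hQ).1.ne e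
    push Not at hz
    have hP := le_antisymm hz.1 eP
    have hQ := le_antisymm hz.2 eQ
    exact ⟨power1M1_eq_zero hw hs.pos₁ (e.trans (metric_two_eq_zero hP hQ)), hP, hQ⟩
  · have hQ : power1M1 η w s = 0 := by
      by_contra hne
      exact n1 ⟨lt_of_le_of_ne (power1M1_nonneg η w s) (Ne.symm hne), e⟩
    refine ⟨hQ, powerrM5_eq_zero hw hs.pos₂ ?_⟩
    rw [← e]
    simp [metric, C1r, hQ, cap_zero]
  · have hz : ¬(0 < power1M3 η w s ∨ 0 < power2M3 η w s) := fun h => by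
      obtain ⟨hP, hQ⟩ := both m0 m1 h
      exact n2 ⟨hP, m0, m1, e⟩
    push Not at hz
    have hP := le_antisymm hz.1 eP
    have hQ := le_antisymm hz.2 eQ
    exact ⟨hP, hQ, powerrM5_eq_zero hw hs.pos₂ (e ▸ metric_two_eq_zero hP hQ)⟩

lemma metric_one_le_four (hw : InBox η w) (h2 : 0 < s.2) (h0 : w.μ₂ = 0) (hμ : 1 - η ≤ w.μ₁) :
    metric η w s 1 ≤ metric η w s 4 := by
  refine le_trans ?_ (waterfilling_le hw.2.2 h2 (power2M2_nonneg η w s))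
  have := cap_nonneg (mul_nonneg (power2M2_nonneg η w s) h2.le)
  simp only [metric, C2r, Matrix.cons_val, h0]
  nlinarith

/-- For these coins the candidate modes attain the maximal Lagrangian. -/
def GoodS2 (η : ℝ) (w : Weights) (c : Coins) : Prop := c 2 = true ∨ w.μ₁ = 1 - η

variable {c c' : Coins}

section

variable (hsel : IsArgMax sel) (hη : η < 1) (hw : InBox η w) (h0 : w.μ₂ = 0) (hμ : 1 - η ≤ w.μ₁)

include hsel hη hw h0 hμ

omit hw in
lemma mode_cases_S2 (hc : GoodS2 η w c) :
    mode sel η w c s = 0 ∨ mode sel η w c s = 2 ∨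
      (mode sel η w c s = 1 ∧ c 2 = false ∧ w.μ₁ = 1 - η) ∨
      (mode sel η w c s = 4 ∧ c 2 = true ∧ c 3 = false) ∨
      (mode sel η w c s = 5 ∧ c 2 = true ∧ c 3 = true) := by
  have hS : w.μ₁ ≠ 0 ∧ w.μ₂ = 0 := ⟨((sub_pos.2 hη).trans_le hμ).ne', h0⟩
  rcases (mem_candidates_S2 hS _).1 (mode_mem η w c s hsel) with (h | h) | ⟨h, h'⟩ | h | h
  · exact Or.inl h
  · exact Or.inr (Or.inl h)
  · exact Or.inr (Or.inr (Or.inl ⟨h, h', hc.resolve_left (by simp [h'])⟩))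
  · exact Or.inr (Or.inr (Or.inr (Or.inl h)))
  · exact Or.inr (Or.inr (Or.inr (Or.inr h)))

lemma metric_le_mode_S2 (h1 : 0 < s.1) (h2 : 0 < s.2) (hc : GoodS2 η w c) :
    metric η w s 0 ≤ metric η w s (mode sel η w c s) ∧
    metric η w s 2 ≤ metric η w s (mode sel η w c s) ∧
    metric η w s 4 ≤ metric η w s (mode sel η w c s) := by
  have hS : w.μ₁ ≠ 0 ∧ w.μ₂ = 0 := ⟨((sub_pos.2 hη).trans_le hμ).ne', h0⟩
  refine ⟨metric_le_mode η w c s hsel ((mem_candidates_S2 hS 0).2 (by simp)),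
    metric_le_mode η w c s hsel ((mem_candidates_S2 hS 2).2 (by simp)), ?_⟩
  rcases hc0 : c 2 with _ | _
  · rw [← metric_one_eq h0 (hc.resolve_left (by simp [hc0]))]
    exact metric_le_mode η w c s hsel ((mem_candidates_S2 hS 1).2 (by simp [hc0]))
  · rcases hc1 : c 3 with _ | _
    · exact metric_le_mode η w c s hsel ((mem_candidates_S2 hS 4).2 (by simp [hc0, hc1]))
    · rw [metric_four_eq hw h1 h2 h0]
      exact metric_le_mode η w c s hsel ((mem_candidates_S2 hS 5).2 (by simp [hc0, hc1]))

lemma metric_mode_relay_S2 (h1 : 0 < s.1) (h2 : 0 < s.2) (hc : GoodS2 η w c)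
    (hk : mode sel η w c s ∈ ({1, 4, 5} : Finset (Fin 6))) :
    metric η w s (mode sel η w c s) = metric η w s 4 := by
  rcases mode_cases_S2 (s := s) hsel hη h0 hμ hc with h | h | h | h | h
  · simp [h] at hk
  · simp [h] at hk
  · rw [h.1, metric_one_eq h0 h.2.2]
  · rw [h.1]
  · rw [h.1, metric_four_eq hw h1 h2 h0]

lemma best_of_goodS2 (hs : Generic η w w s) (hc : GoodS2 η w c) :
    w.Best η s (protocol sel η w c s) := by
  intro b hb
  obtain ⟨m0, m2, m3⟩ := metric_le_mode_S2 hsel hη hw h0 hμ hs.pos₁ hs.pos₂ hc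
  have := lagr_le_of_metric_le hw hs.pos₁ hs.pos₂ hs.ne
    m0 ((metric_one_le_four hw hs.pos₂ h0 hμ).trans m3) m2
    (metric_four_eq (η := η) hw hs.pos₁ hs.pos₂ h0 ▸ m3) hb
  rw [← lagr_protocol] at this
  exact this

/-- The selected group of modes does not depend on the coins, up to vanishing powers. -/
lemma gate_congr_S2 (hs : TieFreeS2 η w s) (hc : GoodS2 η w c) (hc' : GoodS2 η w c') :
    (gate sel η w c {0} s = gate sel η w c' {0} s ∨ power1M1 η w s = 0) ∧
    (gate sel η w c {2} s = gate sel η w c' {2} s ∨ power1M3 η w s = 0 ∧ power2M3 η w s = 0) ∧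
    (gate sel η w c {1, 4, 5} s = gate sel η w c' {1, 4, 5} s ∨ powerrM5 w s = 0) := by
  have h2 := hs.gen.pos₂
  have h1 := hs.gen.pos₁
  have g : ∀ {c}, GoodS2 η w c → mode sel η w c s = 0 ∨ mode sel η w c s = 2 ∨
      mode sel η w c s ∈ ({1, 4, 5} : Finset (Fin 6)) := by
    intro c hc
    rcases mode_cases_S2 (s := s) hsel hη h0 hμ hc with h | h | h | h | h <;> simp [h]
  have m13 := metric_one_le_four hw h2 h0 hμ
  obtain ⟨m0, m2, m3⟩ := metric_le_mode_S2 hsel hη hw h0 hμ h1 h2 hc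
  obtain ⟨m0', m2', m3'⟩ := metric_le_mode_S2 hsel hη hw h0 hμ h1 h2 hc'
  have r := metric_mode_relay_S2 hsel hη hw h0 hμ h1 h2 hc
  have r' := metric_mode_relay_S2 hsel hη hw h0 hμ h1 h2 hc'
  have ng : ∀ {c : Coins}, mode sel η w c s ∈ ({1, 4, 5} : Finset (Fin 6)) →
      mode sel η w c s ≠ 0 ∧ mode sel η w c s ≠ 2 := by
    intro c h
    constructor <;> intro h' <;> simp [h'] at h
  rcases g hc with h | h | h <;> rcases g hc' with h' | h' | h'
  · simp [gate, h, h']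
  · rw [h] at m0 m2 m3
    rw [h'] at m0' m2' m3'
    obtain ⟨a1, a2, a3⟩ := hs.tie₁ (m13.trans m3') (le_antisymm m0' m2)
    exact ⟨Or.inr a1, Or.inr ⟨a2, a3⟩, Or.inl (by simp [gate, h, h'])⟩
  · rw [h] at m0 m2 m3
    rw [r' h'] at m0' m2' m3'
    obtain ⟨a1, a2⟩ := hs.tie₂ (le_antisymm m0' m3)
    exact ⟨Or.inr a1, Or.inl (by simp [gate, h, (ng h').2]), Or.inr a2⟩
  · rw [h] at m0 m2 m3
    rw [h'] at m0' m2' m3'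
    obtain ⟨a1, a2, a3⟩ := hs.tie₁ (m13.trans m3) (le_antisymm m0 m2')
    exact ⟨Or.inr a1, Or.inr ⟨a2, a3⟩, Or.inl (by simp [gate, h, h'])⟩
  · simp [gate, h, h']
  · rw [h] at m0 m2 m3
    rw [r' h'] at m0' m2' m3'
    obtain ⟨a1, a2, a3⟩ := hs.tie₃ (m13.trans m3) m0 (le_antisymm m2' m3)
    exact ⟨Or.inl (by simp [gate, h, (ng h').1]), Or.inr ⟨a1, a2⟩, Or.inr a3⟩
  · rw [r h] at m0 m2 m3
    rw [h'] at m0' m2' m3'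
    obtain ⟨a1, a2⟩ := hs.tie₂ (le_antisymm m0 m3')
    exact ⟨Or.inr a1, Or.inl (by simp [gate, h', (ng h).2]), Or.inr a2⟩
  · rw [r h] at m0 m2 m3
    rw [h'] at m0' m2' m3'
    obtain ⟨a1, a2, a3⟩ := hs.tie₃ (m13.trans m3') m0' (le_antisymm m2 m3')
    exact ⟨Or.inl (by simp [gate, h', (ng h).1]), Or.inr ⟨a1, a2⟩, Or.inr a3⟩
  · have e : ∀ K : Finset (Fin 6), (∀ k ∈ K, k = 0 ∨ k = 2) → gate sel η w c K s = 0 ∧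
        gate sel η w c' K s = 0 := by
      intro K hK
      constructor
      · exact if_neg fun hm => (hK _ hm).elim (ng h).1 (ng h).2
      · exact if_neg fun hm => (hK _ hm).elim (ng h').1 (ng h').2
    refine ⟨Or.inl ?_, Or.inl ?_, Or.inl (by rw [gate, gate, if_pos h, if_pos h'])⟩
    · rw [(e {0} (by simp)).1, (e {0} (by simp)).2]
    · rw [(e {2} (by simp)).1, (e {2} (by simp)).2]

end

end S2

/-! ### The second degenerate region -/

section S2

variable {sel : Finset (Fin 6) → (Fin 6 → ℝ) → Fin 6} {η : ℝ} {w : Weights} {s : Gain}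
  {c c' : Coins}

lemma power2M2_le_powerrM5 (hw : InBox η w) (h0 : w.μ₂ = 0) (hμ : 1 - η ≤ w.μ₁) :
    power2M2 η w s ≤ powerrM5 w s := by
  have hG : 0 < w.γ * Real.log 2 := mul_pos hw.2.2 log_two_pos
  refine max_le_max (sub_le_sub_right ?_ _) le_rfl
  rw [h0, sub_zero]
  exact div_le_div_of_nonneg_right hμ hG.le

variable (hsel : IsArgMax sel) (hη : η < 1) (hw : InBox η w) (h0 : w.μ₂ = 0) (hμ : 1 - η ≤ w.μ₁)

include hsel hη hw h0 hμ

/-- The outcome of a slot in terms of the gates for reference coins. -/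
lemma effects_S2 (hs : TieFreeS2 η w s) (hc : GoodS2 η w c) (hc' : GoodS2 η w c') :
    (protocol sel η w c s).rate2r s = gate sel η w c' {2} s * C21r η w s +
      gate sel η w c' {1, 4, 5} s * C2r η w s * (1 - coinInd 2 c) ∧
    (protocol sel η w c s).rate1r s = gate sel η w c' {0} s * C1r η w s +
      gate sel η w c' {2} s * C12r η w s ∧
    (protocol sel η w c s).rater2 s = gate sel η w c' {1, 4, 5} s * Cr2 w s * coinInd 2 c ∧
    (protocol sel η w c s).rater1 s =
      gate sel η w c' {1, 4, 5} s * Cr1 w s * (coinInd 2 c * coinInd 3 c) ∧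
    totalPower (protocol sel η w c s) = gate sel η w c' {0} s * power1M1 η w s +
      gate sel η w c' {2} s * (power1M3 η w s + power2M3 η w s) +
      gate sel η w c' {1, 4, 5} s * powerrM5 w s := by
  have h2 := hs.gen.pos₂
  have h1 := hs.gen.pos₁
  have e64 := powerrM6_eq_powerrM5 hw h1 h2 h0
  obtain ⟨g1, g2, g3⟩ := gate_congr_S2 hsel hη hw h0 hμ hs hc' hc
  have k1 : gate sel η w c' {0} s * C1r η w s = gate sel η w c {0} s * C1r η w s := by
    rcases g1 with h | h
    · rw [h]
    · simp [C1r, h, cap_zero]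
  have k2 : gate sel η w c' {0} s * power1M1 η w s = gate sel η w c {0} s * power1M1 η w s := by
    rcases g1 with h | h
    · rw [h]
    · simp [h]
  have k3 : gate sel η w c' {2} s * C21r η w s = gate sel η w c {2} s * C21r η w s := by
    rcases g2 with h | ⟨h, h'⟩
    · rw [h]
    · simp [C21r, h, h', macRate₂, cap_zero]
  have k4 : gate sel η w c' {2} s * C12r η w s = gate sel η w c {2} s * C12r η w s := by
    rcases g2 with h | ⟨h, h'⟩
    · rw [h]
    · simp [C12r, h, h', macRate₁, cap_zero]
  have k5 : gate sel η w c' {2} s * (power1M3 η w s + power2M3 η w s) =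
      gate sel η w c {2} s * (power1M3 η w s + power2M3 η w s) := by
    rcases g2 with h | ⟨h, h'⟩
    · rw [h]
    · simp [h, h']
  have k6 : ∀ f : ℝ, (powerrM5 w s = 0 → f = 0) →
      gate sel η w c' {1, 4, 5} s * f = gate sel η w c {1, 4, 5} s * f := by
    intro f hf
    rcases g3 with h | h
    · rw [h]
    · rw [hf h, mul_zero, mul_zero]
  have k7 := k6 (Cr2 w s) fun h => by simp [Cr2, e64, h, cap_zero]
  have k8 := k6 (Cr1 w s) fun h => by simp [Cr1, e64, h, cap_zero]
  have k9 := k6 (powerrM5 w s) id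
  have k10 := k6 (C2r η w s) fun h => by
    have : power2M2 η w s = 0 :=
      le_antisymm (h ▸ power2M2_le_powerrM5 hw h0 hμ) (power2M2_nonneg η w s)
    simp [C2r, this, cap_zero]
  rw [k1, k2, k3, k4, k5, k7, k8, k9, k10]
  unfold totalPower
  rw [protocol_rate2r, protocol_rate1r, protocol_rater2, protocol_rater1, protocol_power₁,
    protocol_power₂, protocol_powerr]
  rcases mode_cases_S2 (s := s) hsel hη h0 hμ hc with h | h | ⟨h, hc0, hμ'⟩ | ⟨h, hc0, hc1⟩ |
    ⟨h, hc0, hc1⟩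
  · simp [gate, h]
  · simp [gate, h]
  · simp [gate, h, coinInd, hc0, power2M2_eq_powerrM5 h0 hμ']
  · simp [gate, h, coinInd, hc0, hc1, Cr2, e64]
  · simp [gate, h, coinInd, hc0, hc1, e64]

variable {ν : Measure Gain} (hν : IsGainLaw ν) (hη' : 0 < η)

include hν hη'

lemma integrable_gates_S2 (hc : GoodS2 η w c) :
    (Integrable (fun s => gate sel η w c {2} s * C21r η w s) ν ∧
      Integrable (fun s => gate sel η w c {1, 4, 5} s * C2r η w s) ν) ∧
    (Integrable (fun s => gate sel η w c {0} s * C1r η w s) ν ∧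
      Integrable (fun s => gate sel η w c {2} s * C12r η w s) ν) ∧
    Integrable (fun s => gate sel η w c {1, 4, 5} s * Cr2 w s) ν ∧
    Integrable (fun s => gate sel η w c {1, 4, 5} s * Cr1 w s) ν := by
  have hl := log_two_pos
  have hC : 0 ≤ 1 / Real.log 2 := by positivity
  have hd : 0 ≤ decOrder η w ∧ decOrder η w ≤ 1 := by
    rcases decOrder_eq η w with h | h <;> rw [h] <;> norm_num
  have capb : ∀ {p q x y T : ℝ}, 0 ≤ p → 0 < x → 0 < y → p ≤ q → q ≤ T →
      0 ≤ cap (p * x) ∧ cap (p * x) ≤ 1 / Real.log 2 * (T + (x + y)) := by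
    intro p q x y T hp hx hy hpq hqT
    refine ⟨cap_nonneg (mul_nonneg hp hx.le), (cap_mul_le hp hx.le).trans ?_⟩
    rw [one_div_mul_eq_div]
    exact div_le_div_of_nonneg_right (by linarith) hl.le
  have hR : ∀ s : Gain, 0 < s.1 → 0 < s.2 → mode sel η w c s ∈ ({1, 4, 5} : Finset (Fin 6)) →
      powerrM6 w s = powerrM5 w s ∧ powerrM5 w s ≤ (protocol sel η w c s).power₁ +
        (protocol sel η w c s).power₂ + (protocol sel η w c s).powerr := by
    intro s h1 h2 hk
    have e64 := powerrM6_eq_powerrM5 hw h1 h2 h0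
    refine ⟨e64, ?_⟩
    rw [protocol_power₁, protocol_power₂, protocol_powerr]
    rcases mode_cases_S2 (s := s) hsel hη h0 hμ hc with h | h | ⟨h, hc0, hμ'⟩ | ⟨h, -⟩ | ⟨h, -⟩
    · simp [h] at hk
    · simp [h] at hk
    · simp [h, power2M2_eq_powerrM5 h0 hμ']
    · simp [h]
    · simp [h, e64]
  have hR' := fun s => power2M2_le_powerrM5 (s := s) hw h0 hμ
  have h2P : ∀ s : Gain, mode sel η w c s = 2 → power1M3 η w s + power2M3 η w s ≤
      (protocol sel η w c s).power₁ + (protocol sel η w c s).power₂ +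
        (protocol sel η w c s).powerr := by
    intro s h
    rw [protocol_power₁, protocol_power₂, protocol_powerr]
    simp [h]
  refine ⟨⟨?_, ?_⟩, ⟨?_, ?_⟩, ?_, ?_⟩
  · refine integrable_gate_mul hsel hν ⟨hη', hη⟩ hw (measurable_C21r η w) _ hC fun s h1 h2 hk => ?_
    have hP := power1M3_nonneg η w s
    have hQ := power2M3_nonneg η w s
    refine ⟨macRate₂_nonneg hd hP hQ h1.le h2.le, (macRate₂_le hd hP hQ h1.le h2.le).trans ?_⟩
    have := h2P s (by simpa using hk)
    rw [add_comm s.1 s.2]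
    exact (capb hQ h2 h1 le_rfl (by linarith)).2
  · refine integrable_gate_mul hsel hν ⟨hη', hη⟩ hw (measurable_C2r η w) _ hC fun s h1 h2 hk => ?_
    rw [add_comm s.1 s.2]
    exact capb (power2M2_nonneg η w s) h2 h1 (hR' s) (hR s h1 h2 hk).2
  · refine integrable_gate_mul hsel hν ⟨hη', hη⟩ hw (measurable_C1r η w) _ hC fun s h1 h2 hk => ?_
    refine capb (power1M1_nonneg η w s) h1 h2 le_rfl ?_
    rw [protocol_power₁, protocol_power₂, protocol_powerr]
    simp only [Finset.mem_singleton] at hk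
    simp [hk]
  · refine integrable_gate_mul hsel hν ⟨hη', hη⟩ hw (measurable_C12r η w) _ hC fun s h1 h2 hk => ?_
    have hP := power1M3_nonneg η w s
    have hQ := power2M3_nonneg η w s
    refine ⟨macRate₁_nonneg hd hP hQ h1.le h2.le, (macRate₁_le hd hP hQ h1.le h2.le).trans ?_⟩
    have := h2P s (by simpa using hk)
    exact (capb hP h1 h2 le_rfl (by linarith)).2
  · refine integrable_gate_mul hsel hν ⟨hη', hη⟩ hw (measurable_Cr2 w) _ hC fun s h1 h2 hk => ?_
    have := hR s h1 h2 hk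
    rw [add_comm s.1 s.2]
    exact capb (powerrM6_nonneg w s) h2 h1 this.1.le this.2
  · refine integrable_gate_mul hsel hν ⟨hη', hη⟩ hw (measurable_Cr1 w) _ hC fun s h1 h2 hk => ?_
    have := hR s h1 h2 hk
    exact capb (powerrM6_nonneg w s) h1 h2 this.1.le this.2

variable {p : Fin 4 → unitInterval}

/-- The expected rates and power of the protocol for random coins. -/
lemma integrals_S2 (hc : GoodS2 η w c) (hp : ∀ᵐ c ∂slotLaw p, GoodS2 η w c) :
    ∫ z, (protocol sel η w z.2 z.1).rate2r z.1 ∂ν.prod (slotLaw p) =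
      ∫ s, gate sel η w c {2} s * C21r η w s ∂ν +
        (∫ s, gate sel η w c {1, 4, 5} s * C2r η w s ∂ν) * (1 - p 2) ∧
    ∫ z, (protocol sel η w z.2 z.1).rate1r z.1 ∂ν.prod (slotLaw p) =
      ∫ s, gate sel η w c {0} s * C1r η w s ∂ν + ∫ s, gate sel η w c {2} s * C12r η w s ∂ν ∧
    ∫ z, (protocol sel η w z.2 z.1).rater2 z.1 ∂ν.prod (slotLaw p) =
      (∫ s, gate sel η w c {1, 4, 5} s * Cr2 w s ∂ν) * p 2 ∧
    ∫ z, (protocol sel η w z.2 z.1).rater1 z.1 ∂ν.prod (slotLaw p) =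
      (∫ s, gate sel η w c {1, 4, 5} s * Cr1 w s ∂ν) * (p 2 * p 3) ∧
    meanPower (ν.prod (slotLaw p)) (fun z => protocol sel η w z.2 z.1) =
      ∫ s, totalPower (protocol sel η w c s) ∂ν := by
  have := hν.prob
  obtain ⟨⟨i1, i2⟩, ⟨i3, i4⟩, i5, i6⟩ := integrable_gates_S2 hsel hη hw h0 hμ hν hη' hc
  have hae : ∀ᵐ z ∂ν.prod (slotLaw p), TieFreeS2 η w z.1 ∧ GoodS2 η w z.2 :=
    (Measure.quasiMeasurePreserving_fst.ae (ae_tieFreeS2 hν hw)).and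
      (Measure.quasiMeasurePreserving_snd.ae hp)
  have eff := hae.mono fun z hz => effects_S2 (c' := c) hsel hη hw h0 hμ hz.1 hz.2 hc
  have zero : Integrable (fun _ : Gain => (0 : ℝ)) ν := integrable_zero _ _ _
  have e0 : ∫ c, (1 - coinInd 2 c) ∂slotLaw p = 1 - p 2 := by
    rw [integral_sub Integrable.of_finite Integrable.of_finite, integral_coinInd]
    simp
  refine ⟨?_, ?_, ?_, ?_, ?_⟩
  · rw [integral_congr_ae (eff.mono fun z hz => hz.1),
      integral_add_mul_coin (κ := slotLaw p) i1 i2 fun c => 1 - coinInd 2 c, e0]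
  · rw [integral_congr_ae (eff.mono fun z hz => hz.2.1), ← integral_add i3 i4,
      integral_fun_fst fun s => gate sel η w c {0} s * C1r η w s +
        gate sel η w c {2} s * C12r η w s]
    simp
  · have := integral_add_mul_coin (κ := slotLaw p) zero i5 (coinInd 2)
    simp only [zero_add, integral_zero] at this
    rw [integral_congr_ae (eff.mono fun z hz => hz.2.2.1), this, integral_coinInd]
  · have := integral_add_mul_coin (κ := slotLaw p) zero i6 fun c => coinInd 2 c * coinInd 3 c
    simp only [zero_add, integral_zero] at this
    rw [integral_congr_ae (eff.mono fun z hz => hz.2.2.2.1), this,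
      integral_coinInd_mul p (by decide)]
  · rw [meanPower_eq_integral (hasFinitePower_protocol hν hsel ⟨hη', hη⟩ hw)]
    have : ∀ᵐ z ∂ν.prod (slotLaw p), totalPower (protocol sel η w z.2 z.1) =
        totalPower (protocol sel η w c z.1) := by
      filter_upwards [hae, eff] with z h2 h1
      rw [h1.2.2.2.2, (effects_S2 (c' := c) hsel hη hw h0 hμ h2.1 hc hc).2.2.2.2]
    rw [integral_congr_ae this, integral_fun_fst fun s => totalPower (protocol sel η w c s)]
    simp

end S2

section S2

variable {sel : Finset (Fin 6) → (Fin 6 → ℝ) → Fin 6} {η Pt : ℝ} {w : Weights} {s : Gain}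
  {c c' : Coins} {ν : Measure Gain} {p : Fin 4 → unitInterval}

/-- The range of `μ₁` for optimal weights of the second degenerate region. -/
lemma OptimalFacts.le_μ₁ {κ : Measure Coins} [IsProbabilityMeasure κ] (hν : IsGainLaw ν)
    (hsel : IsArgMax sel) (hη : 0 < η ∧ η < 1) (h : OptimalFacts ν sel η Pt w κ)
    (hS : w.InRegion .S2) : 1 - η ≤ w.μ₁ := by
  have hb := h.best.and (hν.ae_pos (κ := κ))
  have hex : ∃ z : Gain × Coins, (w.Best η z.1 (protocol sel η w z.2 z.1) ∧ 0 < z.1.1 ∧ 0 < z.1.2) ∧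
      ((mode sel η w z.2 z.1 = 4 ∧ 0 < powerrM5 w z.1) ∨
        (mode sel η w z.2 z.1 = 5 ∧ 0 < powerrM6 w z.1)) := by
    by_contra! hne
    have z1 : ∀ᵐ z ∂ν.prod κ, (protocol sel η w z.2 z.1).rater2 z.1 ≤ 0 := by
      filter_upwards [hb] with z hz
      by_contra! hpos
      rcases rater2_pos_imp hpos with h' | h'
      · exact absurd h'.2 (not_lt.2 ((hne z hz).1 h'.1))
      · exact absurd h'.2 (not_lt.2 ((hne z hz).2 h'.1))
    have z2 : ∀ᵐ z ∂ν.prod κ, (protocol sel η w z.2 z.1).rater1 z.1 ≤ 0 := by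
      filter_upwards [hb] with z hz
      by_contra! hpos
      rcases rater1_pos_imp hpos with h' | h'
      · exact (eq_S1_of_mode_eq_three hsel h'.1).2 hS.2
      · exact absurd h'.2 (not_lt.2 ((hne z hz).2 h'.1))
    have hv := h.value_pos
    have e1 := integral_nonpos_of_ae z1
    have e2 := integral_nonpos_of_ae z2
    rw [value, h.feasible.c1, h.feasible.c2] at hv
    have := mul_nonpos_of_nonneg_of_nonpos hη.1.le e1
    have := mul_nonpos_of_nonneg_of_nonpos (sub_pos.2 hη.2).le e2
    linarith
  obtain ⟨z, ⟨hbz, h1, h2⟩, hz⟩ := hex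
  have key : ∀ r : ℝ, 0 < r → (1 - η - w.μ₂) * cap (r * z.1.2) - w.γ * r ≤
      w.μ₁ * cap (r * z.1.2) - w.γ * r → 1 - η ≤ w.μ₁ := by
    intro r hr hle
    rw [hS.2] at hle
    have := cap_pos (mul_pos hr h2)
    by_contra! hneg
    nlinarith
  rcases hz with ⟨hk, hP⟩ | ⟨hk, hP⟩
  · refine key _ hP ?_
    have := hbz.mode_le 1 (Or.inl rfl) le_rfl hP.le le_rfl
    rw [lagrangian_protocol, hk] at this
    exact this
  · refine key _ hP ?_
    have := hbz.mode_le 1 (Or.inl rfl) le_rfl hP.le le_rfl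
    rw [lagrangian_protocol, hk] at this
    refine this.trans (le_of_eq ?_)
    simp [Cr2, hS.2]

lemma gate_relay_S2 (hsel : IsArgMax sel) (h0 : w.μ₂ = 0) (hμ : w.μ₁ ≠ 0) (hc : c 2 = true) :
    gate sel η w c {4, 5} = gate sel η w c {1, 4, 5} := by
  funext s
  have : mode sel η w c s ≠ 1 := by
    intro hk
    have hm := mode_mem η w c s hsel
    rw [hk, mem_candidates_S2 ⟨hμ, h0⟩] at hm
    simp [hc] at hm
  simp [gate, this]

variable (hsel : IsArgMax sel) (hη : η < 1) (hw : InBox η w) (h0 : w.μ₂ = 0) (hμ : 1 - η ≤ w.μ₁)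
  (hν : IsGainLaw ν) (hη' : 0 < η)

include hsel hη hw h0 hμ hν hη'

lemma isStatFeasible_iff_S2 (hc : GoodS2 η w c) (hp : ∀ᵐ c ∂slotLaw p, GoodS2 η w c) :
    IsStatFeasible Pt (ν.prod (slotLaw p)) (fun z => protocol sel η w z.2 z.1) ↔
      ∫ s, gate sel η w c {2} s * C21r η w s ∂ν +
          (∫ s, gate sel η w c {1, 4, 5} s * C2r η w s ∂ν) * (1 - p 2) =
        (∫ s, gate sel η w c {1, 4, 5} s * Cr1 w s ∂ν) * (p 2 * p 3) ∧
      ∫ s, gate sel η w c {0} s * C1r η w s ∂ν + ∫ s, gate sel η w c {2} s * C12r η w s ∂ν =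
        (∫ s, gate sel η w c {1, 4, 5} s * Cr2 w s ∂ν) * p 2 ∧
      ∫ s, totalPower (protocol sel η w c s) ∂ν = Pt := by
  obtain ⟨e1, e2, e3, e4, e5⟩ := integrals_S2 hsel hη hw h0 hμ hν hη' hc hp
  rw [← e1, ← e2, ← e3, ← e4, ← e5]
  exact ⟨fun h => ⟨h.c2, h.c1, h.power⟩, fun h =>
    ⟨hasFinitePower_protocol hν hsel ⟨hη', hη⟩ hw, h.2.1, h.1, h.2.2⟩⟩

lemma relay_pos_S2 (hc : GoodS2 η w c) (hp : ∀ᵐ c ∂slotLaw p, GoodS2 η w c)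
    (h : OptimalFacts ν sel η Pt w (slotLaw p)) :
    (0 : ℝ) < p 2 ∧ 0 < ∫ s, gate sel η w c {1, 4, 5} s * Cr2 w s ∂ν ∧
      0 < ∫ s, gate sel η w c {1, 4, 5} s * Cr1 w s ∂ν := by
  obtain ⟨-, -, e3, e4, -⟩ := integrals_S2 (p := p) hsel hη hw h0 hμ hν hη' hc hp
  obtain ⟨-, -, i5, i6⟩ := integrable_gates_S2 (c := c) hsel hη hw h0 hμ hν hη' hc
  have hg : ∀ s, 0 ≤ gate sel η w c {1, 4, 5} s := by
    intro s; unfold gate; split_ifs <;> norm_num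
  have n1 : 0 ≤ᵐ[ν] fun s => gate sel η w c {1, 4, 5} s * Cr2 w s := by
    filter_upwards [hν.pos] with s hs
    exact mul_nonneg (hg s) (cap_nonneg (mul_nonneg (powerrM6_nonneg w s) hs.2.le))
  have n2 : 0 ≤ᵐ[ν] fun s => gate sel η w c {1, 4, 5} s * Cr1 w s := by
    filter_upwards [hν.pos] with s hs
    exact mul_nonneg (hg s) (cap_nonneg (mul_nonneg (powerrM6_nonneg w s) hs.1.le))
  have hP : ∀ {x : ℝ}, 0 < x → ∀ s, cap (powerrM6 w s * x) = 0 → powerrM6 w s = 0 := by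
    intro x hx s hcap
    by_contra hne
    exact (cap_pos (mul_pos (lt_of_le_of_ne (powerrM6_nonneg w s) (Ne.symm hne)) hx)).ne' hcap
  have z12 : ∫ s, gate sel η w c {1, 4, 5} s * Cr2 w s ∂ν = 0 →
      ∫ s, gate sel η w c {1, 4, 5} s * Cr1 w s ∂ν = 0 := by
    intro hz
    rw [integral_eq_zero_iff_of_nonneg_ae n2 i6]
    filter_upwards [(integral_eq_zero_iff_of_nonneg_ae n1 i5).1 hz, hν.pos] with s hs hpos
    rcases mul_eq_zero.1 hs with h' | h'
    · simp [h']
    · simp [Cr1, hP hpos.2 s h', cap_zero]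
  have z21 : ∫ s, gate sel η w c {1, 4, 5} s * Cr1 w s ∂ν = 0 →
      ∫ s, gate sel η w c {1, 4, 5} s * Cr2 w s ∂ν = 0 := by
    intro hz
    rw [integral_eq_zero_iff_of_nonneg_ae n1 i5]
    filter_upwards [(integral_eq_zero_iff_of_nonneg_ae n2 i6).1 hz, hν.pos] with s hs hpos
    rcases mul_eq_zero.1 hs with h' | h'
    · simp [h']
    · simp [Cr2, hP hpos.1 s h', cap_zero]
  have j1 := integral_nonneg_of_ae n1
  have j2 := integral_nonneg_of_ae n2
  have hv := h.value_pos
  rw [value, h.feasible.c1, h.feasible.c2, e3, e4] at hv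
  refine ⟨lt_of_le_of_ne (p 2).2.1 fun hz => ?_, lt_of_le_of_ne j1 fun hz => ?_,
    lt_of_le_of_ne j2 fun hz => ?_⟩
  · rw [← hz] at hv
    simp at hv
  · rw [← hz, z12 hz.symm] at hv
    simp at hv
  · rw [← hz, z21 hz.symm] at hv
    simp at hv

omit hν hη' in
/-- Where the protocol is optimal although the third coin shows `0`, the relay is silent. -/
lemma relay_silent_S2 (hμ' : 1 - η < w.μ₁) {c₁ : Coins} (hc₁ : c₁ 2 = false) (ht : TieFreeS2 η w s)
    (hbs : w.Best η s (protocol sel η w c₁ s)) (hc : c 2 = true)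
    (hk : mode sel η w c s = 4 ∨ mode sel η w c s = 5) : powerrM5 w s = 0 := by
  have hS : w.μ₁ ≠ 0 ∧ w.μ₂ = 0 := ⟨((sub_pos.2 hη).trans hμ').ne', h0⟩
  have h2 := ht.gen.pos₂
  have h1 := ht.gen.pos₁
  have hgood : GoodS2 η w c := Or.inl hc
  have hr : metric η w s (mode sel η w c s) = metric η w s 4 :=
    metric_mode_relay_S2 hsel hη hw h0 hμ h1 h2 hgood (by rcases hk with hk | hk <;> simp [hk])
  obtain ⟨m0, m2, -⟩ := metric_le_mode_S2 hsel hη hw h0 hμ h1 h2 hgood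
  rw [hr] at m0 m2
  have h3 : metric η w s 4 ≤ metric η w s (mode sel η w c₁ s) := by
    have e := hbs.mode_le 4 (t := 0) (Or.inl rfl) (le_refl 0) (le_refl 0) (powerrM5_nonneg w s)
    rw [lagrangian_protocol] at e
    exact e
  have h03 : metric η w s 1 ≤ metric η w s 4 := metric_one_le_four hw h2 h0 hμ
  have hm := (mem_candidates_S2 hS _).1 (mode_mem η w c₁ s hsel)
  simp only [hc₁, Bool.false_eq_true, false_and, and_false, or_false, and_true] at hm
  rcases hm with (hm | hm) | hm <;> rw [hm] at h3
  · exact (ht.tie₂ (le_antisymm m0 h3)).2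
  · exact (ht.tie₃ (h03.trans h3) (m0.trans h3) (le_antisymm m2 h3)).2.2
  · have e3 : metric η w s 4 = w.μ₁ * cap (powerrM5 w s * s.2) - w.γ * powerrM5 w s := rfl
    have e4 : metric η w s 1 = (1 - η - w.μ₂) * cap (power2M2 η w s * s.2) -
      w.γ * power2M2 η w s := rfl
    have hP : power2M2 η w s = 0 := by
      by_contra hP
      have hP' := lt_of_le_of_ne (power2M2_nonneg η w s) (Ne.symm hP)
      have e1 : w.μ₁ * cap (power2M2 η w s * s.2) - w.γ * power2M2 η w s ≤
          w.μ₁ * cap (powerrM5 w s * s.2) - w.γ * powerrM5 w s :=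
        waterfilling_le hw.2.2 h2 hP'.le
      have e2 := mul_pos (sub_pos.2 hμ') (cap_pos (mul_pos hP' h2))
      rw [e3, e4, h0] at h3
      linarith
    have e5 : metric η w s 1 = 0 := by rw [e4, hP]; simp [cap_zero]
    rw [e5] at h3 h03
    exact powerrM5_eq_zero hw h2 (le_antisymm h3 h03)

lemma coin_eq_one_S2 (hμ' : 1 - η < w.μ₁) (h : OptimalFacts ν sel η Pt w (slotLaw p)) :
    (p 2 : ℝ) = 1 := by
  have := hν.prob
  by_contra hp
  obtain ⟨c₁, hc₁, hb⟩ := exists_coins_of_ae h.best hp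
  have hS : w.μ₁ ≠ 0 ∧ w.μ₂ = 0 := ⟨((sub_pos.2 hη).trans hμ').ne', h0⟩
  have key : ∀ᵐ s ∂ν, ∀ c : Coins, (mode sel η w c s = 4 ∨ mode sel η w c s = 5) →
      powerrM5 w s = 0 ∧ powerrM6 w s = 0 := by
    filter_upwards [hb, ae_tieFreeS2 hν hw] with s hbs ht c hk
    rw [powerrM6_eq_powerrM5 hw ht.gen.pos₁ ht.gen.pos₂ h0, and_self]
    have hc : c 2 = true := by
      have hm := (mem_candidates_S2 hS _).1 (mode_mem η w c s hsel)
      rcases hk with hk | hk <;> rw [hk] at hm <;> simp at hm <;> exact hm.1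
    exact relay_silent_S2 hsel hη hw h0 hμ hμ' hc₁ ht hbs hc hk
  have hv := h.value_pos
  have hae : ∀ᵐ z ∂ν.prod (slotLaw p), ∀ c : Coins,
      (mode sel η w c z.1 = 4 ∨ mode sel η w c z.1 = 5) →
      powerrM5 w z.1 = 0 ∧ powerrM6 w z.1 = 0 :=
    Measure.quasiMeasurePreserving_fst.ae key
  have z1 : ∀ᵐ z ∂ν.prod (slotLaw p), (protocol sel η w z.2 z.1).rater2 z.1 ≤ 0 := by
    filter_upwards [hae] with z hz
    by_contra! hpos
    rcases rater2_pos_imp hpos with h' | h'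
    · exact h'.2.ne' (hz _ (Or.inl h'.1)).1
    · exact h'.2.ne' (hz _ (Or.inr h'.1)).2
  have z2 : ∀ᵐ z ∂ν.prod (slotLaw p), (protocol sel η w z.2 z.1).rater1 z.1 ≤ 0 := by
    filter_upwards [hae] with z hz
    by_contra! hpos
    rcases rater1_pos_imp hpos with h' | h'
    · exact (eq_S1_of_mode_eq_three hsel h'.1).2 h0
    · exact h'.2.ne' (hz _ (Or.inr h'.1)).2
  rw [value, h.feasible.c1, h.feasible.c2] at hv
  have := mul_nonpos_of_nonneg_of_nonpos hη'.le (integral_nonpos_of_ae z1)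
  have := mul_nonpos_of_nonneg_of_nonpos (sub_pos.2 hη).le (integral_nonpos_of_ae z2)
  linarith

end S2

section S2Optimal

variable {Ω : Type*} [MeasurableSpace Ω] {P : Measure Ω} [IsProbabilityMeasure P]
  {S : ℕ → Ω → Gain} {sel : Finset (Fin 6) → (Fin 6 → ℝ) → Fin 6} {η Pt : ℝ} {w : Weights}
  {c : Coins} {p : Fin 4 → unitInterval} (hS : IsFadingChannel P S) (hsel : IsArgMax sel)
  (hη : 0 < η ∧ η < 1) (hPt : 0 < Pt) (hw : InBox η w) (h0 : w.μ₂ = 0)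

include hS hsel hη hw h0

lemma isOptimalWith_of_feasible_S2 (hμ : 1 - η ≤ w.μ₁) (hp : ∀ᵐ c ∂slotLaw p, GoodS2 η w c)
    (h : IsStatFeasible Pt ((P.map (S 0)).prod (slotLaw p)) fun z => protocol sel η w z.2 z.1) :
    IsOptimalWith P S sel η Pt w p := by
  have hν := hS.isGainLaw
  have := hν.prob
  refine isOptimalWith_of_best hS hsel h ?_
  filter_upwards [Measure.quasiMeasurePreserving_fst.ae (hν.ae_generic η w w hw.2.2),
    Measure.quasiMeasurePreserving_snd.ae hp] with z h1 h2
  exact best_of_goodS2 hsel hη.2 hw h0 hμ h1 h2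

include hPt

/-- Optimality in the second degenerate region for `μ₁ > 1 - η`. -/
theorem isOptimalWith_iff_S2_gt (hμ : 1 - η < w.μ₁) (hc : c 2 = true) :
    IsOptimalWith P S sel η Pt w p ↔
      0 < selExpect P S sel η w c {4, 5} (Cr1 w) ∧ (p 2 : ℝ) = 1 ∧
      (p 3 : ℝ) * selExpect P S sel η w c {4, 5} (Cr1 w) =
        selExpect P S sel η w c {2} (C21r η w) ∧
      HoldsC1 P S sel η w c ∧ HoldsPower P S sel η Pt w c := by
  have hν := hS.isGainLaw
  have hgood : GoodS2 η w c := Or.inl hc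
  have hae : (p 2 : ℝ) = 1 → ∀ᵐ c ∂slotLaw p, GoodS2 η w c := fun hp =>
    (ae_coin_eq_true hp).mono fun c hc => Or.inl hc
  have hC2 : HoldsC1 P S sel η w c ↔
      ∫ s, gate sel η w c {0} s * C1r η w s ∂P.map (S 0) +
        ∫ s, gate sel η w c {2} s * C12r η w s ∂P.map (S 0) =
      ∫ s, gate sel η w c {1, 4, 5} s * Cr2 w s ∂P.map (S 0) := by
    obtain ⟨-, ⟨i3, i4⟩, -⟩ := integrable_gates_S2 hsel hη.2 hw h0 hμ.le hν hη.1 hgood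
    have eff := (ae_tieFreeS2 hν hw).mono fun s hs =>
      effects_S2 (c' := c) hsel hη.2 hw h0 hμ.le hs hgood hgood
    rw [holdsC1_iff hS hsel, integral_congr_ae (eff.mono fun s hs => hs.2.1),
      integral_congr_ae (eff.mono fun s hs => hs.2.2.1), integral_add i3 i4]
    simp [coinInd, hc]
  rw [selExpect_eq hS hsel _ (measurable_Cr1 w), selExpect_eq hS hsel _ (measurable_C21r η w),
    gate_relay_S2 hsel h0 ((sub_pos.2 hη.2).trans hμ).ne' hc, hC2, holdsPower_iff hS hsel hη hw]
  constructor
  · intro h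
    have hf := h.facts hS hsel hη hPt
    have hp := coin_eq_one_S2 hsel hη.2 hw h0 hμ.le hν hη.1 hμ hf
    obtain ⟨e1, e2, e3⟩ :=
      (isStatFeasible_iff_S2 hsel hη.2 hw h0 hμ.le hν hη.1 hgood (hae hp)).1 hf.feasible
    obtain ⟨-, -, hpos⟩ := relay_pos_S2 hsel hη.2 hw h0 hμ.le hν hη.1 hgood (hae hp) hf
    rw [hp] at e1 e2
    exact ⟨hpos, hp, by linarith, by linarith, e3⟩
  · rintro ⟨-, hp, e1, e2, e3⟩
    refine isOptimalWith_of_feasible_S2 hS hsel hη hw h0 hμ.le (hae hp)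
      ((isStatFeasible_iff_S2 hsel hη.2 hw h0 hμ.le hν hη.1 hgood (hae hp)).2 ?_)
    rw [hp]
    exact ⟨by linarith, by linarith, e3⟩

/-- Optimality in the second degenerate region for `μ₁ = 1 - η`. -/
theorem isOptimalWith_iff_S2_eq (hμ : w.μ₁ = 1 - η) :
    IsOptimalWith P S sel η Pt w p ↔
      0 < selExpect P S sel η w c {1, 4, 5} (Cr2 w) ∧ (0 : ℝ) < p 2 ∧
      0 < selExpect P S sel η w c {1, 4, 5} (Cr1 w) ∧
      (p 2 : ℝ) * selExpect P S sel η w c {1, 4, 5} (Cr2 w) =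
        selExpect P S sel η w c {0} (C1r η w) + selExpect P S sel η w c {2} (C12r η w) ∧
      (p 3 : ℝ) * (p 2 * selExpect P S sel η w c {1, 4, 5} (Cr1 w)) =
        (1 - p 2) * selExpect P S sel η w c {1, 4, 5} (C2r η w) +
          selExpect P S sel η w c {2} (C21r η w) ∧
      HoldsPower P S sel η Pt w c := by
  have hν := hS.isGainLaw
  have hgood : ∀ c, GoodS2 η w c := fun c => Or.inr hμ
  have hae : ∀ᵐ c ∂slotLaw p, GoodS2 η w c := ae_of_all _ hgood
  rw [selExpect_eq hS hsel _ (measurable_Cr1 w), selExpect_eq hS hsel _ (measurable_C21r η w),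
    selExpect_eq hS hsel _ (measurable_Cr2 w), selExpect_eq hS hsel _ (measurable_C12r η w),
    selExpect_eq hS hsel _ (measurable_C2r η w), selExpect_eq hS hsel _ (measurable_C1r η w),
    holdsPower_iff hS hsel hη hw]
  have hiff := isStatFeasible_iff_S2 (Pt := Pt) hsel hη.2 hw h0 hμ.ge hν hη.1 (hgood c) hae
  constructor
  · intro h
    have hf := h.facts hS hsel hη hPt
    obtain ⟨e1, e2, e3⟩ := hiff.1 hf.feasible
    obtain ⟨hp, hpos1, hpos2⟩ := relay_pos_S2 hsel hη.2 hw h0 hμ.ge hν hη.1 (hgood c) hae hf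
    exact ⟨hpos1, hp, hpos2, by linarith, by linarith, e3⟩
  · rintro ⟨-, -, -, e1, e2, e3⟩
    exact isOptimalWith_of_feasible_S2 hS hsel hη hw h0 hμ.ge hae
      (hiff.2 ⟨by linarith, by linarith, e3⟩)

end S2Optimal

/-! ### The region without coin flips -/

section S0

variable {sel : Finset (Fin 6) → (Fin 6 → ℝ) → Fin 6} {η Pt : ℝ} {w : Weights}

lemma protocol_congr_S0 (h : w.InRegion .S0) (c c' : Coins) (s : Gain) :
    protocol sel η w c s = protocol sel η w c' s := by
  have hc : candidates w c = candidates w c' := by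
    simp [candidates, indicator, h.1, h.2]
  have hm : mode sel η w c s = mode sel η w c' s := by rw [mode, mode, hc]
  simp only [protocol, hm]

lemma best_S0 (hsel : IsArgMax sel) (hw : InBox η w) (h : w.InRegion .S0) (c : Coins) {s : Gain}
    (hs : Generic η w w s) : w.Best η s (protocol sel η w c s) := by
  intro b hb
  have key : ∀ k : Fin 6, k ≠ 3 ∧ k ≠ 4 → metric η w s k ≤ metric η w s (mode sel η w c s) :=
    fun k hk => metric_le_mode η w c s hsel
      ((mem_candidates_S0 (fun h' => h.1 h'.1) (fun h' => h.2 h'.2) k).2 hk)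
  have := lagr_le_of_metric_le hw hs.pos₁ hs.pos₂ hs.ne (key 0 (by decide)) (key 1 (by decide))
    (key 2 (by decide)) (key 5 (by decide)) hb
  rw [← lagr_protocol] at this
  exact this

variable {Ω : Type*} [MeasurableSpace Ω] {P : Measure Ω} [IsProbabilityMeasure P]
  {S : ℕ → Ω → Gain}

/-- Optimality in the region without coin flips. -/
theorem isOptimalWith_iff_S0 (hS : IsFadingChannel P S) (hsel : IsArgMax sel)
    (hη : 0 < η ∧ η < 1) (hPt : 0 < Pt) (hw : InBox η w) (h : w.InRegion .S0) (c : Coins)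
    (p : Fin 4 → unitInterval) : IsOptimalWith P S sel η Pt w p ↔
      HoldsC1 P S sel η w c ∧ HoldsC2 P S sel η w c ∧ HoldsPower P S sel η Pt w c := by
  have hν := hS.isGainLaw
  have := hν.prob
  have e : (fun z : Gain × Coins => protocol sel η w z.2 z.1) =
      fun z => protocol sel η w c z.1 := funext fun z => protocol_congr_S0 h _ _ _
  have hfin := hasFinitePower_protocol (κ := slotLaw p) hν hsel hη hw
  have fst : ∀ f : Gain → ℝ, ∫ z, f z.1 ∂(P.map (S 0)).prod (slotLaw p) = ∫ s, f s ∂P.map (S 0) := by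
    intro f
    rw [integral_fun_fst]
    simp
  have hfeas : IsStatFeasible Pt ((P.map (S 0)).prod (slotLaw p))
      (fun z => protocol sel η w z.2 z.1) ↔
        HoldsC1 P S sel η w c ∧ HoldsC2 P S sel η w c ∧ HoldsPower P S sel η Pt w c := by
    rw [holdsC1_iff hS hsel, holdsC2_iff hS hsel, holdsPower_iff hS hsel hη hw,
      ← fst fun s => (protocol sel η w c s).rate1r s, ← fst fun s => (protocol sel η w c s).rater2 s,
      ← fst fun s => (protocol sel η w c s).rate2r s, ← fst fun s => (protocol sel η w c s).rater1 s,
      ← fst fun s => totalPower (protocol sel η w c s)]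
    rw [e] at hfin ⊢
    have hp := meanPower_eq_integral hfin
    rw [← hp]
    exact ⟨fun h => ⟨h.c1, h.c2, h.power⟩, fun h => ⟨hfin, h.1, h.2.1, h.2.2⟩⟩
  rw [← hfeas]
  refine ⟨fun h => (h.facts hS hsel hη hPt).feasible, fun hf => isOptimalWith_of_best hS hsel hf ?_⟩
  filter_upwards [Measure.quasiMeasurePreserving_fst.ae (hν.ae_generic η w w hw.2.2)] with z hz
  exact best_S0 hsel hw h z.2 hz

end S0

/-! ### Solving for the coin probabilities -/

section Coins

variable {O : (Fin 4 → unitInterval) → Prop} {i j : Fin 4}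

lemma exists_coin_iff_of_one (hij : i ≠ j) {N D : ℝ} {R : Prop}
    (h : ∀ p, O p ↔ 0 < D ∧ (p i : ℝ) = 1 ∧ (p j : ℝ) * D = N ∧ R) :
    ((∃ p, O p) ↔ 0 < D ∧ (0 ≤ N / D ∧ N / D ≤ 1) ∧ R) ∧
      ∀ p, O p ↔ (∃ p, O p) ∧ (p i : ℝ) = 1 ∧ (p j : ℝ) = N / D := by
  have hq : 0 < D → ∀ p : Fin 4 → unitInterval, (p j : ℝ) * D = N ↔ (p j : ℝ) = N / D :=
    fun hD p => (eq_div_iff hD.ne').symm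
  refine ⟨⟨?_, ?_⟩, fun p => ⟨fun hp => ⟨⟨p, hp⟩, ?_⟩, ?_⟩⟩
  · rintro ⟨p, hp⟩
    obtain ⟨hD, -, hj, hR⟩ := (h p).1 hp
    rw [← (hq hD p).1 hj]
    exact ⟨hD, (p j).2, hR⟩
  · rintro ⟨hD, hm, hR⟩
    let p : Fin 4 → unitInterval := fun n => if n = i then 1 else ⟨N / D, hm⟩
    refine ⟨p, (h p).2 ⟨hD, by simp [p], (hq hD p).2 ?_, hR⟩⟩
    simp [p, hij.symm]
  · obtain ⟨hD, hi, hj, -⟩ := (h p).1 hp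
    exact ⟨hi, (hq hD p).1 hj⟩
  · rintro ⟨⟨p', hp'⟩, hi, hj⟩
    obtain ⟨hD, -, -, hR⟩ := (h p').1 hp'
    exact (h p).2 ⟨hD, hi, (hq hD p).2 hj, hR⟩

lemma exists_coin_iff_of_pos (hij : i ≠ j) {N D E F G : ℝ} {R : Prop}
    (h : ∀ p, O p ↔ 0 < D ∧ (0 : ℝ) < p i ∧ 0 < E ∧ (p i : ℝ) * D = N ∧
      (p j : ℝ) * (p i * E) = (1 - p i) * F + G ∧ R) :
    ((∃ p, O p) ↔ 0 < D ∧ (0 < N / D ∧ N / D ≤ 1) ∧ 0 < E ∧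
      (0 ≤ ((1 - N / D) * F + G) / (N / D * E) ∧ ((1 - N / D) * F + G) / (N / D * E) ≤ 1) ∧ R) ∧
      ∀ p, O p ↔ (∃ p, O p) ∧ (p i : ℝ) = N / D ∧
        (p j : ℝ) = ((1 - N / D) * F + G) / (N / D * E) := by
  have sol : ∀ p, O p → (p i : ℝ) = N / D ∧
      (p j : ℝ) = ((1 - N / D) * F + G) / (N / D * E) := by
    intro p hp
    obtain ⟨hD, hi, hE, e1, e2, -⟩ := (h p).1 hp
    have e := (eq_div_iff hD.ne').2 e1
    rw [← e, ← e2]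
    exact ⟨rfl, (mul_div_cancel_right₀ _ (mul_pos hi hE).ne').symm⟩
  have suff : ∀ p : Fin 4 → unitInterval, 0 < D → 0 < N / D → 0 < E → R → (p i : ℝ) = N / D →
      (p j : ℝ) = ((1 - N / D) * F + G) / (N / D * E) → O p := by
    intro p hD hN hE hR hi hj
    rw [h p, hj, hi]
    exact ⟨hD, hN, hE, div_mul_cancel₀ _ hD.ne', div_mul_cancel₀ _ (mul_pos hN hE).ne', hR⟩
  refine ⟨⟨?_, ?_⟩, fun p => ⟨fun hp => ⟨⟨p, hp⟩, sol p hp⟩, ?_⟩⟩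
  · rintro ⟨p, hp⟩
    obtain ⟨hD, hi, hE, -, -, hR⟩ := (h p).1 hp
    obtain ⟨e1, e2⟩ := sol p hp
    rw [← e2, ← e1]
    exact ⟨hD, ⟨hi, (p i).2.2⟩, hE, (p j).2, hR⟩
  · rintro ⟨hD, hm, hE, hm', hR⟩
    refine ⟨fun n => if n = i then ⟨N / D, hm.1.le, hm.2⟩ else ⟨_, hm'⟩,
      suff _ hD hm.1 hE hR ?_ ?_⟩
    · simp
    · simp [hij.symm]
  · rintro ⟨⟨p', hp'⟩, hi, hj⟩
    obtain ⟨hD, hpos, hE, -, -, hR⟩ := (h p').1 hp'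
    exact suff p hD ((sol p' hp').1 ▸ hpos) hE hR hi hj

end Coins

end BidirRelay

open BidirRelay in
theorem proposition1 {Ω : Type*} [MeasurableSpace Ω] (P : Measure Ω) [IsProbabilityMeasure P]
    (S : ℕ → Ω → Gain) (hS : IsFadingChannel P S)
    (sel : Finset (Fin 6) → (Fin 6 → ℝ) → Fin 6) (hsel : IsArgMax sel)
    (η : ℝ) (hη : 0 < η ∧ η < 1) (Pt : ℝ) (hPt : 0 < Pt) :
    -- optimal weights lie in the searched box and in one of the selection regions
    (∀ w : Weights, IsOptimal P S sel η Pt w → InBox η w ∧ ∃ r, w.InRegion r) ∧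
    -- the regions are mutually exclusive
    (∀ (w : Weights) (r r' : Region), w.InRegion r → w.InRegion r' → r = r') ∧
    -- only one of the regions contains optimal weights
    (∀ (w w' : Weights) (r r' : Region), IsOptimal P S sel η Pt w → IsOptimal P S sel η Pt w' →
      w.InRegion r → w'.InRegion r' → r = r') ∧
    -- region S0
    (∀ w : Weights, InBox η w → w.InRegion .S0 → ∀ c : Coins,
      (IsOptimal P S sel η Pt w ↔
        HoldsC1 P S sel η w c ∧ HoldsC2 P S sel η w c ∧ HoldsPower P S sel η Pt w c) ∧
      ∀ p, IsOptimalWith P S sel η Pt w p ↔ IsOptimal P S sel η Pt w) ∧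
    -- region S1: range of the optimal weights
    (∀ w : Weights, w.InRegion .S1 → IsOptimal P S sel η Pt w → η ≤ w.μ₂ ∧ w.μ₂ < 1 - η) ∧
    -- region S1, case 1
    (∀ w : Weights, InBox η w → w.μ₁ = 0 → η < w.μ₂ →
      (∀ s : Gain, 0 < s.1 → 0 < s.2 → metric η w s 3 = metric η w s 5) ∧
      ∀ c : Coins, c 0 = true →
        (IsOptimal P S sel η Pt w ↔
          0 < selExpect P S sel η w c {3, 5} (Cr2 w) ∧
          (0 ≤ p2CaseOne P S sel η w c ∧ p2CaseOne P S sel η w c ≤ 1) ∧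
          HoldsC2 P S sel η w c ∧ HoldsPower P S sel η Pt w c) ∧
        ∀ p, IsOptimalWith P S sel η Pt w p ↔
          IsOptimal P S sel η Pt w ∧ (p 0 : ℝ) = 1 ∧ (p 1 : ℝ) = p2CaseOne P S sel η w c) ∧
    -- region S1, case 2
    (∀ w : Weights, InBox η w → w.μ₁ = 0 → w.μ₂ = η →
      (∀ s : Gain, 0 < s.1 → 0 < s.2 →
        metric η w s 0 = metric η w s 3 ∧ metric η w s 3 = metric η w s 5) ∧
      ∀ c : Coins,
        (IsOptimal P S sel η Pt w ↔
          0 < selExpect P S sel η w c {0, 3, 5} (Cr1 w) ∧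
          (0 < p1CaseTwo P S sel η w c ∧ p1CaseTwo P S sel η w c ≤ 1) ∧
          0 < selExpect P S sel η w c {0, 3, 5} (Cr2 w) ∧
          (0 ≤ p2CaseTwo P S sel η w c ∧ p2CaseTwo P S sel η w c ≤ 1) ∧
          HoldsPower P S sel η Pt w c) ∧
        ∀ p, IsOptimalWith P S sel η Pt w p ↔
          IsOptimal P S sel η Pt w ∧ (p 0 : ℝ) = p1CaseTwo P S sel η w c ∧
            (p 1 : ℝ) = p2CaseTwo P S sel η w c) ∧
    -- region S2: range of the optimal weights
    (∀ w : Weights, w.InRegion .S2 → IsOptimal P S sel η Pt w → 1 - η ≤ w.μ₁ ∧ w.μ₁ < η) ∧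
    -- region S2, case 1
    (∀ w : Weights, InBox η w → w.μ₂ = 0 → 1 - η < w.μ₁ →
      (∀ s : Gain, 0 < s.1 → 0 < s.2 → metric η w s 4 = metric η w s 5) ∧
      ∀ c : Coins, c 2 = true →
        (IsOptimal P S sel η Pt w ↔
          0 < selExpect P S sel η w c {4, 5} (Cr1 w) ∧
          (0 ≤ p4CaseOne P S sel η w c ∧ p4CaseOne P S sel η w c ≤ 1) ∧
          HoldsC1 P S sel η w c ∧ HoldsPower P S sel η Pt w c) ∧
        ∀ p, IsOptimalWith P S sel η Pt w p ↔
          IsOptimal P S sel η Pt w ∧ (p 2 : ℝ) = 1 ∧ (p 3 : ℝ) = p4CaseOne P S sel η w c) ∧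
    -- region S2, case 2
    (∀ w : Weights, InBox η w → w.μ₂ = 0 → w.μ₁ = 1 - η →
      (∀ s : Gain, 0 < s.1 → 0 < s.2 →
        metric η w s 1 = metric η w s 4 ∧ metric η w s 4 = metric η w s 5) ∧
      ∀ c : Coins,
        (IsOptimal P S sel η Pt w ↔
          0 < selExpect P S sel η w c {1, 4, 5} (Cr2 w) ∧
          (0 < p3CaseTwo P S sel η w c ∧ p3CaseTwo P S sel η w c ≤ 1) ∧
          0 < selExpect P S sel η w c {1, 4, 5} (Cr1 w) ∧
          (0 ≤ p4CaseTwo P S sel η w c ∧ p4CaseTwo P S sel η w c ≤ 1) ∧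
          HoldsPower P S sel η Pt w c) ∧
        ∀ p, IsOptimalWith P S sel η Pt w p ↔
          IsOptimal P S sel η Pt w ∧ (p 2 : ℝ) = p3CaseTwo P S sel η w c ∧
            (p 3 : ℝ) = p4CaseTwo P S sel η w c) := by
  refine ⟨?_, fun w r r' h h' => h.eq h', ?_, ?_, ?_, ?_, ?_, ?_, ?_, ?_⟩
  · rintro w ⟨p, hp⟩
    have hf := hp.facts hS hsel hη hPt
    exact ⟨hf.inBox, hf.region⟩
  · rintro w w' r r' ⟨p, hp⟩ ⟨p', hp'⟩ hr hr'
    exact (hp.facts hS hsel hη hPt).region_eq hS.isGainLaw hsel hη (hp'.facts hS hsel hη hPt) hr hr'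
  · intro w hw h c
    have key := isOptimalWith_iff_S0 hS hsel hη hPt hw h c
    have hex : IsOptimal P S sel η Pt w ↔
        HoldsC1 P S sel η w c ∧ HoldsC2 P S sel η w c ∧ HoldsPower P S sel η Pt w c :=
      ⟨fun ⟨p, hp⟩ => (key p).1 hp, fun hc => ⟨fun _ => 0, (key _).2 hc⟩⟩
    exact ⟨hex, fun p => (key p).trans hex.symm⟩
  · rintro w h ⟨p, hp⟩
    have hf := hp.facts hS hsel hη hPt
    exact ⟨hf.le_μ₂ hS.isGainLaw hsel hη h, hf.inBox.2.1.2⟩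
  · refine fun w hw h0 hμ => ⟨fun s h1 h2 => metric_three_eq hw h1 h2 h0, fun c hc => ?_⟩
    exact exists_coin_iff_of_one (by decide) fun p =>
      isOptimalWith_iff_S1_gt hS hsel hη hPt hw h0 hμ hc
  · refine fun w hw h0 hμ => ⟨fun s h1 h2 =>
      ⟨metric_zero_eq h0 hμ, metric_three_eq hw h1 h2 h0⟩, fun c => ?_⟩
    exact exists_coin_iff_of_pos (by decide) fun p =>
      isOptimalWith_iff_S1_eq hS hsel hη hPt hw h0 hμ
  · rintro w h ⟨p, hp⟩
    have hf := hp.facts hS hsel hη hPt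
    exact ⟨hf.le_μ₁ hS.isGainLaw hsel hη h, hf.inBox.1.2⟩
  · refine fun w hw h0 hμ => ⟨fun s h1 h2 => metric_four_eq hw h1 h2 h0, fun c hc => ?_⟩
    exact exists_coin_iff_of_one (by decide) fun p =>
      isOptimalWith_iff_S2_gt hS hsel hη hPt hw h0 hμ hc
  · refine fun w hw h0 hμ => ⟨fun s h1 h2 =>
      ⟨metric_one_eq h0 hμ, metric_four_eq hw h1 h2 h0⟩, fun c => ?_⟩
    exact exists_coin_iff_of_pos (by decide) fun p =>
      isOptimalWith_iff_S2_eq hS hsel hη hPt hw h0 hμ
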